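/- Let $\alpha\in\mathbb R$, $\mu\in(1,\infty)$, $m\in(1,\infty]$, and put $c_\mu=\frac{\mu+2}{2(\mu-1)}$. Let $\rho_m(r)=(1+\frac r{4m})^m$ if $m<\infty$ and $\rho_\infty(r)=e^{r/4}$, and let $L^2(m)^2$ be the complex Hilbert space of (classes of) measurable $w:\mathbb R^2\to\mathbb C^2$ with $\|w\|^2=\int_{\mathbb R^2}|w(\xi)|^2\rho_m(|\xi|^2)\,d\xi<\infty$. Let $U(\xi)=\frac{1-e^{-|\xi|^2/4}}{2\pi|\xi|^2}(-\xi_2,\xi_1)$, with $U(0)=0$, and let $\mathscr L=\mathscr L_{\mu,\alpha,h}$ be the operator $$\mathscr L w=\Delta w+\tfrac12\,\xi\cdot\nabla w+w-(1+c_\mu)w-\alpha\,U\cdot\nabla w+\alpha\,w\cdot\nabla U$$ in $L^2(m)^2$, understood in the sense of distributions, with its maximal domain $\{w\in L^2(m)^2:\mathscr L w\in L^2(m)^2\}$. For a bounded operator $A$ let $r_{ess}(A)=\sup\{|z|:z\in\mathbb C,\ z-A\text{ is not Fredholm}\}$ be the radius of its essential spectrum. Then $\mathscr L$ generates a strongly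 continuous semigroup $(e^{\tau\mathscr L})_{\tau\ge0}$ on $L^2(m)^2$, and the following hold. (i) If $m<\infty$, then $r_{ess}(e^{\tau\mathscr L})=e^{-(\frac12+c_\mu+\frac m2)\tau}$ for all $\tau\ge0$. If $m=\infty$, then $r_{ess}(e^{\tau\mathscr L})=0$ for all $\tau>0$. (ii) If $\lambda\in\mathbb C$ is an eigenvalue of $\mathscr L$ in $L^2(m)^2$ with $\operatorname{Re}\lambda\ge-\frac12-c_\mu-\frac m2$ (no condition if $m=\infty$), then $\operatorname{Re}\lambda\le-1-c_\mu$. -/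

import Mathlib

open MeasureTheory Filter Topology
open scoped ENNReal NNReal ContDiff

noncomputable section

namespace SingularBurgers

/-! ### Essential spectrum and strongly continuous semigroups -/

section Operators

variable {X : Type*} [NormedAddCommGroup X] [NormedSpace ℂ X]

/-- The essential spectrum of a bounded operator: the complement of its Fredholm domain. -/
def essentialSpectrum (A : X →L[ℂ] X) : Set ℂ :=
  {z | ¬ (z • ContinuousLinearMap.id ℂ X - A).IsFredholm}

/-- The radius of the essential spectrum, `sup {|z| : z ∈ σ_ess(A)}`, as an element of `[0, ∞]`. -/
def essentialSpectralRadius (A : X →L[ℂ] X) : ℝ≥0∞ :=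
  ⨆ z ∈ essentialSpectrum A, (‖z‖₊ : ℝ≥0∞)

/-- A strongly continuous semigroup of bounded operators on `X`. -/
structure IsC0Semigroup (T : ℝ≥0 → X →L[ℂ] X) : Prop where
  map_zero : T 0 = ContinuousLinearMap.id ℂ X
  map_add : ∀ s t, T (s + t) = (T s).comp (T t)
  continuous_orbit : ∀ x, Continuous fun t => T t x

/-- `x` belongs to the domain of the infinitesimal generator of `T`, whose value at `x` is `y`. -/
def GeneratorGraph (T : ℝ≥0 → X →L[ℂ] X) (x y : X) : Prop :=
  Tendsto (fun t : ℝ≥0 => ((t : ℝ) : ℂ)⁻¹ • (T t x - x)) (𝓝[>] 0) (𝓝 y)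

/-- `T` is the strongly continuous semigroup generated by the (possibly unbounded) operator whose
graph is `A`, i.e. `A x y` means that `x` is in the domain and is mapped to `y`. -/
structure IsSemigroupGeneratedBy (T : ℝ≥0 → X →L[ℂ] X) (A : X → X → Prop) : Prop where
  isC0Semigroup : IsC0Semigroup T
  generator_iff : ∀ x y, GeneratorGraph T x y ↔ A x y

/-- `z` is an eigenvalue of the operator with graph `A`. -/
def IsEigenvalue (A : X → X → Prop) (z : ℂ) : Prop :=
  ∃ x : X, x ≠ 0 ∧ A x (z • x)

end Operators

/-! ### The weighted spaces -/

/-- The horizontal plane `ℝ²`. -/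
abbrev Plane : Type := EuclideanSpace ℝ (Fin 2)

/-- The weight function `ρ_m`, for `m ∈ [0, ∞]`. -/
def rho (m : ℝ≥0∞) (r : ℝ) : ℝ :=
  if m = 0 then 1
  else if m = ⊤ then Real.exp (r / 4)
  else (1 + r / (4 * m.toReal)) ^ m.toReal

/-- The measure `ρ_m(|ξ|²) dξ` on the plane. -/
def weightedMeasure (m : ℝ≥0∞) : Measure Plane :=
  volume.withDensity fun x => ENNReal.ofReal (rho m (‖x‖ ^ 2))

/-- The space `L²(m)²` of (complex) planar vector fields `w` with `∫ |w|² ρ_m(|ξ|²) dξ < ∞`. -/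
abbrev L2sq (m : ℝ≥0∞) : Type :=
  Lp (EuclideanSpace ℂ (Fin 2)) 2 (weightedMeasure m)

/-! ### The operator -/

/-- The partial derivative `∂ₖ f`. -/
def partialDeriv (k : Fin 2) (f : Plane → ℝ) (x : Plane) : ℝ :=
  fderiv ℝ f x (EuclideanSpace.single k 1)

/-- The two horizontal components of the velocity
`U^G(ξ) = (1 - e^{-|ξ|²/4}) / (2π|ξ|²) (-ξ₂, ξ₁)`; it vanishes at the origin. -/
def velocity (k : Fin 2) (x : Plane) : ℝ :=
  (1 - Real.exp (-‖x‖ ^ 2 / 4)) / (2 * Real.pi * ‖x‖ ^ 2) * (![-x 1, x 0] : Fin 2 → ℝ) k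

/-- The constant `(μ + 2) / (2 (μ - 1))`. -/
def strainConst (μ : ℝ) : ℝ := (μ + 2) / (2 * (μ - 1))

/-- The formal transpose of the scalar operator
`Δ + (ξ/2)·∇ + 1 - (1 + (μ+2)/(2(μ-1))) - α U^G·∇`, applied to a test function `φ`:
`Δφ - ½ div(ξφ) + φ - (1 + (μ+2)/(2(μ-1))) φ + α div(U^G φ)`. -/
def transposeScalarPart (μ α : ℝ) (φ : Plane → ℝ) (x : Plane) : ℝ :=
  (∑ k, partialDeriv k (partialDeriv k φ) x)
    - (1 / 2) * (∑ k, partialDeriv k (fun y => y k * φ y) x)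
    + φ x
    - (1 + strainConst μ) * φ x
    + α * ∑ k, partialDeriv k (fun y => velocity k y * φ y) x

/-- The graph of the operator
`w ↦ (Δ + (ξ/2)·∇ + 1) w - (1 + (μ+2)/(2(μ-1))) w - α (U^G·∇) w + α (w·∇) U^G`
in `L²(m)²`, with its maximal domain: `w` and `f` lie in `L²(m)²`, and the image of `w`
in the sense of distributions is `f`. -/
def linearizedGraph (μ α : ℝ) (m : ℝ≥0∞) (w f : L2sq m) : Prop :=
  ∀ φ : Plane → ℝ, ContDiff ℝ ∞ φ → HasCompactSupport φ → ∀ j : Fin 2,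
    ∫ x, f x j * (φ x : ℂ) =
      ∫ x, (w x j * (transposeScalarPart μ α φ x : ℂ)
        + (α : ℂ) * (∑ k, w x k * (partialDeriv k (velocity j) x : ℂ)) * (φ x : ℂ))

end SingularBurgers

end

open SingularBurgers

/-!
The constant `1 + c_μ` only multiplies the semigroup by `e^{-(1 + c_μ) t}`, so let it be removed.
What remains is `L + B`, where `L = Δ + ξ/2·∇ + 1` and `B w = -α U·∇w + α w·∇U`.

*The semigroup.* `e^{tL}` has the explicit Mehler kernel (`mehler`), bounded on the weighted spaces
by Schur's test (`schur_test`). The velocity is tangential, `U = H(|ξ|²) ξ^⊥` (`profile`), so the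
derivative in `B` can be moved onto the kernel; the factor `y^⊥·∇` then produces the cross product
of `x` and `y` only, and `K t = e^{tL} B` (`drift`) is bounded with norm `O(t^{-1/2})` near `0`. The
Neumann series of `T t = S t + ∫₀ᵗ K (t - s) T s ds` is the perturbed semigroup
(`PerturbationData.perturbed`), and its generator is characterised by an integrated equation
containing `S` and `K` only. In kernel form (`KernelEq`) this equation holds exactly when the
equation holds in the sense of distributions: in one direction the Mehler kernel is inserted as a
test function, in the other `t → 0`. Hence the maximal operator is the generator
(`linearizedGraph_iff_generatorGraph`).

*The essential spectrum.* Since `U` and `∇U` decay, `K t` is compact, and so is the difference of the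
perturbed semigroup and `e^{tL}` (`DecayingDrift.isCompactOperator_perturbed_sub`); only `e^{tL}`
matters. For `m = ∞` it is a Hilbert–Schmidt operator. For `m < ∞`, the kernel restricted to
`|y| > R` has norm arbitrarily close to `e^{(1-m)t/2}`, and the rest is compact
(`exists_kernelBound_outer`); this bounds the radius from above. From below, `e^{tL}` maps the
Gaussian of variance parameter `1 + e^t σ` to that of parameter `1 + σ`, hence acts as a backward
shift on a sequence of Gaussians, and suitable superpositions of these form a Weyl sequence at
`e^{(1-m)t/2}` (`not_isFredholm_vortexSemigroup`).

*The eigenvalues.* If `L + B` has no eigenvalue in the half-plane `Re l > 0` on the Gaussian space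
`L²(∞)²`, it has none on `L²(m)²`, `m > 1` (`DecayingDrift.eq_zero_of_kernelEq`): for `|z| > 1` the
operator `z - T` is onto on the first space, which is dense in the second, where its range is
closed; and surjectivity of `z - T` for all these `z` excludes eigenvectors
(`eq_zero_of_surjective`). On the Gaussian space `e^{tL}` is a symmetric contraction, so `L` is
dissipative and remains so after adding an imaginary potential (`eq_zero_of_kernelEq_skew`). Since
everything commutes with rotations, an eigenvector may be taken to be an angular mode
`w(R_φ ξ) = e^{inφ} R_φ w(ξ)` (`eq_zero_of_modes`). On a mode the drift reduces to multiplication by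
a matrix (`modeMatrix`), and three scalar arguments finish (`eq_zero_of_mode`):

* the divergence `D` of `w` satisfies `(L + 1/2) D - i α n H D = l D`; since `e^{t(L + 1/2)}` is
  symmetric and `e^{t(L + 1/2)} D = div e^{tL} w` stays bounded as `t → ∞`, its norm does not exceed
  that of `D`, so `Re ⟪D, (L + 1/2) D⟫ ≤ 0` (`re_inner_divergence_nonpos`) and `D = 0`;
* then `y·w` satisfies `L (y·w) - i α n H (y·w) = (l + 1/2) y·w` in `L²(2)`, where the absence of
  unstable eigenvalues carries over from the Gaussian space, so `y·w = 0`;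
* then the matrix acts on `w` as `-i α n H`, so `w = 0`.
-/

noncomputable section

open Real
open ENNReal (ofReal ofReal_mul ofReal_le_ofReal ofReal_pow measurable_ofReal ofReal_one)
open Complex (norm_real real_smul)
open EuclideanSpace (proj single)
open Function (uncurry)
open Metric (closedBall ball)
open Set (uIcc_of_le uIoc_of_le indicator_of_mem indicator_of_notMem mem_Ioi mem_Iio)
open intervalIntegral (integral_of_le integral_add_adjacent_intervals integral_same)

namespace SingularBurgers

variable {E F : Type*} [NormedAddCommGroup E] [NormedSpace ℂ E] [NormedAddCommGroup F]
  [NormedSpace ℂ F] {m : ℝ≥0∞} {a b c s t C : ℝ}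

/-- Complex planar vectors. -/
notation "ℂ²" => EuclideanSpace ℂ (Fin 2)

/-- The weighted space of classes of functions with values in `E`. -/
notation "L²(" E ", " m ")" => Lp E 2 (weightedMeasure m)

/-- The identity as a bounded operator. -/
notation "idL" => ContinuousLinearMap.id ℂ

lemma idL_apply (v : E) : idL E v = v := rfl

/-! ### Perturbation of strongly continuous semigroups -/

section Perturbation

variable {X : Type*} [NormedAddCommGroup X] [NormedSpace ℂ X]

/-- A strongly continuous semigroup `S` together with a family `K t`, `t > 0`, which plays the role
of `S t ∘ B` for an unbounded perturbation `B` of the generator of `S`: one has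
`S s ∘ K t = K (s+t)` and the singularity of `‖K t‖` at `t = 0` is integrable. Both families are
extended to `t ≤ 0` by the constants `1` and `0`. -/
structure PerturbationData (S K : ℝ → X →L[ℂ] X) (M C β : ℝ) : Prop where
  one_le : 1 ≤ M
  C_nonneg : 0 ≤ C
  β_nonneg : 0 ≤ β
  S_nonpos : ∀ t ≤ 0, S t = 1
  S_add : ∀ s t, 0 ≤ s → 0 ≤ t → S (s + t) = (S s).comp (S t)
  S_cont : ∀ x, Continuous fun t => S t x
  S_bound : ∀ t, 0 ≤ t → ‖S t‖ ≤ M * exp (β * t)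
  K_nonpos : ∀ t ≤ 0, K t = 0
  K_add : ∀ s t, 0 ≤ s → 0 < t → K (s + t) = (S s).comp (K t)
  K_bound : ∀ t, 0 < t → ‖K t‖ ≤ C * exp (β * t) / √t

/-- The convolution `∫₀ᵗ K(s) u(t - s) ds`. -/
noncomputable def volterra (K : ℝ → X →L[ℂ] X) (u : ℝ → X) (t : ℝ) : X :=
  ∫ s in (0 : ℝ)..t, K s (u (t - s))

namespace PerturbationData

variable {S K : ℝ → X →L[ℂ] X} {M C β : ℝ} (h : PerturbationData S K M C β)
include h

lemma S_norm_le (t : ℝ) : ‖S t‖ ≤ M * exp (β * |t|) := by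
  rcases le_total 0 t with ht | ht
  · simpa [abs_of_nonneg ht] using h.S_bound t ht
  · have := one_le_exp (mul_nonneg h.β_nonneg (abs_nonneg t))
    rw [h.S_nonpos t ht]
    exact ContinuousLinearMap.norm_id_le.trans (by nlinarith [h.one_le])

lemma S_joint : Continuous fun p : ℝ × X => S p.1 p.2 := by
  rw [continuous_iff_continuousAt]
  rintro ⟨t, v⟩
  have hc : Continuous fun p : ℝ × X => M * exp (β * |p.1|) * ‖p.2 - v‖ + ‖S p.1 v - S t v‖ := by
    have := (h.S_cont v).comp (continuous_fst (X := ℝ) (Y := X))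
    exact .add (by fun_prop) (this.sub continuous_const).norm
  rw [ContinuousAt, tendsto_iff_norm_sub_tendsto_zero]
  refine squeeze_zero (fun _ => norm_nonneg _) (fun p => ?_) (by simpa using hc.tendsto (t, v))
  rw [show S p.1 p.2 - S t v = S p.1 (p.2 - v) + (S p.1 v - S t v) by rw [map_sub]; abel]
  exact (norm_add_le _ _).trans (add_le_add_left ((S p.1).le_of_opNorm_le (h.S_norm_le _) _) _)

lemma K_joint : ContinuousOn (fun p : ℝ × X => K p.1 p.2) (Set.Ioi 0 ×ˢ Set.univ) := by
  rintro ⟨t, v⟩ ⟨ht, -⟩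
  have ht : 0 < t := ht
  have h1 : Continuous fun p : ℝ × X => S (p.1 - t / 2) (K (t / 2) p.2) :=
    h.S_joint.comp (f := fun p : ℝ × X => (p.1 - t / 2, K (t / 2) p.2)) (by fun_prop)
  refine (h1.continuousAt.congr ?_).continuousWithinAt
  filter_upwards [continuous_fst.continuousAt.eventually (lt_mem_nhds (half_lt_self ht))] with p hp
  rw [← ContinuousLinearMap.comp_apply, ← h.K_add _ _ (sub_nonneg.2 hp.le) (half_pos ht),
    sub_add_cancel]

omit h in
lemma intervalIntegrable_kernel (C β a b : ℝ) :
    IntervalIntegrable (fun s => C * exp (β * s) / √s) volume a b := by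
  have h2 : IntervalIntegrable (fun s : ℝ => (√s)⁻¹) volume a b := by
    refine (intervalIntegral.intervalIntegrable_rpow' (r := -(1 / 2)) (by norm_num)).abs.mono_fun'
      (by fun_prop) (.of_forall fun s => ?_)
    rcases le_total 0 s with hs | hs
    · simp only [sqrt_eq_rpow, rpow_neg hs, norm_eq_abs, le_rfl]
    · simp [sqrt_eq_zero'.2 hs]
  simpa [div_eq_mul_inv] using h2.continuousOn_mul (g := fun s => C * exp (β * s)) (by fun_prop)

lemma continuousOn_K_comp {u : ℝ → X} (hu : Continuous u) (t : ℝ) :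
    ContinuousOn (fun s => K s (u (t - s))) (Set.Ioi 0) :=
  h.K_joint.comp (f := fun s : ℝ => (s, u (t - s))) (by fun_prop) fun s hs => ⟨hs, trivial⟩

lemma norm_K_apply_le (hs : 0 < s) (v : X) {B : ℝ} (hv : ‖v‖ ≤ B) :
    ‖K s v‖ ≤ C * exp (β * s) / √s * B :=
  ((K s).le_opNorm _).trans (mul_le_mul (h.K_bound s hs) hv (norm_nonneg _)
    ((norm_nonneg _).trans (h.K_bound s hs)))

lemma aestronglyMeasurable_K_comp {u : ℝ → X} (hu : Continuous u) (t : ℝ) {s : Set ℝ}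
    (hs : s ⊆ Set.Ioi 0) (hm : MeasurableSet s) :
    AEStronglyMeasurable (fun s => K s (u (t - s))) (volume.restrict s) :=
  ((h.continuousOn_K_comp hu t).mono hs).aestronglyMeasurable hm

omit h [NormedSpace ℂ X] in
lemma exists_bound {u : ℝ → X} (hu : Continuous u) (τ : ℝ) :
    ∃ B, 0 ≤ B ∧ ∀ r ∈ Set.Icc 0 τ, ‖u r‖ ≤ B := by
  obtain ⟨B, hB⟩ := isCompact_Icc.exists_bound_of_continuousOn (hu.continuousOn (s := Set.Icc 0 τ))
  exact ⟨max B 0, le_max_right _ _, fun r hr => (hB r hr).trans (le_max_left _ _)⟩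

lemma intervalIntegrable_K {u : ℝ → X} (hu : Continuous u) (t : ℝ) (ha : 0 ≤ a)
    (hab : a ≤ b) : IntervalIntegrable (fun s => K s (u (t - s))) volume a b := by
  obtain ⟨B, hB⟩ := isCompact_Icc.exists_bound_of_continuousOn (s := Set.Icc a b)
    (f := fun s => u (t - s)) (by fun_prop)
  have hi := (intervalIntegrable_kernel C β a b).mul_const B
  rw [intervalIntegrable_iff_integrableOn_Ioc_of_le hab] at hi ⊢
  refine hi.mono' (h.aestronglyMeasurable_K_comp hu t (fun s hs => ha.trans_lt hs.1)
    measurableSet_Ioc) ?_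
  filter_upwards [ae_restrict_mem measurableSet_Ioc] with s hs
  exact h.norm_K_apply_le (ha.trans_lt hs.1) _ (hB s ⟨hs.1.le, hs.2⟩)

lemma volterra_nonpos (u : ℝ → X) (ht : t ≤ 0) : volterra K u t = 0 := by
  rw [volterra, intervalIntegral.integral_of_ge ht, setIntegral_eq_zero_of_forall_eq_zero, neg_zero]
  intro s hs
  rw [h.K_nonpos s hs.2]; rfl

lemma volterra_eq (u : ℝ → X) (t : ℝ) : volterra K u t =
    ∫ s in Set.Ioi 0, (Set.Iio t).indicator (fun s => K s (u (t - s))) s := by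
  rw [setIntegral_indicator measurableSet_Iio, Set.Ioi_inter_Iio]
  rcases le_total t 0 with ht | ht
  · rw [h.volterra_nonpos u ht, Set.Ioo_eq_empty (not_lt.2 ht), setIntegral_empty]
  · rw [volterra, integral_of_le ht, integral_Ioc_eq_integral_Ioo]

omit h in
lemma volterra_congr {u v : ℝ → X} (ht : 0 ≤ t) (huv : ∀ s ∈ Set.Icc 0 t, u s = v s) :
    volterra K u t = volterra K v t := by
  unfold volterra
  refine intervalIntegral.integral_congr fun s hs => ?_
  rw [uIcc_of_le ht] at hs
  simp only [huv (t - s) ⟨by linarith [hs.2], by linarith [hs.1]⟩]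

lemma volterra_continuous {u : ℝ → X} (hu : Continuous u) : Continuous (volterra K u) := by
  rw [funext (h.volterra_eq u), continuous_iff_continuousAt]
  intro t₀
  set τ := |t₀| + 1
  obtain ⟨B, hB0, hB⟩ := exists_bound hu τ
  have hi := (intervalIntegrable_iff_integrableOn_Ioc_of_le (by positivity : 0 ≤ τ)).1
    ((intervalIntegrable_kernel C β 0 τ).mul_const B)
  refine continuousAt_of_dominated
    (bound := (Set.Ioc 0 τ).indicator fun s => C * exp (β * s) / √s * B)
    (.of_forall fun t => (h.aestronglyMeasurable_K_comp hu t subset_rfl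
      measurableSet_Ioi).indicator measurableSet_Iio) ?_
    ((integrable_indicator_iff measurableSet_Ioc).2 hi).integrableOn ?_
  · filter_upwards [gt_mem_nhds (show t₀ < τ by linarith [le_abs_self t₀])] with t ht
    filter_upwards [ae_restrict_mem measurableSet_Ioi] with s hs
    by_cases hst : s < t
    · rw [indicator_of_mem (Set.mem_Iio.2 hst), indicator_of_mem
          (Set.mem_Ioc.2 ⟨hs, (hst.trans ht).le⟩)]
      exact h.norm_K_apply_le hs _ (hB _ ⟨by linarith, by linarith [mem_Ioi.1 hs]⟩)
    · have := h.C_nonneg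
      rw [indicator_of_notMem (by simpa using hst), norm_zero]
      exact Set.indicator_nonneg (fun s _ => by positivity) s
  · filter_upwards [ae_restrict_of_ae (Measure.ae_ne volume t₀)] with s hs
    rcases lt_or_gt_of_ne hs with hlt | hlt
    · refine ((K s).continuous.comp (hu.comp (continuous_sub_right s))).continuousAt.congr ?_
      filter_upwards [lt_mem_nhds hlt] with t ht
      exact (indicator_of_mem (Set.mem_Iio.2 ht) fun s => K s (u (t - s))).symm
    · refine (continuousAt_const (y := (0 : X))).congr ?_
      filter_upwards [gt_mem_nhds hlt] with t ht
      exact (indicator_of_notMem (by simpa using ht.le) _).symm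

omit h in
/-- A growth rate for which the weighted mass of the singular kernel is at most `1 / 2`. -/
lemma exists_rate (C β : ℝ) (hC : 0 ≤ C) : ∃ η, β ≤ η ∧ ∀ t, 0 ≤ t →
    ∫ s in (0 : ℝ)..t, C * exp (β * s) / √s * exp (-η * s) ≤ 1 / 2 := by
  set l : ℝ := (2 * C * √π + 1) ^ 2 with hl
  have hb : 0 < 2 * C * √π + 1 := by positivity
  have hl0 : 0 < l := by positivity
  refine ⟨β + l, by linarith, fun t ht => ?_⟩
  have key := integral_rpow_mul_exp_neg_mul_Ioi (a := 1 / 2) (r := l) (by norm_num) hl0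
  have e : ∀ s ∈ Set.Ioi (0 : ℝ), C * exp (β * s) / √s * exp (-(β + l) * s) =
      C * (s ^ ((1 / 2 : ℝ) - 1) * exp (-(l * s))) := fun s hs => by
    have hs' : (0 : ℝ) < s := hs
    have : s ^ ((1 / 2 : ℝ) - 1) = (√s)⁻¹ := by rw [sqrt_eq_rpow, ← rpow_neg hs'.le]; norm_num
    rw [this, show -(β + l) * s = -(β * s) + -(l * s) by ring, exp_add, exp_neg (β * s)]
    field_simp
  have hint : IntegrableOn (fun s => s ^ ((1 / 2 : ℝ) - 1) * exp (-(l * s))) (Set.Ioi 0) := by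
    by_contra hcon
    rw [integral_undef hcon, Real.Gamma_one_half_eq] at key
    have : 0 < (1 / l) ^ (1 / 2 : ℝ) * √π := by positivity
    linarith
  rw [integral_of_le ht]
  calc ∫ s in Set.Ioc 0 t, C * exp (β * s) / √s * exp (-(β + l) * s)
      ≤ ∫ s in Set.Ioi 0, C * exp (β * s) / √s * exp (-(β + l) * s) := by
        refine setIntegral_mono_set ?_ ?_ (.of_forall fun s hs => hs.1)
        · exact IntegrableOn.congr_fun (hint.const_mul C)
              (fun s hs => (e s hs).symm) measurableSet_Ioi
        · filter_upwards with s
          simp only [Pi.zero_apply]; positivity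
    _ = C * ((1 / l) ^ (1 / 2 : ℝ) * √π) := by
        rw [setIntegral_congr_fun measurableSet_Ioi e, integral_const_mul, key,
          Real.Gamma_one_half_eq]
    _ = C * √π / (2 * C * √π + 1) := by
        rw [← sqrt_eq_rpow, hl, one_div, sqrt_inv, sqrt_sq hb.le]; ring
    _ ≤ 1 / 2 := by rw [div_le_div_iff₀ hb (by norm_num)]; nlinarith

/-- The convolution with `K` halves the norm `sup_t e^{-ηt} ‖u t‖`. -/
lemma norm_volterra_le {η : ℝ} (hη : ∀ t, 0 ≤ t →
      ∫ s in (0 : ℝ)..t, C * exp (β * s) / √s * exp (-η * s) ≤ 1 / 2)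
    {u : ℝ → X} {B : ℝ} (ht : 0 ≤ t) (hB : ∀ r ∈ Set.Icc 0 t, ‖u r‖ ≤ B * exp (η * r)) :
    ‖volterra K u t‖ ≤ B / 2 * exp (η * t) := by
  have hB0 : 0 ≤ B := by simpa using (norm_nonneg _).trans (hB 0 ⟨le_rfl, ht⟩)
  refine (intervalIntegral.norm_integral_le_of_norm_le (g := fun s =>
    C * exp (β * s) / √s * exp (-η * s) * (B * exp (η * t))) ht (.of_forall fun s hs => ?_)
    (((intervalIntegrable_kernel C β 0 t).mul_continuousOn (by fun_prop)).mul_const _)).trans ?_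
  · refine (h.norm_K_apply_le hs.1 _ (hB (t - s) ⟨by linarith [hs.2], by linarith [hs.1]⟩)).trans
      (le_of_eq ?_)
    rw [show η * (t - s) = -η * s + η * t by ring, exp_add]; ring
  · rw [intervalIntegral.integral_mul_const]
    have := mul_le_mul_of_nonneg_right (hη t ht) (show 0 ≤ B * exp (η * t) by positivity)
    linarith

/-- Uniqueness for the homogeneous Volterra equation. -/
lemma volterra_unique {u : ℝ → X} (hu : Continuous u)
    (hv : ∀ t, 0 ≤ t → u t = volterra K u t) : ∀ t, 0 ≤ t → u t = 0 := fun τ hτ => by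
  obtain ⟨η, -, hη⟩ := exists_rate C β h.C_nonneg
  obtain ⟨t, ht, hmax⟩ := isCompact_Icc.exists_isMaxOn (s := Set.Icc 0 τ)
    (f := fun t => exp (-η * t) * ‖u t‖) ⟨0, le_rfl, hτ⟩ (by fun_prop)
  set m := exp (-η * t) * ‖u t‖
  have e : ∀ r, exp (-η * r) * exp (η * r) = 1 := fun r => by rw [← exp_add]; simp
  have hle : ∀ r ∈ Set.Icc 0 τ, ‖u r‖ ≤ m * exp (η * r) := fun r hr => by
    calc ‖u r‖ = exp (-η * r) * ‖u r‖ * exp (η * r) := by rw [mul_right_comm, e, one_mul]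
      _ ≤ _ := mul_le_mul_of_nonneg_right (hmax hr) (exp_pos _).le
  have h1 := h.norm_volterra_le hη ht.1 (fun r hr => hle r ⟨hr.1, hr.2.trans ht.2⟩)
  rw [← hv t ht.1] at h1
  have h2 : m ≤ exp (-η * t) * (m / 2 * exp (η * t)) := mul_le_mul_of_nonneg_left h1 (exp_pos _).le
  rw [mul_left_comm, e] at h2
  have h4 := (hle τ ⟨hτ, le_rfl⟩).trans
    (mul_nonpos_of_nonpos_of_nonneg (by linarith : m ≤ 0) (exp_pos _).le)
  simpa using h4

end PerturbationData

end Perturbation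

section Perturbation

variable {X : Type*} [NormedAddCommGroup X] [NormedSpace ℂ X]

/-- The terms of the Neumann series that solves `u = S(·)x + K * u`. -/
noncomputable def neumannTerm (S K : ℝ → X →L[ℂ] X) (x : X) : ℕ → ℝ → X
  | 0 => fun t => S t x
  | n + 1 => volterra K (neumannTerm S K x n)

namespace PerturbationData

variable {S K : ℝ → X →L[ℂ] X} {M C β : ℝ} (h : PerturbationData S K M C β)
include h

lemma neumannTerm_continuous (x : X) (n : ℕ) : Continuous (neumannTerm S K x n) := by
  induction n with
  | zero => exact h.S_cont x
  | succ n ih => exact h.volterra_continuous ih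

lemma volterra_add {u v : ℝ → X} (hu : Continuous u) (hv : Continuous v) (ht : 0 ≤ t) :
    volterra K (fun s => u s + v s) t = volterra K u t + volterra K v t := by
  unfold volterra
  rw [← intervalIntegral.integral_add (h.intervalIntegrable_K hu t le_rfl ht)
    (h.intervalIntegrable_K hv t le_rfl ht)]
  simp only [map_add]

omit h in
lemma volterra_smul (c : ℂ) (u : ℝ → X) (t : ℝ) :
    volterra K (fun s => c • u s) t = c • volterra K u t := by
  unfold volterra
  rw [← intervalIntegral.integral_smul]
  simp only [map_smul]

lemma volterra_sub {u v : ℝ → X} (hu : Continuous u) (hv : Continuous v) (ht : 0 ≤ t) :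
    volterra K (fun s => u s - v s) t = volterra K u t - volterra K v t := by
  unfold volterra
  rw [← intervalIntegral.integral_sub (h.intervalIntegrable_K hu t le_rfl ht)
    (h.intervalIntegrable_K hv t le_rfl ht)]
  simp only [map_sub]

lemma neumannTerm_nonpos (x : X) (n : ℕ) (ht : t ≤ 0) :
    neumannTerm S K x (n + 1) t = 0 := h.volterra_nonpos _ ht

lemma neumannTerm_add (x y : X) (n : ℕ) (t : ℝ) :
    neumannTerm S K (x + y) n t = neumannTerm S K x n t + neumannTerm S K y n t := by
  induction n generalizing t with
  | zero => simp [neumannTerm]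
  | succ n ih =>
    rcases le_total t 0 with ht | ht
    · simp only [h.neumannTerm_nonpos _ n ht, add_zero]
    · simp only [neumannTerm]
      rw [← h.volterra_add (h.neumannTerm_continuous x n) (h.neumannTerm_continuous y n) ht]
      congr 1; funext s; exact ih s

omit h in
lemma neumannTerm_smul (c : ℂ) (x : X) (n : ℕ) (t : ℝ) :
    neumannTerm S K (c • x) n t = c • neumannTerm S K x n t := by
  induction n generalizing t with
  | zero => simp [neumannTerm]
  | succ n ih =>
    simp only [neumannTerm]
    rw [← volterra_smul]
    congr 1; funext s; exact ih s

lemma norm_neumannTerm_le {η : ℝ} (hβη : β ≤ η) (hη : ∀ t, 0 ≤ t →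
      ∫ s in (0 : ℝ)..t, C * exp (β * s) / √s * exp (-η * s) ≤ 1 / 2)
    (x : X) (n : ℕ) (t : ℝ) :
    ‖neumannTerm S K x n t‖ ≤ M * ‖x‖ * (1 / 2) ^ n * exp (η * |t|) := by
  have hM : 0 ≤ M := zero_le_one.trans h.one_le
  induction n generalizing t with
  | zero =>
    have h1 := ((S t).le_opNorm x).trans
      (mul_le_mul_of_nonneg_right (h.S_norm_le t) (norm_nonneg x))
    have h2 : exp (β * |t|) ≤ exp (η * |t|) := by gcongr
    simp only [neumannTerm, pow_zero, mul_one]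
    refine h1.trans ?_
    calc M * exp (β * |t|) * ‖x‖ = M * ‖x‖ * exp (β * |t|) := by ring
      _ ≤ _ := by gcongr
  | succ n ih =>
    rcases le_total t 0 with ht | ht
    · rw [h.neumannTerm_nonpos x n ht, norm_zero]; positivity
    · refine (h.norm_volterra_le hη ht (B := M * ‖x‖ * (1 / 2) ^ n) ?_).trans (le_of_eq ?_)
      · intro r hr
        simpa [abs_of_nonneg hr.1] using ih r
      · rw [abs_of_nonneg ht]; ring

lemma integral_shift [CompleteSpace X] {u : ℝ → X} (hu : Continuous u) {r : ℝ} (hr : 0 ≤ r)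
    (ht : 0 ≤ t) :
    ∫ s in r..(r + t), K s (u (r + t - s)) = S r (volterra K u t) := by
  unfold volterra
  rw [← (S r).intervalIntegral_comp_comm (h.intervalIntegrable_K hu t le_rfl ht)]
  have := intervalIntegral.integral_comp_add_right (a := 0) (b := t)
    (fun s => K s (u (r + t - s))) r
  rw [zero_add, add_comm t r] at this
  rw [← this]
  refine intervalIntegral.integral_congr_ae (.of_forall fun s hs' => ?_)
  rw [uIoc_of_le ht] at hs'
  rw [add_comm s r, h.K_add r s hr hs'.1, show r + t - (r + s) = t - s by ring]
  rfl

section Complete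
variable [CompleteSpace X]

lemma summable_neumannTerm (x : X) (t : ℝ) : Summable fun n => neumannTerm S K x n t := by
  obtain ⟨η, h1, h2⟩ := exists_rate C β h.C_nonneg
  refine Summable.of_norm_bounded ?_ (fun n => h.norm_neumannTerm_le h1 h2 x n t)
  exact (summable_geometric_two.mul_left (M * ‖x‖)).mul_right _

/-- The perturbed semigroup, as the sum of its Neumann series. -/
noncomputable def perturbed (t : ℝ) : X →L[ℂ] X :=
  LinearMap.mkContinuousOfExistsBound
    { toFun := fun x => ∑' n, neumannTerm S K x n t
      map_add' := fun x y => by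
        simp only [h.neumannTerm_add]
        exact (h.summable_neumannTerm x t).tsum_add (h.summable_neumannTerm y t)
      map_smul' := fun c x => by
        simp only [neumannTerm_smul, RingHom.id_apply]
        exact (h.summable_neumannTerm x t).tsum_const_smul c }
    (by
      obtain ⟨η, h1, h2⟩ := exists_rate C β h.C_nonneg
      refine ⟨M * 2 * exp (η * |t|), fun x => ?_⟩
      refine (tsum_of_norm_bounded (a := M * ‖x‖ * 2 * exp (η * |t|)) ?_
        (fun n => h.norm_neumannTerm_le h1 h2 x n t)).trans (le_of_eq (by ring))
      exact (hasSum_geometric_two.mul_left (M * ‖x‖)).mul_right _)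

lemma perturbed_apply (t : ℝ) (x : X) : h.perturbed t x = ∑' n, neumannTerm S K x n t := rfl

lemma perturbed_continuous (x : X) : Continuous fun t => h.perturbed t x := by
  obtain ⟨η, h1, h2⟩ := exists_rate C β h.C_nonneg
  have hη : 0 ≤ η := h.β_nonneg.trans h1
  have hM : 0 ≤ M := zero_le_one.trans h.one_le
  refine continuous_iff_continuousAt.2 fun t₀ => ContinuousOn.continuousAt (s := ball t₀ 1) ?_
    (Metric.ball_mem_nhds _ one_pos)
  refine continuousOn_tsum (u := fun n => M * ‖x‖ * (1 / 2) ^ n * exp (η * (|t₀| + 1)))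
    (fun n => (h.neumannTerm_continuous x n).continuousOn)
    ((summable_geometric_two.mul_left (M * ‖x‖)).mul_right _) fun n t ht => ?_
  refine (h.norm_neumannTerm_le h1 h2 x n t).trans ?_
  have h3 : |t - t₀| < 1 := by simpa [dist_eq] using ht
  have : |t| ≤ |t₀| + 1 := by linarith [abs_sub_abs_le_abs_sub t t₀]
  gcongr

lemma perturbed_nonpos (ht : t ≤ 0) : h.perturbed t = 1 := by
  ext x
  rw [perturbed_apply, tsum_eq_single 0]
  · simp [neumannTerm, h.S_nonpos t ht]
  · intro n hn
    obtain ⟨k, rfl⟩ := Nat.exists_eq_succ_of_ne_zero hn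
    exact h.neumannTerm_nonpos x k ht

/-- The Duhamel formula. -/
lemma perturbed_eq (x : X) (ht : 0 ≤ t) :
    h.perturbed t x = S t x + volterra K (fun s => h.perturbed s x) t := by
  obtain ⟨η, h1, h2⟩ := exists_rate C β h.C_nonneg
  have hη : 0 ≤ η := h.β_nonneg.trans h1
  have hM : 0 ≤ M := zero_le_one.trans h.one_le
  have hsum := fun r => (summable_geometric_two.mul_left (M * ‖x‖)).mul_right (exp (η * r))
  rw [perturbed_apply, (h.summable_neumannTerm x t).tsum_eq_zero_add]
  congr 1
  refine (intervalIntegral.hasSum_integral_of_dominated_convergence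
    (bound := fun n s => C * exp (β * s) / √s * (M * ‖x‖ * (1 / 2) ^ n * exp (η * t)))
    (fun n => ?_) (fun n => .of_forall fun s hs => ?_) (.of_forall fun s _ => (hsum t).mul_left _)
    ?_ (.of_forall fun s _ => (h.summable_neumannTerm x (t - s)).hasSum.mapL (K s))).tsum_eq
  · rw [uIoc_of_le ht]
    exact (h.intervalIntegrable_K (h.neumannTerm_continuous x n) t le_rfl ht).1.1
  · rw [uIoc_of_le ht] at hs
    refine h.norm_K_apply_le hs.1 _ ((h.norm_neumannTerm_le h1 h2 x n _).trans ?_)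
    have : |t - s| ≤ t := by rw [abs_of_nonneg (by linarith [hs.2])]; linarith [hs.1]
    gcongr
  · simp only [tsum_mul_left, tsum_mul_right]
    exact (intervalIntegrable_kernel C β 0 t).mul_const _

/-- A continuous solution of the Duhamel equation is an orbit of the perturbed semigroup. -/
lemma eq_perturbed {u : ℝ → X} (hu : Continuous u) {x : X}
    (hv : ∀ t, 0 ≤ t → u t = S t x + volterra K u t) (ht : 0 ≤ t) :
    u t = h.perturbed t x := by
  have := h.volterra_unique (hu.sub (h.perturbed_continuous x)) (fun s hs => by
    rw [show (u - fun t => h.perturbed t x) = fun t => u t - h.perturbed t x from rfl,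
      h.volterra_sub hu (h.perturbed_continuous x) hs]
    simp only
    rw [hv s hs, h.perturbed_eq x hs]; abel) t ht
  exact sub_eq_zero.1 this

lemma perturbed_add (hs : 0 ≤ s) (ht : 0 ≤ t) :
    h.perturbed (s + t) = (h.perturbed s).comp (h.perturbed t) := by
  ext x
  have hc : Continuous fun r => h.perturbed (r + t) x :=
    (h.perturbed_continuous x).comp (continuous_id.add continuous_const)
  refine h.eq_perturbed hc (fun r hr => ?_) hs
  change h.perturbed (r + t) x = S r (h.perturbed t x) + _
  rw [h.perturbed_eq x (add_nonneg hr ht), h.S_add r t hr ht, h.perturbed_eq x ht, map_add,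
    add_assoc]
  congr 1
  have i1 := h.intervalIntegrable_K (h.perturbed_continuous x) (r + t) le_rfl hr
  have i2 := h.intervalIntegrable_K (h.perturbed_continuous x) (r + t) hr (by linarith : r ≤ r + t)
  have e1 : volterra K (fun s => h.perturbed s x) (r + t) =
      (∫ s in (0 : ℝ)..r, K s (h.perturbed (r + t - s) x)) +
        ∫ s in r..(r + t), K s (h.perturbed (r + t - s) x) :=
    (integral_add_adjacent_intervals i1 i2).symm
  have e2 := h.integral_shift (h.perturbed_continuous x) hr ht
  rw [e1, e2, add_comm]
  congr 1
  unfold volterra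
  refine intervalIntegral.integral_congr fun s _ => ?_
  simp only [show r + t - s = r - s + t by ring]

end Complete

/-- Convolution with `K` commutes with integration in time. -/
lemma volterra_integral [CompleteSpace X] {u : ℝ → X} (hu : Continuous u) (ht : 0 ≤ t) :
    volterra K (fun s => ∫ r in (0 : ℝ)..s, u r) t = ∫ r in (0 : ℝ)..t, volterra K u r := by
  obtain ⟨B, hB0, hB⟩ := exists_bound hu t
  let F : ℝ → ℝ → X := fun s r => (Set.Ioi s).indicator (fun r => K s (u (r - s))) r
  have e1 : volterra K (fun s => ∫ r in (0 : ℝ)..s, u r) t =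
      ∫ s in Set.Ioc 0 t, ∫ r in Set.Ioc 0 t, F s r := by
    rw [volterra, integral_of_le ht]
    refine setIntegral_congr_fun measurableSet_Ioc fun s hs => ?_
    have := intervalIntegral.integral_comp_sub_right (a := s) (b := t) (fun r => K s (u r)) s
    rw [sub_self] at this
    simp only [← (K s).intervalIntegral_comp_comm (hu.intervalIntegrable _ _), ← this, F,
      integral_of_le hs.2, setIntegral_indicator measurableSet_Ioi, Set.Ioc_inter_Ioi,
      sup_of_le_right hs.1.le]
  have e2 : ∫ r in (0 : ℝ)..t, volterra K u r = ∫ r in Set.Ioc 0 t, ∫ s in Set.Ioc 0 t, F s r := by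
    rw [integral_of_le ht]
    refine setIntegral_congr_fun measurableSet_Ioc fun r hr => ?_
    have : ∀ s, F s r = (Set.Iio r).indicator (fun s => K s (u (r - s))) s := fun s => by
      simp only [F, Set.indicator, mem_Ioi, mem_Iio]
    have h2 : Set.Ioc 0 t ∩ Set.Iio r = Set.Ioo 0 r := by
      ext s
      exact ⟨fun q => ⟨q.1.1, q.2⟩, fun q => ⟨⟨q.1, q.2.le.trans hr.2⟩, q.2⟩⟩
    simp only [this, volterra, integral_of_le hr.1.le, setIntegral_indicator measurableSet_Iio, h2,
      integral_Ioc_eq_integral_Ioo]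
  rw [e1, e2]
  refine integral_integral_swap ?_
  have hi := ((intervalIntegrable_iff_integrableOn_Ioc_of_le ht).1
    ((intervalIntegrable_kernel C β 0 t).mul_const B)).comp_fst (volume.restrict (Set.Ioc 0 t))
  have hF : uncurry F = {p : ℝ × ℝ | p.1 < p.2}.indicator fun p => K p.1 (u (p.2 - p.1)) := rfl
  rw [Measure.prod_restrict] at hi ⊢
  have hm2 := measurableSet_Ioc (a := (0 : ℝ)) (b := t) |>.prod
      (measurableSet_Ioc (a := 0) (b := t))
  rw [hF]
  refine hi.mono' (((h.K_joint.comp (f := fun p : ℝ × ℝ => (p.1, u (p.2 - p.1))) (by fun_prop)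
    fun p hp => ⟨hp.1.1, trivial⟩).aestronglyMeasurable hm2).indicator
    (measurableSet_lt measurable_fst measurable_snd)) ?_
  filter_upwards [ae_restrict_mem hm2] with p hp
  by_cases hlt : p.1 < p.2
  · rw [indicator_of_mem (by exact hlt)]
    exact h.norm_K_apply_le hp.1.1 _ (hB _ ⟨by linarith, by linarith [hp.1.1, hp.2.2]⟩)
  · have := h.C_nonneg
    rw [indicator_of_notMem (by exact hlt), norm_zero]
    positivity

end PerturbationData

end Perturbation

section Perturbation

variable {X : Type*} [NormedAddCommGroup X] [NormedSpace ℂ X]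

lemma map_coe_nhdsGT_zero : map ((↑) : ℝ≥0 → ℝ) (𝓝[>] 0) = 𝓝[>] 0 := by
  refine ((Topology.IsEmbedding.subtypeVal
      (p := fun r : ℝ => 0 ≤ r)).map_nhdsWithin_eq _ _).trans ?_
  congr 1
  ext x
  exact ⟨fun ⟨y, hy, e⟩ => e ▸ hy, fun hx => ⟨⟨x, (show 0 < x from hx).le⟩, hx, rfl⟩⟩

lemma generatorGraph_iff_deriv {T : ℝ → X →L[ℂ] X} (hT0 : T 0 = 1) {x y : X} :
    GeneratorGraph (fun t : ℝ≥0 => T t) x y ↔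
      HasDerivWithinAt (fun t => T t x) y (Set.Ioi 0) 0 := by
  rw [hasDerivWithinAt_iff_tendsto_slope' (by simp), ← map_coe_nhdsGT_zero, tendsto_map'_iff]
  refine tendsto_congr fun t => ?_
  rw [Function.comp_apply, slope, sub_zero, ← Complex.ofReal_inv, Complex.coe_smul, hT0]
  rfl

/-- Rescaling a semigroup by `e^{-ct}` shifts its generator by `-c`. -/
lemma generatorGraph_rescale {T : ℝ → X →L[ℂ] X} (hT0 : T 0 = 1) {x y : X} (l : ℂ)
    (hg : GeneratorGraph (fun t : ℝ≥0 => T t) x y) :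
    GeneratorGraph (fun t : ℝ≥0 => Complex.exp (-l * (t : ℝ)) • T t) x (y - l • x) := by
  rw [generatorGraph_iff_deriv (T := fun t : ℝ => Complex.exp (-l * t) • T t) (by simp [hT0])]
  have hd : HasDerivAt (fun t : ℝ => Complex.exp (-l * t)) (-l) 0 := by
    simpa using ((Complex.ofRealCLM.hasDerivAt (x := 0)).const_mul (-l)).cexp
  refine (hd.hasDerivWithinAt.smul ((generatorGraph_iff_deriv hT0).1 hg)).congr_deriv ?_
  simp [hT0, sub_eq_add_neg]

/-- The generator in integrated form. -/
lemma generatorGraph_iff_integral [CompleteSpace X] {T : ℝ → X →L[ℂ] X}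
    (hT : ∀ x, Continuous fun t => T t x) (hT0 : T 0 = 1)
    (hadd : ∀ s t, 0 ≤ s → 0 ≤ t → T (s + t) = (T s).comp (T t)) {x y : X} :
    GeneratorGraph (fun t : ℝ≥0 => T t) x y ↔
      ∀ t, 0 ≤ t → T t x = x + ∫ s in (0 : ℝ)..t, T s y := by
  rw [generatorGraph_iff_deriv hT0]
  refine ⟨fun hg t ht => ?_, fun hi => ?_⟩
  · have hder : ∀ s ∈ Set.Ioo 0 t, HasDerivWithinAt (fun r => T r x) (T s y) (Set.Ioi s) s :=
      fun s hs => by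
        have h1 : HasDerivWithinAt (fun r => r - s) 1 (Set.Ioi s) s :=
          ((hasDerivAt_id s).sub_const s).hasDerivWithinAt
        have h2 := ((T s).restrictScalars ℝ).hasFDerivAt.comp_hasDerivWithinAt s
          (hg.scomp_of_eq s h1 (fun r hr => mem_Ioi.2 (sub_pos.2 hr)) (sub_self s).symm)
        rw [one_smul] at h2
        refine h2.congr (fun r hr => ?_) (by simp [hT0])
        have e := hadd s (r - s) hs.1.le (sub_nonneg.2 (le_of_lt hr))
        rw [add_sub_cancel] at e
        rw [e]; rfl
    have := intervalIntegral.integral_eq_sub_of_hasDeriv_right (f := fun r => T r x)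
      (f' := fun r => T r y) (a := 0) (b := t) (hT x).continuousOn
      (by rwa [min_eq_left ht, max_eq_right ht]) ((hT y).intervalIntegrable _ _)
    simp [this, hT0]
  · have hd := ((hT y).integral_hasStrictDerivAt 0 0).hasDerivAt.const_add x
    rw [hT0] at hd
    exact hd.hasDerivWithinAt.congr (fun t ht => hi t (le_of_lt ht)) (hi 0 le_rfl)

namespace PerturbationData

variable {S K : ℝ → X →L[ℂ] X} {M C β : ℝ} (h : PerturbationData S K M C β)
include h

variable [CompleteSpace X]

/-- The generator of the perturbed semigroup is described by the mild form of the equation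
`A x = y`. -/
lemma generatorGraph_perturbed_iff {x y : X} :
    GeneratorGraph (fun t : ℝ≥0 => h.perturbed t) x y ↔
      ∀ t, 0 ≤ t → S t x + volterra K (fun _ => x) t = x + ∫ s in (0 : ℝ)..t, S s y := by
  rw [generatorGraph_iff_integral h.perturbed_continuous (h.perturbed_nonpos le_rfl)
    (fun s t => h.perturbed_add)]
  have hcy := h.perturbed_continuous y
  have hci : Continuous fun t => ∫ s in (0 : ℝ)..t, h.perturbed s y :=
    intervalIntegral.continuous_primitive (fun a b => hcy.intervalIntegrable a b) 0
  set v : ℝ → X := fun t => x + ∫ s in (0 : ℝ)..t, h.perturbed s y with hv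
  have key : ∀ t, 0 ≤ t → volterra K v t = volterra K (fun _ => x) t +
      ((∫ s in (0 : ℝ)..t, h.perturbed s y) - ∫ s in (0 : ℝ)..t, S s y) := fun t ht => by
    rw [hv, h.volterra_add continuous_const hci ht, h.volterra_integral hcy ht,
      ← intervalIntegral.integral_sub (hcy.intervalIntegrable _ _)
        ((h.S_cont y).intervalIntegrable _ _)]
    congr 1
    refine intervalIntegral.integral_congr fun s hs => ?_
    rw [uIcc_of_le ht] at hs
    exact eq_sub_of_add_eq' (h.perturbed_eq y hs.1).symm
  refine ⟨fun H t ht => ?_, fun H t ht => ?_⟩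
  · have e1 := h.perturbed_eq x ht
    rw [volterra_congr ht fun s hs => H s hs.1, key t ht, H t ht] at e1
    rw [← sub_eq_zero] at e1 ⊢
    rw [← neg_eq_zero, ← e1]
    abel
  · refine (h.eq_perturbed (u := v) (continuous_const.add hci) (fun s hs => ?_) ht).symm
    rw [key s hs, ← add_assoc, H s hs, hv]
    abel_nf

lemma isC0Semigroup_perturbed : IsC0Semigroup (fun t : ℝ≥0 => h.perturbed t) where
  map_zero := h.perturbed_nonpos (by simp)
  map_add s t := by rw [NNReal.coe_add]; exact h.perturbed_add s.2 t.2
  continuous_orbit x := (h.perturbed_continuous x).comp NNReal.continuous_coe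

/-- An eigenvector of the generator is an eigenvector of the semigroup. -/
lemma perturbed_eigenvector {x : X} {l : ℂ}
    (hg : GeneratorGraph (fun t : ℝ≥0 => h.perturbed t) x (l • x)) (ht : 0 ≤ t) :
    h.perturbed t x = Complex.exp (l * t) • x := by
  have h0 := h.perturbed_nonpos le_rfl
  have := generatorGraph_rescale h0 l hg
  rw [sub_self, generatorGraph_iff_integral (T := fun t : ℝ => Complex.exp (-l * t) • h.perturbed t)
    (fun x => .smul (by fun_prop) (h.perturbed_continuous x)) (by simp [h0])
    fun s t hs ht => by
      ext v
      simp only [h.perturbed_add hs ht, smul_apply, ContinuousLinearMap.comp_apply, map_smul,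
        smul_smul, ← Complex.exp_add]
      congr 2; push_cast; ring] at this
  have e := this t ht
  simp only [smul_apply, map_zero, intervalIntegral.integral_zero, add_zero] at e
  nth_rw 2 [← e]
  rw [smul_smul, ← Complex.exp_add, neg_mul, add_neg_cancel, Complex.exp_zero, one_smul]

end PerturbationData

end Perturbation

/-! ### Compact perturbations and the essential spectrum -/

section Perturbation

variable {X : Type*} [NormedAddCommGroup X] [NormedSpace ℂ X] [CompleteSpace X]

/-- If the operators `K t` are compact, the perturbed semigroup differs from the unperturbed one by
compact operators. -/
lemma PerturbationData.isCompactOperator_perturbed_sub {S K : ℝ → X →L[ℂ] X} {M β : ℝ}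
    (h : PerturbationData S K M C β) (hK : ∀ t, 0 < t → IsCompactOperator (K t)) (ht : 0 ≤ t) :
    IsCompactOperator (h.perturbed t - S t) := by
  rcases ht.eq_or_lt with rfl | ht
  · rw [h.perturbed_nonpos le_rfl, h.S_nonpos 0 le_rfl, sub_self]
    exact isCompactOperator_zero
  -- a uniform bound on `[0, t]`
  obtain ⟨B, hB⟩ := banach_steinhaus (g := fun s : Set.Icc (0 : ℝ) t => h.perturbed s) fun x => by
    obtain ⟨B, hB⟩ := isCompact_Icc.exists_bound_of_continuousOn
      ((h.perturbed_continuous x).continuousOn (s := Set.Icc 0 t))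
    exact ⟨B, fun s => hB s s.2⟩
  have hB0 : 0 ≤ B := (norm_nonneg _).trans (hB ⟨0, le_rfl, ht.le⟩)
  let D : ℝ → X →L[ℂ] X := fun ε => (S ε).comp (h.perturbed (t - ε) - S (t - ε))
  have hi : ∀ x {a b : ℝ}, 0 ≤ a → a ≤ b → IntervalIntegrable _ volume a b := fun x =>
    h.intervalIntegrable_K (h.perturbed_continuous x) t
  have hD : ∀ ε ∈ Set.Icc 0 t, ∀ x, D ε x = ∫ s in ε..t, K s (h.perturbed (t - s) x) :=
      fun ε hε x => by
    have := h.integral_shift (h.perturbed_continuous x) hε.1 (sub_nonneg.2 hε.2)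
    rw [add_sub_cancel] at this
    rw [this, ← sub_eq_of_eq_add' (h.perturbed_eq x (sub_nonneg.2 hε.2))]; rfl
  have hD0 : D 0 = h.perturbed t - S t := by simp only [D, h.S_nonpos 0 le_rfl, sub_zero]; rfl
  have hlim : Tendsto D (𝓝[>] 0) (𝓝 (D 0)) := by
    rw [tendsto_iff_norm_sub_tendsto_zero]
    have hprim : Tendsto (fun ε => (∫ s in (0 : ℝ)..ε, C * exp (β * s) / √s) * B)
        (𝓝[>] 0) (𝓝 0) := by
      have := ((intervalIntegral.continuous_primitive (intervalIntegrable_kernel C β) 0).tendsto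
        0).mul_const B
      rw [integral_same, zero_mul] at this
      exact this.mono_left nhdsWithin_le_nhds
    refine squeeze_zero' (.of_forall fun _ => norm_nonneg _) ?_ hprim
    filter_upwards [Ioo_mem_nhdsGT ht] with ε hε
    refine ContinuousLinearMap.opNorm_le_bound _ (mul_nonneg (intervalIntegral.integral_nonneg
      hε.1.le fun s _ => ?_) hB0) fun x => ?_
    · have := h.C_nonneg; positivity
    rw [sub_apply, hD ε ⟨hε.1.le, hε.2.le⟩, hD 0 ⟨le_rfl, ht.le⟩, ← integral_add_adjacent_intervals
      (hi x le_rfl hε.1.le) (hi x hε.1.le hε.2.le), sub_add_cancel_right, norm_neg, mul_assoc,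
      ← intervalIntegral.integral_mul_const]
    refine intervalIntegral.norm_integral_le_of_norm_le hε.1.le (.of_forall fun s hs => ?_)
      ((intervalIntegrable_kernel C β 0 ε).mul_const _)
    exact h.norm_K_apply_le hs.1 _ (ContinuousLinearMap.le_of_opNorm_le _
      (hB ⟨t - s, by linarith [hs.2, hε.2], by linarith [hs.1]⟩) x)
  rw [← hD0]
  refine isCompactOperator_of_tendsto hlim ?_
  filter_upwards [Ioo_mem_nhdsGT ht] with ε hε
  -- the values of the integrand on the unit ball lie in a fixed compact set
  obtain ⟨Q₀, hQ₀, hQ₀'⟩ := (hK ε hε.1).image_subset_compact_of_bounded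
    (Metric.isBounded_closedBall (x := (0 : X)) (r := B))
  let Q : Set X := (fun p : ℝ × X => S p.1 p.2) '' (Set.Icc 0 (t - ε) ×ˢ Q₀)
  have hQ : IsCompact Q := (isCompact_Icc.prod hQ₀).image h.S_joint
  have hQc : IsCompact (closedConvexHull ℝ Q) := by
    rw [closedConvexHull_eq_closure_convexHull]
    exact hQ.totallyBounded.convexHull.closure.isCompact_of_isClosed isClosed_closure
  rw [isCompactOperator_iff_exists_mem_nhds_image_subset_compact]
  refine ⟨closedBall 0 1, Metric.closedBall_mem_nhds _ one_pos,
    (fun y : X => (t - ε) • y) '' (closedConvexHull ℝ Q), hQc.image (continuous_const_smul _), ?_⟩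
  rintro _ ⟨x, hx, rfl⟩
  have hpos : 0 < t - ε := sub_pos.2 hε.2
  refine ⟨(t - ε)⁻¹ • D ε x, ?_, smul_inv_smul₀ hpos.ne' _⟩
  have hav := (convex_closedConvexHull (𝕜 := ℝ) (s := Q)).set_average_mem
    isClosed_closedConvexHull (t := Set.Ioc ε t) (μ := volume)
    (f := fun s => K s (h.perturbed (t - s) x)) (by simp [hε.2]) (by simp)
    (by
      filter_upwards [ae_restrict_mem measurableSet_Ioc] with s hs
      refine subset_closedConvexHull ⟨(s - ε, K ε (h.perturbed (t - s) x)),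
        ⟨⟨sub_nonneg.2 hs.1.le, sub_le_sub_right hs.2 ε⟩, hQ₀' ⟨_, ?_, rfl⟩⟩, ?_⟩
      · rw [mem_closedBall_zero_iff] at hx ⊢
        exact (ContinuousLinearMap.le_of_opNorm_le _ (hB ⟨t - s, by linarith [hs.2],
          by linarith [hs.1, hε.1]⟩) x).trans (mul_le_of_le_one_right hB0 hx)
      · change ((S (s - ε)).comp (K ε)) _ = _
        rw [← h.K_add _ ε (sub_nonneg.2 hs.1.le) hε.1, sub_add_cancel])
    ((intervalIntegrable_iff_integrableOn_Ioc_of_le hε.2.le).1 (hi x hε.1.le hε.2.le))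
  rw [setAverage_eq, ← integral_of_le hε.2.le, ← hD ε ⟨hε.1.le, hε.2.le⟩] at hav
  simpa [measureReal_def, volume_Ioc, hpos.le] using hav

end Perturbation

section Hilbert

variable {X Y : Type*} [NormedAddCommGroup X] [InnerProductSpace ℂ X] [CompleteSpace X]
  [NormedAddCommGroup Y] [InnerProductSpace ℂ Y] [CompleteSpace Y]

omit [CompleteSpace X] in
lemma isCompactOperator_of_mem {V : Submodule ℂ X} [FiniteDimensional ℂ V] {T : X →L[ℂ] X}
    (hT : ∀ x, T x ∈ V) : IsCompactOperator T := by
  have := FiniteDimensional.proper ℂ V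
  have h : IsCompactOperator (T.codRestrict V hT) := isCompactOperator_of_locallyCompactSpace_dom _
  exact h.clm_comp V.subtypeL

omit [CompleteSpace X] in
/-- A compact operator with values in a Hilbert space is a norm limit of finite-rank operators. -/
lemma exists_finiteRank_approx {C : X →L[ℂ] X} (hC : IsCompactOperator C) {ε : ℝ} (hε : 0 < ε) :
    ∃ F : X →L[ℂ] X, FiniteDimensional ℂ F.range ∧ ‖C - F‖ ≤ ε := by
  obtain ⟨Q, hQ, hQ'⟩ := hC.image_closedBall_subset_compact (1 : ℝ)
  obtain ⟨s, hs, hsf, hcov⟩ := hQ.finite_cover_balls hε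
  let V : Submodule ℂ X := Submodule.span ℂ s
  have : FiniteDimensional ℂ V := FiniteDimensional.span_of_finite ℂ hsf
  refine ⟨V.starProjection.comp C, Submodule.finiteDimensional_of_le (S₂ := V) ?_,
    ContinuousLinearMap.opNorm_le_of_unit_norm hε.le fun x hx => ?_⟩
  · rintro _ ⟨x, rfl⟩
    exact V.starProjection_apply_mem _
  · obtain ⟨v, hv, hxv⟩ := Set.mem_iUnion₂.1 (hcov (hQ' ⟨x, by simp [hx], rfl⟩))
    have h1 : ‖C x - V.starProjection (C x)‖ ≤ ‖C x - v‖ := by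
      rw [Submodule.starProjection_minimal]
      exact ciInf_le ⟨0, by rintro _ ⟨w, rfl⟩; exact norm_nonneg _⟩
        (⟨v, Submodule.subset_span hv⟩ : V)
    exact h1.trans (mem_ball_iff_norm.1 hxv).le

open LinearMap.FiniteRangeSetoid in
/-- `z - A - C` is Fredholm when `‖A‖ < |z|` and `C` is compact. -/
lemma isFredholm_of_norm_lt {A C : X →L[ℂ] X} {z : ℂ} (hA : ‖A‖ < ‖z‖)
    (hC : IsCompactOperator C) : (z • idL X - (A + C)).IsFredholm := by
  obtain ⟨F, hF, hCF⟩ := exists_finiteRank_approx hC (half_pos (sub_pos.2 hA))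
  obtain ⟨u, hu⟩ : z ∈ resolventSet ℂ (A + (C - F)) :=
    spectrum.mem_resolventSet_of_norm_lt_mul ((mul_le_of_le_one_right (norm_nonneg _)
      ContinuousLinearMap.norm_id_le).trans_lt (by linarith [norm_add_le A (C - F)]))
  have e : z • idL X - (A + C) = (u : X →L[ℂ] X) - F := by
    rw [hu, Algebra.algebraMap_eq_smul_one, sub_sub, add_assoc, sub_add_cancel]; rfl
  let U := ContinuousLinearEquiv.unitsEquiv ℂ X u
  refine ContinuousLinearMap.IsFredholm.of_isQuasiInverse (v := (U.symm : X →L[ℂ] X))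
    ((LinearEquiv.isQuasiInverse U.toLinearEquiv).congr (Setoid.refl _) ?_)
  rw [e, equiv_iff_hasNoetherianRange, show (((u : X →L[ℂ] X) - F : X →L[ℂ] X) : X →ₗ[ℂ] X) -
    U.toLinearEquiv = -F from sub_eq_of_eq_add (neg_add_eq_sub _ _).symm]
  exact .neg (LinearMap.hasNoetherianRange_iff_range.2 inferInstance)

omit [CompleteSpace X] in
open LinearMap.FiniteRangeSetoid in
/-- A singular (Weyl) sequence for a compact perturbation `S` of `T` prevents `z - T` from being
Fredholm. -/
lemma not_isFredholm_of_singular_sequence {S T : X →L[ℂ] X} {z : ℂ}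
    (hTS : IsCompactOperator (T - S)) {u : ℕ → X} (hu1 : ∀ n, ‖u n‖ = 1)
    (hu : Tendsto (fun n => z • u n - S (u n)) atTop (𝓝 0))
    (hweak : ∀ φ : ℕ → ℕ, StrictMono φ → ∀ v, Tendsto (u ∘ φ) atTop (𝓝 v) → v = 0) :
    ¬ (z • idL X - T).IsFredholm := fun hF => by
  obtain ⟨R, hR⟩ := ContinuousLinearMap.isFredholm_iff_exists_isQuasiInverse.1 hF
  let F : X →L[ℂ] X := R.comp (z • idL X - T) - idL X
  have hfd : FiniteDimensional ℂ F.range := @Module.IsNoetherian.finite _ _ _ _ _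
    (LinearMap.hasNoetherianRange_iff_range.1 (equiv_iff_hasNoetherianRange.1 hR.1))
  let G : X →L[ℂ] X := R.comp (T - S) + F
  have hGc : IsCompactOperator G := (hTS.clm_comp R).add
    (isCompactOperator_of_mem (V := F.range) fun x => ⟨x, rfl⟩)
  obtain ⟨Q, hQ, hQ'⟩ := hGc.image_closedBall_subset_compact (1 : ℝ)
  obtain ⟨v, -, φ, hφ, hv⟩ := hQ.tendsto_subseq (x := fun n => G (u n))
    (fun n => hQ' ⟨u n, by simp [hu1], rfl⟩)
  have hconv : Tendsto (u ∘ φ) atTop (𝓝 (R 0 - v)) := by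
    refine ((((R.continuous.tendsto 0).comp hu).comp hφ.tendsto_atTop).sub hv).congr fun n => ?_
    simp only [G, F, Function.comp_apply, sub_apply, add_apply, ContinuousLinearMap.comp_apply,
      map_sub, smul_apply, idL_apply, map_smul]
    abel
  have := hconv.norm
  simp only [hweak φ hφ _ hconv, Function.comp_apply, hu1, norm_zero] at this
  exact one_ne_zero (tendsto_nhds_unique tendsto_const_nhds this)

omit [CompleteSpace X] in
/-- A Hilbert–Schmidt operator is compact. -/
lemma isCompactOperator_of_summable {ι : Type*} (e : HilbertBasis ι ℂ X) {T : X →L[ℂ] Y}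
    (hT : Summable fun i => ‖T (e i)‖ ^ 2) : IsCompactOperator T := by
  classical
  -- the operator norm is bounded by the Hilbert–Schmidt norm
  have hb : ∀ A : X →L[ℂ] Y, (Summable fun i => ‖A (e i)‖ ^ 2) →
      ‖A‖ ≤ √(∑' i, ‖A (e i)‖ ^ 2) := fun A hA => by
    have hs : ∀ x, HasSum (fun i => e.repr x i • A (e i)) (A x) := fun x => by
      simpa using (e.hasSum_repr x).mapL A
    refine A.opNorm_le_bound (sqrt_nonneg _) fun x => le_of_tendsto (hs x).norm
        (.of_forall fun t => ?_)
    refine (norm_sum_le _ _).trans ?_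
    simp only [norm_smul]
    refine (sum_mul_le_sqrt_mul_sqrt _ _ _).trans ?_
    rw [mul_comm]
    refine mul_le_mul (sqrt_le_sqrt (hA.sum_le_tsum _ fun _ _ => by positivity)) ?_ (sqrt_nonneg _)
      (sqrt_nonneg _)
    rw [sqrt_le_left (norm_nonneg x)]
    simpa [e.repr_apply_apply] using e.orthonormal.sum_inner_products_le (s := t) x
  let P : Finset ι → X →L[ℂ] X := fun s => ∑ i ∈ s, (innerSL ℂ (e i)).smulRight (e i)
  have h1 : ∀ s, (fun j => ‖(T - T.comp (P s)) (e j)‖ ^ 2) =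
      {i | i ∉ s}.indicator fun i => ‖T (e i)‖ ^ 2 := fun s => by
    ext j
    by_cases h : j ∈ s <;> simp [P, orthonormal_iff_ite.1 e.orthonormal, h]
  have hlim : Tendsto (fun s => T.comp (P s)) atTop (𝓝 T) := by
    rw [tendsto_iff_norm_sub_tendsto_zero]
    have htail := (continuous_sqrt.tendsto 0).comp
      (tendsto_tsum_compl_atTop_zero fun i => ‖T (e i)‖ ^ 2)
    rw [sqrt_zero] at htail
    refine squeeze_zero (fun _ => norm_nonneg _) (fun s => ?_) htail
    have := hb (T - T.comp (P s)) (by rw [h1]; exact hT.indicator _)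
    rwa [h1, ← tsum_subtype, norm_sub_rev] at this
  refine isCompactOperator_of_tendsto hlim (.of_forall fun s => ?_)
  have : FiniteDimensional ℂ (Submodule.span ℂ (e '' (s : Set ι))) :=
    FiniteDimensional.span_of_finite ℂ (s.finite_toSet.image _)
  refine (isCompactOperator_of_mem
      (V := Submodule.span ℂ (e '' (s : Set ι))) fun x => ?_).clm_comp T
  simp only [P, sum_apply]
  exact Submodule.sum_mem _ fun i hi => Submodule.smul_mem _ _ (Submodule.subset_span ⟨i, hi, rfl⟩)

end Hilbert

/-! ### The Mehler kernel -/

/-- The two-dimensional Gauss kernel `e^{-|z|²/(4a)} / (4πa)`. -/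
def gauss (a : ℝ) (z : Plane) : ℝ := (4 * π * a)⁻¹ * exp (-‖z‖ ^ 2 / (4 * a))

/-- The variance parameter `1 - e^{-t}` of the Mehler kernel. -/
def mvar (t : ℝ) : ℝ := 1 - exp (-t)

/-- The contraction factor `e^{-t/2}` of the Mehler kernel. -/
def damp (t : ℝ) : ℝ := exp (-t / 2)

/-- The Mehler kernel, i.e. the integral kernel of `e^{t(Δ + ξ/2·∇ + 1)}`. -/
def mehler (t : ℝ) (x y : Plane) : ℝ := gauss (mvar t) (x - damp t • y)

lemma plane_norm_sq (x : Plane) : ‖x‖ ^ 2 = x 0 ^ 2 + x 1 ^ 2 := by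
  rw [EuclideanSpace.norm_sq_eq]; simp [Fin.sum_univ_two]

lemma damp_pos (t : ℝ) : 0 < damp t := exp_pos _

lemma damp_sq (t : ℝ) : damp t ^ 2 = 1 - mvar t := by
  unfold damp mvar
  rw [← exp_nat_mul]; ring_nf

lemma damp_sq' (t : ℝ) : damp t ^ 2 = exp (-t) := by rw [damp_sq, mvar]; ring

lemma damp_le_one (ht : 0 ≤ t) : damp t ≤ 1 := exp_le_one_iff.2 (by linarith)

lemma damp_lt_one (ht : 0 < t) : damp t < 1 := exp_lt_one_iff.2 (by linarith)

lemma mvar_pos (ht : 0 < t) : 0 < mvar t := by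
  unfold mvar; linarith [exp_lt_one_iff.2 (neg_lt_zero.2 ht)]

lemma mvar_lt_one (t : ℝ) : mvar t < 1 := by unfold mvar; linarith [exp_pos (-t)]

lemma damp_add (s t : ℝ) : damp (s + t) = damp s * damp t := by unfold damp; rw [← exp_add]; ring_nf

lemma mvar_add (s t : ℝ) : mvar (s + t) = mvar s + damp s ^ 2 * mvar t := by
  rw [damp_sq']; unfold mvar
  rw [neg_add, exp_add]; ring

lemma le_mvar (t : ℝ) : t * exp (-t) ≤ mvar t := by
  unfold mvar
  have h1 := add_one_le_exp t
  have h2 := exp_pos (-t)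
  have h3 : exp t * exp (-t) = 1 := by rw [← exp_add]; simp
  nlinarith

lemma gauss_pos (ha : 0 < a) (z : Plane) : 0 < gauss a z := by
  unfold gauss; have := pi_pos; positivity

lemma gauss_continuous (a : ℝ) : Continuous (gauss a) := by unfold gauss; fun_prop

@[simp] lemma gauss_neg (a : ℝ) (z : Plane) : gauss a (-z) = gauss a z := by simp [gauss]

lemma gauss_sub_comm (a : ℝ) (x y : Plane) : gauss a (x - y) = gauss a (y - x) := by
  rw [← gauss_neg, neg_sub]

lemma integral_gauss (ha : 0 < a) : ∫ z, gauss a z = 1 := by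
  unfold gauss
  rw [integral_const_mul]
  have h := GaussianFourier.integral_rexp_neg_mul_sq_norm (V := Plane) (b := 1 / (4 * a))
    (by positivity)
  have e : ∀ z : Plane, -‖z‖ ^ 2 / (4 * a) = -(1 / (4 * a)) * ‖z‖ ^ 2 := fun z => by ring
  simp only [e, h]
  have hpi := pi_pos
  simp only [finrank_euclideanSpace, Fintype.card_fin]
  norm_num
  field_simp

lemma integrable_gauss (ha : 0 < a) : Integrable (gauss a) := by
  by_contra h
  have := integral_gauss ha
  rw [integral_undef h] at this
  exact zero_ne_one this

lemma lintegral_gauss (ha : 0 < a) : ∫⁻ z, ofReal (gauss a z) = 1 := by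
  rw [← ofReal_integral_eq_lintegral_ofReal (integrable_gauss ha)
    (.of_forall fun z => (gauss_pos ha z).le), integral_gauss ha,
    ofReal_one]

lemma lintegral_gauss_sub (ha : 0 < a) (c : Plane) :
    ∫⁻ z, ofReal (gauss a (z - c)) = 1 := by
  rw [← lintegral_gauss ha]
  exact lintegral_sub_right_eq_self (fun z => ofReal (gauss a z)) c

lemma integrable_gauss_sub (ha : 0 < a) (c : Plane) : Integrable fun z => gauss a (z - c) :=
  (integrable_gauss ha).comp_sub_right c

lemma integral_gauss_sub (ha : 0 < a) (c : Plane) : ∫ z, gauss a (z - c) = 1 := by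
  rw [← integral_gauss ha]
  exact integral_sub_right_eq_self (gauss a) c

/-- As a function of `y`, the kernel `G_a(x - by)` is a multiple of a Gauss kernel. -/
lemma gauss_smul_sub (ha : 0 < a) (hb : 0 < b) (x y : Plane) :
    gauss a (x - b • y) = (b ^ 2)⁻¹ * gauss (a / b ^ 2) (y - b⁻¹ • x) := by
  unfold gauss
  rw [← mul_assoc]
  congr 1
  · have := pi_pos
    field_simp
  · congr 1
    simp only [plane_norm_sq, PiLp.sub_apply, PiLp.smul_apply, smul_eq_mul]
    field_simp
    ring

/-- Product of two Gauss kernels, by completing the square. -/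
lemma gauss_mul {p q : ℝ} (hp : 0 < p) (hq : 0 < q) (x z c : Plane) :
    gauss p (x - b • z) * gauss q (z - c) =
      gauss (p + b ^ 2 * q) (x - b • c) *
        gauss (p * q / (p + b ^ 2 * q)) (z - (p + b ^ 2 * q)⁻¹ • (p • c + (b * q) • x)) := by
  have hr : 0 < p + b ^ 2 * q := by positivity
  have hpi := pi_pos
  unfold gauss
  rw [mul_mul_mul_comm (4 * π * p)⁻¹, mul_mul_mul_comm (4 * π * (p + b ^ 2 * q))⁻¹,
    ← exp_add, ← exp_add]
  congr 1
  · field_simp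
  · congr 1
    simp only [plane_norm_sq, PiLp.sub_apply, PiLp.add_apply, PiLp.smul_apply, smul_eq_mul]
    field_simp
    ring

/-- The Gauss kernels are invariant under convolution. -/
lemma integral_gauss_mul {p q : ℝ} (hp : 0 < p) (hq : 0 < q) (x c : Plane) :
    ∫ z, gauss p (x - b • z) * gauss q (z - c) = gauss (p + b ^ 2 * q) (x - b • c) := by
  simp only [gauss_mul hp hq]
  rw [integral_const_mul, integral_gauss_sub (by positivity), mul_one]

lemma integrable_gauss_mul {p q : ℝ} (hp : 0 < p) (hq : 0 < q) (x c : Plane) :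
    Integrable fun z => gauss p (x - b • z) * gauss q (z - c) := by
  simp only [gauss_mul hp hq]
  exact (integrable_gauss_sub (by positivity) _).const_mul _

lemma norm_sq_mul_gauss_le (ha : 0 < a) (z : Plane) :
    ‖z‖ ^ 2 / (4 * a ^ 2) * gauss a z ≤ 2 / a * gauss (2 * a) z := by
  unfold gauss
  have hpi := pi_pos
  set s := ‖z‖ ^ 2 / (4 * a) with hs
  have hs0 : 0 ≤ s := by positivity
  have e1 : -‖z‖ ^ 2 / (4 * a) = -s := by rw [hs]; ring
  have e2 : -‖z‖ ^ 2 / (4 * (2 * a)) = -s / 2 := by rw [hs]; field_simp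
  have e3 : ‖z‖ ^ 2 / (4 * a ^ 2) = s / a := by rw [hs]; field_simp
  rw [e1, e2, e3]
  have h1 : s * exp (-s) ≤ exp (-s / 2) := by
    have h2 := add_one_le_exp (s / 2 - 1)
    have h3 : s ≤ exp (s / 2) := by
      have h4 : exp (s / 2) = exp 1 * exp (s / 2 - 1) := by rw [← exp_add]; ring_nf
      have h5 := add_one_le_exp (1 : ℝ)
      rw [h4]
      nlinarith [exp_pos (s / 2 - 1)]
    calc s * exp (-s) ≤ exp (s / 2) * exp (-s) := by gcongr
      _ = exp (-s / 2) := by rw [← exp_add]; ring_nf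
  calc s / a * ((4 * π * a)⁻¹ * exp (-s)) = (a * (4 * π * a))⁻¹ * (s * exp (-s)) := by field_simp
    _ ≤ (a * (4 * π * a))⁻¹ * exp (-s / 2) := by gcongr
    _ = _ := by field_simp

lemma mehler_pos (ht : 0 < t) (x y : Plane) : 0 < mehler t x y := gauss_pos (mvar_pos ht) _

lemma mehler_continuous (t : ℝ) : Continuous fun p : Plane × Plane => mehler t p.1 p.2 :=
  (gauss_continuous _).comp (by fun_prop)

/-- The Mehler kernel is symmetric with respect to the Gaussian weight. -/
lemma mehler_symm (ht : 0 < t) (x y : Plane) :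
    mehler t x y * exp (-‖y‖ ^ 2 / 4) = exp (-‖x‖ ^ 2 / 4) * mehler t y x := by
  unfold mehler gauss
  have ha := mvar_pos ht
  rw [mul_assoc, mul_left_comm (exp _), ← exp_add, ← exp_add]
  congr 2
  have hb := damp_sq t
  set a := mvar t
  set b := damp t
  simp only [plane_norm_sq, PiLp.sub_apply, PiLp.smul_apply, smul_eq_mul]
  have ha' : a = 1 - b ^ 2 := by linarith
  have hne : (1 - b ^ 2) ≠ 0 := by rw [← ha']; exact ha.ne'
  rw [ha']
  field_simp
  ring

/-- The Chapman–Kolmogorov equation. -/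
lemma mehler_mul (hs : 0 < s) (ht : 0 < t) (x z y : Plane) :
    mehler s x z * mehler t z y = mehler (s + t) x y *
      gauss (mvar s * mvar t / mvar (s + t))
        (z - (mvar (s + t))⁻¹ • ((mvar s * damp t) • y + (damp s * mvar t) • x)) := by
  unfold mehler
  rw [gauss_mul (mvar_pos hs) (mvar_pos ht), mvar_add, damp_add, smul_smul, smul_smul]

lemma integral_mehler_mul (hs : 0 < s) (ht : 0 < t) (x y : Plane) :
    ∫ z, mehler s x z * mehler t z y = mehler (s + t) x y := by
  unfold mehler
  rw [integral_gauss_mul (mvar_pos hs) (mvar_pos ht), mvar_add, damp_add, smul_smul]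

lemma integrable_mehler_mul (hs : 0 < s) (ht : 0 < t) (x y : Plane) :
    Integrable fun z => mehler s x z * mehler t z y :=
  integrable_gauss_mul (mvar_pos hs) (mvar_pos ht) _ _

lemma lintegral_mehler_left (ht : 0 < t) (y : Plane) : ∫⁻ x, ofReal (mehler t x y) = 1 :=
  lintegral_gauss_sub (mvar_pos ht) _

lemma lintegral_gauss_right (ha : 0 < a) (hb : 0 < b) (x : Plane) :
    ∫⁻ y, ofReal (gauss a (x - b • y)) = ofReal ((b ^ 2)⁻¹) := by
  simp only [gauss_smul_sub ha hb]
  have : ∀ y, ofReal ((b ^ 2)⁻¹ * gauss (a / b ^ 2) (y - b⁻¹ • x)) =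
      ofReal ((b ^ 2)⁻¹) * ofReal (gauss (a / b ^ 2) (y - b⁻¹ • x)) :=
    fun y => ofReal_mul (by positivity)
  simp only [this]
  rw [lintegral_const_mul' _ _ (by simp), lintegral_gauss_sub (by positivity), mul_one]

lemma integrable_gauss_mul_clm (ha : 0 < a) (ℓ : Plane →L[ℝ] ℝ) :
    Integrable fun z => gauss a z * ℓ z := by
  have hb : Integrable fun z => ‖ℓ‖ * (4 * a + 1) * (gauss a z + 4 * gauss (2 * a) z) :=
    ((integrable_gauss ha).add
      ((integrable_gauss (by positivity : 0 < 2 * a)).const_mul 4)).const_mul _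
  refine hb.mono' (((gauss_continuous a).mul ℓ.continuous).aestronglyMeasurable) ?_
  refine Eventually.of_forall fun z => ?_
  have hg := gauss_pos ha z
  have hg2 := gauss_pos (by positivity : 0 < 2 * a) z
  rw [norm_mul, norm_of_nonneg hg.le]
  have h2 := norm_sq_mul_gauss_le ha z
  have h3 : ‖z‖ ^ 2 * gauss a z ≤ 8 * a * gauss (2 * a) z := by
    have := mul_le_mul_of_nonneg_left h2 (by positivity : 0 ≤ 4 * a ^ 2)
    calc ‖z‖ ^ 2 * gauss a z = 4 * a ^ 2 * (‖z‖ ^ 2 / (4 * a ^ 2) * gauss a z) := by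
          field_simp
      _ ≤ _ := this
      _ = _ := by field_simp; ring
  have h4 : ‖z‖ * gauss a z ≤ gauss a z + 8 * a * gauss (2 * a) z := by
    have : ‖z‖ ≤ 1 + ‖z‖ ^ 2 := by nlinarith [sq_nonneg (‖z‖ - 1), norm_nonneg z]
    nlinarith
  calc gauss a z * ‖ℓ z‖ ≤ gauss a z * (‖ℓ‖ * ‖z‖) := by
        gcongr; exact ℓ.le_opNorm z
    _ = ‖ℓ‖ * (‖z‖ * gauss a z) := by ring
    _ ≤ ‖ℓ‖ * (gauss a z + 8 * a * gauss (2 * a) z) := by gcongr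
    _ ≤ ‖ℓ‖ * (4 * a + 1) * (gauss a z + 4 * gauss (2 * a) z) := by
        rw [mul_assoc ‖ℓ‖, mul_assoc 8]
        refine mul_le_mul_of_nonneg_left ?_ (norm_nonneg ℓ)
        nlinarith [mul_pos ha hg, mul_pos ha hg2]

lemma integrable_gauss_sub_mul_clm (ha : 0 < a) (c : Plane) (ℓ : Plane →L[ℝ] ℝ) :
    Integrable fun z => gauss a (z - c) * ℓ z := by
  have h := ((integrable_gauss_mul_clm ha ℓ).comp_sub_right c).add
    ((integrable_gauss_sub ha c).const_mul (ℓ c))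
  refine h.congr (.of_forall fun z => ?_)
  simp only [Pi.add_apply, map_sub]; ring

/-- First moment of a Gauss kernel. -/
lemma integral_gauss_mul_inner (ha : 0 < a) (c : Plane) (ℓ : Plane →L[ℝ] ℝ) :
    ∫ z, gauss a (z - c) * ℓ z = ℓ c := by
  have h1 : ∫ z, gauss a z * ℓ z = 0 := by
    have := integral_neg_eq_self (fun z => gauss a z * ℓ z) (volume : Measure Plane)
    simp only [gauss_neg, map_neg, mul_neg, integral_neg] at this
    linarith
  have hint := integrable_gauss_mul_clm ha ℓ
  have h2 : ∫ z, gauss a (z - c) * ℓ z =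
      ∫ z, (gauss a (z - c) * ℓ (z - c) + ℓ c * gauss a (z - c)) := by
    congr 1; funext z; rw [map_sub]; ring
  rw [h2, integral_add (hint.comp_sub_right c)
    ((integrable_gauss_sub ha c).const_mul _), integral_const_mul, integral_gauss_sub ha,
    mul_one]
  have h3 := integral_sub_right_eq_self (fun z => gauss a z * ℓ z) c (μ := (volume : Measure Plane))
  rw [h3, h1, zero_add]

/-! ### Weighted spaces and integral operators -/

/-- The weight `ρ_m(|x|²)` as an extended nonnegative number. -/
def wt (m : ℝ≥0∞) (x : Plane) : ℝ≥0∞ := ofReal (rho m (‖x‖ ^ 2))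

lemma one_le_rho (m : ℝ≥0∞) {r : ℝ} (hr : 0 ≤ r) : 1 ≤ rho m r := by
  unfold rho
  split_ifs with h0 h1
  · exact le_rfl
  · exact one_le_exp (by positivity)
  · have : 0 < m.toReal := ENNReal.toReal_pos h0 h1
    exact one_le_rpow (by linarith [show 0 ≤ r / (4 * m.toReal) by positivity]) this.le

lemma rho_continuous (m : ℝ≥0∞) : Continuous fun x : Plane => rho m (‖x‖ ^ 2) := by
  unfold rho
  split_ifs with h0 h1
  · exact continuous_const
  · fun_prop
  · have : 0 < m.toReal := ENNReal.toReal_pos h0 h1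
    refine Continuous.rpow_const (by fun_prop) fun x => Or.inl ?_
    positivity

lemma one_le_wt (m : ℝ≥0∞) (x : Plane) : 1 ≤ wt m x := by
  unfold wt
  rw [← ofReal_one]
  exact ofReal_le_ofReal (one_le_rho m (by positivity))

lemma wt_ne_zero (m : ℝ≥0∞) (x : Plane) : wt m x ≠ 0 := (zero_lt_one.trans_le (one_le_wt m x)).ne'

lemma wt_ne_top (m : ℝ≥0∞) (x : Plane) : wt m x ≠ ⊤ := ENNReal.ofReal_ne_top

lemma wt_continuous (m : ℝ≥0∞) : Continuous (wt m) :=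
  ENNReal.continuous_ofReal.comp (rho_continuous m)

lemma wt_measurable (m : ℝ≥0∞) : Measurable (wt m) := (wt_continuous m).measurable


lemma weightedMeasure_eq (m : ℝ≥0∞) : weightedMeasure m = volume.withDensity (wt m) := rfl

lemma lintegral_weightedMeasure (m : ℝ≥0∞) (f : Plane → ℝ≥0∞) :
    ∫⁻ x, f x ∂weightedMeasure m = ∫⁻ x, wt m x * f x := by
  rw [weightedMeasure_eq, lintegral_withDensity_eq_lintegral_mul_non_measurable _ (wt_measurable m)
    (.of_forall fun x => (wt_ne_top m x).lt_top)]
  rfl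

lemma weightedMeasure_ac (m : ℝ≥0∞) : weightedMeasure m ≪ volume :=
  withDensity_absolutelyContinuous _ _

lemma ac_weightedMeasure (m : ℝ≥0∞) : (volume : Measure Plane) ≪ weightedMeasure m :=
  withDensity_absolutelyContinuous' (wt_measurable m).aemeasurable
    (.of_forall fun x => wt_ne_zero m x)

lemma ae_weighted (m : ℝ≥0∞) {p : Plane → Prop} : (∀ᵐ x ∂weightedMeasure m, p x) ↔ ∀ᵐ x, p x :=
  ⟨fun h => (ac_weightedMeasure m).ae_le h, fun h => (weightedMeasure_ac m).ae_le h⟩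

lemma volume_le_weightedMeasure (m : ℝ≥0∞) : (volume : Measure Plane) ≤ weightedMeasure m := by
  refine Measure.le_iff.2 fun s hs => ?_
  rw [weightedMeasure_eq, withDensity_apply _ hs, ← setLIntegral_one]
  exact lintegral_mono fun x => one_le_wt m x

section

variable {E F : Type*} [NormedAddCommGroup E] [NormedAddCommGroup F]

lemma aestronglyMeasurable_weighted_iff {f : Plane → E} :
    AEStronglyMeasurable f (weightedMeasure m) ↔ AEStronglyMeasurable f volume :=
  ⟨fun h => h.mono_ac (ac_weightedMeasure m), fun h => h.mono_ac (weightedMeasure_ac m)⟩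

lemma memLp_weighted_iff {f : Plane → E} :
    MemLp f 2 (weightedMeasure m) ↔
      AEStronglyMeasurable f volume ∧ ∫⁻ x, wt m x * ‖f x‖ₑ ^ 2 < ⊤ := by
  rw [MemLp, aestronglyMeasurable_weighted_iff,
    eLpNorm_lt_top_iff_lintegral_rpow_enorm_lt_top (by norm_num) (by norm_num)]
  simp only [ENNReal.toReal_ofNat, ENNReal.rpow_ofNat]
  rw [lintegral_weightedMeasure]

lemma MemLp.volume {f : Plane → E} (hf : MemLp f 2 (weightedMeasure m)) :
    MemLp f 2 MeasureTheory.MeasureSpace.volume :=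
  hf.mono_measure (volume_le_weightedMeasure m)

lemma enorm_Lp_sq (f : L²(E, m)) : ‖f‖ₑ ^ 2 = ∫⁻ x, wt m x * ‖f x‖ₑ ^ 2 := by
  rw [Lp.enorm_def, eLpNorm_eq_lintegral_rpow_enorm_toReal (by norm_num) (by norm_num)]
  simp only [ENNReal.toReal_ofNat, ENNReal.rpow_ofNat]
  rw [lintegral_weightedMeasure, ← ENNReal.rpow_natCast, ← ENNReal.rpow_mul]
  norm_num

end

lemma norm_toLp_le {E F : Type*} [NormedAddCommGroup E] [NormedAddCommGroup F] (hC : 0 ≤ C)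
    {g : Plane → F} (hg : MemLp g 2 (weightedMeasure m))
    {f : L²(E, m)}
    (h : ∫⁻ x, wt m x * ‖g x‖ₑ ^ 2 ≤ ofReal C ^ 2 * ∫⁻ x, wt m x * ‖f x‖ₑ ^ 2) :
    ‖hg.toLp g‖ ≤ C * ‖f‖ := by
  have h1 : ‖hg.toLp g‖ₑ ^ 2 = ∫⁻ x, wt m x * ‖g x‖ₑ ^ 2 := by
    rw [enorm_Lp_sq]
    refine lintegral_congr_ae ?_
    filter_upwards [(ae_weighted m).1 hg.coeFn_toLp] with x hx
    rw [hx]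
  rw [← h1, ← enorm_Lp_sq, ← mul_pow, ENNReal.pow_le_pow_left_iff (by norm_num)] at h
  have h2 := ENNReal.toReal_mono (by finiteness) h
  rwa [ENNReal.toReal_mul, ENNReal.toReal_ofReal hC, toReal_enorm, toReal_enorm] at h2

/-- Cauchy–Schwarz for the lower Lebesgue integral. -/
lemma lintegral_mul_sq_le {α : Type*} [MeasurableSpace α] {μ : Measure α} {f g : α → ℝ≥0∞}
    (hf : AEMeasurable f μ) (hg : AEMeasurable g μ) :
    (∫⁻ x, f x * g x ∂μ) ^ 2 ≤ (∫⁻ x, f x ^ 2 ∂μ) * ∫⁻ x, g x ^ 2 ∂μ := by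
  have h := ENNReal.lintegral_mul_le_Lp_mul_Lq μ (Real.HolderConjugate.two_two) hf hg
  calc (∫⁻ x, f x * g x ∂μ) ^ 2
      ≤ ((∫⁻ x, f x ^ (2 : ℝ) ∂μ) ^ (1 / 2 : ℝ) * (∫⁻ x, g x ^ (2 : ℝ) ∂μ) ^ (1 / 2 : ℝ)) ^ 2 := by
        gcongr; exact h
    _ = _ := by
        rw [mul_pow, ← ENNReal.rpow_natCast, ← ENNReal.rpow_natCast, ← ENNReal.rpow_mul,
          ← ENNReal.rpow_mul]
        norm_num

/-- Schur's test on a weighted `L²` space. -/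
lemma schur_test {W p p' : Plane → ℝ≥0∞} {q q₁ q₂ : Plane → Plane → ℝ≥0∞} {A B : ℝ≥0∞}
    (hW : Measurable W) (hp : Measurable p) (hp' : Measurable p') (hp0 : ∀ y, p y ≠ 0)
    (hpt : ∀ y, p y ≠ ⊤) (hq₁ : Measurable (uncurry q₁))
    (hq₂ : Measurable (uncurry q₂)) (hq : ∀ x y, q x y ^ 2 ≤ q₁ x y * q₂ x y)
    (h₁ : ∀ x, ∫⁻ y, q₁ x y * p y ≤ A * p' x)
    (h₂ : ∀ y, ∫⁻ x, W x * p' x * q₂ x y ≤ B * (W y * p y)) {g : Plane → ℝ≥0∞}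
    (hg : AEMeasurable g) :
    ∫⁻ x, W x * (∫⁻ y, q x y * g y) ^ 2 ≤ A * B * ∫⁻ y, W y * g y ^ 2 := by
  have hq₁x : ∀ x, Measurable (q₁ x) := fun x => hq₁.comp (measurable_const.prodMk measurable_id)
  have hq₂x : ∀ x, Measurable (q₂ x) := fun x => hq₂.comp (measurable_const.prodMk measurable_id)
  have key : ∀ x, (∫⁻ y, q x y * g y) ^ 2 ≤ A * p' x * ∫⁻ y, q₂ x y / p y * g y ^ 2 := fun x => by
    have h0 : ∀ y, q x y * g y ≤
        (q₁ x y * p y) ^ (1 / 2 : ℝ) * ((q₂ x y / p y) ^ (1 / 2 : ℝ) * g y) := fun y => by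
      rw [← mul_assoc, ← ENNReal.mul_rpow_of_nonneg _ _ (by norm_num : (0 : ℝ) ≤ 1 / 2)]
      gcongr
      have e : q₁ x y * p y * (q₂ x y / p y) = q₁ x y * q₂ x y := by
        rw [mul_assoc, ENNReal.mul_div_cancel (hp0 y) (hpt y)]
      rw [e]
      calc q x y = (q x y ^ 2) ^ (1 / 2 : ℝ) := by
            rw [← ENNReal.rpow_natCast, ← ENNReal.rpow_mul]; norm_num
        _ ≤ _ := by gcongr; exact hq x y
    calc (∫⁻ y, q x y * g y) ^ 2
        ≤ (∫⁻ y, (q₁ x y * p y) ^ (1 / 2 : ℝ) * ((q₂ x y / p y) ^ (1 / 2 : ℝ) * g y)) ^ 2 := by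
          exact pow_le_pow_left' (lintegral_mono h0) 2
      _ ≤ (∫⁻ y, ((q₁ x y * p y) ^ (1 / 2 : ℝ)) ^ 2) *
            ∫⁻ y, ((q₂ x y / p y) ^ (1 / 2 : ℝ) * g y) ^ 2 :=
          lintegral_mul_sq_le ((((hq₁x x).mul hp).pow_const _).aemeasurable)
            ((((hq₂x x).div hp).pow_const _).aemeasurable.mul hg)
      _ = (∫⁻ y, q₁ x y * p y) * ∫⁻ y, q₂ x y / p y * g y ^ 2 := by
          have e : ∀ r : ℝ≥0∞, (r ^ (1 / 2 : ℝ)) ^ 2 = r := fun r => by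
            rw [← ENNReal.rpow_natCast, ← ENNReal.rpow_mul]; norm_num
          simp only [mul_pow, e]
      _ ≤ _ := by gcongr; exact h₁ x
  have hmeas : AEMeasurable (fun z : Plane × Plane =>
      W z.1 * p' z.1 * q₂ z.1 z.2 * (g z.2 ^ 2 / p z.2)) (volume.prod volume) := by
    refine AEMeasurable.mul (Measurable.aemeasurable ?_) ?_
    · exact ((hW.comp measurable_fst).mul (hp'.comp measurable_fst)).mul hq₂
    · exact AEMeasurable.comp_snd (f := fun y => g y ^ 2 / p y)
        ((hg.pow_const 2).div hp.aemeasurable)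
  calc ∫⁻ x, W x * (∫⁻ y, q x y * g y) ^ 2
      ≤ ∫⁻ x, W x * (A * p' x * ∫⁻ y, q₂ x y / p y * g y ^ 2) := by gcongr with x; exact key x
    _ = ∫⁻ x, A * ∫⁻ y, W x * p' x * q₂ x y * (g y ^ 2 / p y) := by
        congr 1; funext x
        have e : ∀ y, W x * p' x * q₂ x y * (g y ^ 2 / p y) =
            W x * p' x * (q₂ x y / p y * g y ^ 2) := fun y => by
          simp only [div_eq_mul_inv]; ring
        simp only [e]
        rw [lintegral_const_mul'' (f := fun y => q₂ x y / p y * g y ^ 2) _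
          (((hq₂x x).div hp).aemeasurable.mul (hg.pow_const 2))]
        ring
    _ = A * ∫⁻ x, ∫⁻ y, W x * p' x * q₂ x y * (g y ^ 2 / p y) := by
        rw [lintegral_const_mul'']
        exact hmeas.lintegral_prod_right'
    _ = A * ∫⁻ y, ∫⁻ x, W x * p' x * q₂ x y * (g y ^ 2 / p y) := by
        rw [lintegral_lintegral_swap hmeas]
    _ ≤ A * ∫⁻ y, B * (W y * p y) * (g y ^ 2 / p y) := by
        gcongr with y
        rw [lintegral_mul_const]
        · gcongr; exact h₂ y
        · exact (hW.mul hp').mul (hq₂.comp (measurable_id.prodMk measurable_const))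
    _ = A * B * ∫⁻ y, W y * g y ^ 2 := by
        have e : ∀ y, B * (W y * p y) * (g y ^ 2 / p y) = B * (W y * g y ^ 2) := fun y => by
          rw [mul_assoc, mul_assoc (W y), ENNReal.mul_div_cancel (hp0 y) (hpt y)]
        simp only [e]
        rw [lintegral_const_mul'' (f := fun y => W y * g y ^ 2) _
          (hW.aemeasurable.mul (hg.pow_const 2)), mul_assoc]

section Kernel

/-- The integral operator with kernel `κ`, on functions. -/
def kernelFun (κ : Plane → Plane → E →L[ℂ] F) (f : Plane → E) (x : Plane) : F := ∫ y, κ x y (f y)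

/-- The kernel `κ` defines an absolutely convergent integral operator on the weighted space, of norm
at most `C`. -/
structure KernelBound (m : ℝ≥0∞) (κ : Plane → Plane → E →L[ℂ] F) (C : ℝ) : Prop where
  meas : StronglyMeasurable (uncurry κ)
  nonneg : 0 ≤ C
  bound : ∀ g : Plane → ℝ≥0∞, AEMeasurable g volume →
    ∫⁻ x, wt m x * (∫⁻ y, ‖κ x y‖ₑ * g y) ^ 2 ≤ ofReal C ^ 2 * ∫⁻ y, wt m y * g y ^ 2

lemma kernelFun_congr (κ : Plane → Plane → E →L[ℂ] F) {f g : Plane → E} (h : f =ᵐ[volume] g) :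
    kernelFun κ f = kernelFun κ g := by
  funext x
  refine integral_congr_ae ?_
  filter_upwards [h] with y hy
  rw [hy]

namespace KernelBound

variable {m : ℝ≥0∞} {κ : Plane → Plane → E →L[ℂ] F} {C : ℝ} (h : KernelBound m κ C)
include h

lemma aestronglyMeasurable_apply {f : Plane → E} (hf : AEStronglyMeasurable f volume) (x : Plane) :
    AEStronglyMeasurable (fun y => κ x y (f y)) volume := by
  have h1 : StronglyMeasurable (κ x) :=
    h.meas.comp_measurable (measurable_const.prodMk measurable_id)
  exact (idL (E →L[ℂ] F)).aestronglyMeasurable_comp₂ h1.aestronglyMeasurable hf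

lemma aestronglyMeasurable_prod {f : Plane → E} (hf : AEStronglyMeasurable f volume) :
    AEStronglyMeasurable (fun z : Plane × Plane => κ z.1 z.2 (f z.2)) (volume.prod volume) :=
  (idL (E →L[ℂ] F)).aestronglyMeasurable_comp₂ h.meas.aestronglyMeasurable hf.comp_snd

lemma aestronglyMeasurable_kernelFun {f : Plane → E} (hf : AEStronglyMeasurable f volume) :
    AEStronglyMeasurable (kernelFun κ f) volume :=
  (h.aestronglyMeasurable_prod hf).integral_prod_right'

lemma lintegral_le {f : Plane → E} (hf : AEStronglyMeasurable f volume) :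
    ∫⁻ x, wt m x * (∫⁻ y, ‖κ x y (f y)‖ₑ) ^ 2 ≤ ofReal C ^ 2 * ∫⁻ y, wt m y * ‖f y‖ₑ ^ 2 := by
  refine le_trans ?_ (h.bound (fun y => ‖f y‖ₑ) hf.enorm)
  gcongr with x y
  exact ContinuousLinearMap.le_opENorm _ _

/-- For almost every `x` the integral defining the operator converges absolutely. -/
lemma ae_integrable {f : Plane → E} (hf : MemLp f 2 (weightedMeasure m)) :
    ∀ᵐ x, Integrable (fun y => κ x y (f y)) := by
  obtain ⟨hf1, hf2⟩ := memLp_weighted_iff.1 hf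
  have h1 := h.lintegral_le hf1
  have h2 : ∫⁻ x, wt m x * (∫⁻ y, ‖κ x y (f y)‖ₑ) ^ 2 ≠ ⊤ :=
    (h1.trans_lt (ENNReal.mul_lt_top (by simp) hf2)).ne
  have h3 : AEMeasurable (fun x => wt m x * (∫⁻ y, ‖κ x y (f y)‖ₑ) ^ 2) := by
    refine (wt_measurable m).aemeasurable.mul (AEMeasurable.pow_const ?_ 2)
    exact (h.aestronglyMeasurable_prod hf1).enorm.lintegral_prod_right'
  filter_upwards [ae_lt_top' h3 h2] with x hx
  refine ⟨h.aestronglyMeasurable_apply hf1 x, ?_⟩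
  by_contra hc
  rw [HasFiniteIntegral, not_lt, top_le_iff] at hc
  rw [hc] at hx
  simp [ENNReal.mul_top (wt_ne_zero m x)] at hx

lemma lintegral_kernelFun_le {f : Plane → E} (hf : AEStronglyMeasurable f volume) :
    ∫⁻ x, wt m x * ‖kernelFun κ f x‖ₑ ^ 2 ≤ ofReal C ^ 2 * ∫⁻ y, wt m y * ‖f y‖ₑ ^ 2 := by
  refine le_trans ?_ (h.lintegral_le hf)
  gcongr with x
  exact enorm_integral_le_lintegral_enorm _

lemma memLp_kernelFun {f : Plane → E} (hf : MemLp f 2 (weightedMeasure m)) :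
    MemLp (kernelFun κ f) 2 (weightedMeasure m) := by
  obtain ⟨hf1, hf2⟩ := memLp_weighted_iff.1 hf
  exact memLp_weighted_iff.2 ⟨h.aestronglyMeasurable_kernelFun hf1,
    (h.lintegral_kernelFun_le hf1).trans_lt (ENNReal.mul_lt_top (by simp) hf2)⟩

/-- The bounded operator on the weighted space with integral kernel `κ`. -/
def op : L²(E, m) →L[ℂ] L²(F, m) :=
  LinearMap.mkContinuous
    { toFun := fun f => (h.memLp_kernelFun (Lp.memLp f)).toLp _
      map_add' := fun f g => by
        rw [← MemLp.toLp_add]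
        refine (MemLp.toLp_eq_toLp_iff _ _).2 ?_
        have h1 : kernelFun κ (f + g : L²(E, m)) = kernelFun κ (fun y => f y + g y) :=
          kernelFun_congr κ ((ae_weighted m).1 (Lp.coeFn_add f g))
        refine (ae_weighted m).2 ?_
        filter_upwards [h.ae_integrable (Lp.memLp f), h.ae_integrable (Lp.memLp g)] with x hx hy
        rw [h1]
        simp only [kernelFun, Pi.add_apply, map_add]
        exact integral_add hx hy
      map_smul' := fun c f => by
        rw [RingHom.id_apply, ← MemLp.toLp_const_smul]
        refine (MemLp.toLp_eq_toLp_iff _ _).2 ?_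
        have h1 : kernelFun κ (c • f : L²(E, m)) = kernelFun κ (fun y => c • f y) :=
          kernelFun_congr κ ((ae_weighted m).1 (Lp.coeFn_smul c f))
        rw [h1]
        refine Eventually.of_forall fun x => ?_
        simp only [kernelFun, Pi.smul_apply, map_smul]
        exact integral_smul c _ } C fun f => by
    exact norm_toLp_le h.nonneg (h.memLp_kernelFun (Lp.memLp f))
        (h.lintegral_kernelFun_le (memLp_weighted_iff.1 (Lp.memLp f)).1)

lemma op_coeFn (f : L²(E, m)) : ⇑(h.op f) =ᵐ[volume] kernelFun κ f :=
  (ae_weighted m).1 (MemLp.coeFn_toLp (h.memLp_kernelFun (Lp.memLp f)))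

lemma norm_op_le : ‖h.op‖ ≤ C := LinearMap.mkContinuous_norm_le _ h.nonneg _

end KernelBound

section Functional

variable {m : ℝ≥0∞} {k : Plane → E →L[ℂ] F} {C : ℝ}

lemma lintegral_functional_sq_le (hk : StronglyMeasurable k) {f : Plane → E}
    (hf : AEStronglyMeasurable f volume) :
    (∫⁻ y, ‖k y (f y)‖ₑ) ^ 2 ≤ (∫⁻ y, ‖k y‖ₑ ^ 2 / wt m y) * ∫⁻ y, wt m y * ‖f y‖ₑ ^ 2 := by
  have e : ∀ r : ℝ≥0∞, (r ^ (1 / 2 : ℝ)) ^ 2 = r := fun r => by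
    rw [← ENNReal.rpow_natCast, ← ENNReal.rpow_mul]; norm_num
  have m1 : AEMeasurable (fun y => ‖k y‖ₑ ^ 2 / wt m y) := by
    have h0 : AEMeasurable (fun y => ‖k y‖ₑ ^ 2) := hk.aestronglyMeasurable.enorm.pow_const 2
    exact h0.div (wt_measurable m).aemeasurable
  have m2 : AEMeasurable (fun y => wt m y * ‖f y‖ₑ ^ 2) :=
    (wt_measurable m).aemeasurable.mul (hf.enorm.pow_const 2)
  have h1 := lintegral_mul_sq_le (μ := (volume : Measure Plane))
    (f := fun y => (‖k y‖ₑ ^ 2 / wt m y) ^ (1 / 2 : ℝ))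
    (g := fun y => (wt m y * ‖f y‖ₑ ^ 2) ^ (1 / 2 : ℝ))
    (m1.pow_const _) (m2.pow_const _)
  simp only [e] at h1
  refine le_trans (pow_le_pow_left' (lintegral_mono fun y => ?_) 2) h1
  rw [← ENNReal.mul_rpow_of_nonneg _ _ (by norm_num : (0 : ℝ) ≤ 1 / 2), ← mul_assoc,
    ENNReal.div_mul_cancel (wt_ne_zero m y) (wt_ne_top m y), ← mul_pow]
  calc ‖k y (f y)‖ₑ ≤ ‖k y‖ₑ * ‖f y‖ₑ := ContinuousLinearMap.le_opENorm _ _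
    _ = ((‖k y‖ₑ * ‖f y‖ₑ) ^ 2) ^ (1 / 2 : ℝ) := by
        rw [← ENNReal.rpow_natCast, ← ENNReal.rpow_mul]; norm_num

/-- An operator-valued function that is square integrable against the inverse weight. -/
structure FunctionalBound (m : ℝ≥0∞) (k : Plane → E →L[ℂ] F) (C : ℝ) : Prop where
  meas : StronglyMeasurable k
  nonneg : 0 ≤ C
  bound : ∫⁻ y, ‖k y‖ₑ ^ 2 / wt m y ≤ ofReal C ^ 2

namespace FunctionalBound

variable (h : FunctionalBound m k C)
include h

lemma lintegral_le (f : L²(E, m)) : ∫⁻ y, ‖k y (f y)‖ₑ ≤ ofReal C * ‖f‖ₑ := by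
  have h1 := lintegral_functional_sq_le (m := m) h.meas (memLp_weighted_iff.1 (Lp.memLp f)).1
  rw [← ENNReal.pow_le_pow_left_iff (by norm_num : 2 ≠ 0), mul_pow, enorm_Lp_sq]
  exact h1.trans (by gcongr; exact h.bound)

lemma integrable (f : L²(E, m)) : Integrable fun y => k y (f y) :=
  ⟨(idL (E →L[ℂ] F)).aestronglyMeasurable_comp₂
    h.meas.aestronglyMeasurable (memLp_weighted_iff.1 (Lp.memLp f)).1,
    (h.lintegral_le f).trans_lt (by finiteness)⟩

/-- The bounded operator `f ↦ ∫ k f` on the weighted space. -/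
def functional : L²(E, m) →L[ℂ] F :=
  LinearMap.mkContinuous
    { toFun := fun f => ∫ y, k y (f y)
      map_add' := fun f g => by
        rw [← integral_add (h.integrable f) (h.integrable g)]
        refine integral_congr_ae ?_
        filter_upwards [(ae_weighted m).1 (Lp.coeFn_add f g)] with y hy
        rw [hy, Pi.add_apply, map_add]
      map_smul' := fun c f => by
        rw [RingHom.id_apply, ← integral_smul]
        refine integral_congr_ae ?_
        filter_upwards [(ae_weighted m).1 (Lp.coeFn_smul c f)] with y hy
        rw [hy, Pi.smul_apply, map_smul] } C fun f => by
    have h1 := (enorm_integral_le_lintegral_enorm fun y => k y (f y)).trans (h.lintegral_le f)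
    have h2 := ENNReal.toReal_mono (by finiteness) h1
    rwa [ENNReal.toReal_mul, ENNReal.toReal_ofReal h.nonneg, toReal_enorm, toReal_enorm] at h2

lemma functional_apply (f : L²(E, m)) : h.functional f = ∫ y, k y (f y) := rfl

lemma norm_functional_le : ‖h.functional‖ ≤ C := LinearMap.mkContinuous_norm_le _ h.nonneg _

end FunctionalBound

end Functional

end Kernel

/-- Bessel's inequality for a bounded functional. -/
lemma sum_norm_sq_le_of_orthonormal {H ι : Type*} [NormedAddCommGroup H] [InnerProductSpace ℂ H]
    [CompleteSpace H] {v : ι → H} (hv : Orthonormal ℂ v) (φ : H →L[ℂ] ℂ) (s : Finset ι) :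
    ∑ i ∈ s, ‖φ (v i)‖ ^ 2 ≤ ‖φ‖ ^ 2 := by
  have h := hv.sum_inner_products_le ((InnerProductSpace.toDual ℂ H).symm φ) (s := s)
  rw [LinearIsometryEquiv.norm_map] at h
  refine le_trans (le_of_eq (Finset.sum_congr rfl fun i _ => ?_)) h
  rw [← InnerProductSpace.toDual_symm_apply, ← norm_inner_symm]

/-- Integral operators of Hilbert–Schmidt type are compact. -/
lemma KernelBound.isCompactOperator {κ : Plane → Plane → ℂ² →L[ℂ] ℂ²} (h : KernelBound m κ C)
    (hHS : ∫⁻ x, wt m x * ∫⁻ y, ‖κ x y‖ₑ ^ 2 / wt m y ≠ ⊤) :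
    IsCompactOperator h.op := by
  obtain ⟨w, b, -⟩ := exists_hilbertBasis ℂ (L2sq m)
  have hx : ∀ x (s : Finset w), ∑ i ∈ s, ‖kernelFun κ (b i) x‖ₑ ^ 2 ≤
      2 * ∫⁻ y, ‖κ x y‖ₑ ^ 2 / wt m y := fun x s => by
    by_cases hB : ∫⁻ y, ‖κ x y‖ₑ ^ 2 / wt m y = ⊤
    · rw [hB]; simp
    set B := ∫⁻ y, ‖κ x y‖ₑ ^ 2 / wt m y with hBdef
    have hΛ : FunctionalBound m (κ x) (sqrt B.toReal) :=
      ⟨h.meas.comp_measurable (measurable_const.prodMk measurable_id), sqrt_nonneg _, by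
        rw [← ofReal_pow (sqrt_nonneg _), sq_sqrt ENNReal.toReal_nonneg, ENNReal.ofReal_toReal hB]⟩
    have h1 : ∀ i, kernelFun κ (b i) x = hΛ.functional (b i) := fun i => rfl
    have h2 : ∀ j : Fin 2, ∑ i ∈ s, ‖hΛ.functional (b i) j‖ ^ 2 ≤ B.toReal := fun j => by
      refine (sum_norm_sq_le_of_orthonormal b.orthonormal ((proj j).comp hΛ.functional) s).trans ?_
      have hn : ‖(proj j : ℂ² →L[ℂ] ℂ).comp hΛ.functional‖ ≤ sqrt B.toReal := by
        refine ContinuousLinearMap.opNorm_le_bound _ (sqrt_nonneg _) fun f => ?_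
        refine (PiLp.norm_apply_le _ j).trans ?_
        exact hΛ.functional.le_of_opNorm_le hΛ.norm_functional_le f
      calc _ ≤ sqrt B.toReal ^ 2 := by gcongr
        _ = B.toReal := sq_sqrt ENNReal.toReal_nonneg
    have h3 : ∑ i ∈ s, ‖hΛ.functional (b i)‖ ^ 2 ≤ 2 * B.toReal := by
      simp only [EuclideanSpace.norm_sq_eq, Fin.sum_univ_two, Finset.sum_add_distrib]
      linarith [h2 0, h2 1]
    simp only [h1]
    have h4 : ∀ i, ‖hΛ.functional (b i)‖ₑ ^ 2 = ofReal (‖hΛ.functional (b i)‖ ^ 2) :=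
      fun i => by rw [ofReal_pow (norm_nonneg _), ofReal_norm]
    simp only [h4]
    rw [← ENNReal.ofReal_sum_of_nonneg fun i _ => by positivity]
    refine (ofReal_le_ofReal h3).trans (le_of_eq ?_)
    rw [ofReal_mul (by norm_num), ENNReal.ofReal_toReal hB]
    norm_num
  have hT : ∀ i, ‖h.op (b i)‖ₑ ^ 2 = ∫⁻ x, wt m x * ‖kernelFun κ (b i) x‖ₑ ^ 2 := fun i => by
    rw [enorm_Lp_sq]
    refine lintegral_congr_ae ?_
    filter_upwards [h.op_coeFn (b i)] with x hx
    rw [hx]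
  refine isCompactOperator_of_summable b ?_
  have hfin : (2 : ℝ≥0∞) * ∫⁻ x, wt m x * ∫⁻ y, ‖κ x y‖ₑ ^ 2 / wt m y ≠ ⊤ :=
    ENNReal.mul_ne_top (by simp) hHS
  refine summable_of_sum_le (c := (2 * ∫⁻ x, wt m x * ∫⁻ y, ‖κ x y‖ₑ ^ 2 / wt m y).toReal)
    (fun i => by positivity) fun s => ?_
  rw [← ENNReal.ofReal_le_iff_le_toReal hfin, ENNReal.ofReal_sum_of_nonneg fun i _ => by positivity]
  have h4 : ∀ i, ofReal (‖h.op (b i)‖ ^ 2) = ‖h.op (b i)‖ₑ ^ 2 :=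
    fun i => by rw [ofReal_pow (norm_nonneg _), ofReal_norm]
  simp only [h4, hT]
  rw [← lintegral_finsetSum']
  · rw [← lintegral_const_mul' _ _ (by simp)]
    refine lintegral_mono fun x => ?_
    rw [← Finset.mul_sum, mul_left_comm]
    gcongr
    exact hx x s
  · intro i _
    exact (wt_measurable m).aemeasurable.mul ((h.aestronglyMeasurable_kernelFun
      (memLp_weighted_iff.1 (Lp.memLp (b i))).1).enorm.pow_const 2)

/-! ### Schur bounds for kernels dominated by the Mehler kernel -/

lemma mehler_measurable (t : ℝ) : Measurable (uncurry (mehler t)) :=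
  (mehler_continuous t).measurable

lemma rho_top (r : ℝ) : rho ⊤ r = exp (r / 4) := by simp [rho]

lemma rho_eq (h0 : m ≠ 0) (h1 : m ≠ ⊤) (r : ℝ) :
    rho m r = (1 + r / (4 * m.toReal)) ^ m.toReal := by simp [rho, h0, h1]

/-- The constant in the comparison of `S(t)^* ρ_m` with `ρ_m`. -/
def schurConst (m : ℝ≥0∞) : ℝ := 2 * 4 ^ m.toReal

lemma schurConst_pos (m : ℝ≥0∞) : 0 < schurConst m := by unfold schurConst; positivity

lemma one_le_schurConst (m : ℝ≥0∞) : 1 ≤ schurConst m := by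
  unfold schurConst
  have : (1 : ℝ) ≤ 4 ^ m.toReal := one_le_rpow (by norm_num) ENNReal.toReal_nonneg
  linarith

/-- The polynomial weight is submultiplicative up to a Gaussian factor. -/
lemma rho_le_mul (hm : m ≠ ⊤) (hb0 : 0 ≤ b) (hb : b ≤ 1) (x y : Plane) :
    rho m (‖x‖ ^ 2) ≤ 4 ^ m.toReal * exp (‖x - b • y‖ ^ 2 / 8) * rho m (‖y‖ ^ 2) := by
  rcases eq_or_ne m 0 with rfl | h0
  · simp [rho]; positivity
  rw [rho_eq h0 hm, rho_eq h0 hm]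
  set M := m.toReal with hM
  have hM0 : 0 < M := ENNReal.toReal_pos h0 hm
  set z := x - b • y with hz
  have hx : ‖x‖ ^ 2 ≤ 2 * ‖z‖ ^ 2 + 2 * ‖y‖ ^ 2 := by
    have h1 : ‖x‖ ≤ ‖z‖ + ‖y‖ := by
      calc ‖x‖ = ‖z + b • y‖ := by rw [hz]; simp
        _ ≤ ‖z‖ + ‖b • y‖ := norm_add_le _ _
        _ ≤ ‖z‖ + ‖y‖ := by
          rw [norm_smul, norm_of_nonneg hb0]
          nlinarith [norm_nonneg y]
    nlinarith [norm_nonneg x, norm_nonneg y, norm_nonneg z, sq_nonneg (‖z‖ - ‖y‖)]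
  have h2 : 1 + ‖x‖ ^ 2 / (4 * M) ≤ 4 * exp (‖z‖ ^ 2 / (8 * M)) * (1 + ‖y‖ ^ 2 / (4 * M)) := by
    have h3 := add_one_le_exp (‖z‖ ^ 2 / (8 * M))
    have h4 : ‖x‖ ^ 2 / (4 * M) ≤ 4 * (‖z‖ ^ 2 / (8 * M)) + 2 * (‖y‖ ^ 2 / (4 * M)) := by
      calc ‖x‖ ^ 2 / (4 * M) ≤ (2 * ‖z‖ ^ 2 + 2 * ‖y‖ ^ 2) / (4 * M) := by gcongr
        _ = _ := by field_simp; ring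
    have h5 : 0 ≤ ‖z‖ ^ 2 / (8 * M) := by positivity
    have h6 : 0 ≤ ‖y‖ ^ 2 / (4 * M) := by positivity
    nlinarith
  calc (1 + ‖x‖ ^ 2 / (4 * M)) ^ M
      ≤ (4 * exp (‖z‖ ^ 2 / (8 * M)) * (1 + ‖y‖ ^ 2 / (4 * M))) ^ M := by gcongr
    _ = _ := by
        rw [mul_rpow (by positivity) (by positivity), mul_rpow (by positivity)
          (by positivity), ← exp_mul]
        congr 3
        field_simp

lemma lintegral_exp_mul_gauss_le (ha : 0 < a) (ha1 : a ≤ 1) (c : Plane) :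
    ∫⁻ x, ofReal (exp (‖x - c‖ ^ 2 / 8) * gauss a (x - c)) ≤ 2 := by
  have e : ∀ x : Plane, exp (‖x - c‖ ^ 2 / 8) * gauss a (x - c) =
      2 / (2 - a) * gauss (2 * a / (2 - a)) (x - c) := fun x => by
    have h2 : (0 : ℝ) < 2 - a := by linarith
    have hpi := pi_pos
    unfold gauss
    rw [mul_left_comm, ← exp_add, ← mul_assoc]
    congr 1
    · field_simp
    · congr 1
      field_simp
      ring
  have h2 : (0 : ℝ) < 2 - a := by linarith
  simp only [e]
  have e2 : ∀ x : Plane, ofReal (2 / (2 - a) * gauss (2 * a / (2 - a)) (x - c)) =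
      ofReal (2 / (2 - a)) * ofReal (gauss (2 * a / (2 - a)) (x - c)) :=
    fun x => ofReal_mul (by positivity)
  simp only [e2]
  rw [lintegral_const_mul' _ _ (by simp), lintegral_gauss_sub (by positivity), mul_one,
    ← ENNReal.ofReal_ofNat 2]
  refine ofReal_le_ofReal ?_
  rw [div_le_iff₀ h2]; linarith

/-- The adjoint Mehler semigroup maps the polynomial weight to a multiple of itself. -/
lemma lintegral_wt_mul_mehler_le (hm : m ≠ ⊤) (ht : 0 < t) (y : Plane) :
    ∫⁻ x, wt m x * ofReal (mehler t x y) ≤ ofReal (schurConst m) * wt m y := by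
  have hr : ∀ y : Plane, 0 ≤ rho m (‖y‖ ^ 2) := fun y =>
    zero_le_one.trans (one_le_rho m (by positivity))
  have h1 : ∀ x, wt m x * ofReal (mehler t x y) ≤
      (ofReal (4 ^ m.toReal) * wt m y) * ofReal
        (exp (‖x - damp t • y‖ ^ 2 / 8) * gauss (mvar t) (x - damp t • y)) := fun x => by
    have hk := (mehler_pos ht x y).le
    unfold wt
    rw [← ofReal_mul (hr x), ← ofReal_mul (by positivity),
      ← ofReal_mul (mul_nonneg (by positivity) (hr y))]
    refine ofReal_le_ofReal ?_
    have := rho_le_mul hm (damp_pos t).le (damp_le_one ht.le) x y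
    calc rho m (‖x‖ ^ 2) * mehler t x y ≤ _ := mul_le_mul_of_nonneg_right this hk
      _ = _ := by unfold mehler; ring
  refine (lintegral_mono h1).trans ?_
  rw [lintegral_const_mul' _ _ (by unfold wt; finiteness)]
  calc _ ≤ (ofReal (4 ^ m.toReal) * wt m y) * 2 := by
        gcongr
        exact lintegral_exp_mul_gauss_le (mvar_pos ht) (mvar_lt_one t).le _
    _ = _ := by
        unfold schurConst
        rw [ofReal_mul (by norm_num)]
        rw [ENNReal.ofReal_ofNat]; ring

lemma lintegral_mehler_right (ht : 0 < t) (x : Plane) :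
    ∫⁻ y, ofReal (mehler t x y) = ofReal (exp t) := by
  unfold mehler
  rw [lintegral_gauss_right (mvar_pos ht) (damp_pos t), damp_sq', ← exp_neg, neg_neg]

/-- The Gaussian `e^{-|y|²/4}`, the inverse of the weight `ρ_∞`. -/
def gaussWeight (y : Plane) : ℝ := exp (-‖y‖ ^ 2 / 4)

lemma gaussWeight_pos (y : Plane) : 0 < gaussWeight y := exp_pos _

lemma gaussWeight_continuous : Continuous gaussWeight := by unfold gaussWeight; fun_prop

lemma wt_top_mul_gaussWeight (x : Plane) : wt ⊤ x * ofReal (gaussWeight x) = 1 := by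
  unfold wt gaussWeight
  rw [rho_top, ← ofReal_mul (exp_pos _).le, ← exp_add,
    neg_div, add_neg_cancel, exp_zero, ofReal_one]

section

lemma ofReal_sqrt_sq {A : ℝ} (hA : 0 ≤ A) : ofReal (sqrt A) ^ 2 = ofReal A := by
  rw [← ofReal_pow (sqrt_nonneg _), sq_sqrt hA]

/-- Schur's test for polynomial weights. -/
lemma kernelBound_of_ne_top (hm : m ≠ ⊤) (ht : 0 < t)
    {κ : Plane → Plane → E →L[ℂ] F} (hκ : StronglyMeasurable (uncurry κ))
    {q : Plane → Plane → ℝ} (hq : Measurable (uncurry q)) (hq0 : ∀ x y, 0 ≤ q x y)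
    (hle : ∀ x y, ‖κ x y‖ ^ 2 ≤ q x y * mehler t x y) {A : ℝ} (hA : 0 ≤ A)
    (hqA : ∀ x, ∫⁻ y, ofReal (q x y) ≤ ofReal A) :
    KernelBound m κ (sqrt (A * schurConst m)) := by
  refine ⟨hκ, sqrt_nonneg _, fun g hg => ?_⟩
  rw [ofReal_sqrt_sq (mul_nonneg hA (schurConst_pos m).le), ofReal_mul hA]
  refine schur_test (W := wt m) (p := fun _ => 1) (p' := fun _ => 1) (q := fun x y => ‖κ x y‖ₑ)
    (q₁ := fun x y => ofReal (q x y)) (q₂ := fun x y => ofReal (mehler t x y))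
    (wt_measurable m) measurable_const measurable_const (by simp) (by simp)
    (measurable_ofReal.comp hq) (measurable_ofReal.comp (mehler_measurable t))
    (fun x y => ?_) (fun x => ?_) (fun y => ?_) hg
  · rw [← ofReal_norm, ← ofReal_pow (norm_nonneg _), ← ofReal_mul (hq0 x y)]
    exact ofReal_le_ofReal (hle x y)
  · simpa using hqA x
  · simpa using lintegral_wt_mul_mehler_le hm ht y

/-- Schur's test for the Gaussian weight. -/
lemma kernelBound_top (ht : 0 < t)
    {κ : Plane → Plane → E →L[ℂ] F} (hκ : StronglyMeasurable (uncurry κ))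
    {q : Plane → Plane → ℝ} (hq : Measurable (uncurry q)) (hq0 : ∀ x y, 0 ≤ q x y)
    (hle : ∀ x y, ‖κ x y‖ ^ 2 ≤ q x y * mehler t x y) {A : ℝ} (hA : 0 ≤ A)
    (hqA : ∀ x, ∫⁻ y, ofReal (q x y * gaussWeight y) ≤ ofReal A * ofReal (gaussWeight x)) :
    KernelBound ⊤ κ (sqrt A) := by
  refine ⟨hκ, sqrt_nonneg _, fun g hg => ?_⟩
  rw [ofReal_sqrt_sq hA]
  have hm : Measurable fun y => ofReal (gaussWeight y) :=
    measurable_ofReal.comp gaussWeight_continuous.measurable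
  have := schur_test (W := wt ⊤) (p := fun y => ofReal (gaussWeight y))
    (p' := fun y => ofReal (gaussWeight y)) (q := fun x y => ‖κ x y‖ₑ)
    (q₁ := fun x y => ofReal (q x y)) (q₂ := fun x y => ofReal (mehler t x y))
    (A := ofReal A) (B := 1)
    (wt_measurable ⊤) hm hm (fun y => by simpa using gaussWeight_pos y) (by simp)
    (measurable_ofReal.comp hq) (measurable_ofReal.comp (mehler_measurable t))
    (fun x y => ?_) (fun x => ?_) (fun y => ?_) hg
  · simpa using this
  · rw [← ofReal_norm, ← ofReal_pow (norm_nonneg _), ← ofReal_mul (hq0 x y)]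
    exact ofReal_le_ofReal (hle x y)
  · simp only [← ofReal_mul (hq0 x _)]
    exact hqA x
  · simp only [wt_top_mul_gaussWeight, one_mul]
    rw [lintegral_mehler_left ht]

/-- A kernel dominated by a multiple of the Mehler kernel is bounded. -/
lemma kernelBound_of_le_mehler (m : ℝ≥0∞) (ht : 0 < t)
    {κ : Plane → Plane → E →L[ℂ] F} (hκ : StronglyMeasurable (uncurry κ)) (hc : 0 ≤ c)
        (hle : ∀ x y, ‖κ x y‖ ≤ c * mehler t x y) :
    KernelBound m κ (c * sqrt (schurConst m) * exp (t / 2)) := by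
  have hle2 : ∀ x y, ‖κ x y‖ ^ 2 ≤ c ^ 2 * mehler t x y * mehler t x y := fun x y => by
    calc ‖κ x y‖ ^ 2 ≤ (c * mehler t x y) ^ 2 := by gcongr; exact hle x y
      _ = _ := by ring
  have h0 : ∀ x y, 0 ≤ c ^ 2 * mehler t x y := fun x y =>
    mul_nonneg (sq_nonneg c) (mehler_pos ht x y).le
  by_cases hm : m = ⊤
  · subst hm
    have h := kernelBound_top ht hκ (q := fun x y => c ^ 2 * mehler t x y)
      ((mehler_measurable t).const_mul _) h0 hle2 (sq_nonneg c) fun x => by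
        have e : ∀ y, ofReal (c ^ 2 * mehler t x y * gaussWeight y) =
            ofReal (c ^ 2) * ofReal (gaussWeight x) * ofReal (mehler t y x) := fun y => by
          rw [← ofReal_mul (sq_nonneg c),
            ← ofReal_mul (mul_nonneg (sq_nonneg c) (gaussWeight_pos x).le), mul_assoc,
            mul_assoc]
          congr 2
          exact mehler_symm ht x y
        simp only [e]
        rw [lintegral_const_mul' _ _ (by finiteness), lintegral_mehler_left ht, mul_one]
    refine ⟨h.meas, mul_nonneg (mul_nonneg hc (sqrt_nonneg _)) (exp_pos _).le,
      fun g hg => (h.bound g hg).trans ?_⟩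
    gcongr
    rw [sqrt_sq hc, mul_assoc]
    refine le_mul_of_one_le_right hc ?_
    have h1 : 1 ≤ sqrt (schurConst ⊤) := by rw [one_le_sqrt]; exact one_le_schurConst _
    have h2 : 1 ≤ exp (t / 2) := one_le_exp (by positivity)
    nlinarith
  · have h := kernelBound_of_ne_top hm ht hκ (q := fun x y => c ^ 2 * mehler t x y)
      ((mehler_measurable t).const_mul _) h0 hle2 (A := c ^ 2 * exp t) (by positivity)
      fun x => by
        simp only [ofReal_mul (sq_nonneg c)]
        rw [lintegral_const_mul' _ _ (by finiteness), lintegral_mehler_right ht]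
    convert h using 1
    rw [mul_right_comm, sqrt_mul (by positivity), sqrt_mul (by positivity), sqrt_sq hc]
    congr 2
    rw [sqrt_eq_rpow, ← exp_mul]
    ring_nf

end

section

lemma inv_mvar_le (ht : 0 < t) : (mvar t)⁻¹ ≤ exp t / t := by
  have h1 := le_mvar t
  have h2 : 0 < t * exp (-t) := mul_pos ht (exp_pos _)
  calc (mvar t)⁻¹ ≤ (t * exp (-t))⁻¹ := inv_anti₀ h2 h1
    _ = _ := by rw [mul_inv, exp_neg, inv_inv]; ring

lemma sq_mul_gauss_le {r G : ℝ} (ha : 0 < a) (z : Plane)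
    (hr : r ≤ c * (1 + ‖z‖ / (2 * a)) * G) (hr0 : 0 ≤ r) :
    r ^ 2 ≤ 2 * c ^ 2 * ((1 + ‖z‖ ^ 2 / (4 * a ^ 2)) * G) * G := by
  have h1 : (1 + ‖z‖ / (2 * a)) ^ 2 ≤ 2 * (1 + ‖z‖ ^ 2 / (4 * a ^ 2)) := by
    have e : ‖z‖ ^ 2 / (4 * a ^ 2) = (‖z‖ / (2 * a)) ^ 2 := by field_simp; ring
    rw [e]
    nlinarith [sq_nonneg (1 - ‖z‖ / (2 * a))]
  calc r ^ 2 ≤ (c * (1 + ‖z‖ / (2 * a)) * G) ^ 2 := by gcongr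
    _ = c ^ 2 * G ^ 2 * (1 + ‖z‖ / (2 * a)) ^ 2 := by ring
    _ ≤ c ^ 2 * G ^ 2 * (2 * (1 + ‖z‖ ^ 2 / (4 * a ^ 2))) := by gcongr
    _ = _ := by ring

lemma lintegral_moment_le (ha : 0 < a) (hC : 0 ≤ C) {z : Plane → Plane}
    {μ : Measure Plane} {B : ℝ≥0∞} (hz : Measurable z)
    (h1 : ∫⁻ y, ofReal (gauss a (z y)) ∂μ ≤ B)
    (h2 : ∫⁻ y, ofReal (gauss (2 * a) (z y)) ∂μ ≤ B) :
    ∫⁻ y, ofReal (C * ((1 + ‖z y‖ ^ 2 / (4 * a ^ 2)) * gauss a (z y))) ∂μ ≤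
      ofReal (C * (1 + 2 / a)) * B := by
  have hle : ∀ y, ofReal (C * ((1 + ‖z y‖ ^ 2 / (4 * a ^ 2)) * gauss a (z y))) ≤
      ofReal C * (ofReal (gauss a (z y)) + ofReal (2 / a) * ofReal (gauss (2 * a) (z y))) :=
          fun y => by
    have hg := (gauss_pos ha (z y)).le
    have hg2 := (gauss_pos (by positivity : 0 < 2 * a) (z y)).le
    rw [← ofReal_mul (by positivity), ← ENNReal.ofReal_add hg (by positivity), ← ofReal_mul hC]
    refine ofReal_le_ofReal (mul_le_mul_of_nonneg_left ?_ hC)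
    rw [add_mul, one_mul]
    exact add_le_add_right (norm_sq_mul_gauss_le ha (z y)) _
  refine (lintegral_mono hle).trans ?_
  have hm : ∀ a', Measurable fun y => ofReal (gauss a' (z y)) := fun a' =>
    measurable_ofReal.comp ((gauss_continuous a').measurable.comp hz)
  rw [lintegral_const_mul' _ _ (by finiteness), lintegral_add_left (hm a),
    lintegral_const_mul' _ _ (by finiteness)]
  calc _ ≤ ofReal C * (B + ofReal (2 / a) * B) := by gcongr
    _ = _ := by
        rw [ofReal_mul hC, ENNReal.ofReal_add (by norm_num) (by positivity), ofReal_one]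
        ring

/-- The constant in the bound for kernels with a first-order singularity. -/
def driftConst (m : ℝ≥0∞) : ℝ := sqrt (6 * schurConst m)

lemma driftConst_nonneg (m : ℝ≥0∞) : 0 ≤ driftConst m := sqrt_nonneg _

lemma two_mul_one_add_le (ht : 0 < t) (c : ℝ) :
    2 * c ^ 2 * (1 + 2 / mvar t) ≤ 6 * c ^ 2 * (exp t / t) := by
  have h1 := inv_mvar_le ht
  have h2 : 1 ≤ (mvar t)⁻¹ := (one_le_inv₀ (mvar_pos ht)).2 (mvar_lt_one t).le
  rw [div_eq_mul_inv]
  nlinarith [sq_nonneg c]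

lemma sqrt_driftConst_eq (hc : 0 ≤ c) :
    sqrt (6 * c ^ 2 * (exp t / t) * exp t * schurConst m) =
      c * driftConst m * exp (1 * t) / sqrt t := by
  have e : 6 * c ^ 2 * (exp t / t) * exp t * schurConst m =
      (c * exp t) ^ 2 * (6 * schurConst m) / t := by ring
  have := schurConst_pos m
  rw [e, sqrt_div (by positivity), sqrt_mul (by positivity),
    sqrt_sq (by positivity), driftConst, one_mul]
  ring

lemma KernelBound.mono {κ : Plane → Plane → E →L[ℂ] F} {C' : ℝ}
    (h : KernelBound m κ C) (hC : C ≤ C') : KernelBound m κ C' :=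
  ⟨h.meas, h.nonneg.trans hC, fun g hg => (h.bound g hg).trans (by gcongr)⟩

/-- First-order kernels for polynomial weights. -/
lemma kernelBound_first_order (hm : m ≠ ⊤) (ht : 0 < t)
    {κ : Plane → Plane → E →L[ℂ] F} (hκ : StronglyMeasurable (uncurry κ)) (hc : 0 ≤ c)
        (hle : ∀ x y, ‖κ x y‖ ≤ c * (1 + ‖x - damp t • y‖ / (2 * mvar t)) * mehler t x y) :
    KernelBound m κ (c * driftConst m * exp (1 * t) / sqrt t) := by
  have ha := mvar_pos ht
  rw [← sqrt_driftConst_eq hc]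
  refine kernelBound_of_ne_top hm ht hκ
    (q := fun x y => 2 * c ^ 2 * ((1 + ‖x - damp t • y‖ ^ 2 / (4 * mvar t ^ 2)) *
      gauss (mvar t) (x - damp t • y))) ?_ (fun x y => ?_) (fun x y => ?_)
    (by positivity) fun x => ?_
  · have := gauss_continuous (mvar t)
    refine Continuous.measurable ?_
    unfold uncurry
    fun_prop
  · have := (gauss_pos ha (x - damp t • y)).le
    positivity
  · exact sq_mul_gauss_le ha _ (hle x y) (norm_nonneg _)
  · refine (lintegral_moment_le ha (by positivity) (by fun_prop)
      (lintegral_gauss_right ha (damp_pos t) x).le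
      (lintegral_gauss_right (by positivity) (damp_pos t) x).le).trans ?_
    rw [← ofReal_mul (by positivity), damp_sq', ← exp_neg, neg_neg]
    refine ofReal_le_ofReal ?_
    exact mul_le_mul_of_nonneg_right (two_mul_one_add_le ht c) (exp_pos _).le

/-- First-order kernels for the Gaussian weight. -/
lemma kernelBound_first_order_top (ht : 0 < t)
    {κ : Plane → Plane → E →L[ℂ] F} (hκ : StronglyMeasurable (uncurry κ)) (hc : 0 ≤ c)
        (hle : ∀ x y, ‖κ x y‖ ≤ c * (1 + ‖y - damp t • x‖ / (2 * mvar t)) * mehler t x y) :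
    KernelBound ⊤ κ (c * driftConst ⊤ * exp (1 * t) / sqrt t) := by
  have ha := mvar_pos ht
  have h := kernelBound_top ht hκ
    (q := fun x y => 2 * c ^ 2 * ((1 + ‖y - damp t • x‖ ^ 2 / (4 * mvar t ^ 2)) *
      mehler t x y)) (A := 6 * c ^ 2 * (exp t / t)) ?_ (fun x y => ?_) (fun x y => ?_)
    (by positivity) fun x => ?_
  · refine h.mono ?_
    rw [← sqrt_driftConst_eq hc]
    refine sqrt_le_sqrt ?_
    rw [mul_assoc (6 * c ^ 2 * (exp t / t))]
    refine le_mul_of_one_le_right (by positivity) ?_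
    have := one_le_exp ht.le
    nlinarith [one_le_schurConst ⊤]
  · have := mehler_continuous t
    refine Continuous.measurable ?_
    unfold uncurry
    fun_prop
  · have := (mehler_pos ht x y).le
    positivity
  · exact sq_mul_gauss_le ha _ (hle x y) (norm_nonneg _)
  · have e : ∀ y, ofReal (2 * c ^ 2 * ((1 + ‖y - damp t • x‖ ^ 2 /
        (4 * mvar t ^ 2)) * mehler t x y) * gaussWeight y) =
        ofReal (gaussWeight x) * ofReal (2 * c ^ 2 *
          ((1 + ‖y - damp t • x‖ ^ 2 / (4 * mvar t ^ 2)) * gauss (mvar t) (y - damp t • x))) :=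
              fun y => by
      rw [← ofReal_mul (gaussWeight_pos x).le]
      congr 1
      have := mehler_symm ht x y
      unfold gaussWeight
      rw [mul_assoc, mul_assoc (1 + _), this]
      unfold mehler
      ring
    simp only [e]
    rw [lintegral_const_mul' _ _ (by finiteness), mul_comm]
    gcongr
    refine (lintegral_moment_le ha (by positivity) (by fun_prop)
      (lintegral_gauss_sub ha _).le (lintegral_gauss_sub (by positivity) _).le).trans ?_
    rw [mul_one]
    exact ofReal_le_ofReal (two_mul_one_add_le ht c)

/-! ### Composition of integral operators -/

/-- Fubini's theorem for an integral operator followed by a functional. -/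
lemma KernelBound.integral_kernelFun {G : Type*} [NormedAddCommGroup G] [NormedSpace ℂ G]
    [CompleteSpace F] [CompleteSpace G] {k : Plane → F →L[ℂ] G}
    {κ : Plane → Plane → E →L[ℂ] F} {k' : Plane → E →L[ℂ] G} (hk : StronglyMeasurable k)
        (h : KernelBound m κ C) {f : Plane → E}
    (hf : MemLp f 2 (weightedMeasure m)) (hfin : ∫⁻ z, ‖k z‖ₑ * ∫⁻ y, ‖κ z y (f y)‖ₑ < ⊤)
    (hcomp : ∀ y v, ∫ z, k z (κ z y v) = k' y v) :
    ∫ z, k z (kernelFun κ f z) = ∫ y, k' y (f y) := by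
  have hae := h.ae_integrable hf
  have hf' := (memLp_weighted_iff.1 hf).1
  unfold kernelFun
  have e1 : ∫ z, k z (∫ y, κ z y (f y)) = ∫ z, ∫ y, k z (κ z y (f y)) := by
    refine integral_congr_ae ?_
    filter_upwards [hae] with z hz
    exact ((k z).integral_comp_comm hz).symm
  have hm2 : AEStronglyMeasurable (uncurry fun z y => k z (κ z y (f y)))
      (volume.prod volume) :=
    (idL (F →L[ℂ] G)).aestronglyMeasurable_comp₂
      ((hk.comp_measurable measurable_fst).aestronglyMeasurable)
      (h.aestronglyMeasurable_prod hf')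
  have hint : Integrable (uncurry fun z y => k z (κ z y (f y)))
      (volume.prod volume) := by
    refine ⟨hm2, ?_⟩
    rw [HasFiniteIntegral, lintegral_prod _ hm2.enorm]
    refine lt_of_le_of_lt (lintegral_mono fun z => ?_) hfin
    rw [← lintegral_const_mul' _ _ (by finiteness)]
    exact lintegral_mono fun y => (k z).le_opENorm _
  rw [e1, integral_integral_swap hint]
  congr 1
  funext y
  exact hcomp y (f y)

/-- Operators whose kernels satisfy a composition law compose accordingly. -/
lemma KernelBound.op_comp {G : Type*} [NormedAddCommGroup G] [NormedSpace ℂ G] [CompleteSpace F]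
    [CompleteSpace G] {κ₁ : Plane → Plane → F →L[ℂ] G} {κ₂ : Plane → Plane → E →L[ℂ] F}
    {κ₃ : Plane → Plane → E →L[ℂ] G} {C₁ C₂ C₃ : ℝ} (h₁ : KernelBound m κ₁ C₁)
    (h₂ : KernelBound m κ₂ C₂) (h₃ : KernelBound m κ₃ C₃)
    (hcomp : ∀ x y v, ∫ z, κ₁ x z (κ₂ z y v) = κ₃ x y v) : h₁.op.comp h₂.op = h₃.op := by
  ext1 f
  rw [ContinuousLinearMap.comp_apply]
  have hf := (memLp_weighted_iff.1 (Lp.memLp f)).1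
  have hf2 := (memLp_weighted_iff.1 (Lp.memLp f)).2
  refine Lp.ext ((ae_weighted m).2 ?_)
  have hg : AEMeasurable (fun z => ∫⁻ y, ‖κ₂ z y (f y)‖ₑ) :=
    (h₂.aestronglyMeasurable_prod hf).enorm.lintegral_prod_right'
  have hfin : ∫⁻ x, wt m x * (∫⁻ z, ‖κ₁ x z‖ₑ * ∫⁻ y, ‖κ₂ z y (f y)‖ₑ) ^ 2 ≠ ⊤ := by
    refine ((h₁.bound _ hg).trans_lt (ENNReal.mul_lt_top (by finiteness) ?_)).ne
    exact (h₂.lintegral_le hf).trans_lt (ENNReal.mul_lt_top (by finiteness) hf2)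
  have hmeas : AEMeasurable (fun x => wt m x * (∫⁻ z, ‖κ₁ x z‖ₑ * ∫⁻ y, ‖κ₂ z y (f y)‖ₑ) ^ 2) := by
    refine (wt_measurable m).aemeasurable.mul (AEMeasurable.pow_const ?_ 2)
    refine AEMeasurable.lintegral_prod_right' (f := fun p : Plane × Plane =>
      ‖κ₁ p.1 p.2‖ₑ * ∫⁻ y, ‖κ₂ p.2 y (f y)‖ₑ) ?_
    exact h₁.meas.aestronglyMeasurable.enorm.mul hg.comp_snd
  filter_upwards [h₁.op_coeFn (h₂.op f), h₃.op_coeFn f, ae_lt_top' hmeas hfin] with x hx1 hx2 hx3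
  rw [hx1, hx2, kernelFun_congr κ₁ (h₂.op_coeFn f)]
  have hx4 : ∫⁻ z, ‖κ₁ x z‖ₑ * ∫⁻ y, ‖κ₂ z y (f y)‖ₑ < ⊤ := by
    by_contra hc
    rw [not_lt, top_le_iff] at hc
    rw [hc] at hx3
    simp [ENNReal.mul_top (wt_ne_zero m x)] at hx3
  exact h₂.integral_kernelFun (h₁.meas.comp_measurable (measurable_const.prodMk measurable_id))
    (Lp.memLp f) hx4 (hcomp x)

/-- A functional given by a kernel, composed with an integral operator. -/
lemma FunctionalBound.functional_comp {G : Type*} [NormedAddCommGroup G] [NormedSpace ℂ G]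
    [CompleteSpace F] [CompleteSpace G] {k : Plane → F →L[ℂ] G}
    {κ : Plane → Plane → E →L[ℂ] F} {k' : Plane → E →L[ℂ] G} {C₁ C₂ : ℝ}
    (h₁ : FunctionalBound m k C₁) (h₂ : KernelBound m κ C₂)
    (hcomp : ∀ y v, ∫ z, k z (κ z y v) = k' y v) (f : L²(E, m)) :
    h₁.functional (h₂.op f) = ∫ y, k' y (f y) := by
  rw [h₁.functional_apply]
  have hf := (memLp_weighted_iff.1 (Lp.memLp f)).1
  have hf2 := (memLp_weighted_iff.1 (Lp.memLp f)).2
  have e : ∫ y, k y (h₂.op f y) = ∫ y, k y (kernelFun κ f y) := by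
    refine integral_congr_ae ?_
    filter_upwards [h₂.op_coeFn f] with y hy
    rw [hy]
  rw [e]
  refine h₂.integral_kernelFun h₁.meas (Lp.memLp f) ?_ hcomp
  have hg : AEMeasurable (fun z => ∫⁻ y, ‖κ z y (f y)‖ₑ) :=
    (h₂.aestronglyMeasurable_prod hf).enorm.lintegral_prod_right'
  have m1 : AEMeasurable (fun y => ‖k y‖ₑ ^ 2 / wt m y) := by
    have h0 : AEMeasurable (fun y => ‖k y‖ₑ ^ 2) := h₁.meas.aestronglyMeasurable.enorm.pow_const 2
    exact h0.div (wt_measurable m).aemeasurable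
  have m2 : AEMeasurable (fun z => wt m z * (∫⁻ y, ‖κ z y (f y)‖ₑ) ^ 2) :=
    (wt_measurable m).aemeasurable.mul (hg.pow_const 2)
  have e2 : ∀ r : ℝ≥0∞, (r ^ (1 / 2 : ℝ)) ^ 2 = r := fun r => by
    rw [← ENNReal.rpow_natCast, ← ENNReal.rpow_mul]; norm_num
  have hCS := lintegral_mul_sq_le (μ := (volume : Measure Plane)) (m1.pow_const (1 / 2 : ℝ))
    (m2.pow_const (1 / 2 : ℝ))
  simp only [e2] at hCS
  have hfin : (∫⁻ z, ‖k z‖ₑ * ∫⁻ y, ‖κ z y (f y)‖ₑ) ^ 2 < ⊤ := by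
    refine lt_of_le_of_lt (pow_le_pow_left' (lintegral_mono fun z => ?_) 2) (hCS.trans_lt
      (ENNReal.mul_lt_top (h₁.bound.trans_lt (by finiteness)) ((h₂.lintegral_le hf).trans_lt
        (ENNReal.mul_lt_top (by finiteness) hf2))))
    rw [← ENNReal.mul_rpow_of_nonneg _ _ (by norm_num : (0 : ℝ) ≤ 1 / 2), ← mul_assoc,
      ENNReal.div_mul_cancel (wt_ne_zero m z) (wt_ne_top m z), ← mul_pow,
      ← ENNReal.rpow_natCast, ← ENNReal.rpow_mul]
    norm_num
  exact (ENNReal.pow_lt_top_iff.1 hfin).resolve_right (by norm_num)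

end

/-! ### The unperturbed semigroup and the drift operators -/

/-- The scalar `x · y^⊥`, where `y^⊥ = (-y₂, y₁)`. -/
def cross (x y : Plane) : ℝ := x 1 * y 0 - x 0 * y 1

/-- The linear functional `x ↦ x · y^⊥`. -/
def crossL (y : Plane) : Plane →L[ℝ] ℝ :=
  y 0 • (proj 1 : Plane →L[ℝ] ℝ) - y 1 • (proj 0 : Plane →L[ℝ] ℝ)

lemma crossL_apply (x y : Plane) : crossL y x = cross x y := by simp [crossL, cross]; ring

lemma cross_continuous : Continuous fun p : Plane × Plane => cross p.1 p.2 := by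
  unfold cross; fun_prop

lemma cross_sub_smul_left (b : ℝ) (x y : Plane) : cross (x - b • y) y = cross x y := by
  simp [cross]; ring

lemma abs_cross_le (x y : Plane) : |cross x y| ≤ ‖x‖ * ‖y‖ := by
  refine abs_le_of_sq_le_sq ?_ (by positivity)
  rw [mul_pow, plane_norm_sq, plane_norm_sq, cross]
  nlinarith [sq_nonneg (x 0 * y 0 + x 1 * y 1)]

lemma mul_cross_eq (b : ℝ) (x y : Plane) : b * cross x y = - cross (y - b • x) y := by
  simp [cross]; ring

section

/-- Coefficients of a first-order perturbation `-h(y) y^⊥ · ∇ + A(y)` whose drift is tangential. -/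
structure DriftCoeff (h : Plane → ℝ) (A : Plane → E →L[ℂ] E) (c : ℝ) : Prop where
  meas_h : Measurable h
  meas_A : StronglyMeasurable A
  nonneg : 0 ≤ c
  bound_h : ∀ y, |h y| * ‖y‖ ≤ c
  bound_A : ∀ y, ‖A y‖ ≤ c

/-- The kernel of `e^{tL}(-h y^⊥ · ∇ + A)`, with the derivative moved onto the Mehler kernel. -/
def driftKer (h : Plane → ℝ) (A : Plane → E →L[ℂ] E) (t : ℝ) (x y : Plane) : E →L[ℂ] E :=
  (mehler t x y : ℂ) • (((damp t / (2 * mvar t) * (h y * cross x y) : ℝ) : ℂ) • idL E + A y)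

variable (E) in
/-- The kernel of the unperturbed semigroup. -/
def mehlerKer (t : ℝ) (x y : Plane) : E →L[ℂ] E := (mehler t x y : ℂ) • idL E

lemma norm_id_le' : ‖idL E‖ ≤ 1 := ContinuousLinearMap.norm_id_le

lemma norm_mehlerKer_le (ht : 0 < t) (x y : Plane) :
    ‖mehlerKer E t x y‖ ≤ 1 * mehler t x y := by
  unfold mehlerKer
  rw [norm_smul, norm_real, norm_of_nonneg (mehler_pos ht x y).le, mul_comm]
  gcongr
  · exact (mehler_pos ht x y).le
  · exact norm_id_le'

lemma mehlerKer_meas (t : ℝ) : StronglyMeasurable (uncurry (mehlerKer E t)) := by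
  have h := (Complex.continuous_ofReal.comp (mehler_continuous t)).stronglyMeasurable
  exact h.smul_const _

lemma kernelBound_mehler (m : ℝ≥0∞) (ht : 0 < t) :
    KernelBound m (mehlerKer E t) (1 * sqrt (schurConst m) * exp (t / 2)) :=
  kernelBound_of_le_mehler m ht (mehlerKer_meas t) zero_le_one (norm_mehlerKer_le ht)

variable (E) in
/-- The semigroup generated by `Δ + ξ/2·∇ + 1`, extended by the identity to nonpositive times. -/
def semi (m : ℝ≥0∞) (t : ℝ) : L²(E, m) →L[ℂ] L²(E, m) :=
  if ht : 0 < t then (kernelBound_mehler m ht).op else idL _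

lemma semi_of_nonpos (m : ℝ≥0∞) (ht : t ≤ 0) : semi E m t = idL _ := dif_neg ht.not_gt

lemma semi_of_pos (m : ℝ≥0∞) (ht : 0 < t) : semi E m t = (kernelBound_mehler m ht).op :=
  dif_pos ht

lemma norm_semi_le (m : ℝ≥0∞) (ht : 0 ≤ t) :
    ‖semi E m t‖ ≤ sqrt (schurConst m) * exp (t / 2) := by
  rcases ht.eq_or_lt with rfl | ht
  · rw [semi_of_nonpos m le_rfl]
    refine ContinuousLinearMap.norm_id_le.trans ?_
    have h1 : 1 ≤ sqrt (schurConst m) := by rw [one_le_sqrt]; exact one_le_schurConst _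
    simpa using h1
  · rw [semi_of_pos m ht]
    simpa only [one_mul] using (kernelBound_mehler m ht).norm_op_le

lemma integral_mehlerKer_apply [CompleteSpace E] (hs : 0 < s) (ht : 0 < t) (x y : Plane)
    (v : E) : ∫ z, mehlerKer E s x z (mehlerKer E t z y v) = mehlerKer E (s + t) x y v := by
  simp only [mehlerKer, smul_apply, idL_apply, smul_smul]
  rw [integral_smul_const]
  congr 1
  simp only [← Complex.ofReal_mul]
  rw [integral_complex_ofReal, integral_mehler_mul hs ht]

lemma semi_add [CompleteSpace E] (m : ℝ≥0∞) (hs : 0 ≤ s) (ht : 0 ≤ t) :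
    semi E m (s + t) = (semi E m s).comp (semi E m t) := by
  rcases hs.eq_or_lt with rfl | hs
  · rw [semi_of_nonpos m le_rfl, zero_add, ContinuousLinearMap.id_comp]
  rcases ht.eq_or_lt with rfl | ht
  · rw [semi_of_nonpos m le_rfl, add_zero, ContinuousLinearMap.comp_id]
  rw [semi_of_pos m hs, semi_of_pos m ht, semi_of_pos m (add_pos hs ht)]
  exact (KernelBound.op_comp _ _ _ (integral_mehlerKer_apply hs ht)).symm

lemma semi_coeFn (ht : 0 < t) (f : L²(E, m)) :
    ⇑(semi E m t f) =ᵐ[volume] kernelFun (mehlerKer E t) f := by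
  rw [semi_of_pos m ht]; exact (kernelBound_mehler m ht).op_coeFn f

namespace DriftCoeff

variable {h : Plane → ℝ} {A : Plane → E →L[ℂ] E} {c : ℝ} (D : DriftCoeff h A c)
include D

lemma meas (t : ℝ) : StronglyMeasurable (uncurry (driftKer h A t)) := by
  have h1 := (Complex.continuous_ofReal.comp (mehler_continuous t)).stronglyMeasurable
  have h2 : Measurable fun p : Plane × Plane =>
      ((damp t / (2 * mvar t) * (h p.2 * cross p.1 p.2) : ℝ) : ℂ) := by
    refine Complex.measurable_ofReal.comp (Measurable.const_mul ?_ _)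
    exact (D.meas_h.comp measurable_snd).mul cross_continuous.measurable
  exact h1.smul ((h2.stronglyMeasurable.smul_const _).add (D.meas_A.comp_measurable measurable_snd))

lemma norm_driftKer_le (ht : 0 < t) {x y : Plane} {r : ℝ}
    (hr : damp t * |cross x y| ≤ r * ‖y‖) (hr0 : 0 ≤ r) :
    ‖driftKer h A t x y‖ ≤ c * (1 + r / (2 * mvar t)) * mehler t x y := by
  have ha := mvar_pos ht
  unfold driftKer
  rw [norm_smul, norm_real, norm_of_nonneg (mehler_pos ht x y).le, mul_comm]
  refine mul_le_mul_of_nonneg_right ?_ (mehler_pos ht x y).le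
  have h1 : |damp t / (2 * mvar t) * (h y * cross x y)| ≤ c * (r / (2 * mvar t)) := by
    rw [abs_mul, abs_mul, abs_of_pos (div_pos (damp_pos t) (by positivity))]
    calc damp t / (2 * mvar t) * (|h y| * |cross x y|)
        = |h y| * (damp t * |cross x y|) / (2 * mvar t) := by ring
      _ ≤ |h y| * (r * ‖y‖) / (2 * mvar t) := by gcongr
      _ = (|h y| * ‖y‖) * (r / (2 * mvar t)) := by ring
      _ ≤ c * (r / (2 * mvar t)) := by gcongr; exact D.bound_h y
  calc _ ≤ |damp t / (2 * mvar t) * (h y * cross x y)| * 1 + c := by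
        refine (norm_add_le _ _).trans (add_le_add ?_ (D.bound_A y))
        rw [norm_smul, norm_real, norm_eq_abs]
        gcongr
        exact norm_id_le'
    _ ≤ c * (r / (2 * mvar t)) * 1 + c := by gcongr
    _ = _ := by ring

lemma kernelBound (m : ℝ≥0∞) (ht : 0 < t) :
    KernelBound m (driftKer h A t) (c * driftConst m * exp (1 * t) / sqrt t) := by
  by_cases hm : m = ⊤
  · subst hm
    refine kernelBound_first_order_top ht (D.meas t) D.nonneg fun x y =>
      D.norm_driftKer_le ht ?_ (norm_nonneg _)
    rw [← abs_of_pos (damp_pos t), ← abs_mul, abs_of_pos (damp_pos t), mul_cross_eq, abs_neg]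
    exact abs_cross_le _ _
  · refine kernelBound_first_order hm ht (D.meas t) D.nonneg fun x y =>
      D.norm_driftKer_le ht ?_ (norm_nonneg _)
    rw [← cross_sub_smul_left (damp t)]
    exact (mul_le_of_le_one_left (abs_nonneg _) (damp_le_one ht.le)).trans (abs_cross_le _ _)

/-- The operators `e^{tL}(-h y^⊥ · ∇ + A)`, extended by zero to nonpositive times. -/
def drift (m : ℝ≥0∞) (t : ℝ) : L²(E, m) →L[ℂ] L²(E, m) :=
  if ht : 0 < t then (D.kernelBound m ht).op else 0

lemma drift_of_nonpos (m : ℝ≥0∞) (ht : t ≤ 0) : D.drift m t = 0 := dif_neg ht.not_gt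

lemma drift_of_pos (m : ℝ≥0∞) (ht : 0 < t) : D.drift m t = (D.kernelBound m ht).op :=
  dif_pos ht

lemma norm_drift_le (m : ℝ≥0∞) (t : ℝ) :
    ‖D.drift m t‖ ≤ c * driftConst m * exp (1 * t) / sqrt t := by
  rcases le_or_gt t 0 with ht | ht
  · rw [D.drift_of_nonpos m ht, norm_zero]
    have := D.nonneg
    have := driftConst_nonneg m
    positivity
  · rw [D.drift_of_pos m ht]; exact (D.kernelBound m ht).norm_op_le

omit D in
lemma integral_mehlerKer_driftKer [CompleteSpace E] (hs : 0 < s) (ht : 0 < t)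
    (x y : Plane) (v : E) :
    ∫ z, mehlerKer E s x z (driftKer h A t z y v) = driftKer h A (s + t) x y v := by
  have ha := mvar_pos ht
  have hast := mvar_pos (add_pos hs ht)
  set σ := mvar s * mvar t / mvar (s + t) with hσ
  have hσ0 : 0 < σ := div_pos (mul_pos (mvar_pos hs) ha) hast
  set p := (mvar (s + t))⁻¹ • ((mvar s * damp t) • y + (damp s * mvar t) • x) with hp
  have e : ∀ z, mehlerKer E s x z (driftKer h A t z y v) =
      ((mehler (s + t) x y * (damp t / (2 * mvar t) * h y) *
        (gauss σ (z - p) * crossL y z) : ℝ) : ℂ) • v +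
      ((mehler (s + t) x y * gauss σ (z - p) : ℝ) : ℂ) • A y v := fun z => by
    have hk := mehler_mul hs ht x z y
    rw [← hσ, ← hp] at hk
    simp only [mehlerKer, driftKer, smul_apply, add_apply, idL_apply, smul_add, smul_smul]
    rw [← hk, crossL_apply, ← Complex.ofReal_mul, ← Complex.ofReal_mul, ← Complex.ofReal_mul]
    congr 3
    have : mehler (s + t) x y * (damp t / (2 * mvar t) * h y) *
        (gauss σ (z - p) * cross z y) = (mehler (s + t) x y * gauss σ (z - p)) *
          ((damp t / (2 * mvar t) * h y) * cross z y) := by ring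
    rw [this, ← hk]
    ring
  have hi1 : Integrable fun z => gauss σ (z - p) := integrable_gauss_sub hσ0 p
  have hi2 : Integrable fun z => gauss σ (z - p) * crossL y z := by
    exact integrable_gauss_sub_mul_clm hσ0 p _
  have hi3 : Integrable fun z => ((mehler (s + t) x y * (damp t / (2 * mvar t) * h y) *
        (gauss σ (z - p) * crossL y z) : ℝ) : ℂ) • v :=
    (hi2.const_mul _).ofReal.smul_const v
  have hi4 : Integrable fun z => ((mehler (s + t) x y * gauss σ (z - p) : ℝ) : ℂ) • A y v :=
    (hi1.const_mul _).ofReal.smul_const _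
  simp only [e]
  rw [integral_add hi3 hi4,
    integral_smul_const, integral_smul_const, integral_complex_ofReal, integral_complex_ofReal,
    integral_const_mul, integral_const_mul, integral_gauss_sub hσ0,
    integral_gauss_mul_inner hσ0]
  simp only [driftKer, smul_apply, add_apply, idL_apply, smul_add, smul_smul, mul_one]
  congr 2
  rw [← Complex.ofReal_mul, crossL_apply, mul_assoc]
  congr 2
  have e3 : cross p y = (mvar (s + t))⁻¹ * (damp s * mvar t) * cross x y := by
    rw [hp]; simp [cross]; ring
  rw [e3, damp_add]
  field_simp

lemma semi_comp_drift [CompleteSpace E] (m : ℝ≥0∞) (hs : 0 ≤ s) (ht : 0 < t) :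
    D.drift m (s + t) = (semi E m s).comp (D.drift m t) := by
  rcases hs.eq_or_lt with rfl | hs
  · rw [semi_of_nonpos m le_rfl, zero_add, ContinuousLinearMap.id_comp]
  rw [semi_of_pos m hs, D.drift_of_pos m ht, D.drift_of_pos m (add_pos hs ht)]
  exact (KernelBound.op_comp _ _ _ (integral_mehlerKer_driftKer hs ht)).symm

end DriftCoeff

end

/-! ### Strong continuity -/

lemma rho_le_exp (m : ℝ≥0∞) {r : ℝ} (hr : 0 ≤ r) : rho m r ≤ exp (r / 4) := by
  by_cases h0 : m = 0
  · subst h0; simp only [rho, if_true]; exact one_le_exp (by positivity)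
  by_cases h1 : m = ⊤
  · rw [h1, rho_top]
  rw [rho_eq h0 h1]
  have hM : 0 < m.toReal := ENNReal.toReal_pos h0 h1
  calc (1 + r / (4 * m.toReal)) ^ m.toReal ≤ (exp (r / (4 * m.toReal))) ^ m.toReal := by
        gcongr
        rw [add_comm]; exact add_one_le_exp _
    _ = exp (r / 4) := by rw [← exp_mul]; congr 1; field_simp

instance (m : ℝ≥0∞) : IsLocallyFiniteMeasure (weightedMeasure m) :=
  IsLocallyFiniteMeasure.withDensity_ofReal (rho_continuous m)

/-- A semigroup that is locally bounded and strongly continuous at `0` is strongly continuous. -/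
lemma continuous_of_tendsto_zero {X : Type*} [NormedAddCommGroup X] [NormedSpace ℂ X]
    {S : ℝ → X →L[ℂ] X} (h0 : ∀ t ≤ 0, S t = 1)
    (hadd : ∀ s t, 0 ≤ s → 0 ≤ t → S (s + t) = (S s).comp (S t)) {M β : ℝ} (hβ : 0 ≤ β)
    (hM : 0 ≤ M) (hb : ∀ t, 0 ≤ t → ‖S t‖ ≤ M * exp (β * t)) {x : X}
    (hx : Tendsto (fun t => S t x) (𝓝[>] 0) (𝓝 x)) : Continuous fun t => S t x := by
  have hx0 : Tendsto (fun t => ‖S t x - x‖) (𝓝 0) (𝓝 0) := by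
    have h1 : Tendsto (fun t => ‖S t x - x‖) (𝓝[≤] 0) (𝓝 0) :=
      tendsto_const_nhds.congr' (eventually_nhdsWithin_of_forall fun t ht => by simp [h0 t ht])
    have h2 := h1.sup (tendsto_iff_norm_sub_tendsto_zero.1 hx)
    rwa [nhdsLE_sup_nhdsGT] at h2
  have hS : ∀ t, S t = S (max t 0) := fun t => by
    rcases le_total t 0 with ht | ht
    · rw [max_eq_right ht, h0 t ht, h0 0 le_rfl]
    · rw [max_eq_left ht]
  have hkey : ∀ u v, 0 ≤ u → 0 ≤ v →
      ‖S u x - S v x‖ ≤ M * exp (β * max u v) * ‖S |u - v| x - x‖ := fun u v hu hv => by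
    wlog h : v ≤ u generalizing u v
    · rw [norm_sub_rev, max_comm, abs_sub_comm]
      exact this v u hv hu (le_of_not_ge h)
    have e := hadd v (u - v) hv (sub_nonneg.2 h)
    rw [add_sub_cancel] at e
    rw [abs_of_nonneg (sub_nonneg.2 h), max_eq_left h, e, ContinuousLinearMap.comp_apply, ← map_sub]
    exact (S v).le_of_opNorm_le ((hb v hv).trans (by gcongr)) _
  refine continuous_iff_continuousAt.2 fun t₀ => ?_
  rw [ContinuousAt, tendsto_iff_norm_sub_tendsto_zero]
  have hlim : Tendsto (fun t => M * exp (β * max (max t 0) (max t₀ 0)) *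
      ‖S |max t 0 - max t₀ 0| x - x‖) (𝓝 t₀) (𝓝 (M * exp (β * max (max t₀ 0) (max t₀ 0)) * 0)) :=
    (Continuous.tendsto (by fun_prop) _).mul (hx0.comp (Continuous.tendsto' (by fun_prop) _ _
      (by simp)))
  rw [mul_zero] at hlim
  refine squeeze_zero (fun t => norm_nonneg _) (fun t => ?_) hlim
  rw [hS t, hS t₀]
  exact hkey _ _ (le_max_right _ _) (le_max_right _ _)

section

lemma kernelFun_mehlerKer (t : ℝ) (f : Plane → E) (x : Plane) :
    kernelFun (mehlerKer E t) f x = ∫ y, mehler t x y • f y := by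
  unfold kernelFun mehlerKer
  congr 1

/-- The Mehler average as an average over a fixed Gaussian. -/
lemma integral_mehler_smul (ht : 0 < t) (f : Plane → E) (x : Plane) :
    ∫ y, mehler t x y • f y = exp t • ∫ u, gauss 1 u •
      f (sqrt (mvar t / damp t ^ 2) • u + (damp t)⁻¹ • x) := by
  have ha := mvar_pos ht
  have hb := damp_pos t
  set σ := mvar t / damp t ^ 2 with hσ
  have hσ0 : 0 < σ := by positivity
  set c := (damp t)⁻¹ • x with hc
  have e1 : ∀ y, mehler t x y • f y = exp t • (gauss σ (y - c) • f ((y - c) + c)) := fun y => by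
    unfold mehler
    rw [gauss_smul_sub ha hb, damp_sq', ← exp_neg, neg_neg, mul_smul, ← damp_sq', sub_add_cancel]
  simp only [e1]
  rw [integral_smul, integral_sub_right_eq_self (fun z => gauss σ z • f (z + c)) c]
  congr 1
  have e2 : ∀ u : Plane, gauss 1 u • f (sqrt σ • u + c) =
      σ • (gauss σ (sqrt σ • u) • f (sqrt σ • u + c)) := fun u => by
    rw [smul_smul]
    congr 1
    unfold gauss
    rw [norm_smul, norm_of_nonneg (sqrt_nonneg _), mul_pow, sq_sqrt hσ0.le]
    have := pi_pos
    rw [← mul_assoc]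
    congr 1
    · field_simp
    · congr 1
      field_simp
  simp only [e2]
  rw [integral_smul, Measure.integral_comp_smul (volume : Measure Plane)
    (fun z => gauss σ z • f (z + c)), smul_smul]
  have e3 : σ * |(sqrt σ ^ Module.finrank ℝ Plane)⁻¹| = 1 := by
    simp only [finrank_euclideanSpace, Fintype.card_fin]
    rw [sq_sqrt hσ0.le, abs_of_pos (by positivity)]
    field_simp
  rw [e3, one_smul]

lemma damp_continuous : Continuous damp := by unfold damp; fun_prop

lemma mvar_continuous : Continuous mvar := by unfold mvar; fun_prop

@[simp] lemma damp_zero : damp 0 = 1 := by simp [damp]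

@[simp] lemma mvar_zero : mvar 0 = 0 := by simp [mvar]

/-- Mehler averages of a bounded continuous function converge pointwise to it. -/
lemma tendsto_kernelFun_mehlerKer [CompleteSpace E] {f : Plane → E} (hf : Continuous f) {B : ℝ}
    (hB : ∀ y, ‖f y‖ ≤ B) (x : Plane) :
    Tendsto (fun t => kernelFun (mehlerKer E t) f x) (𝓝[>] 0) (𝓝 (f x)) := by
  have hlim : Tendsto (fun t => ∫ u, gauss 1 u • f (sqrt (mvar t /
      damp t ^ 2) • u + (damp t)⁻¹ • x)) (𝓝[>] 0)
      (𝓝 (∫ u, gauss 1 u • f x)) := by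
    refine tendsto_integral_filter_of_dominated_convergence (fun u => gauss 1 u * B)
      (.of_forall fun t => ?_) (.of_forall fun t => .of_forall fun u => ?_)
      ((integrable_gauss one_pos).mul_const B) (.of_forall fun u => ?_)
    · exact ((gauss_continuous 1).smul (hf.comp (by fun_prop))).aestronglyMeasurable
    · have hg := (gauss_pos one_pos u).le
      rw [norm_smul, norm_of_nonneg hg]
      exact mul_le_mul_of_nonneg_left (hB _) hg
    · have h2 : ∀ t, damp t ≠ 0 := fun t => (damp_pos t).ne'
      have h4 := damp_continuous
      exact ((hf.comp (((continuous_sqrt.comp (mvar_continuous.div (h4.pow 2) fun t =>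
        pow_ne_zero 2 (h2 t))).smul continuous_const).add ((h4.inv₀ h2).smul
          continuous_const))).tendsto' 0 (f x) (by simp)).const_smul _ |>.mono_left
            nhdsWithin_le_nhds
  rw [integral_smul_const, integral_gauss one_pos, one_smul] at hlim
  have h3 := ((continuous_exp.tendsto' 0 1 exp_zero).mono_left nhdsWithin_le_nhds).smul hlim
  rw [one_smul] at h3
  refine h3.congr' ?_
  filter_upwards [self_mem_nhdsWithin] with t ht
  rw [kernelFun_mehlerKer, integral_mehler_smul ht]

/-- Mehler averages of a function with Gaussian bounds have uniform Gaussian bounds. -/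
lemma norm_kernelFun_mehlerKer_le (ht : 0 < t) {f : Plane → E} {B q : ℝ} (hq : 0 < q)
    (hB : ∀ y, ‖f y‖ ≤ B * gauss q y) (x : Plane) :
    ‖kernelFun (mehlerKer E t) f x‖ ≤ B * gauss (mvar t + damp t ^ 2 * q) x := by
  rw [kernelFun_mehlerKer]
  have hi := (integrable_gauss_mul (b := damp t) (mvar_pos ht) hq x 0).const_mul B
  have h := integral_gauss_mul (b := damp t) (mvar_pos ht) hq x 0
  rw [smul_zero, sub_zero] at h
  rw [← h, ← integral_const_mul]
  refine norm_integral_le_of_norm_le hi (.of_forall fun y => ?_)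
  rw [norm_smul, norm_of_nonneg (mehler_pos ht x y).le, sub_zero]
  calc mehler t x y * ‖f y‖ ≤ mehler t x y * (B * gauss q y) :=
        mul_le_mul_of_nonneg_left (hB y) (mehler_pos ht x y).le
    _ = _ := by unfold mehler; ring

lemma gauss_le_of_mem (h1 : 1 / 8 ≤ s) (h2 : s ≤ 1 / 4) (x : Plane) :
    gauss s x ≤ exp (-‖x‖ ^ 2) := by
  unfold gauss
  have hpi := pi_gt_three
  have h3 : (4 * π * s)⁻¹ ≤ 1 := inv_le_one_of_one_le₀ (by nlinarith)
  have h4 : -‖x‖ ^ 2 / (4 * s) ≤ -‖x‖ ^ 2 := by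
    rw [div_le_iff₀ (by linarith)]
    nlinarith [sq_nonneg ‖x‖]
  calc _ ≤ 1 * exp (-‖x‖ ^ 2) := by gcongr
    _ = _ := one_mul _

lemma exists_le_gauss {f : Plane → E} (hf : Continuous f) (hc : HasCompactSupport f) {q : ℝ}
    (hq : 0 < q) : ∃ B, 0 ≤ B ∧ ∀ y, ‖f y‖ ≤ B * gauss q y := by
  have hg := gauss_continuous q
  obtain ⟨B, hB⟩ := (Continuous.bounded_above_of_compact_support
    (f := fun y => (gauss q y)⁻¹ • f y)
    ((hg.inv₀ fun y => (gauss_pos hq y).ne').smul hf) hc.smul_left)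
  refine ⟨B, (norm_nonneg _).trans (hB 0), fun y => ?_⟩
  have h := hB y
  have hp := gauss_pos hq y
  rw [norm_smul, norm_inv, norm_of_nonneg hp.le] at h
  rwa [inv_mul_le_iff₀ hp, mul_comm] at h

lemma lintegral_wt_mul_exp_lt_top (m : ℝ≥0∞) : ∫⁻ x, wt m x * ofReal (exp (-‖x‖ ^ 2)) ^ 2 < ⊤ := by
  refine lt_of_le_of_lt (lintegral_mono fun x => ?_)
    ((integrable_gauss one_pos).const_mul (4 * π * 1)).lintegral_lt_top
  unfold wt gauss
  rw [← ofReal_pow (exp_pos _).le, ← ofReal_mul (zero_le_one.trans (one_le_rho m (by positivity))),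
    mul_inv_cancel_left₀ (by have := pi_pos; positivity)]
  refine ofReal_le_ofReal ?_
  calc _ ≤ exp (‖x‖ ^ 2 / 4) * exp (-‖x‖ ^ 2) ^ 2 := by
        gcongr; exact rho_le_exp m (by positivity)
    _ = exp (‖x‖ ^ 2 / 4 + 2 * -‖x‖ ^ 2) := by rw [← exp_nat_mul, ← exp_add]; norm_num
    _ ≤ _ := exp_le_exp.2 (by nlinarith [sq_nonneg ‖x‖])

variable [CompleteSpace E]

lemma tendsto_semi_of_hasCompactSupport {f : Plane → E} (hf : Continuous f)
    (hc : HasCompactSupport f) (hm : MemLp f 2 (weightedMeasure m)) :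
    Tendsto (fun t => semi E m t (hm.toLp f)) (𝓝[>] 0) (𝓝 (hm.toLp f)) := by
  obtain ⟨B, hB0, hB⟩ := exists_le_gauss hf hc (by norm_num : (0 : ℝ) < 1 / 8)
  obtain ⟨B', hB'⟩ := hf.bounded_above_of_compact_support hc
  have hae : (hm.toLp f : Plane → E) =ᵐ[volume] f := (ae_weighted m).1 hm.coeFn_toLp
  have hlim : Tendsto (fun t => ∫⁻ x, wt m x * ‖kernelFun (mehlerKer E t) f x - f x‖ₑ ^ 2)
      (𝓝[>] 0) (𝓝 (∫⁻ _ : Plane, 0)) := by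
    refine tendsto_lintegral_filter_of_dominated_convergence'
      (fun x => ofReal (2 * B) ^ 2 * (wt m x * ofReal (exp (-‖x‖ ^ 2)) ^ 2)) ?_ ?_ ?_
      (.of_forall fun x => ?_)
    · filter_upwards [self_mem_nhdsWithin] with t ht
      exact (wt_measurable m).aemeasurable.mul ((((kernelBound_mehler m
        ht).aestronglyMeasurable_kernelFun hf.aestronglyMeasurable).sub
          hf.aestronglyMeasurable).enorm.pow_const 2)
    · filter_upwards [self_mem_nhdsWithin, ((mvar_continuous.tendsto' 0 0 mvar_zero).mono_left
        nhdsWithin_le_nhds).eventually (gt_mem_nhds (by norm_num : (0 : ℝ) < 1 / 8))] with t ht ht1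
      refine .of_forall fun x => ?_
      have ha := mvar_pos ht
      rw [mul_left_comm, ← mul_pow]
      gcongr
      rw [← ofReal_norm, ← ofReal_mul (by positivity)]
      refine ofReal_le_ofReal ?_
      calc _ ≤ ‖kernelFun (mehlerKer E t) f x‖ + ‖f x‖ := norm_sub_le _ _
        _ ≤ B * exp (-‖x‖ ^ 2) + B * exp (-‖x‖ ^ 2) := by
            gcongr
            · refine (norm_kernelFun_mehlerKer_le ht (by norm_num) hB x).trans ?_
              gcongr
              apply gauss_le_of_mem <;> rw [damp_sq] <;> linarith
            · refine (hB x).trans ?_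
              gcongr
              exact gauss_le_of_mem le_rfl (by norm_num) x
        _ = _ := by ring
    · rw [lintegral_const_mul' _ _ (by finiteness)]
      exact ENNReal.mul_ne_top (by finiteness) (lintegral_wt_mul_exp_lt_top m).ne
    · have h1 := (tendsto_kernelFun_mehlerKer hf hB' x).sub_const (f x)
      rw [sub_self] at h1
      simpa using ENNReal.Tendsto.const_mul (a := wt m x)
        (((ENNReal.continuous_pow 2).tendsto _).comp h1.enorm) (Or.inr (wt_ne_top m x))
  rw [lintegral_zero] at hlim
  rw [tendsto_iff_norm_sub_tendsto_zero]
  have h4 := (continuous_sqrt.tendsto _).comp ((ENNReal.tendsto_toReal ENNReal.zero_ne_top).comp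
    hlim)
  simp only [ENNReal.toReal_zero, sqrt_zero] at h4
  refine h4.congr' (eventually_nhdsWithin_of_forall fun t ht => ?_)
  have e : ‖semi E m t (hm.toLp f) - hm.toLp f‖ₑ ^ 2 =
      ∫⁻ x, wt m x * ‖kernelFun (mehlerKer E t) f x - f x‖ₑ ^ 2 := by
    rw [enorm_Lp_sq]
    refine lintegral_congr_ae ?_
    filter_upwards [semi_coeFn ht (hm.toLp f), hae, (ae_weighted m).1
      (Lp.coeFn_sub (semi E m t (hm.toLp f)) (hm.toLp f))] with x h1 h2 h3
    rw [h3, Pi.sub_apply, h1, h2, kernelFun_congr _ hae]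
  rw [Function.comp_apply, Function.comp_apply, ← e, ENNReal.toReal_pow, toReal_enorm,
    sqrt_sq (norm_nonneg _)]

omit [CompleteSpace E] in
/-- Continuous functions with compact support are dense in the weighted space. -/
lemma exists_norm_sub_toLp_le (f : L²(E, m)) {ε : ℝ} (hε : 0 < ε) :
    ∃ (g : Plane → E) (hg : MemLp g 2 (weightedMeasure m)), Continuous g ∧ HasCompactSupport g ∧
      ‖f - hg.toLp g‖ ≤ ε := by
  obtain ⟨g, hgc, hgε, hg, hgm⟩ := (Lp.memLp f).exists_hasCompactSupport_eLpNorm_sub_le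
    (by norm_num) (ENNReal.ofReal_pos.2 hε).ne'
  refine ⟨g, hgm, hg, hgc, (ENNReal.ofReal_le_ofReal_iff hε.le).1 ?_⟩
  rw [ofReal_norm, Lp.enorm_def]
  refine le_trans (le_of_eq (eLpNorm_congr_ae ?_)) hgε
  exact (Lp.coeFn_sub _ _).trans (EventuallyEq.rfl.sub hgm.coeFn_toLp)

lemma tendsto_semi (m : ℝ≥0∞) (f : L²(E, m)) : Tendsto (fun t => semi E m t f) (𝓝[>] 0) (𝓝 f) := by
  set M := sqrt (schurConst m) * exp (1 / 2) with hM
  have hM0 : 0 ≤ M := by positivity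
  rw [Metric.tendsto_nhds]
  intro ε hε
  obtain ⟨g, hgm, hg, hgc, hfg⟩ := exists_norm_sub_toLp_le f
    (by positivity : 0 < ε / (2 * (M + 2)))
  filter_upwards [Metric.tendsto_nhds.1 (tendsto_semi_of_hasCompactSupport hg hgc hgm) (ε / 2)
    (by positivity), self_mem_nhdsWithin, nhdsWithin_le_nhds (gt_mem_nhds one_pos)]
    with t ht (ht0 : 0 < t) ht1
  rw [dist_eq_norm] at ht ⊢
  have hS : ‖semi E m t‖ ≤ M := (norm_semi_le m ht0.le).trans (by rw [hM]; gcongr)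
  have e : semi E m t f - f = semi E m t (f - hgm.toLp g) +
      (semi E m t (hgm.toLp g) - hgm.toLp g) - (f - hgm.toLp g) := by
    rw [map_sub]; abel
  have h1 := norm_sub_le (semi E m t (f - hgm.toLp g) +
    (semi E m t (hgm.toLp g) - hgm.toLp g)) (f - hgm.toLp g)
  have h2 := norm_add_le (semi E m t (f - hgm.toLp g)) (semi E m t (hgm.toLp g) - hgm.toLp g)
  have h3 := (semi E m t).le_of_opNorm_le_of_le hS hfg
  have e2 : ε / (2 * (M + 2)) * (2 * (M + 2)) = ε := by field_simp
  rw [e]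
  nlinarith

lemma semi_continuous (m : ℝ≥0∞) (f : L²(E, m)) : Continuous fun t => semi E m t f :=
  continuous_of_tendsto_zero (M := sqrt (schurConst m)) (β := 1 / 2)
    (fun _ ht => semi_of_nonpos m ht) (fun _ _ hs ht => semi_add m hs ht)
    (by norm_num) (sqrt_nonneg _)
    (fun t ht => (norm_semi_le m ht).trans (by rw [one_div_mul_eq_div])) (tendsto_semi m f)

lemma DriftCoeff.perturbationData (m : ℝ≥0∞) {h : Plane → ℝ} {A : Plane → E →L[ℂ] E}
    (D : DriftCoeff h A c) : PerturbationData (semi E m) (D.drift m) (sqrt (schurConst m))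
      (c * driftConst m) 1 where
  one_le := by rw [one_le_sqrt]; exact one_le_schurConst _
  C_nonneg := mul_nonneg D.nonneg (driftConst_nonneg m)
  β_nonneg := zero_le_one
  S_nonpos _ ht := semi_of_nonpos m ht
  S_add _ _ hs ht := semi_add m hs ht
  S_cont := semi_continuous m
  S_bound t ht := (norm_semi_le m ht).trans (by gcongr; linarith)
  K_nonpos _ ht := D.drift_of_nonpos m ht
  K_add _ _ hs ht := D.semi_comp_drift m hs ht
  K_bound t _ := D.norm_drift_le m t

end

/-! ### The vortex profile -/

/-- The angular velocity `H(s) = (1 - e^{-s/4}) / (2πs)` of the vortex as a function of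
`s = |ξ|²`, with its smooth extension to `s = 0`. -/
def profile (s : ℝ) : ℝ := (8 * π)⁻¹ * dslope (fun r => -exp (-r)) 0 (s / 4)

lemma profile_of_ne (hs : s ≠ 0) : profile s = (1 - exp (-s / 4)) / (2 * π * s) := by
  unfold profile
  rw [dslope_of_ne _ (by positivity), slope_def_field]
  have := pi_pos
  simp only [neg_zero, exp_zero, sub_zero]
  rw [show -(s / 4) = -s / 4 by ring]
  field_simp
  ring

lemma profile_contDiff : ContDiff ℝ ∞ profile := by
  have hf : AnalyticOnNhd ℝ (fun r : ℝ => -exp (-r)) Set.univ := fun x _ => by fun_prop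
  have hd : ContDiff ℝ ∞ (dslope (fun r : ℝ => -exp (-r)) 0) := by
    refine contDiff_iff_contDiffAt.2 fun x => ?_
    rcases eq_or_ne x 0 with rfl | hx
    · obtain ⟨p, hp⟩ := hf 0 trivial
      exact (hp.has_fpower_series_dslope_fslope.analyticAt).contDiffAt
    · have h1 : ContDiffAt ℝ ∞ (fun r : ℝ => (r - 0)⁻¹ * (-exp (-r) - -exp (-0))) x := by
        refine ContDiffAt.mul (ContDiffAt.inv (by fun_prop) (by simpa using hx)) (by fun_prop)
      refine h1.congr_of_eventuallyEq ?_
      filter_upwards [isOpen_ne.mem_nhds hx] with r hr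
      rw [dslope_of_ne _ hr, slope_def_field, div_eq_inv_mul]
  unfold profile
  exact contDiff_const.mul (hd.comp (by fun_prop))

lemma velocity_eq (k : Fin 2) (x : Plane) :
    velocity k x = profile (‖x‖ ^ 2) * (![-x 1, x 0] : Fin 2 → ℝ) k := by
  unfold velocity
  rcases eq_or_ne x 0 with rfl | hx
  · fin_cases k <;> simp
  · rw [profile_of_ne (by positivity)]

lemma velocity_contDiff (k : Fin 2) : ContDiff ℝ ∞ (velocity k) := by
  have h : velocity k = fun x => profile (‖x‖ ^ 2) * (![-x 1, x 0] : Fin 2 → ℝ) k := by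
    funext x; exact velocity_eq k x
  rw [h]
  refine (profile_contDiff.comp (contDiff_norm_sq ℝ)).mul ?_
  fin_cases k
  · exact (contDiff_euclidean.1 contDiff_id 1).neg
  · exact contDiff_euclidean.1 contDiff_id 0

lemma profile_zero : profile 0 = (8 * π)⁻¹ := by
  unfold profile
  rw [zero_div, dslope_same]
  have h : HasDerivAt (fun r : ℝ => -exp (-r)) 1 0 := by
    have h0 : HasDerivAt (fun r : ℝ => -exp (-r)) (-(exp (-0) * -1)) 0 :=
      ((hasDerivAt_id (0 : ℝ)).neg.exp).neg
    convert h0 using 1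
    simp
  rw [h.deriv, mul_one]

/-- Decay of the profile. -/
lemma one_add_mul_profile_le (hs : 0 ≤ s) : (1 + s) * |profile s| ≤ 1 := by
  have hpi := pi_gt_three
  rcases hs.eq_or_lt with rfl | hs
  · rw [profile_zero, add_zero, one_mul, abs_of_pos (by positivity)]
    exact inv_le_one_of_one_le₀ (by linarith)
  · rw [profile_of_ne hs.ne']
    have h1 := add_one_le_exp (-s / 4)
    have h2 := exp_pos (-s / 4)
    have h3 : exp (-s / 4) ≤ 1 := exp_le_one_iff.2 (by linarith)
    rw [abs_of_nonneg (div_nonneg (by linarith) (by positivity)), ← mul_div_assoc,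
      div_le_one (by positivity)]
    nlinarith

lemma hasDerivAt_profile (hs : 0 < s) : HasDerivAt profile
    ((exp (-s / 4) * (1 + s / 4) - 1) / (2 * π * s ^ 2)) s := by
  have hpi := pi_pos
  have h1 : HasDerivAt (fun s => (1 - exp (-s / 4)) / (2 * π * s))
      (((-(exp (-s / 4) * (-1 / 4))) * (2 * π * s) -
        (1 - exp (-s / 4)) * (2 * π * 1)) / (2 * π * s) ^ 2) s := by
    refine HasDerivAt.div ?_ ((hasDerivAt_id s).const_mul _) (by positivity)
    exact (((hasDerivAt_id s).neg.div_const 4).exp).const_sub 1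
  have h2 : HasDerivAt profile (((-(exp (-s / 4) * (-1 / 4))) * (2 * π * s) -
        (1 - exp (-s / 4)) * (2 * π * 1)) / (2 * π * s) ^ 2) s := by
    refine h1.congr_of_eventuallyEq ?_
    filter_upwards [isOpen_ne.mem_nhds hs.ne'] with r hr
    exact profile_of_ne hr
  convert h2 using 1
  field_simp
  ring

lemma one_add_mul_deriv_profile_le (hs : 0 ≤ s) : (1 + s) * (s * |deriv profile s|) ≤ 1 := by
  have hpi := pi_gt_three
  rcases hs.eq_or_lt with rfl | hs
  · simp
  · rw [(hasDerivAt_profile hs).deriv]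
    have h1 := add_one_le_exp (-s / 4)
    have h2 := exp_pos (-s / 4)
    have h3 := add_one_le_exp (s / 4)
    have h4 : exp (-s / 4) * exp (s / 4) = 1 := by rw [← exp_add, neg_div, neg_add_cancel, exp_zero]
    have h5 : exp (-s / 4) * (1 + s / 4) ≤ 1 := by rw [← h4]; gcongr; linarith
    rw [abs_div, abs_of_nonpos (by linarith), abs_of_pos (by positivity), ← mul_div_assoc,
      ← mul_div_assoc, div_le_one (by positivity)]
    have h6 : -(exp (-s / 4) * (1 + s / 4) - 1) ≤ s / 4 := by nlinarith
    have h7 : -(exp (-s / 4) * (1 + s / 4) - 1) ≤ 1 := by nlinarith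
    have h8 : (1 + s) * -(exp (-s / 4) * (1 + s / 4) - 1) ≤ 2 * π * s := by nlinarith
    nlinarith

lemma partialDeriv_velocity (k j : Fin 2) (x : Plane) :
    partialDeriv k (velocity j) x = 2 * deriv profile (‖x‖ ^ 2) * x k * (![-x 1, x 0] : Fin 2 → ℝ) j
      + profile (‖x‖ ^ 2) * (!![0, 1; -1, 0] : Matrix (Fin 2) (Fin 2) ℝ) k j := by
  have h : velocity j = fun x => profile (‖x‖ ^ 2) * (![-x 1, x 0] : Fin 2 → ℝ) j := by
    funext x; exact velocity_eq j x
  have h1 : HasFDerivAt (fun y : Plane => ‖y‖ ^ 2) (2 • innerSL ℝ x) x :=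
    (hasStrictFDerivAt_norm_sq x).hasFDerivAt
  have hp : HasDerivAt profile (deriv profile (‖x‖ ^ 2)) (‖x‖ ^ 2) :=
    (profile_contDiff.differentiable (by simp) _).hasDerivAt
  have h2 := hp.comp_hasFDerivAt x h1
  have hin : ∀ k : Fin 2, inner ℝ x (single k (1 : ℝ)) = x k := fun k => by
    rw [EuclideanSpace.inner_single_right]; simp
  have h3 : ∀ i : Fin 2, HasFDerivAt (fun y : Plane => y i) (proj i : Plane →L[ℝ] ℝ) x :=
    fun i => (proj i : Plane →L[ℝ] ℝ).hasFDerivAt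
  unfold partialDeriv
  rw [h]
  fin_cases j
  · have h4 := h2.mul (h3 1).neg
    have h5 := h4.fderiv
    simp only [Function.comp_def] at h5
    simp only [Fin.zero_eta, Matrix.cons_val_zero]
    erw [h5]
    fin_cases k <;> simp [hin] <;> ring
  · have h4 := h2.mul (h3 0)
    have h5 := h4.fderiv
    simp only [Function.comp_def] at h5
    simp only [Fin.mk_one, Matrix.cons_val_one]
    erw [h5]
    fin_cases k <;> simp [hin] <;> ring

/-! ### The operator as a perturbation -/

/-- The operator `(w₁, w₂) ↦ w_k e_j`. -/
def unitOp (k j : Fin 2) : ℂ² →L[ℂ] ℂ² := (proj k : ℂ² →L[ℂ] ℂ).smulRight (single j 1)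

lemma unitOp_apply (k j i : Fin 2) (w : ℂ²) : unitOp k j w i = if i = j then w k else 0 := by
  simp [unitOp]

lemma norm_unitOp_le (k j : Fin 2) : ‖unitOp k j‖ ≤ 1 := by
  refine ContinuousLinearMap.opNorm_le_bound _ zero_le_one fun w => ?_
  have h : unitOp k j w = w k • single j (1 : ℂ) := rfl
  rw [h, norm_smul]
  simpa using PiLp.norm_apply_le w k

/-- The matrix field `w ↦ α (w · ∇) U`. -/
def stretch (α : ℝ) (y : Plane) : ℂ² →L[ℂ] ℂ² :=
  ∑ j, ∑ k, ((α * partialDeriv k (velocity j) y : ℝ) : ℂ) • unitOp k j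

lemma stretch_apply (α : ℝ) (y : Plane) (w : ℂ²) (j : Fin 2) :
    stretch α y w j = (α : ℂ) * ∑ k, w k * (partialDeriv k (velocity j) y : ℂ) := by
  fin_cases j <;>
  · simp [stretch, Fin.sum_univ_two, unitOp_apply]
    ring

lemma partialDeriv_velocity_continuous (k j : Fin 2) : Continuous (partialDeriv k (velocity j)) :=
    by
  unfold partialDeriv
  exact ((velocity_contDiff j).continuous_fderiv (by simp)).clm_apply continuous_const

lemma stretch_continuous (α : ℝ) : Continuous (stretch α) := by
  unfold stretch
  refine continuous_finsetSum _ fun j _ => continuous_finsetSum _ fun k _ => ?_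
  have := partialDeriv_velocity_continuous k j
  fun_prop

lemma abs_coord_le (x : Plane) (k : Fin 2) : |x k| ≤ ‖x‖ := PiLp.norm_apply_le x k

lemma abs_partialDeriv_velocity_le (k j : Fin 2) (x : Plane) :
    (1 + ‖x‖ ^ 2) * |partialDeriv k (velocity j) x| ≤ 3 := by
  rw [partialDeriv_velocity]
  have h1 := one_add_mul_profile_le (sq_nonneg ‖x‖)
  have h2 := one_add_mul_deriv_profile_le (sq_nonneg ‖x‖)
  have h3 : |(!![0, 1; -1, 0] : Matrix (Fin 2) (Fin 2) ℝ) k j| ≤ 1 := by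
    fin_cases k <;> fin_cases j <;> simp
  have h4 : |(![-x 1, x 0] : Fin 2 → ℝ) j| ≤ ‖x‖ := by
    fin_cases j
    · simpa using abs_coord_le x 1
    · simpa using abs_coord_le x 0
  have h5 := abs_coord_le x k
  calc _ ≤ (1 + ‖x‖ ^ 2) * (2 * |deriv profile (‖x‖ ^ 2)| * ‖x‖ * ‖x‖ +
        |profile (‖x‖ ^ 2)| * 1) := by
        gcongr
        refine (abs_add_le _ _).trans ?_
        rw [abs_mul, abs_mul, abs_mul, abs_mul, abs_two]
        gcongr
    _ = 2 * ((1 + ‖x‖ ^ 2) * (‖x‖ ^ 2 * |deriv profile (‖x‖ ^ 2)|)) +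
        (1 + ‖x‖ ^ 2) * |profile (‖x‖ ^ 2)| := by ring
    _ ≤ _ := by linarith

lemma norm_stretch_le (α : ℝ) (y : Plane) : (1 + ‖y‖ ^ 2) * ‖stretch α y‖ ≤ 12 * |α| := by
  have h0 : ‖stretch α y‖ ≤ ∑ j : Fin 2, ∑ k : Fin 2, |α| * |partialDeriv k (velocity j) y| := by
    refine (norm_sum_le _ _).trans (Finset.sum_le_sum fun j _ => (norm_sum_le _ _).trans
      (Finset.sum_le_sum fun k _ => ?_))
    rw [norm_smul, norm_real, norm_eq_abs, abs_mul]
    exact mul_le_of_le_one_right (by positivity) (norm_unitOp_le k j)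
  have hp : (0 : ℝ) ≤ 1 + ‖y‖ ^ 2 := by positivity
  refine (mul_le_mul_of_nonneg_left h0 hp).trans ?_
  simp only [Fin.sum_univ_two]
  have h := fun k j => mul_le_mul_of_nonneg_left (abs_partialDeriv_velocity_le k j y) (abs_nonneg α)
  nlinarith [h 0 0, h 0 1, h 1 0, h 1 1]

/-- Tangential drift coefficients that decay at infinity. -/
structure DecayingDrift (h : Plane → ℝ)
    (A : Plane → E →L[ℂ] E) (c : ℝ) : Prop where
  meas_h : Measurable h
  meas_A : StronglyMeasurable A
  nonneg : 0 ≤ c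
  bound_h : ∀ y, |h y| * ‖y‖ ≤ c / (1 + ‖y‖)
  bound_A : ∀ y, ‖A y‖ ≤ c / (1 + ‖y‖)

lemma DecayingDrift.driftCoeff {h : Plane → ℝ}
    {A : Plane → E →L[ℂ] E} (D : DecayingDrift h A c) : DriftCoeff h A c :=
  have hc : ∀ y : Plane, c / (1 + ‖y‖) ≤ c := fun y => div_le_self D.nonneg (by simp)
  ⟨D.meas_h, D.meas_A, D.nonneg, fun y => (D.bound_h y).trans (hc y),
    fun y => (D.bound_A y).trans (hc y)⟩

lemma decayingDrift (α : ℝ) :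
    DecayingDrift (fun y => α * profile (‖y‖ ^ 2)) (stretch α) (24 * |α|) where
  meas_h := by
    have := profile_contDiff.continuous
    exact Continuous.measurable (by fun_prop)
  meas_A := (stretch_continuous α).stronglyMeasurable
  nonneg := by positivity
  bound_h y := by
    have h1 := mul_le_mul_of_nonneg_left (one_add_mul_profile_le (sq_nonneg ‖y‖)) (abs_nonneg α)
    have hy := norm_nonneg y
    rw [le_div_iff₀ (by positivity), abs_mul]
    have h3 : ‖y‖ * (1 + ‖y‖) ≤ 2 * (1 + ‖y‖ ^ 2) := by nlinarith [sq_nonneg (‖y‖ - 1)]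
    calc |α| * |profile (‖y‖ ^ 2)| * ‖y‖ * (1 + ‖y‖) =
          |α| * |profile (‖y‖ ^ 2)| * (‖y‖ * (1 + ‖y‖)) := by ring
      _ ≤ |α| * |profile (‖y‖ ^ 2)| * (2 * (1 + ‖y‖ ^ 2)) := by gcongr
      _ ≤ _ := by nlinarith [abs_nonneg α]
  bound_A y := by
    have h1 := norm_stretch_le α y
    rw [le_div_iff₀ (by positivity)]
    nlinarith [sq_nonneg (‖y‖ - 1), norm_nonneg (stretch α y), norm_nonneg y]

/-- The semigroup generated by the operator with `c_μ + 1` replaced by zero. -/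
def vortexSemigroup (α : ℝ) (m : ℝ≥0∞) (t : ℝ) : L2sq m →L[ℂ] L2sq m :=
  ((decayingDrift α).driftCoeff.perturbationData m).perturbed t

/-! ### Compactness -/

lemma mehler_le (ht : 0 < t) (x y : Plane) : mehler t x y ≤ (4 * π * mvar t)⁻¹ := by
  have := mvar_pos ht
  have := pi_pos
  unfold mehler gauss
  refine mul_le_of_le_one_right (by positivity) (exp_le_one_iff.2 ?_)
  refine div_nonpos_of_nonpos_of_nonneg (by simp) (by positivity)

lemma exp_mul_mehler_symm (ht : 0 < t) (x y : Plane) :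
    exp (‖x‖ ^ 2 / 4) * mehler t x y = exp (‖y‖ ^ 2 / 4) * mehler t y x := by
  have e := mehler_symm ht x y
  rw [neg_div, neg_div, exp_neg, exp_neg] at e
  field_simp at e
  linarith

lemma KernelBound.op_add {κ κ₁ κ₂ : Plane → Plane → ℂ² →L[ℂ] ℂ²} {C₁ C₂ : ℝ}
    (h : KernelBound m κ C) (h₁ : KernelBound m κ₁ C₁) (h₂ : KernelBound m κ₂ C₂)
    (e : ∀ x y, κ x y = κ₁ x y + κ₂ x y) : h.op = h₁.op + h₂.op := by
  ext1 f
  refine Lp.ext ((ae_weighted m).2 ?_)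
  filter_upwards [h.op_coeFn f, h₁.op_coeFn f, h₂.op_coeFn f, h₁.ae_integrable (Lp.memLp f),
    h₂.ae_integrable (Lp.memLp f), (ae_weighted m).1 (Lp.coeFn_add (h₁.op f) (h₂.op f))]
    with x a a₁ a₂ i₁ i₂ s
  rw [add_apply, s, Pi.add_apply, a, a₁, a₂]
  simp only [kernelFun, e, add_apply]
  exact integral_add i₁ i₂

/-- First-order kernels that vanish for large `y` define compact operators. -/
lemma isCompactOperator_of_local (ht : 0 < t) {κ : Plane → Plane → ℂ² →L[ℂ] ℂ²} {R : ℝ}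
    (h : KernelBound m κ C) (hle : ∀ x y, ‖κ x y‖ ≤
      c * (1 + ‖y - damp t • x‖ / (2 * mvar t)) * mehler t x y)
    (h0 : ∀ x, ∀ y ∉ closedBall 0 R, κ x y = 0) : IsCompactOperator h.op := by
  have ha := mvar_pos ht
  set a := mvar t
  set b := damp t
  set k₀ := (4 * π * a)⁻¹
  set C' := 2 * c ^ 2 * k₀ * exp (R ^ 2 / 4)
  have hC' : 0 ≤ C' := by have := pi_pos; positivity
  have hms : MeasurableSet (closedBall (0 : Plane) R) := Metric.isClosed_closedBall.measurableSet
  let g : Plane → Plane → ℝ≥0∞ := fun x y => (closedBall (0 : Plane) R).indicator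
    (fun y => ofReal (C' * ((1 + ‖y - b • x‖ ^ 2 / (4 * a ^ 2)) * gauss a (y - b • x)))) y
  have hpt : ∀ x y, wt m x * (‖κ x y‖ₑ ^ 2 / wt m y) ≤ g x y := fun x y => by
    by_cases hy : y ∈ closedBall 0 R
    swap
    · rw [h0 x y hy, ← ofReal_norm, norm_zero]
      simp
    simp only [g, indicator_of_mem hy]
    refine (mul_le_mul_right (ENNReal.div_le_of_le_mul
      (le_mul_of_one_le_right' (one_le_wt m y))) _).trans ?_
    unfold wt
    rw [← ofReal_norm, ← ofReal_pow (norm_nonneg _), ← ofReal_mul (zero_le_one.trans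
      (one_le_rho m (by positivity)))]
    refine ofReal_le_ofReal ?_
    have hsq := sq_mul_gauss_le ha (y - b • x) (hle x y) (norm_nonneg _)
    have hk := (mehler_pos ht x y).le
    have hk' := (mehler_pos ht y x).le
    have hR : exp (‖y‖ ^ 2 / 4) ≤ exp (R ^ 2 / 4) := by gcongr; simpa using hy
    set q := 1 + ‖y - b • x‖ ^ 2 / (4 * a ^ 2)
    have hq0 : 0 ≤ q := by positivity
    calc rho m (‖x‖ ^ 2) * ‖κ x y‖ ^ 2
        ≤ exp (‖x‖ ^ 2 / 4) * (2 * c ^ 2 * (q * mehler t x y) * k₀) := by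
          gcongr
          · exact rho_le_exp m (by positivity)
          · exact hsq.trans (by gcongr; exact mehler_le ht x y)
      _ = 2 * c ^ 2 * k₀ * (exp (‖y‖ ^ 2 / 4) * mehler t y x) * q := by
          rw [← exp_mul_mehler_symm ht]; ring
      _ ≤ 2 * c ^ 2 * k₀ * (exp (R ^ 2 / 4) * mehler t y x) * q := by
          have : 0 ≤ k₀ := (mehler_pos ht x y).le.trans (mehler_le ht x y)
          gcongr
      _ = C' * (q * gauss a (y - b • x)) := by unfold C' mehler; ring
  have hg : Measurable (uncurry g) := by
    have := gauss_continuous a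
    refine Measurable.indicator (s := {p : Plane × Plane | p.2 ∈ closedBall (0 : Plane) R}) ?_
      (measurable_snd hms)
    exact (ENNReal.continuous_ofReal.comp (by fun_prop)).measurable
  refine h.isCompactOperator (((lintegral_mono fun x => ?_).trans_lt
    (b := ∫⁻ x, ∫⁻ y, g x y) ?_).ne)
  · rw [← lintegral_const_mul' _ _ (wt_ne_top m x)]
    exact lintegral_mono (hpt x)
  rw [lintegral_lintegral_swap hg.aemeasurable]
  refine (lintegral_mono (g := (closedBall (0 : Plane) R).indicator fun _ =>
    ofReal (C' * (1 + 2 / a)) * ofReal ((b ^ 2)⁻¹)) fun y => ?_).trans_lt ?_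
  · by_cases hy : y ∈ closedBall 0 R
    · simp only [g, indicator_of_mem hy]
      exact lintegral_moment_le ha hC' (by fun_prop) (lintegral_gauss_right ha (damp_pos t) y).le
        (lintegral_gauss_right (by positivity) (damp_pos t) y).le
    · simp only [g, indicator_of_notMem hy, lintegral_zero, le_refl]
  rw [lintegral_indicator hms, setLIntegral_const]
  exact ENNReal.mul_lt_top (by finiteness) measure_closedBall_lt_top

/-- In the Gaussian space the unperturbed semigroup is Hilbert–Schmidt. -/
lemma isCompactOperator_semi_top (ht : 0 < t) : IsCompactOperator (semi ℂ² ⊤ t) := by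
  rw [semi_of_pos ⊤ ht]
  have ht2 : 0 < t + t := by linarith
  have hle : ∀ x, wt ⊤ x * ∫⁻ y, ‖mehlerKer ℂ² t x y‖ₑ ^ 2 / wt ⊤ y ≤
      ofReal (mehler (t + t) x x) := fun x => by
    rw [← lintegral_const_mul' _ _ (wt_ne_top ⊤ x), ← integral_mehler_mul ht ht,
      ofReal_integral_eq_lintegral_ofReal (integrable_mehler_mul ht ht x x)
      (.of_forall fun y => mul_nonneg (mehler_pos ht _ _).le (mehler_pos ht _ _).le)]
    refine lintegral_mono fun y => ?_
    have hk := norm_mehlerKer_le (E := ℂ²) ht x y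
    rw [one_mul] at hk
    unfold wt
    rw [rho_top, rho_top, ← ofReal_norm, ← ofReal_pow (norm_nonneg _),
      ← ENNReal.ofReal_div_of_pos (exp_pos _), ← ofReal_mul (exp_pos _).le]
    refine ofReal_le_ofReal ?_
    calc _ ≤ exp (‖x‖ ^ 2 / 4) * (mehler t x y ^ 2 / exp (‖y‖ ^ 2 / 4)) := by gcongr
      _ = mehler t x y * (exp (‖x‖ ^ 2 / 4) * mehler t x y) / exp (‖y‖ ^ 2 / 4) := by ring
      _ = mehler t x y * mehler t y x := by
          rw [exp_mul_mehler_symm ht]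
          field_simp
  refine KernelBound.isCompactOperator _ ((lintegral_mono hle).trans_lt ?_).ne
  have e : ∀ x, mehler (t + t) x x = gauss (mvar (t + t)) (0 - (1 - damp (t + t)) • x) :=
      fun x => by
    unfold mehler
    rw [← gauss_neg, sub_smul, one_smul]
    congr 1
    abel
  simp only [e]
  rw [lintegral_gauss_right (mvar_pos ht2) (by linarith [damp_lt_one ht2])]
  exact ENNReal.ofReal_lt_top

section

variable {h : Plane → ℝ}
  {A : Plane → ℂ² →L[ℂ] ℂ²} {c : ℝ}

lemma DriftCoeff.indicator {C : ℝ} (D : DriftCoeff h A c) {s : Set Plane} (hs : MeasurableSet s)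
    (hC : 0 ≤ C) (h1 : ∀ y ∈ s, |h y| * ‖y‖ ≤ C) (h2 : ∀ y ∈ s, ‖A y‖ ≤ C) :
    DriftCoeff (s.indicator h) (s.indicator A) C :=
  ⟨D.meas_h.indicator hs, D.meas_A.indicator hs, hC,
    fun y => by by_cases hy : y ∈ s <;> simp [hy, hC, h1],
    fun y => by by_cases hy : y ∈ s <;> simp [hy, hC, h2]⟩

/-- The drift operators with decaying coefficients are compact. -/
lemma DecayingDrift.isCompactOperator_drift (D : DecayingDrift h A c) (m : ℝ≥0∞) (ht : 0 < t) :
    IsCompactOperator (D.driftCoeff.drift m t) := by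
  classical
  -- split the coefficients at radius `n`
  let B : ℕ → Set Plane := fun n => closedBall 0 n
  have hms : ∀ n, MeasurableSet (B n) := fun n => Metric.isClosed_closedBall.measurableSet
  have Di : ∀ n, DriftCoeff ((B n).indicator h) ((B n).indicator A) c := fun n =>
    D.driftCoeff.indicator (hms n) D.nonneg (fun y _ => D.driftCoeff.bound_h y)
      fun y _ => D.driftCoeff.bound_A y
  have hlt : ∀ n, ∀ y ∈ (B n)ᶜ, c / (1 + ‖y‖) ≤ c / (1 + n) := fun n y hy => by
    have : (n : ℝ) < ‖y‖ := by simpa [B] using hy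
    have := D.nonneg
    gcongr
  have Do : ∀ n : ℕ, DriftCoeff ((B n)ᶜ.indicator h) ((B n)ᶜ.indicator A) (c / (1 + n)) := fun n =>
    D.driftCoeff.indicator (hms n).compl (div_nonneg D.nonneg (by positivity))
      (fun y hy => (D.bound_h y).trans (hlt n y hy)) fun y hy => (D.bound_A y).trans (hlt n y hy)
  have hsum : ∀ n, D.driftCoeff.drift m t = (Di n).drift m t + (Do n).drift m t := fun n => by
    simp only [DriftCoeff.drift_of_pos _ m ht]
    refine KernelBound.op_add _ _ _ fun x y => ?_
    by_cases hy : y ∈ B n <;> simp [driftKer, hy]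
  have hlim : Tendsto (fun n : ℕ => (Di n).drift m t) atTop (𝓝 (D.driftCoeff.drift m t)) := by
    rw [tendsto_iff_norm_sub_tendsto_zero]
    have hz : Tendsto (fun n : ℕ => c / (1 + (n : ℝ)) * (driftConst m * exp (1 * t) /
        sqrt t)) atTop (𝓝 (0 * (driftConst m * exp (1 * t) / sqrt t))) :=
      (tendsto_const_nhds.div_atTop
        (tendsto_atTop_add_const_left _ _ tendsto_natCast_atTop_atTop)).mul_const _
    rw [zero_mul] at hz
    refine squeeze_zero (fun n => norm_nonneg _) (fun n => ?_) hz
    rw [hsum n, sub_add_cancel_left, norm_neg]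
    exact ((Do n).norm_drift_le m t).trans (le_of_eq (by ring))
  refine isCompactOperator_of_tendsto hlim (.of_forall fun n => ?_)
  rw [DriftCoeff.drift_of_pos _ m ht]
  refine isCompactOperator_of_local ht (R := n) _ (c := c)
    (fun x y => (Di n).norm_driftKer_le ht ?_ (norm_nonneg _)) fun x y hy => ?_
  · rw [← abs_of_pos (damp_pos t), ← abs_mul, abs_of_pos (damp_pos t), mul_cross_eq, abs_neg]
    exact abs_cross_le _ _
  · have hy' : y ∉ B n := hy
    simp [driftKer, hy']

end

/-! ### The radius of the essential spectrum: upper bound -/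

lemma tendsto_weight_ratio {M : ℝ} (hM : 0 < M) (z : Plane) (hb : 0 ≤ b) (hb1 : b ≤ 1) :
    Tendsto (fun y : Plane => (1 + ‖z + b • y‖ ^ 2 / (4 * M)) / (1 + ‖y‖ ^ 2 / (4 * M)))
      (comap norm atTop) (𝓝 (b ^ 2)) := by
  rw [tendsto_iff_norm_sub_tendsto_zero]
  set C := 4 * M + ‖z‖ ^ 2 + 2 * ‖z‖
  have hlim : Tendsto (fun y : Plane => C / ‖y‖) (comap norm atTop) (𝓝 0) :=
    tendsto_const_nhds.div_atTop tendsto_comap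
  refine squeeze_zero' (.of_forall fun y => norm_nonneg _) ?_ hlim
  filter_upwards [tendsto_comap.eventually (eventually_ge_atTop 1)] with y (hy : 1 ≤ ‖y‖)
  have hy0 : 0 < ‖y‖ := by linarith
  have h1 : |‖z + b • y‖ ^ 2 - b ^ 2 * ‖y‖ ^ 2| ≤ (‖z‖ ^ 2 + 2 * ‖z‖) * ‖y‖ := by
    have e : ‖b • y‖ = b * ‖y‖ := by rw [norm_smul, norm_of_nonneg hb]
    have h2 := norm_add_le z (b • y)
    have h3 := norm_sub_le (z + b • y) z
    rw [add_sub_cancel_left, e] at h3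
    rw [e] at h2
    have hzy : b * ‖y‖ ≤ ‖y‖ := mul_le_of_le_one_left hy0.le hb1
    have hby : 0 ≤ b * ‖y‖ := by positivity
    have hz := norm_nonneg z
    have hn := norm_nonneg (z + b • y)
    rw [← mul_pow, abs_le]
    constructor <;> nlinarith
  have e : (1 + ‖z + b • y‖ ^ 2 / (4 * M)) / (1 + ‖y‖ ^ 2 / (4 * M)) - b ^ 2 =
      (4 * M * (1 - b ^ 2) + (‖z + b • y‖ ^ 2 - b ^ 2 * ‖y‖ ^ 2)) / (4 * M + ‖y‖ ^ 2) := by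
    field_simp
    ring
  rw [e, norm_eq_abs, abs_div, abs_of_pos (by positivity : 0 < 4 * M + ‖y‖ ^ 2),
    div_le_div_iff₀ (by positivity) hy0]
  have h4 : |4 * M * (1 - b ^ 2) + (‖z + b • y‖ ^ 2 - b ^ 2 * ‖y‖ ^ 2)| ≤ C * ‖y‖ := by
    refine (abs_add_le _ _).trans ?_
    rw [abs_of_nonneg (mul_nonneg (by positivity) (by nlinarith))]
    nlinarith [mul_nonneg hM.le (sq_nonneg b)]
  have : 0 ≤ C := by positivity
  nlinarith

/-- Far away the adjoint Mehler semigroup acts on the weight like `e^{-mt}`. -/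
lemma exists_radius (hm0 : m ≠ 0) (hm : m ≠ ⊤) {δ : ℝ} (ht : 0 < t)
    (hδ : exp (-m.toReal * t) < δ) : ∃ R : ℝ, ∀ y : Plane, R < ‖y‖ →
      ∫⁻ x, wt m x * ofReal (mehler t x y) ≤ ofReal δ * wt m y := by
  have hM : 0 < m.toReal := ENNReal.toReal_pos hm0 hm
  set M := m.toReal
  have ha := mvar_pos ht
  have hb := damp_pos t
  have hb1 := damp_le_one ht.le
  have hr : ∀ y : Plane, 0 < rho m (‖y‖ ^ 2) := fun y =>
    zero_lt_one.trans_le (one_le_rho m (by positivity))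
  have hlim : Tendsto (fun y : Plane => ∫⁻ z, ofReal (rho m (‖z + damp t • y‖ ^ 2) /
      rho m (‖y‖ ^ 2) * gauss (mvar t) z)) (comap norm atTop)
      (𝓝 (∫⁻ z, ofReal (exp (-M * t) * gauss (mvar t) z))) := by
    refine tendsto_lintegral_filter_of_dominated_convergence
      (fun z => ofReal (4 ^ M) * ofReal (exp (‖z - 0‖ ^ 2 / 8) * gauss (mvar t) (z - 0)))
      (.of_forall fun y => ?_) (.of_forall fun y => .of_forall fun z => ?_) ?_
      (.of_forall fun z => (ENNReal.continuous_ofReal.tendsto _).comp (Tendsto.mul_const _ ?_))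
    · have h1 : Continuous fun z : Plane => rho m (‖z + damp t • y‖ ^ 2) :=
        (rho_continuous m).comp (continuous_id.add continuous_const)
      have h2 := gauss_continuous (mvar t)
      exact (ENNReal.continuous_ofReal.comp (by fun_prop)).measurable
    · rw [← ofReal_mul (by positivity), ← mul_assoc, sub_zero]
      refine ofReal_le_ofReal (mul_le_mul_of_nonneg_right ?_ (gauss_pos ha z).le)
      rw [div_le_iff₀ (hr y)]
      simpa using rho_le_mul hm hb.le hb1 (z + damp t • y) y
    · rw [lintegral_const_mul' _ _ (by finiteness)]
      exact ENNReal.mul_ne_top (by finiteness)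
        ((lintegral_exp_mul_gauss_le ha (mvar_lt_one t).le 0).trans_lt (by finiteness)).ne
    · have h1 := (tendsto_weight_ratio hM z hb.le hb1).rpow_const (p := M) (Or.inr hM.le)
      rw [damp_sq', ← exp_mul, neg_mul_comm, mul_comm t] at h1
      refine h1.congr fun y => ?_
      rw [div_rpow (by positivity) (by positivity), rho_eq hm0 hm, rho_eq hm0 hm]
  simp only [ofReal_mul (exp_pos _).le] at hlim
  rw [lintegral_const_mul' _ _ (by finiteness), lintegral_gauss ha, mul_one] at hlim
  have hev := hlim.eventually (gt_mem_nhds ((ENNReal.ofReal_lt_ofReal_iff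
    ((exp_pos _).trans hδ)).2 hδ))
  rw [eventually_comap] at hev
  obtain ⟨R, hR⟩ := eventually_atTop.1 hev
  refine ⟨R, fun y hy => (le_of_eq ?_).trans (mul_le_mul_left (hR ‖y‖ hy.le y rfl).le _)⟩
  rw [← lintegral_mul_const' _ _ (wt_ne_top m y), ← lintegral_add_right_eq_self _ (damp t • y)]
  refine lintegral_congr fun x => ?_
  unfold wt mehler
  rw [← ofReal_mul (hr _).le, ← ofReal_mul (mul_nonneg
    (div_nonneg (hr _).le (hr _).le) (gauss_pos ha _).le), add_sub_cancel_right]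
  have := (hr y).ne'
  field_simp

/-- The part of the Mehler kernel with `y ∈ s`. -/
def cutKer (s : Set Plane) (t : ℝ) (x y : Plane) : ℂ² →L[ℂ] ℂ² :=
  s.indicator (mehlerKer ℂ² t x) y

lemma cutKer_meas {s : Set Plane} (hs : MeasurableSet s) (t : ℝ) :
    StronglyMeasurable (uncurry (cutKer s t)) := by
  exact (mehlerKer_meas t).indicator (s := {p : Plane × Plane | p.2 ∈ s}) (measurable_snd hs)

lemma norm_cutKer_le {s : Set Plane} (ht : 0 < t) (x y : Plane) :
    ‖cutKer s t x y‖ ≤ 1 * mehler t x y :=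
  (norm_indicator_le_norm_self _ _).trans (norm_mehlerKer_le ht x y)

lemma measurableSet_ball (R : ℝ) : MeasurableSet (closedBall (0 : Plane) R) :=
  Metric.isClosed_closedBall.measurableSet

lemma kernelBound_inner (m : ℝ≥0∞) (R : ℝ) (ht : 0 < t) : KernelBound m
    (cutKer (closedBall 0 R) t) (1 * sqrt (schurConst m) * exp (t / 2)) :=
  kernelBound_of_le_mehler m ht (cutKer_meas (measurableSet_ball R) t) zero_le_one
    (norm_cutKer_le ht)

lemma isCompactOperator_inner (m : ℝ≥0∞) (R : ℝ) (ht : 0 < t) :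
    IsCompactOperator (kernelBound_inner m R ht).op := by
  refine isCompactOperator_of_local ht (R := R) (c := 1) _ (fun x y =>
    (norm_cutKer_le ht x y).trans (mul_le_mul_of_nonneg_right ?_ (mehler_pos ht x y).le))
    fun x y hy => indicator_of_notMem hy _
  have := mvar_pos ht
  rw [one_mul]
  exact le_add_of_nonneg_right (by positivity)

/-- Outside a large ball the unperturbed semigroup has norm close to `e^{(1-m)t/2}`. -/
lemma exists_kernelBound_outer (hm0 : m ≠ 0) (hm : m ≠ ⊤) {θ : ℝ} (ht : 0 < t)
    (hθ : exp ((1 - m.toReal) / 2 * t) < θ) :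
    ∃ R, KernelBound m (cutKer (closedBall 0 R)ᶜ t) θ := by
  have hθ0 : 0 < θ := (exp_pos _).trans hθ
  obtain ⟨R, hR⟩ := exists_radius hm0 hm (δ := exp (-t) * θ ^ 2) ht (by
    calc exp (-m.toReal * t) = exp (-t) * exp ((1 - m.toReal) / 2 * t) ^ 2 := by
          rw [← exp_nat_mul, ← exp_add]; congr 1; push_cast; ring
      _ < _ := by gcongr)
  have hs := (measurableSet_ball R).compl
  set s := (closedBall (0 : Plane) R)ᶜ with hs_def
  refine ⟨R, cutKer_meas hs t, hθ0.le, fun g hg => ?_⟩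
  have hmk : Measurable fun p : Plane × Plane => ofReal (mehler t p.1 p.2) :=
    measurable_ofReal.comp (mehler_measurable t)
  refine (schur_test (W := wt m) (p := fun _ => 1) (p' := fun _ => 1)
    (q := fun x y => ‖cutKer s t x y‖ₑ) (q₁ := fun x y => ofReal (mehler t x y))
    (q₂ := fun x y => s.indicator (fun y => ofReal (mehler t x y)) y)
    (A := ofReal (exp t)) (B := ofReal (exp (-t) * θ ^ 2))
    (wt_measurable m) measurable_const measurable_const (by simp) (by simp)
    hmk (hmk.indicator (s := {p : Plane × Plane | p.2 ∈ s}) (measurable_snd hs))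
    (fun x y => ?_) (fun x => ?_) (fun y => ?_) hg).trans (le_of_eq ?_)
  · by_cases hy : y ∈ s
    · simp only [indicator_of_mem hy]
      rw [← ofReal_norm, ← ofReal_pow (norm_nonneg _), ← ofReal_mul (mehler_pos ht x y).le]
      have h1 := norm_cutKer_le (s := s) ht x y
      rw [one_mul] at h1
      exact ofReal_le_ofReal (by nlinarith [norm_nonneg (cutKer s t x y)])
    · rw [cutKer, indicator_of_notMem hy, ← ofReal_norm, norm_zero]
      simp
  · simpa only [mul_one] using (lintegral_mehler_right ht x).le
  · by_cases hy : y ∈ s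
    · simp only [indicator_of_mem hy, mul_one]
      exact hR y (by simpa [hs_def] using hy)
    · simp [indicator_of_notMem hy]
  · rw [← ofReal_mul (exp_pos _).le, ← mul_assoc, ← exp_add, add_neg_cancel,
      exp_zero, one_mul, ofReal_pow hθ0.le]

lemma semi_eq_outer_add_inner {R θ : ℝ} (ht : 0 < t)
    (h : KernelBound m (cutKer (closedBall 0 R)ᶜ t) θ) :
    semi ℂ² m t = h.op + (kernelBound_inner m R ht).op := by
  rw [semi_of_pos m ht]
  exact KernelBound.op_add _ _ _ fun x y => (Set.indicator_compl_add_self_apply _ _ y).symm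

lemma DecayingDrift.isCompactOperator_perturbed_sub {h : Plane → ℝ}
    {A : Plane → ℂ² →L[ℂ] ℂ²} (D : DecayingDrift h A c) (m : ℝ≥0∞) (ht : 0 ≤ t) :
    IsCompactOperator ((D.driftCoeff.perturbationData m).perturbed t - semi ℂ² m t) :=
  (D.driftCoeff.perturbationData m).isCompactOperator_perturbed_sub
    (fun _ hs => D.isCompactOperator_drift m hs) ht

lemma isCompactOperator_vortexSemigroup_sub (α : ℝ) (m : ℝ≥0∞) (ht : 0 ≤ t) :
    IsCompactOperator (vortexSemigroup α m t - semi ℂ² m t) :=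
  (decayingDrift α).isCompactOperator_perturbed_sub m ht

lemma DecayingDrift.isFredholm_perturbed {h : Plane → ℝ}
    {A : Plane → ℂ² →L[ℂ] ℂ²} (D : DecayingDrift h A c) (hm0 : m ≠ 0) (hm : m ≠ ⊤) (ht : 0 < t)
    {κ : ℝ} (hκ : 0 < κ) {z : ℂ} (hz : κ * exp ((1 - m.toReal) / 2 * t) < ‖z‖) :
    (z • idL (L2sq m) - (κ : ℂ) • (D.driftCoeff.perturbationData m).perturbed t).IsFredholm := by
  obtain ⟨θ, h1, h2⟩ := exists_between (show exp ((1 - m.toReal) / 2 * t) < ‖z‖ / κ by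
    rw [lt_div_iff₀ hκ]; linarith)
  obtain ⟨R, hR⟩ := exists_kernelBound_outer hm0 hm ht h1
  have e : (κ : ℂ) • (D.driftCoeff.perturbationData m).perturbed t = (κ : ℂ) • hR.op + (κ : ℂ) •
      (((D.driftCoeff.perturbationData m).perturbed t - semi ℂ² m t) +
        (kernelBound_inner m R ht).op) := by
    rw [semi_eq_outer_add_inner ht hR, ← smul_add]
    congr 1
    abel
  rw [e]
  refine isFredholm_of_norm_lt ?_ (((D.isCompactOperator_perturbed_sub m ht.le).add
    (isCompactOperator_inner m R ht)).smul (κ : ℂ))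
  rw [norm_smul, norm_real, norm_of_nonneg hκ.le]
  calc κ * ‖hR.op‖ ≤ κ * θ := by gcongr; exact hR.norm_op_le
    _ < ‖z‖ := by rw [lt_div_iff₀ hκ] at h2; linarith

lemma isFredholm_vortexSemigroup_top (α : ℝ) (ht : 0 < t) (κ : ℂ) {z : ℂ} (hz : z ≠ 0) :
    (z • idL (L2sq ⊤) - κ • vortexSemigroup α ⊤ t).IsFredholm := by
  have h : IsCompactOperator (vortexSemigroup α ⊤ t) := by
    simpa using (isCompactOperator_vortexSemigroup_sub α ⊤ ht.le).add
      (isCompactOperator_semi_top ht)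
  simpa using isFredholm_of_norm_lt (z := z) (A := (0 : L2sq ⊤ →L[ℂ] L2sq ⊤))
      (by simpa using hz) (h.smul κ)

/-! ### The radius of the essential spectrum: lower bound -/

/-- Growth of the weighted norm of wide Gaussians, upper bound. -/
lemma lintegral_wt_mul_gauss_sq_le (hm0 : m ≠ 0) (hm : m ≠ ⊤) (hs : 1 ≤ s) :
    ∫⁻ x, wt m x * ofReal (gauss s x) ^ 2 ≤ ofReal (2 ^ m.toReal * s ^ (m.toReal - 1)) := by
  have hM : 0 < m.toReal := ENNReal.toReal_pos hm0 hm
  set M := m.toReal with hMdef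
  have hs0 : 0 < s := by linarith
  have hpi := pi_gt_three
  have hpt : ∀ x : Plane, wt m x * ofReal (gauss s x) ^ 2 ≤
      ofReal (2 ^ M * s ^ (M - 1) / 2) * ofReal (2 * gauss (2 * s) x) := fun x => by
    have hg := (gauss_pos hs0 x).le
    have h1 : rho m (‖x‖ ^ 2) ≤ (2 * s) ^ M * exp (‖x‖ ^ 2 / (8 * s)) := by
      rw [rho_eq hm0 hm]
      have h2 : 1 + ‖x‖ ^ 2 / (4 * M) ≤ 2 * s * exp (‖x‖ ^ 2 / (8 * M * s)) := by
        have h3 := add_one_le_exp (‖x‖ ^ 2 / (8 * M * s))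
        have h4 : ‖x‖ ^ 2 / (4 * M) = 2 * s * (‖x‖ ^ 2 / (8 * M * s)) := by field_simp; ring
        rw [h4]
        nlinarith
      calc _ ≤ (2 * s * exp (‖x‖ ^ 2 / (8 * M * s))) ^ M := by gcongr
        _ = _ := by
          rw [mul_rpow (by positivity) (by positivity), ← exp_mul]
          congr 2
          field_simp
    have h5 : exp (‖x‖ ^ 2 / (8 * s)) * gauss s x = 2 * gauss (2 * s) x := by
      unfold gauss
      rw [mul_left_comm, ← exp_add, ← mul_assoc]
      congr 2 <;> field_simp
      ring
    have h6 : gauss s x ^ 2 ≤ (4 * π * s)⁻¹ * gauss s x := by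
      rw [sq]
      gcongr
      exact mul_le_of_le_one_right (by positivity) (exp_le_one_iff.2
        (div_nonpos_of_nonpos_of_nonneg (by simp) (by positivity)))
    have h7 : (4 * π * s)⁻¹ ≤ s⁻¹ / 2 := by
      rw [mul_inv]
      have : (4 * π)⁻¹ ≤ 2⁻¹ := inv_anti₀ (by norm_num) (by linarith)
      have hs' : 0 < s⁻¹ := by positivity
      nlinarith
    rw [wt, ← ofReal_pow hg, ← ofReal_mul (zero_le_one.trans
      (one_le_rho m (by positivity))), ← ofReal_mul (by positivity), ← h5]
    refine ofReal_le_ofReal ?_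
    calc _ ≤ ((2 * s) ^ M * exp (‖x‖ ^ 2 / (8 * s))) * ((s⁻¹ / 2) * gauss s x) := by
          gcongr
          exact h6.trans (by gcongr)
      _ = _ := by
          rw [mul_rpow (by norm_num) hs0.le, rpow_sub hs0, rpow_one]
          ring
  refine (lintegral_mono hpt).trans ?_
  rw [lintegral_const_mul' _ _ (by finiteness)]
  simp only [ofReal_mul (show (0 : ℝ) ≤ 2 by norm_num)]
  rw [lintegral_const_mul' _ _ (by finiteness), lintegral_gauss (by positivity), mul_one,
    ← ofReal_mul (by positivity)]
  refine ofReal_le_ofReal (le_of_eq ?_)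
  ring

/-- Growth of the weighted norm of wide Gaussians, lower bound. -/
lemma exists_le_lintegral_wt_mul_gauss_sq (hm0 : m ≠ 0) (hm : m ≠ ⊤) :
    ∃ c : ℝ, 0 < c ∧ ∀ s : ℝ, 0 < s → ofReal (c * s ^ (m.toReal - 1)) ≤
      ∫⁻ x, wt m x * ofReal (gauss s x) ^ 2 := by
  have hM : 0 < m.toReal := ENNReal.toReal_pos hm0 hm
  set M := m.toReal with hMdef
  set v := (volume (ball (0 : Plane) 1)).toReal with hv
  have hvt : volume (ball (0 : Plane) 1) ≠ ⊤ := measure_ball_lt_top.ne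
  have hv0 : 0 < v := ENNReal.toReal_pos (Metric.measure_ball_pos _ _ one_pos).ne' hvt
  have hpi := pi_pos
  refine ⟨(1 / (4 * M)) ^ M * ((4 * π)⁻¹ * exp (-(9 / 4))) ^ 2 * v, by positivity, fun s hs => ?_⟩
  set p : Plane := single 0 (2 * sqrt s) with hp
  have hpn : ‖p‖ = 2 * sqrt s := by rw [hp, PiLp.norm_single, norm_of_nonneg (by positivity)]
  set B := ball p (sqrt s) with hB
  have hBv : volume B = ofReal (s * v) := by
    rw [hB, Measure.addHaar_ball _ _ (sqrt_nonneg s), finrank_euclideanSpace, Fintype.card_fin,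
      sq_sqrt hs.le, ofReal_mul hs.le, hv, ENNReal.ofReal_toReal hvt]
  have hlow : ∀ x ∈ B, ofReal ((s / (4 * M)) ^ M *
      ((4 * π * s)⁻¹ * exp (-(9 / 4))) ^ 2) ≤ wt m x * ofReal (gauss s x) ^ 2 := fun x hx => by
    have hx' : ‖x - p‖ < sqrt s := by rwa [hB, Metric.mem_ball, dist_eq_norm] at hx
    have h1 : sqrt s ≤ ‖x‖ := by
      have := norm_sub_norm_le p x
      rw [norm_sub_rev] at this
      linarith
    have h2 : ‖x‖ ≤ 3 * sqrt s := by
      have := norm_sub_norm_le x p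
      linarith
    have hsq := sq_sqrt hs.le
    have hs0 := sqrt_nonneg s
    have h3 : s ≤ ‖x‖ ^ 2 := by nlinarith
    have h4 : ‖x‖ ^ 2 ≤ 9 * s := by nlinarith [norm_nonneg x]
    have hg := (gauss_pos hs x).le
    unfold wt
    rw [← ofReal_pow hg, ← ofReal_mul (zero_le_one.trans (one_le_rho m (by positivity)))]
    refine ofReal_le_ofReal ?_
    rw [rho_eq hm0 hm]
    unfold gauss
    gcongr
    · have : s / (4 * M) ≤ ‖x‖ ^ 2 / (4 * M) := by gcongr
      linarith
    · rw [le_div_iff₀ (by positivity)]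
      linarith
  refine le_trans (le_of_eq ?_) ((setLIntegral_mono' Metric.isOpen_ball.measurableSet hlow).trans
    (setLIntegral_le_lintegral _ _))
  rw [setLIntegral_const, hBv, ← ofReal_mul (by positivity), show s / (4 * M) = s * (1 / (4 * M)) by
    ring, mul_rpow hs.le (by positivity), rpow_sub hs, rpow_one]
  congr 1
  field_simp

/-- The vector field `G_{1+σ} e₁`. -/
def gaussField (σ : ℝ) (x : Plane) : ℂ² := (gauss (1 + σ) x : ℂ) • single 0 1

lemma gaussField_continuous (σ : ℝ) : Continuous (gaussField σ) := by
  have := gauss_continuous (1 + σ)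
  unfold gaussField
  fun_prop

lemma enorm_gaussField {σ : ℝ} (hσ : 0 ≤ σ) (x : Plane) :
    ‖gaussField σ x‖ₑ = ofReal (gauss (1 + σ) x) := by
  rw [← ofReal_norm, gaussField, norm_smul, norm_real,
    norm_of_nonneg (gauss_pos (by linarith) x).le]
  simp

section

variable {m : ℝ≥0∞} (hm0 : m ≠ 0) (hm : m ≠ ⊤)
include hm0 hm

lemma memLp_gaussField {σ : ℝ} (hσ : 0 ≤ σ) : MemLp (gaussField σ) 2 (weightedMeasure m) := by
  refine memLp_weighted_iff.2 ⟨(gaussField_continuous σ).aestronglyMeasurable, ?_⟩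
  simp only [enorm_gaussField hσ]
  exact (lintegral_wt_mul_gauss_sq_le hm0 hm (by linarith)).trans_lt (by finiteness)

/-- The Mehler semigroup narrows the Gaussians `G_{1+σ}`. -/
lemma semi_gaussField {σ : ℝ} (hσ : 0 ≤ σ) (ht : 0 < t) :
    semi _ m t ((memLp_gaussField hm0 hm hσ).toLp _) =
      (memLp_gaussField hm0 hm (mul_nonneg (sq_nonneg (damp t)) hσ)).toLp _ := by
  refine Lp.ext ((ae_weighted m).2 ?_)
  filter_upwards [semi_coeFn ht ((memLp_gaussField hm0 hm hσ).toLp _), (ae_weighted m).1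
    (memLp_gaussField hm0 hm (mul_nonneg (sq_nonneg (damp t)) hσ)).coeFn_toLp] with x h1 h2
  rw [h1, h2, kernelFun_congr _ ((ae_weighted m).1 (memLp_gaussField hm0 hm hσ).coeFn_toLp),
    kernelFun_mehlerKer]
  have h := integral_gauss_mul (b := damp t) (mvar_pos ht) (by linarith : 0 < 1 + σ) x 0
  rw [smul_zero, sub_zero] at h
  have e : ∀ y, mehler t x y • gaussField σ y = ((gauss (mvar t)
      (x - damp t • y) * gauss (1 + σ) (y - 0) : ℝ) : ℂ) • (single 0 1 : ℂ²) := fun y => by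
    rw [sub_zero, Complex.ofReal_mul, mul_smul]
    rfl
  simp only [e]
  rw [integral_smul_const, integral_complex_ofReal, h, gaussField]
  congr 3
  have := damp_sq t
  linear_combination this

end

/-- The point `e^{(1-m)t/2}` belongs to the essential spectrum. -/
lemma not_isFredholm_vortexSemigroup (hm1 : 1 < m) (hm : m ≠ ⊤) (α : ℝ) (ht : 0 < t) {κ : ℝ}
    (hκ : 0 < κ) :
    ¬ (((κ * exp ((1 - m.toReal) / 2 * t) : ℝ) : ℂ) • idL (L2sq m) -
      (κ : ℂ) • vortexSemigroup α m t).IsFredholm := by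
  have hm0 : m ≠ 0 := (zero_lt_one.trans hm1).ne'
  have hM : 1 < m.toReal := by simpa using (ENNReal.toReal_lt_toReal (by simp) hm).2 hm1
  set M := m.toReal
  set b := damp t with hb
  have hb0 : 0 < b := damp_pos t
  have hb1 : b < 1 := damp_lt_one ht
  set θ := exp ((1 - M) / 2 * t) with hθ
  have hθ0 : 0 < θ := exp_pos _
  have hθ1 : θ < 1 := exp_lt_one_iff.2 (by nlinarith)
  have hθb : θ ^ 2 = (b ^ 2) ^ (M - 1) := by
    rw [hθ, hb, damp_sq', ← exp_mul, ← exp_nat_mul]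
    congr 1; push_cast; ring
  -- the widths
  let σ : ℕ → ℝ := fun j => ((b ^ 2)⁻¹) ^ j
  have hσ1 : ∀ j, 1 ≤ σ j := fun j => one_le_pow₀ ((one_le_inv₀ (by positivity)).2 (by nlinarith))
  have hσ : ∀ j, 0 ≤ σ j := fun j => zero_le_one.trans (hσ1 j)
  have hθσ : ∀ j, (θ ^ j) ^ 2 * (σ j) ^ (M - 1) = 1 := fun j => by
    rw [pow_right_comm, hθb, rpow_pow_comm (by positivity), ← mul_rpow (by positivity) (hσ j),
      ← mul_pow, mul_inv_cancel₀ (by positivity), one_pow, one_rpow]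
  let e : ℕ → L2sq m := fun j => (memLp_gaussField hm0 hm (hσ j)).toLp _
  let e' : L2sq m := (memLp_gaussField hm0 hm (mul_nonneg (sq_nonneg b) (hσ 0))).toLp _
  have hae := fun j => (ae_weighted m).1 (memLp_gaussField hm0 hm (hσ j)).coeFn_toLp
  have hS : ∀ j, semi _ m t (e (j + 1)) = e j := fun j =>
    (semi_gaussField hm0 hm (hσ (j + 1)) ht).trans ((MemLp.toLp_eq_toLp_iff _ _).2 (by
      rw [show damp t ^ 2 * σ (j + 1) = σ j by simp only [σ, pow_succ, ← hb]; field_simp]))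
  let w : ℕ → L2sq m := fun N => ∑ j ∈ Finset.range N, (θ : ℂ) ^ j • e j
  have hw : ∀ N, w (N + 1) = w N + (θ : ℂ) ^ N • e N := fun N => Finset.sum_range_succ _ _
  have hSw : ∀ N, (θ : ℂ) • w (N + 1) - semi _ m t (w (N + 1)) = (θ : ℂ) ^ (N + 1) • e N - e' :=
      fun N => by
    induction N with
    | zero => simpa [w] using semi_gaussField hm0 hm (hσ 0) ht
    | succ N ih =>
      rw [hw (N + 1), map_add, map_smul, hS]
      rw [smul_add, add_sub_add_comm, ih]
      module
  have hn : ∀ j, ‖e j‖ₑ ^ 2 = ∫⁻ x, wt m x * ofReal (gauss (1 + σ j) x) ^ 2 := fun j => by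
    rw [enorm_Lp_sq]
    refine lintegral_congr_ae ?_
    filter_upwards [hae j] with x hx
    rw [hx, enorm_gaussField (hσ j)]
  have hM1 : (0 : ℝ) ≤ M - 1 := by linarith
  have hθn : ∀ j, ‖(θ : ℂ) ^ j‖ = θ ^ j :=
      fun j => by rw [norm_pow, norm_real, norm_of_nonneg hθ0.le]
  obtain ⟨c, hc0, hc⟩ := exists_le_lintegral_wt_mul_gauss_sq hm0 hm
  have hlow : ∀ j, c ≤ ‖(θ : ℂ) ^ j • e j‖ ^ 2 := fun j => by
    have h2 := hc (1 + σ j) (by linarith [hσ j])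
    rw [← hn, ← ofReal_norm, ← ofReal_pow (norm_nonneg _),
      ENNReal.ofReal_le_ofReal_iff (by positivity)] at h2
    rw [norm_smul, hθn, mul_pow]
    calc c = (θ ^ j) ^ 2 * (c * σ j ^ (M - 1)) := by rw [mul_left_comm, hθσ, mul_one]
      _ ≤ (θ ^ j) ^ 2 * (c * (1 + σ j) ^ (M - 1)) := by
        have := hσ j; gcongr; linarith
      _ ≤ _ := by gcongr
  have heN : ∀ N, ‖(θ : ℂ) ^ (N + 1) • e N‖ ≤ sqrt (2 ^ M * 2 ^ (M - 1)) := fun N => by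
    have h1 := (hn N).le.trans (lintegral_wt_mul_gauss_sq_le hm0 hm (by linarith [hσ N]))
    have := hσ N
    have := hσ1 N
    rw [← ofReal_norm, ← ofReal_pow (norm_nonneg _), ENNReal.ofReal_le_ofReal_iff
        (by positivity)] at h1
    refine le_sqrt_of_sq_le ?_
    rw [norm_smul, hθn, mul_pow]
    calc _ ≤ (θ ^ N) ^ 2 * (2 ^ M * (2 * σ N) ^ (M - 1)) := by
          refine mul_le_mul ?_ (h1.trans (by gcongr; linarith)) (sq_nonneg _) (sq_nonneg _)
          gcongr ?_ ^ 2
          exact pow_le_pow_of_le_one hθ0.le hθ1.le (Nat.le_succ N)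
      _ = 2 ^ M * 2 ^ (M - 1) * ((θ ^ N) ^ 2 * σ N ^ (M - 1)) := by
          rw [mul_rpow (by norm_num) (hσ N)]; ring
      _ = _ := by rw [hθσ, mul_one]
  -- the summands have nonnegative inner products
  have hin : ∀ i j, 0 ≤ RCLike.re (inner ℂ ((θ : ℂ) ^ i • e i) ((θ : ℂ) ^ j • e j)) := fun i j => by
    rw [inner_smul_left, inner_smul_right, L2.inner_def, ← Complex.ofReal_pow, ← Complex.ofReal_pow,
      Complex.conj_ofReal, RCLike.re_to_complex, Complex.re_ofReal_mul, Complex.re_ofReal_mul,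
      ← RCLike.re_to_complex, ← integral_re (L2.integrable_inner _ _)]
    refine mul_nonneg (by positivity) (mul_nonneg (by positivity) (integral_nonneg_of_ae
      ((ae_weighted m).2 ?_)))
    filter_upwards [hae i, hae j] with x h1 h2
    have := gauss_pos (by linarith [hσ i] : 0 < 1 + σ i) x
    have := gauss_pos (by linarith [hσ j] : 0 < 1 + σ j) x
    rw [Pi.zero_apply, h1, h2, gaussField, gaussField, inner_smul_left, inner_smul_right,
        Complex.conj_ofReal, RCLike.re_to_complex,
      Complex.re_ofReal_mul, Complex.re_ofReal_mul]
    simp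
    positivity
  have hwn : ∀ N : ℕ, c * N ≤ ‖w N‖ ^ 2 := fun N => by
    induction N with
    | zero => simp
    | succ N ih =>
      have h1 : 0 ≤ RCLike.re (inner ℂ (w N) ((θ : ℂ) ^ N • e N)) := by
        rw [sum_inner, map_sum]
        exact Finset.sum_nonneg fun i _ => hin i N
      rw [hw, norm_add_sq (𝕜 := ℂ)]
      push_cast
      linarith [hlow N]
  have hwb : ∀ N, ∀ᵐ x, ‖w N x‖ ≤ ∑ j ∈ Finset.range N, θ ^ j := fun N => by
    induction N with
    | zero =>
      filter_upwards [(ae_weighted m).1 (Lp.coeFn_zero ℂ² 2 (weightedMeasure m))] with x hx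
      rw [show w 0 = 0 from rfl, hx]
      simp
    | succ N ih =>
      rw [hw, Finset.sum_range_succ]
      filter_upwards [ih, (ae_weighted m).1 (Lp.coeFn_add (w N) ((θ : ℂ) ^ N • e N)),
        (ae_weighted m).1 (Lp.coeFn_smul ((θ : ℂ) ^ N) (e N)), hae N] with x h1 h2 h3 h4
      rw [h2, Pi.add_apply, h3, Pi.smul_apply, h4]
      refine (norm_add_le _ _).trans (add_le_add h1 ?_)
      rw [norm_smul, hθn, ← toReal_enorm (gaussField _ _), enorm_gaussField (hσ N),
        ENNReal.toReal_ofReal (gauss_pos (by linarith [hσ N]) x).le]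
      refine mul_le_of_le_one_right (by positivity) (mul_le_one₀ (inv_le_one_of_one_le₀
        (by nlinarith [pi_gt_three, hσ N])) (exp_pos _).le (exp_le_one_iff.2
          (div_nonpos_of_nonpos_of_nonneg (by simp) (by linarith [hσ N]))))
  have hinv : Tendsto (fun N => ‖w (N + 1)‖⁻¹) atTop (𝓝 0) := by
    refine tendsto_inv_atTop_zero.comp (tendsto_atTop_mono (fun N => sqrt_le_iff.2
      ⟨norm_nonneg _, hwn (N + 1)⟩) (tendsto_sqrt_atTop.comp (Tendsto.const_mul_atTop hc0 ?_)))
    exact tendsto_natCast_atTop_atTop.comp (tendsto_add_atTop_nat 1)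
  have hlim : ∀ R : ℝ, Tendsto (fun N => ‖w (N + 1)‖⁻¹ * R) atTop (𝓝 0) := fun R => by
    simpa using hinv.mul_const R
  have hun : ∀ N, ‖(‖w (N + 1)‖⁻¹ : ℂ)‖ = ‖w (N + 1)‖⁻¹ := fun N => by simp
  refine not_isFredholm_of_singular_sequence (S := (κ : ℂ) • semi _ m t)
    (u := fun N => (‖w (N + 1)‖⁻¹ : ℂ) • w (N + 1)) ?_
        (fun N => norm_smul_inv_norm fun h0 => ?_) ?_ ?_
  · rw [← smul_sub]
    exact (isCompactOperator_vortexSemigroup_sub α m ht.le).smul (κ : ℂ)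
  · have := hwn (N + 1)
    rw [h0, norm_zero] at this
    push_cast at this
    nlinarith [mul_nonneg hc0.le (N.cast_nonneg (α := ℝ))]
  · refine squeeze_zero_norm (fun N => ?_) (hlim (κ * (sqrt (2 ^ M * 2 ^ (M - 1)) + ‖e'‖)))
    have h1 : ((κ * θ : ℝ) : ℂ) • (‖w (N + 1)‖⁻¹ : ℂ) • w (N + 1) - ((κ : ℂ) • semi _ m t)
        ((‖w (N + 1)‖⁻¹ : ℂ) • w (N + 1)) = (‖w (N + 1)‖⁻¹ : ℂ) • (κ : ℂ) •
          ((θ : ℂ) ^ (N + 1) • e N - e') := by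
      rw [← hSw N, smul_apply, map_smul, Complex.ofReal_mul]
      module
    rw [h1, norm_smul, norm_smul, hun, norm_real, norm_of_nonneg hκ.le]
    gcongr
    exact (norm_sub_le _ _).trans (by gcongr; exact heN N)
  · intro φ hφ v hv
    -- a subsequence converges almost everywhere, and the sequence tends to zero pointwise
    obtain ⟨ns, hns, hns'⟩ := (tendstoInMeasure_of_tendsto_Lp hv).exists_seq_tendsto_ae
    refine Lp.ext ((ae_weighted m).2 ?_)
    filter_upwards [ae_all_iff.2 fun N => (ae_weighted m).1 (Lp.coeFn_smul (‖w (N + 1)‖⁻¹ : ℂ)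
      (w (N + 1))), ae_all_iff.2 fun N => hwb (N + 1), (ae_weighted m).1 hns', (ae_weighted m).1
      (Lp.coeFn_zero ℂ² 2 (weightedMeasure m))] with x h1 h4 h2 h3
    rw [h3, Pi.zero_apply]
    refine tendsto_nhds_unique h2 (squeeze_zero_norm (fun N => ?_) ((hlim (1 - θ)⁻¹).comp
      (hφ.tendsto_atTop.comp hns.tendsto_atTop)))
    simp only [Function.comp_apply]
    rw [h1, Pi.smul_apply, norm_smul, hun]
    gcongr
    refine (h4 _).trans ?_
    rw [← tsum_geometric_of_lt_one hθ0.le hθ1]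
    exact (summable_geometric_of_lt_one hθ0.le hθ1).sum_le_tsum _ fun j _ => by positivity

/-! ### Derivatives of the Mehler kernel -/

lemma inner_single_right' (x : Plane) (k : Fin 2) : inner ℝ x (single k (1 : ℝ)) = x k := by
  rw [EuclideanSpace.inner_single_right]; simp

lemma hasFDerivAt_gauss_sub_smul (ha : a ≠ 0) (p y : Plane) (c : ℝ) :
    HasFDerivAt (fun y => gauss a (p - c • y)) ((gauss a (p - c • y) * (c / (2 * a))) •
      innerSL ℝ (p - c • y)) y := by
  have h1 : HasFDerivAt (fun y : Plane => p - c • y) (-(c • ContinuousLinearMap.id ℝ Plane)) y :=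
    ((hasFDerivAt_id y).const_smul c).const_sub p
  simp only [gauss, div_eq_mul_inv _ (4 * a)]
  refine (h1.norm_sq.neg.mul_const (4 * a)⁻¹).exp.const_mul (4 * π * a)⁻¹ |>.congr_fderiv ?_
  ext v
  simp
  field_simp
  ring

lemma partialDeriv_gauss_sub_smul (ha : a ≠ 0) (p y : Plane) (c : ℝ) (i : Fin 2) :
    partialDeriv i (fun y => gauss a (p - c • y)) y =
      c / (2 * a) * (p i - c * y i) * gauss a (p - c • y) := by
  rw [partialDeriv, (hasFDerivAt_gauss_sub_smul ha p y c).fderiv]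
  simp [inner_single_right']
  ring

lemma gauss_sub_smul_contDiff (a : ℝ) (p : Plane) (c : ℝ) :
    ContDiff ℝ ∞ fun y : Plane => gauss a (p - c • y) :=
  contDiff_const.mul (((by fun_prop : ContDiff ℝ ∞ fun y : Plane => p - c • y).norm_sq
    ℝ).neg.div_const _).exp

lemma hasFDerivAt_mehler (hs : 0 < s) (x y : Plane) :
    HasFDerivAt (mehler s x) ((mehler s x y * (damp s / (2 * mvar s))) •
      innerSL ℝ (x - damp s • y)) y := hasFDerivAt_gauss_sub_smul (mvar_pos hs).ne' x y _

lemma partialDeriv_mehler (hs : 0 < s) (x y : Plane) (i : Fin 2) : partialDeriv i (mehler s x) y =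
    damp s / (2 * mvar s) * (x i - damp s * y i) * mehler s x y :=
  partialDeriv_gauss_sub_smul (mvar_pos hs).ne' x y _ i

lemma partialDeriv_mul {f g : Plane → ℝ} {x : Plane} (hf : DifferentiableAt ℝ f x)
    (hg : DifferentiableAt ℝ g x) (i : Fin 2) : partialDeriv i (fun y => f y * g y) x =
      f x * partialDeriv i g x + partialDeriv i f x * g x := by
  unfold partialDeriv
  rw [fderiv_fun_mul hf hg]
  simp [mul_comm]

lemma partialDeriv_coord (i k : Fin 2) (x : Plane) :
    partialDeriv i (fun y => y k) x = if i = k then 1 else 0 := by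
  unfold partialDeriv
  have h : HasFDerivAt (fun y : Plane => y k) (proj k : Plane →L[ℝ] ℝ) x :=
    (proj k : Plane →L[ℝ] ℝ).hasFDerivAt
  rw [h.fderiv]
  simp [eq_comm]

lemma differentiableAt_mehler (hs : 0 < s) (x y : Plane) :
    DifferentiableAt ℝ (mehler s x) y := (hasFDerivAt_mehler hs x y).differentiableAt

lemma mehler_contDiff (s : ℝ) (x : Plane) : ContDiff ℝ ∞ (mehler s x) :=
  gauss_sub_smul_contDiff _ x _

lemma partialDeriv_partialDeriv_gauss_sub_smul (ha : a ≠ 0) (p y : Plane) (c : ℝ) (i : Fin 2) :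
    partialDeriv i (partialDeriv i fun y => gauss a (p - c • y)) y =
      ((c / (2 * a)) ^ 2 * (p i - c * y i) ^ 2 - c ^ 2 / (2 * a)) * gauss a (p - c • y) := by
  have h1 : HasFDerivAt (fun y : Plane => c / (2 * a) * (p i - c * y i)) _ y :=
    (((proj i : Plane →L[ℝ] ℝ).hasFDerivAt.const_mul c).const_sub (p i)).const_mul _
  have h2 : partialDeriv i (fun y : Plane => c / (2 * a) * (p i - c * y i)) y = c / (2 * a) * -c :=
      by
    refine (congrArg (· (single i 1)) h1.fderiv).trans ?_
    simp
  rw [funext fun y => partialDeriv_gauss_sub_smul ha p y c i, partialDeriv_mul h1.differentiableAt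
    (hasFDerivAt_gauss_sub_smul ha p y c).differentiableAt, partialDeriv_gauss_sub_smul ha, h2]
  field_simp
  ring

lemma partialDeriv_partialDeriv_mehler (hs : 0 < s) (x y : Plane) (i : Fin 2) :
    partialDeriv i (partialDeriv i (mehler s x)) y =
      ((damp s / (2 * mvar s)) ^ 2 * (x i - damp s * y i) ^ 2 -
        damp s ^ 2 / (2 * mvar s)) * mehler s x y :=
  partialDeriv_partialDeriv_gauss_sub_smul (mvar_pos hs).ne' x y _ i

/-- The logarithmic time derivative of the Mehler kernel. -/
def mehlerLogDeriv (s : ℝ) (x y : Plane) : ℝ :=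
  -(damp s ^ 2 / mvar s) +
    damp s ^ 2 * ‖x - damp s • y‖ ^ 2 / (4 * mvar s ^ 2) -
      damp s * ((x 0 - damp s * y 0) * y 0 + (x 1 - damp s * y 1) * y 1) / (4 * mvar s)

lemma hasDerivAt_damp (s : ℝ) : HasDerivAt damp (-(damp s / 2)) s := by
  have h : HasDerivAt (fun s : ℝ => exp (-s / 2)) (exp (-s / 2) * (-1 / 2)) s :=
    ((hasDerivAt_id s).neg.div_const 2).exp
  refine h.congr_deriv ?_
  unfold damp
  ring

lemma hasDerivAt_mvar (s : ℝ) : HasDerivAt mvar (damp s ^ 2) s := by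
  have h : HasDerivAt (fun s : ℝ => 1 - exp (-s)) (-(exp (-s) * -1)) s :=
    ((hasDerivAt_id s).neg.exp).const_sub 1
  refine h.congr_deriv ?_
  rw [damp_sq']
  simp

lemma hasDerivAt_mehler (hs : 0 < s) (x y : Plane) :
    HasDerivAt (fun s => mehler s x y) (mehlerLogDeriv s x y * mehler s x y) s := by
  have ha := (mvar_pos hs).ne'
  have hpi := pi_ne_zero
  have hA := hasDerivAt_mvar s
  have hB := hasDerivAt_damp s
  have h0 := ((hB.mul_const (y 0)).const_sub (x 0)).pow 2
  have h1 := ((hB.mul_const (y 1)).const_sub (x 1)).pow 2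
  have h2 := (((h0.add h1).neg.div (hA.const_mul 4) (by positivity)).exp)
  have h3 := ((hA.const_mul (4 * π)).inv (by positivity)).mul h2
  have e : (fun s => mehler s x y) = fun s => (4 * π * mvar s)⁻¹ *
      exp (-((x 0 - damp s * y 0) ^ 2 + (x 1 - damp s * y 1) ^ 2) / (4 * mvar s)) := by
    funext s
    simp only [mehler, gauss, plane_norm_sq, PiLp.sub_apply, PiLp.smul_apply, smul_eq_mul]
  rw [e]
  refine HasDerivAt.congr_deriv (f := fun s => (4 * π * mvar s)⁻¹ *
      exp (-((x 0 - damp s * y 0) ^ 2 + (x 1 - damp s * y 1) ^ 2) / (4 * mvar s))) h3 ?_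
  rw [congrFun e s]
  simp only [mehlerLogDeriv, plane_norm_sq, PiLp.sub_apply, PiLp.smul_apply, smul_eq_mul,
    Pi.add_apply, Pi.neg_apply, Pi.pow_apply, Pi.inv_apply, Pi.div_apply]
  field_simp
  ring

/-- The backward equation `∂ₛ k = Δ_y k - ½ y·∇_y k`. -/
lemma mehler_backward (hs : 0 < s) (x y : Plane) :
    (∑ i, partialDeriv i (partialDeriv i (mehler s x)) y) -
      (1 / 2) * ∑ i, y i * partialDeriv i (mehler s x) y = mehlerLogDeriv s x y * mehler s x y := by
  have ha := (mvar_pos hs).ne'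
  simp only [Fin.sum_univ_two, partialDeriv_partialDeriv_mehler hs, partialDeriv_mehler hs,
    mehlerLogDeriv, plane_norm_sq, PiLp.sub_apply, PiLp.smul_apply, smul_eq_mul]
  field_simp
  ring

/-- A Gaussian bound, uniform on compact time intervals and on balls. -/
lemma exists_gaussian_bound {s₁ s₂ : ℝ} (hs₁ : 0 < s₁) (r : ℝ) :
    ∃ C δ : ℝ, 0 < C ∧ 0 < δ ∧ ∀ s ∈ Set.Icc s₁ s₂, ∀ x : Plane, ‖x‖ ≤ r → ∀ y : Plane,
      (1 + ‖y‖) ^ 2 * mehler s x y ≤ C * exp (-δ * ‖y‖ ^ 2) := by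
  set b := damp s₂ with hb
  have hb0 : 0 < b := damp_pos s₂
  have ha1 := mvar_pos hs₁
  set δ := b ^ 2 / 16 with hδ
  have hδ0 : 0 < δ := by positivity
  have hpi := pi_pos
  refine ⟨(4 * π * mvar s₁)⁻¹ * exp (r ^ 2 / (4 * mvar s₁)) * (2 + 2 / δ), δ,
    by positivity, hδ0, fun s hs x hx y => ?_⟩
  have hs0 : 0 < s := hs₁.trans_le hs.1
  have ha : mvar s₁ ≤ mvar s := by unfold mvar; gcongr; exact hs.1
  have ha0 := mvar_pos hs0
  have ha' := (mvar_lt_one s).le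
  have hbs : b ≤ damp s := by unfold b damp; gcongr; exact hs.2
  have h1 : -‖x - damp s • y‖ ^ 2 / (4 * mvar s) ≤ r ^ 2 / (4 * mvar s₁) + -(2 * δ) * ‖y‖ ^ 2 := by
    have h2 : b ^ 2 * ‖y‖ ^ 2 / 2 - ‖x‖ ^ 2 ≤ ‖x - damp s • y‖ ^ 2 := by
      have h3 : b * ‖y‖ ≤ ‖x - damp s • y‖ + ‖x‖ := by
        calc b * ‖y‖ ≤ damp s * ‖y‖ := by gcongr
          _ = ‖damp s • y‖ := by rw [norm_smul, norm_of_nonneg (damp_pos s).le]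
          _ = ‖x - (x - damp s • y)‖ := by simp
          _ ≤ _ := by rw [add_comm]; exact norm_sub_le _ _
      have h4 : 0 ≤ b * ‖y‖ := by positivity
      nlinarith [sq_nonneg (‖x - damp s • y‖ - ‖x‖), norm_nonneg x, norm_nonneg (x - damp s • y)]
    have h5 : 0 ≤ b ^ 2 * ‖y‖ ^ 2 := by positivity
    calc -‖x - damp s • y‖ ^ 2 / (4 * mvar s)
        ≤ (‖x‖ ^ 2 - b ^ 2 * ‖y‖ ^ 2 / 2) / (4 * mvar s) := by gcongr; linarith
      _ = ‖x‖ ^ 2 / (4 * mvar s) - b ^ 2 * ‖y‖ ^ 2 / 8 / mvar s := by field_simp; ring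
      _ ≤ r ^ 2 / (4 * mvar s₁) - b ^ 2 * ‖y‖ ^ 2 / 8 := by
          have h6 := le_div_self (by positivity : 0 ≤ b ^ 2 * ‖y‖ ^ 2 / 8) ha0 ha'
          have h7 : ‖x‖ ^ 2 / (4 * mvar s) ≤ r ^ 2 / (4 * mvar s₁) := by gcongr
          linarith
      _ = _ := by rw [hδ]; ring
  have h6 : (1 + ‖y‖) ^ 2 ≤ (2 + 2 / δ) * exp (δ * ‖y‖ ^ 2) := by
    have h7 := add_one_le_exp (δ * ‖y‖ ^ 2)
    have h8 : (1 + ‖y‖) ^ 2 ≤ 2 + 2 * ‖y‖ ^ 2 := by nlinarith [sq_nonneg (1 - ‖y‖)]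
    have h9 : (2 + 2 / δ) * (δ * ‖y‖ ^ 2 + 1) = 2 * δ * ‖y‖ ^ 2 + 2 + 2 * ‖y‖ ^ 2 + 2 / δ := by
      field_simp; ring
    have h10 : 0 ≤ 2 * δ * ‖y‖ ^ 2 + 2 / δ := by positivity
    have h11 : (2 + 2 / δ) * (δ * ‖y‖ ^ 2 + 1) ≤ (2 + 2 / δ) * exp (δ * ‖y‖ ^ 2) := by gcongr
    linarith
  calc (1 + ‖y‖) ^ 2 * mehler s x y
      ≤ ((2 + 2 / δ) * exp (δ * ‖y‖ ^ 2)) * ((4 * π * mvar s₁)⁻¹ *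
        exp (r ^ 2 / (4 * mvar s₁) + -(2 * δ) * ‖y‖ ^ 2)) := by
        unfold mehler gauss
        gcongr
    _ = (4 * π * mvar s₁)⁻¹ * exp (r ^ 2 / (4 * mvar s₁)) * (2 + 2 / δ) *
        (exp (δ * ‖y‖ ^ 2) * exp (-(2 * δ) * ‖y‖ ^ 2)) := by
        rw [exp_add]; ring
    _ = _ := by
        rw [← exp_add]
        congr 2
        ring

/-- The logarithmic derivative grows at most quadratically. -/
lemma exists_logDeriv_bound {s₁ s₂ : ℝ} (hs₁ : 0 < s₁) {r : ℝ} (hr : 0 ≤ r) :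
    ∃ C : ℝ, 0 < C ∧ ∀ s ∈ Set.Icc s₁ s₂, ∀ x : Plane, ‖x‖ ≤ r → ∀ y : Plane,
      |mehlerLogDeriv s x y| ≤ C * (1 + ‖y‖) ^ 2 := by
  have ha1 := mvar_pos hs₁
  set a := mvar s₁ with ha
  refine ⟨1 / a + (1 + r) ^ 2 / (4 * a ^ 2) + 2 * (1 + r) / (4 * a), by positivity,
    fun s hs x hx y => ?_⟩
  have hs0 : 0 < s := hs₁.trans_le hs.1
  have has : a ≤ mvar s := by unfold a mvar; gcongr; exact hs.1
  have ha0 := mvar_pos hs0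
  have hb0 := damp_pos s
  have hb1 := damp_le_one hs0.le
  have hy0 := norm_nonneg y
  set z := x - damp s • y with hz
  have hzn : ‖z‖ ≤ (1 + r) * (1 + ‖y‖) := by
    have := norm_sub_le x (damp s • y)
    rw [norm_smul, norm_of_nonneg hb0.le] at this
    nlinarith [mul_nonneg hr hy0]
  rw [mehlerLogDeriv, ← hz, show x 0 - damp s * y 0 = z 0 from rfl,
    show x 1 - damp s * y 1 = z 1 from rfl]
  refine (abs_sub _ _).trans ((add_le_add ((abs_add_le _ _).trans (add_le_add
    (?_ : _ ≤ 1 / a * (1 + ‖y‖) ^ 2) (?_ : _ ≤ (1 + r) ^ 2 / (4 * a ^ 2) * (1 + ‖y‖) ^ 2)))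
    (?_ : _ ≤ 2 * (1 + r) / (4 * a) * (1 + ‖y‖) ^ 2)).trans (by rw [add_mul, add_mul]))
  · rw [abs_neg, abs_of_nonneg (by positivity)]
    calc damp s ^ 2 / mvar s ≤ 1 / a := by gcongr; nlinarith
      _ ≤ _ := le_mul_of_one_le_right (by positivity) (by nlinarith)
  · rw [abs_of_nonneg (by positivity)]
    calc damp s ^ 2 * ‖z‖ ^ 2 / (4 * mvar s ^ 2)
        ≤ 1 * ((1 + r) * (1 + ‖y‖)) ^ 2 / (4 * a ^ 2) := by gcongr; nlinarith
      _ = _ := by ring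
  · rw [abs_div, abs_mul, abs_of_pos hb0, abs_of_pos (by positivity : 0 < 4 * mvar s)]
    have : |z 0 * y 0 + z 1 * y 1| ≤ 2 * ((1 + r) * (1 + ‖y‖) * (1 + ‖y‖)) := by
      have h := fun i => mul_le_mul ((abs_coord_le z i).trans hzn) ((abs_coord_le y i).trans
        (le_add_of_nonneg_left zero_le_one)) (abs_nonneg _) (by positivity)
      simp only [← abs_mul] at h
      linarith [abs_add_le (z 0 * y 0) (z 1 * y 1), h 0, h 1]
    calc _ ≤ 1 * (2 * ((1 + r) * (1 + ‖y‖) * (1 + ‖y‖))) / (4 * a) := by gcongr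
      _ = _ := by ring

lemma exists_mul_mehler_bound {s₁ s₂ r K : ℝ} {p : ℝ → Plane → Plane → ℝ} (hs₁ : 0 < s₁)
    (hK : 0 ≤ K) (hp : ∀ s ∈ Set.Icc s₁ s₂, ∀ x, ‖x‖ ≤ r → ∀ y, |p s x y| ≤ K * (1 + ‖y‖) ^ 2) :
    ∃ C δ : ℝ, 0 < δ ∧ ∀ s ∈ Set.Icc s₁ s₂, ∀ x : Plane, ‖x‖ ≤ r → ∀ y : Plane,
      |p s x y * mehler s x y| ≤ C * exp (-δ * ‖y‖ ^ 2) := by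
  obtain ⟨C, δ, -, hδ, hb⟩ := exists_gaussian_bound (s₂ := s₂) hs₁ r
  refine ⟨K * C, δ, hδ, fun s hs x hx y => ?_⟩
  have := mehler_pos (hs₁.trans_le hs.1) x y
  rw [abs_mul, abs_of_pos this, mul_assoc]
  refine le_trans ?_ (mul_le_mul_of_nonneg_left (hb s hs x hx y) hK)
  rw [← mul_assoc]
  gcongr
  exact hp s hs x hx y

/-! ### The mild equation and its pointwise kernel form -/

section

/-- Functions that are integrable against every Gaussian. -/
def GaussIntegrable (w : Plane → E) : Prop := ∀ δ > 0, Integrable fun y => exp (-δ * ‖y‖ ^ 2) • w y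

lemma GaussIntegrable.aestronglyMeasurable {w : Plane → E} (hw : GaussIntegrable w) :
    AEStronglyMeasurable w := by
  have h1 : AEStronglyMeasurable (fun y : Plane => exp (‖y‖ ^ 2)) :=
    Continuous.aestronglyMeasurable (by fun_prop)
  refine (h1.smul (hw 1 one_pos).1).congr (.of_forall fun y => ?_)
  change exp (‖y‖ ^ 2) • exp (-1 * ‖y‖ ^ 2) • w y = w y
  rw [smul_smul, ← exp_add, neg_one_mul, add_neg_cancel, exp_zero, one_smul]

lemma GaussIntegrable.integrable_clm {w : Plane → E} (hw : GaussIntegrable w)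
    {k : Plane → E →L[ℂ] F} (hk : StronglyMeasurable k) {δ : ℝ} (hδ : 0 < δ)
    (hb : ∀ y, ‖k y‖ ≤ C * exp (-δ * ‖y‖ ^ 2)) : Integrable fun y => k y (w y) := by
  refine ((hw δ hδ).norm.const_mul C).mono' (((ContinuousLinearMap.apply ℂ F : E →L[ℂ] _).flip
    |>.isBoundedBilinearMap).continuous.comp_aestronglyMeasurable₂ hk.aestronglyMeasurable
    hw.aestronglyMeasurable) (.of_forall fun y => ?_)
  rw [norm_smul, norm_of_nonneg (exp_pos _).le, ← mul_assoc]
  exact (ContinuousLinearMap.le_opNorm _ _).trans (by gcongr; exact hb y)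

lemma GaussIntegrable.integrable_smul {w : Plane → E} (hw : GaussIntegrable w)
    {g : Plane → ℝ} (hg : Continuous g) {δ : ℝ} (hδ : 0 < δ)
    (hb : ∀ y, |g y| ≤ C * exp (-δ * ‖y‖ ^ 2)) : Integrable fun y => g y • w y := by
  refine ((hw δ hδ).norm.const_mul C).mono' (hg.aestronglyMeasurable.smul hw.aestronglyMeasurable)
    (.of_forall fun y => ?_)
  rw [norm_smul, norm_smul, norm_of_nonneg (exp_pos _).le, ← mul_assoc]
  gcongr
  exact hb y

lemma gaussIntegrable_Lp (w : L²(E, m)) : GaussIntegrable w := fun δ hδ => by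
  have h1 : MemLp (fun y : Plane => exp (-δ * ‖y‖ ^ 2)) 2 volume := by
    rw [memLp_two_iff_integrable_sq (Continuous.aestronglyMeasurable (by fun_prop))]
    have := GaussianFourier.integrable_cexp_neg_mul_sq_norm_add (V := Plane)
        (b := ((2 * δ : ℝ) : ℂ))
      (by simpa using hδ) 0 0
    refine this.re.congr (.of_forall fun y => ?_)
    simp only [zero_mul, add_zero]
    rw [← Complex.ofReal_pow, ← Complex.ofReal_neg, ← Complex.ofReal_mul, ← Complex.ofReal_exp,
      ← exp_nat_mul]
    simp only [RCLike.re_to_complex, Complex.ofReal_re]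
    congr 1; push_cast; ring
  refine (MemLp.integrable_mul h1 (MemLp.volume (Lp.memLp w)).norm).mono'
    (h1.1.smul (MemLp.volume (Lp.memLp w)).1) (.of_forall fun y => ?_)
  rw [norm_smul, norm_of_nonneg (exp_pos _).le]
  rfl

lemma continuous_mehler_right (s : ℝ) (x : Plane) : Continuous (mehler s x) :=
  (mehler_contDiff s x).continuous

/-- Continuous kernels with Gaussian decay in the second variable, uniformly for the first variable
in balls. -/
def GaussKernel (κ : Plane → Plane → ℝ) : Prop := Continuous (uncurry κ) ∧
  ∀ r, ∃ C δ, 0 < δ ∧ ∀ x, ‖x‖ ≤ r → ∀ y, |κ x y| ≤ C * exp (-δ * ‖y‖ ^ 2)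

lemma gaussKernel_mul_mehler (hs : 0 < s) {p : Plane → Plane → ℝ} (hp : Continuous (uncurry p))
    (h : ∀ r ≥ 0, ∃ K ≥ 0, ∀ x, ‖x‖ ≤ r → ∀ y, |p x y| ≤ K * (1 + ‖y‖) ^ 2) :
    GaussKernel fun x y => p x y * mehler s x y := by
  refine ⟨hp.mul (mehler_continuous s), fun r => ?_⟩
  obtain ⟨K, hK, hb⟩ := h (max r 0) (le_max_right _ _)
  obtain ⟨C, δ, hδ, hb⟩ := exists_mul_mehler_bound (p := fun _ => p) (s₂ := s) hs hK fun _ _ => hb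
  exact ⟨C, δ, hδ, fun x hx => hb s ⟨le_rfl, le_rfl⟩ x (hx.trans (le_max_left _ _))⟩

lemma gaussKernel_mehler (hs : 0 < s) : GaussKernel (mehler s) := by
  simpa using gaussKernel_mul_mehler hs (p := fun _ _ => 1) continuous_const fun r _ =>
    ⟨1, zero_le_one, fun x _ y => by rw [abs_one]; nlinarith [norm_nonneg y]⟩

lemma gaussKernel_logDeriv (hs : 0 < s) :
    GaussKernel fun x y => mehlerLogDeriv s x y * mehler s x y := by
  refine gaussKernel_mul_mehler hs (by unfold mehlerLogDeriv; fun_prop) fun r hr => ?_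
  obtain ⟨K, hK, hb⟩ := exists_logDeriv_bound (s₂ := s) hs hr
  exact ⟨K, hK.le, hb s ⟨le_rfl, le_rfl⟩⟩

/-- The derivative of the Mehler kernel along `y^⊥` in its second variable. -/
def crossKer (s : ℝ) (x y : Plane) : ℝ := damp s / (2 * mvar s) * cross x y * mehler s x y

lemma gaussKernel_crossKer (hs : 0 < s) : GaussKernel (crossKer s) := by
  refine gaussKernel_mul_mehler hs (continuous_const.mul cross_continuous) fun r hr => ?_
  have ha := mvar_pos hs
  have hf := damp_pos s
  refine ⟨damp s / (2 * mvar s) * r, by positivity, fun x hx y => ?_⟩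
  rw [abs_mul, abs_of_pos (by positivity), mul_assoc]
  gcongr
  exact (abs_cross_le x y).trans (by gcongr; nlinarith [norm_nonneg y])

lemma driftKer_apply (h : Plane → ℝ) (A : Plane → E →L[ℂ] E) (s : ℝ) (x y : Plane) (v : E) :
    driftKer h A s x y v = crossKer s x y • h y • v + mehler s x y • A y v := by
  simp only [driftKer, crossKer, smul_apply, add_apply, idL_apply, smul_add, smul_smul,
    ← Complex.coe_smul]
  congr 2
  push_cast
  ring

lemma GaussKernel.continuous_right {κ : Plane → Plane → ℝ} (hκ : GaussKernel κ) (x : Plane) :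
    Continuous (κ x) := hκ.1.comp (by fun_prop : Continuous fun y : Plane => (x, y))

lemma GaussIntegrable.integrable_kernel {w : Plane → E} (hw : GaussIntegrable w)
    {κ : Plane → Plane → ℝ} (hκ : GaussKernel κ) (x : Plane) : Integrable fun y => κ x y • w y := by
  obtain ⟨C, δ, hδ, hb⟩ := hκ.2 ‖x‖
  exact hw.integrable_smul (hκ.continuous_right x) hδ (hb x le_rfl)

lemma GaussIntegrable.integrable_mehler {g : Plane → E} (hg : GaussIntegrable g) (hs : 0 < s)
    (x : Plane) : Integrable fun y => mehler s x y • g y :=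
  hg.integrable_kernel (gaussKernel_mehler hs) x

lemma GaussIntegrable.smul {w : Plane → E} (hw : GaussIntegrable w) {g : Plane → ℝ}
    (hg : Continuous g) (hb : ∀ y, |g y| ≤ C) : GaussIntegrable fun y => g y • w y := fun δ hδ => by
  refine (hw.integrable_smul (g := fun y => exp (-δ * ‖y‖ ^ 2) * g y) (by fun_prop) hδ (C := C)
    fun y => ?_).congr (.of_forall fun y => mul_smul _ _ _)
  rw [abs_mul, abs_of_pos (exp_pos _), mul_comm]
  gcongr
  exact hb y

lemma hasDerivAt_integral_mehler {w : Plane → E} (hw : GaussIntegrable w) (hs : 0 < s)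
    (x : Plane) : HasDerivAt (fun s => ∫ y, mehler s x y • w y)
      (∫ y, (mehlerLogDeriv s x y * mehler s x y) • w y) s := by
  obtain ⟨C', hC', hb'⟩ := exists_logDeriv_bound (s₂ := 2 * s) (half_pos hs) (norm_nonneg x)
  obtain ⟨C, δ, hδ, hb⟩ := exists_mul_mehler_bound (half_pos hs) hC'.le hb'
  refine (hasDerivAt_integral_of_dominated_loc_of_deriv_le (μ := volume)
    (F' := fun r y => (mehlerLogDeriv r x y * mehler r x y) • w y)
    (bound := fun y => C * ‖exp (-δ * ‖y‖ ^ 2) • w y‖)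
    (Ioo_mem_nhds (by linarith : s / 2 < s) (by linarith : s < 2 * s))
    (.of_forall fun r => (continuous_mehler_right r x).aestronglyMeasurable.smul
      hw.aestronglyMeasurable) (hw.integrable_mehler hs x)
    (hw.integrable_kernel (gaussKernel_logDeriv hs) x).1 (.of_forall fun y r hr => ?_)
    ((hw δ hδ).norm.const_mul _) (.of_forall fun y r hr => ?_)).2
  · rw [norm_smul, norm_smul, norm_of_nonneg (exp_pos _).le, ← mul_assoc]
    gcongr
    exact hb r ⟨hr.1.le, hr.2.le⟩ x le_rfl y
  · exact (hasDerivAt_mehler ((half_pos hs).trans hr.1) x y).smul_const (w y)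

lemma exists_functionalBound (m : ℝ≥0∞) {k : Plane → E →L[ℂ] F} (hk : StronglyMeasurable k)
    {δ : ℝ} (hδ : 0 < δ) (hb : ∀ y, ‖k y‖ ≤ C * exp (-δ * ‖y‖ ^ 2)) :
    ∃ C', FunctionalBound m k C' := by
  have h1 : ∫⁻ y, ‖k y‖ₑ ^ 2 / wt m y < ⊤ := by
    have h2 : ∫⁻ y : Plane, ofReal (C ^ 2 * exp (-(2 * δ) * ‖y‖ ^ 2)) < ⊤ := by
      have := GaussianFourier.integrable_cexp_neg_mul_sq_norm_add (V := Plane)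
        (b := ((2 * δ : ℝ) : ℂ)) (by simpa using hδ) 0 0
      have h3 : Integrable fun y : Plane => C ^ 2 * exp (-(2 * δ) * ‖y‖ ^ 2) := by
        refine (this.re.const_mul (C ^ 2)).congr (.of_forall fun y => ?_)
        simp only [zero_mul, add_zero]
        rw [← Complex.ofReal_pow, ← Complex.ofReal_neg, ← Complex.ofReal_mul, ← Complex.ofReal_exp]
        simp only [RCLike.re_to_complex, Complex.ofReal_re]
      exact h3.lintegral_lt_top
    refine lt_of_le_of_lt (lintegral_mono fun y => ?_) h2
    refine (ENNReal.div_le_of_le_mul ?_)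
    refine le_trans ?_ (le_mul_of_one_le_right' (one_le_wt m y))
    rw [← ofReal_norm, ← ofReal_pow (norm_nonneg _)]
    refine ofReal_le_ofReal ?_
    calc ‖k y‖ ^ 2 ≤ (C * exp (-δ * ‖y‖ ^ 2)) ^ 2 := by gcongr; exact hb y
      _ = _ := by rw [mul_pow, ← exp_nat_mul]; congr 2; push_cast; ring
  refine ⟨sqrt (∫⁻ y, ‖k y‖ₑ ^ 2 / wt m y).toReal, hk, sqrt_nonneg _, ?_⟩
  rw [← ofReal_pow (sqrt_nonneg _), sq_sqrt ENNReal.toReal_nonneg, ENNReal.ofReal_toReal h1.ne]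

lemma mehler_le_gaussian (hs : 0 < s) (x : Plane) : ∃ C δ : ℝ, 0 < δ ∧ ∀ y : Plane,
    mehler s x y ≤ C * exp (-δ * ‖y‖ ^ 2) := by
  obtain ⟨C, δ, hδ, hb⟩ := (gaussKernel_mehler hs).2 ‖x‖
  exact ⟨C, δ, hδ, fun y => (le_abs_self _).trans (hb x le_rfl y)⟩

lemma stronglyMeasurable_slice {κ : Plane → Plane → E →L[ℂ] F}
    (hκ : StronglyMeasurable (uncurry κ)) (x : Plane) : StronglyMeasurable (κ x) :=
  hκ.comp_measurable (g := fun y => (x, y)) measurable_prodMk_left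

lemma exists_functionalBound_mehler (m : ℝ≥0∞) (hs : 0 < s) (x : Plane) :
    ∃ C, FunctionalBound m (mehlerKer E s x) C := by
  obtain ⟨C, δ, hδ, hb⟩ := mehler_le_gaussian hs x
  have hm : StronglyMeasurable fun y => mehlerKer E s x y :=
    stronglyMeasurable_slice (mehlerKer_meas s) x
  refine exists_functionalBound m hm hδ (C := C) fun y => (norm_mehlerKer_le hs x y).trans ?_
  rw [one_mul]
  exact hb y

namespace DriftCoeff

variable {h : Plane → ℝ} {A : Plane → E →L[ℂ] E} {c : ℝ} (D : DriftCoeff h A c)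
include D

/-- Evaluation of the mollification `e^{sL} f` at a point is a bounded functional, and it turns the
semigroup and the drift operators into their kernels at a later time. -/
lemma exists_pointEval [CompleteSpace E] (m : ℝ≥0∞) (hs : 0 < s) (x : Plane) :
    ∃ l : L²(E, m) →L[ℂ] E, (∀ f, l f = ∫ y, mehler s x y • f y) ∧
      (∀ t, 0 ≤ t → ∀ f, l (semi E m t f) = ∫ y, mehler (s + t) x y • f y) ∧
      ∀ t, 0 < t → ∀ f, l (D.drift m t f) = ∫ y, driftKer h A (s + t) x y (f y) := by
  obtain ⟨C, hC⟩ := exists_functionalBound_mehler (E := E) m hs x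
  have h0 : ∀ f, hC.functional f = ∫ y, mehler s x y • f y := fun f => rfl
  refine ⟨hC.functional, h0, fun t ht f => ?_, fun t ht f => ?_⟩
  · rcases ht.eq_or_lt with rfl | ht
    · rw [semi_of_nonpos m le_rfl, idL_apply, add_zero, h0]
    · rw [semi_of_pos m ht]
      exact hC.functional_comp (kernelBound_mehler m ht) (integral_mehlerKer_apply hs ht x) f
  · rw [D.drift_of_pos m ht]
    exact hC.functional_comp (D.kernelBound m ht) (integral_mehlerKer_driftKer hs ht x) f

lemma continuousOn_integral_driftKer [CompleteSpace E] (w : L²(E, m))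
    (x : Plane) : ContinuousOn (fun s => ∫ y, driftKer h A s x y (w y)) (Set.Ioi 0) :=
        fun s hs => by
  have hs : 0 < s := hs
  refine ContinuousAt.continuousWithinAt ?_
  have h1 := (hasDerivAt_integral_mehler (gaussIntegrable_Lp (D.drift m (s / 2) w))
    (half_pos hs) x).continuousAt
  have h2 : ContinuousAt (fun r => ∫ y, mehler (r - s / 2) x y • (D.drift m (s / 2) w) y) s := by
    refine ContinuousAt.comp (f := fun r => r - s / 2) (x := s)
      (g := fun r => ∫ y, mehler r x y • (D.drift m (s / 2) w) y) ?_ (by fun_prop)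
    simpa [sub_half] using h1
  refine h2.congr ?_
  filter_upwards [Ioi_mem_nhds (half_lt_self hs)] with r hr
  obtain ⟨l, h3, -, h4⟩ := D.exists_pointEval m (sub_pos.2 (mem_Ioi.1 hr)) x
  rw [← h3, h4 _ (half_pos hs), sub_add_cancel]

end DriftCoeff

/-- The equation `L w + B w = f` tested against the Mehler kernels. -/
def KernelEq (h : Plane → ℝ) (A : Plane → E →L[ℂ] E) (w f : Plane → E) : Prop :=
  ∀ s > 0, ∀ x, ∫ y, (mehlerLogDeriv s x y * mehler s x y) • w y =
    (∫ y, mehler s x y • f y) - ∫ y, driftKer h A s x y (w y)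

/-- The mild equation is equivalent to its kernel form: the mollifications separate points. -/
lemma DriftCoeff.kernelEq_iff [CompleteSpace E] {h : Plane → ℝ} {A : Plane → E →L[ℂ] E}
    (D : DriftCoeff h A c) (w f : L²(E, m)) :
    KernelEq h A w f ↔ ∀ t, 0 ≤ t → semi E m t w + volterra (D.drift m) (fun _ => w) t =
      w + ∫ s in (0 : ℝ)..t, semi E m s f := by
  have hP := fun x (s : ℝ) (hs : 0 < s) => hasDerivAt_integral_mehler (gaussIntegrable_Lp w) hs x
  have hQ : ∀ x, ContinuousOn (fun s => ∫ y, mehler s x y • f y) (Set.Ioi 0) := fun x s hs =>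
    (hasDerivAt_integral_mehler (gaussIntegrable_Lp f) hs x).continuousAt.continuousWithinAt
  have hR := D.continuousOn_integral_driftKer w
  have hQR : ∀ x, ContinuousOn (fun s => (∫ y, mehler s x y • f y) -
    ∫ y, driftKer h A s x y (w y)) (Set.Ioi 0) := fun x => (hQ x).sub (hR x)
  -- the mild equation seen through a point evaluation
  have key : ∀ s > 0, ∀ x, ∀ t, 0 ≤ t → ∀ l : L²(E, m) →L[ℂ] E,
      (∀ t, 0 ≤ t → ∀ f, l (semi E m t f) = ∫ y, mehler (s + t) x y • f y) →
      (∀ t, 0 < t → ∀ f, l (D.drift m t f) = ∫ y, driftKer h A (s + t) x y (f y)) →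
      l (semi E m t w + volterra (D.drift m) (fun _ => w) t -
          (w + ∫ s in (0 : ℝ)..t, semi E m s f)) =
        ((∫ y, mehler (s + t) x y • w y) - ∫ y, mehler s x y • w y) -
        ∫ r in s..(s + t), ((∫ y, mehler r x y • f y) - ∫ y, driftKer h A r x y (w y)) :=
            fun s hs x t ht l h1 h2 => by
    have hsub : ∀ r ∈ Set.uIcc s (s + t), r ∈ Set.Ioi (0 : ℝ) := fun r hr => by
      rw [uIcc_of_le (by linarith)] at hr
      exact hs.trans_le hr.1
    have hiQ : IntervalIntegrable (fun s => ∫ y, mehler s x y • f y) volume s (s + t) :=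
      ((hQ x).mono hsub).intervalIntegrable
    have hiR : IntervalIntegrable (fun s => ∫ y, driftKer h A s x y (w y)) volume s (s + t) :=
      ((hR x).mono hsub).intervalIntegrable
    have e1 : l (∫ s in (0 : ℝ)..t, semi E m s f) = ∫ r in s..(s + t), ∫ y, mehler r x y • f y := by
      rw [← l.intervalIntegral_comp_comm ((semi_continuous m f).intervalIntegrable _ _)]
      have := intervalIntegral.integral_comp_add_left (a := 0) (b := t)
        (fun r => ∫ y, mehler r x y • f y) s
      rw [add_zero] at this
      rw [← this]
      refine intervalIntegral.integral_congr fun r hr => h1 r ?_ f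
      rw [uIcc_of_le ht] at hr
      exact hr.1
    have e2 : l (volterra (D.drift m) (fun _ => w) t) =
        ∫ r in s..(s + t), ∫ y, driftKer h A r x y (w y) := by
      change l (∫ s in (0 : ℝ)..t, D.drift m s w) = _
      rw [← l.intervalIntegral_comp_comm
        ((D.perturbationData m).intervalIntegrable_K
            (u := fun _ => w) continuous_const t le_rfl ht)]
      have := intervalIntegral.integral_comp_add_left (a := 0) (b := t)
        (fun r => ∫ y, driftKer h A r x y (w y)) s
      rw [add_zero] at this
      rw [← this]
      refine intervalIntegral.integral_congr_ae (.of_forall fun r hr => h2 r ?_ w)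
      rw [uIoc_of_le ht] at hr
      exact hr.1
    have e0 := h1 0 le_rfl w
    rw [semi_of_nonpos m le_rfl, add_zero] at e0
    rw [map_sub, map_add, map_add, h1 t ht, e1, e2, intervalIntegral.integral_sub hiQ hiR]
    change _ - (l (idL _ w) + _) = _
    rw [e0]
    abel
  constructor
  · intro hK t ht
    rw [← sub_eq_zero]
    set d := semi E m t w + volterra (D.drift m) (fun _ => w) t -
      (w + ∫ s in (0 : ℝ)..t, semi E m s f) with hd
    have h0 : ∀ s > 0, semi E m s d = 0 := fun s hs => by
      rw [Lp.eq_zero_iff_ae_eq_zero]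
      refine (ae_weighted m).2 ?_
      filter_upwards [semi_coeFn hs d] with x hx
      obtain ⟨l, h3, h1, h2⟩ := D.exists_pointEval m hs x
      rw [hx, kernelFun_mehlerKer, ← h3, hd, key s hs x t ht l h1 h2]
      refine sub_eq_zero.2 (Eq.symm ?_)
      refine intervalIntegral.integral_eq_sub_of_hasDerivAt
        (f := fun s => ∫ y, mehler s x y • w y) (fun r hr => ?_) ?_
      · rw [uIcc_of_le (by linarith)] at hr
        have hr0 := hs.trans_le hr.1
        rw [← hK r hr0 x]
        exact hP x r hr0
      · refine ((hQR x).mono fun r hr => ?_).intervalIntegrable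
        rw [uIcc_of_le (by linarith)] at hr
        exact hs.trans_le hr.1
    refine tendsto_nhds_unique (tendsto_semi m d) (tendsto_const_nhds.congr' ?_)
    filter_upwards [self_mem_nhdsWithin] with s hs
    exact (h0 s hs).symm
  · intro hM s hs x
    obtain ⟨l, -, h1, h2⟩ := D.exists_pointEval m (half_pos hs) x
    have h3 : ∀ t, 0 ≤ t → ∫ y, mehler (s / 2 + t) x y • w y = (∫ y, mehler (s / 2) x y • w y) +
        ∫ r in (s / 2)..(s / 2 + t), ((∫ y, mehler r x y • f y) - ∫ y, driftKer h A r x y (w y)) :=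
            fun t ht => by
      have := key (s / 2) (half_pos hs) x t ht l h1 h2
      rw [hM t ht, sub_self, map_zero, eq_comm, sub_eq_zero] at this
      rw [← this]; abel
    have h4 : HasDerivAt (fun r => ∫ y, mehler r x y • w y)
        ((∫ y, mehler s x y • f y) - ∫ y, driftKer h A s x y (w y)) s := by
      have h5 : HasDerivAt (fun u => ∫ r in (s / 2)..u, ((∫ y, mehler r x y • f y) -
          ∫ y, driftKer h A r x y (w y))) _ s :=
        intervalIntegral.integral_hasDerivAt_right
          (((hQR x).mono fun r hr => by
            rw [uIcc_of_le (by linarith)] at hr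
            exact (half_pos hs).trans_le hr.1).intervalIntegrable)
          ((hQR x).stronglyMeasurableAtFilter isOpen_Ioi s hs)
          ((hQR x).continuousAt (Ioi_mem_nhds hs))
      refine (h5.const_add (∫ y, mehler (s / 2) x y • w y)).congr_of_eventuallyEq ?_
      filter_upwards [Ioi_mem_nhds (half_lt_self hs)] with r hr
      have := h3 (r - s / 2) (sub_nonneg.2 (le_of_lt hr))
      rwa [add_sub_cancel] at this
    exact (hP x s hs).unique h4

end

/-! ### The equation in the sense of distributions -/

lemma contDiff_partialDeriv {f : Plane → ℝ} (hf : ContDiff ℝ ∞ f) (i : Fin 2) :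
    ContDiff ℝ ∞ (partialDeriv i f) := by
  unfold partialDeriv
  exact (hf.fderiv_right (m := ∞) (by simp)).clm_apply contDiff_const

lemma hasCompactSupport_partialDeriv {f : Plane → ℝ} (hf : HasCompactSupport f) (i : Fin 2) :
    HasCompactSupport (partialDeriv i f) := by
  unfold partialDeriv
  exact (hf.fderiv ℝ).comp_left (g := fun L : Plane →L[ℝ] ℝ => L (single i 1)) rfl

lemma partialDeriv_add {f g : Plane → ℝ} {x : Plane} (hf : DifferentiableAt ℝ f x)
    (hg : DifferentiableAt ℝ g x) (i : Fin 2) : partialDeriv i (fun y => f y + g y) x =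
      partialDeriv i f x + partialDeriv i g x := by
  unfold partialDeriv
  rw [fderiv_fun_add hf hg]
  rfl

lemma partialDeriv_comp_smul {f : Plane → ℝ} (hf : ContDiff ℝ ∞ f) (c : ℝ) (i : Fin 2) :
    partialDeriv i (fun y => f (c • y)) = fun y => c * partialDeriv i f (c • y) :=
        funext fun x => by
  have h := ((hf.differentiable (by simp) (c • x)).hasFDerivAt.comp x
    ((hasFDerivAt_id x).const_smul c)).fderiv
  refine (congrArg (· (single i 1)) h).trans ?_
  simp [partialDeriv]

/-- The second-order part `Δ φ - ½ y·∇φ + α U·∇φ` of the transposed operator. -/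
def transposeOp (α : ℝ) (φ : Plane → ℝ) (y : Plane) : ℝ :=
  (∑ i, partialDeriv i (partialDeriv i φ) y) - (1 / 2) * (∑ i, y i * partialDeriv i φ y) +
    α * ∑ i, velocity i y * partialDeriv i φ y

lemma transposeScalarPart_eq (μ α : ℝ) {φ : Plane → ℝ} (hφ : ContDiff ℝ ∞ φ) (x : Plane) :
    transposeScalarPart μ α φ x = transposeOp α φ x - (1 + strainConst μ) * φ x := by
  have hd : DifferentiableAt ℝ φ x := hφ.differentiable (by simp) x
  have hv : ∀ k, DifferentiableAt ℝ (velocity k) x := fun k =>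
    (velocity_contDiff k).differentiable (by simp) x
  have hc : ∀ k : Fin 2, DifferentiableAt ℝ (fun y : Plane => y k) x := fun k => by fun_prop
  unfold transposeScalarPart transposeOp
  simp only [Fin.sum_univ_two, partialDeriv_mul (hv _) hd, partialDeriv_mul (hc _) hd,
    partialDeriv_coord, partialDeriv_velocity]
  simp
  ring

lemma transposeOp_mul (α : ℝ) {χ g : Plane → ℝ} (hχ : ContDiff ℝ ∞ χ) (hg : ContDiff ℝ ∞ g)
    (y : Plane) : transposeOp α (fun y => χ y * g y) y = χ y * transposeOp α g y +
      g y * transposeOp α χ y + 2 * ∑ i, partialDeriv i χ y * partialDeriv i g y := by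
  have d : ∀ {f : Plane → ℝ}, ContDiff ℝ ∞ f → ∀ y, DifferentiableAt ℝ f y := fun hf y =>
    hf.differentiable (by simp) y
  have e : ∀ i, partialDeriv i (fun y => χ y * g y) = fun y =>
      χ y * partialDeriv i g y + partialDeriv i χ y * g y := fun i => funext fun y =>
    partialDeriv_mul (d hχ y) (d hg y) i
  have hχ' := fun i => contDiff_partialDeriv hχ i
  have hg' := fun i => contDiff_partialDeriv hg i
  unfold transposeOp
  simp only [e]
  simp only [Fin.sum_univ_two, partialDeriv_add (d (hχ.mul (hg' _)) y) (d ((hχ' _).mul hg) y),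
    partialDeriv_mul (d hχ y) (d (hg' _) y), partialDeriv_mul (d (hχ' _) y) (d hg y)]
  ring

lemma transposeOp_mehler (α : ℝ) (hs : 0 < s) (x y : Plane) :
    transposeOp α (mehler s x) y = (mehlerLogDeriv s x y + damp s / (2 * mvar s) *
      (α * profile (‖y‖ ^ 2) * cross x y)) * mehler s x y := by
  unfold transposeOp
  rw [mehler_backward hs]
  simp only [Fin.sum_univ_two, partialDeriv_mehler hs, velocity_eq, cross]
  simp
  ring

lemma partialDeriv_of_eventuallyEq {f : Plane → ℝ} {y : Plane} (h : f =ᶠ[𝓝 y] fun _ => c)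
    (i : Fin 2) : partialDeriv i f =ᶠ[𝓝 y] fun _ => 0 := by
  filter_upwards [h.eventuallyEq_nhds] with z hz
  unfold partialDeriv
  rw [hz.fderiv_eq]
  simp

/-- Smooth cutoff functions with uniformly bounded derivatives. -/
lemma exists_cutoff : ∃ (χ : ℕ → Plane → ℝ) (C : ℝ), 0 ≤ C ∧ ∀ n, ContDiff ℝ ∞ (χ n) ∧
    HasCompactSupport (χ n) ∧ (∀ y, |χ n y| ≤ 1) ∧ (∀ y i, |partialDeriv i (χ n) y| ≤ C) ∧
    (∀ y i, |partialDeriv i (partialDeriv i (χ n)) y| ≤ C) ∧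
    ∀ y, ‖y‖ < n → (χ n) =ᶠ[𝓝 y] fun _ => 1 := by
  let f : ContDiffBump (0 : Plane) := ⟨1, 2, one_pos, one_lt_two⟩
  have hf : ContDiff ℝ ∞ f := f.contDiff
  have hf1 := fun i => contDiff_partialDeriv hf i
  have hc1 := fun i => hasCompactSupport_partialDeriv f.hasCompactSupport i
  choose C₁ hb₁ using fun i => (hf1 i).continuous.bounded_above_of_compact_support (hc1 i)
  choose C₂ hb₂ using fun i => (contDiff_partialDeriv (hf1 i)
    i).continuous.bounded_above_of_compact_support (hasCompactSupport_partialDeriv (hc1 i) i)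
  have hp₁ := fun i => (norm_nonneg _).trans (hb₁ i 0)
  have hp₂ := fun i => (norm_nonneg _).trans (hb₂ i 0)
  have hC := fun i => Finset.single_le_sum (f := fun i => C₁ i + C₂ i)
    (fun i _ => add_nonneg (hp₁ i) (hp₂ i)) (Finset.mem_univ i)
  have hc0 : ∀ n : ℕ, (0 : ℝ) < ((n : ℝ) + 1)⁻¹ := fun n => by positivity
  have hc1 : ∀ n : ℕ, ((n : ℝ) + 1)⁻¹ ≤ 1 := fun n => inv_le_one_of_one_le₀ (by simp)
  have hm : ∀ (n : ℕ) {a b : ℝ}, |a| ≤ b → |((n : ℝ) + 1)⁻¹ * a| ≤ b := fun n a b h => by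
    rw [abs_mul, abs_of_pos (hc0 n)]
    exact (mul_le_of_le_one_left (abs_nonneg _) (hc1 n)).trans h
  refine ⟨fun n y => f (((n : ℝ) + 1)⁻¹ • y), ∑ i, (C₁ i + C₂ i), Finset.sum_nonneg fun i _ =>
    add_nonneg (hp₁ i) (hp₂ i), fun n => ⟨hf.comp (contDiff_id.const_smul _),
      f.hasCompactSupport.comp_homeomorph (Homeomorph.smulOfNeZero _ (hc0 n).ne'), fun y => ?_,
      fun y i => ?_, fun y i => ?_, fun y hy => ?_⟩⟩
  · rw [abs_of_nonneg f.nonneg]; exact f.le_one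
  · rw [partialDeriv_comp_smul hf]
    exact hm n ((hb₁ i _).trans (by linarith [hC i, hp₂ i]))
  · rw [partialDeriv_comp_smul hf, partialDeriv_mul (g := fun y => partialDeriv i f
      (((n : ℝ) + 1)⁻¹ • y)) (differentiableAt_const _)
          (((hf1 i).comp (contDiff_id.const_smul _)).differentiable (by simp) y),
      partialDeriv_comp_smul (hf1 i), show partialDeriv i (fun _ => ((n : ℝ) + 1)⁻¹) y = 0 by
        simp [partialDeriv], zero_mul, add_zero]
    exact hm n (hm n ((hb₂ i _).trans (by linarith [hC i, hp₁ i])))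
  · filter_upwards [(continuous_norm.tendsto y).eventually (gt_mem_nhds hy)] with z hz
    refine f.one_of_mem_closedBall ?_
    rw [mem_closedBall_zero_iff, norm_smul, norm_of_nonneg (hc0 n).le]
    change _ ≤ (1 : ℝ)
    rw [inv_mul_le_iff₀ (by positivity)]
    linarith

section

lemma GaussIntegrable.clm_apply_of_growth {w : Plane → E} (hw : GaussIntegrable w)
    {A : Plane → E →L[ℂ] F} (hA : StronglyMeasurable A) (hb : ∀ y, ‖A y‖ ≤ C * (1 + ‖y‖ ^ 2)) :
        GaussIntegrable fun y => A y (w y) := fun δ hδ => by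
  have h1 : StronglyMeasurable fun y : Plane => ((exp (-δ * ‖y‖ ^ 2) : ℝ) : ℂ) :=
    Continuous.stronglyMeasurable (by fun_prop)
  have hC : 0 ≤ C := by simpa using (norm_nonneg _).trans (hb 0)
  refine hw.integrable_clm (k := fun y => ((exp (-δ * ‖y‖ ^ 2) : ℝ) : ℂ) • A y)
    (C := C * (1 + 2 / δ)) (h1.smul hA) (half_pos hδ) fun y => ?_
  rw [norm_smul, norm_real, norm_of_nonneg (exp_pos _).le]
  have h2 : 1 + ‖y‖ ^ 2 ≤ (1 + 2 / δ) * exp (δ / 2 * ‖y‖ ^ 2) := by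
    refine le_trans ?_ (mul_le_mul_of_nonneg_left (add_one_le_exp _) (by positivity))
    have : (1 + 2 / δ) * (δ / 2 * ‖y‖ ^ 2 + 1) = 1 + ‖y‖ ^ 2 + (δ / 2 * ‖y‖ ^ 2 + 2 / δ) := by
      field_simp; ring
    rw [this]
    exact le_add_of_nonneg_right (by positivity)
  calc _ ≤ exp (-δ * ‖y‖ ^ 2) * (C * ((1 + 2 / δ) * exp (δ / 2 * ‖y‖ ^ 2))) := by
        gcongr; exact (hb y).trans (by gcongr)
    _ = C * (1 + 2 / δ) * (exp (-δ * ‖y‖ ^ 2) * exp (δ / 2 * ‖y‖ ^ 2)) := by ring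
    _ = _ := by rw [← exp_add]; congr 2; ring

lemma GaussIntegrable.clm_apply {w : Plane → E} (hw : GaussIntegrable w) {A : Plane → E →L[ℂ] F}
    (hA : StronglyMeasurable A) (hb : ∀ y, ‖A y‖ ≤ C) : GaussIntegrable fun y => A y (w y) :=
  hw.clm_apply_of_growth hA fun y => (hb y).trans (le_mul_of_one_le_right
    ((norm_nonneg _).trans (hb y)) (le_add_of_nonneg_right (sq_nonneg _)))

lemma GaussIntegrable.integrable_of_hasCompactSupport {w : Plane → E} (hw : GaussIntegrable w)
    {g : Plane → ℝ} (hg : Continuous g) (hgc : HasCompactSupport g) :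
    Integrable fun y => g y • w y := by
  obtain ⟨C, hC⟩ := (show Continuous fun y : Plane => exp (‖y‖ ^ 2) * g y by
    fun_prop).bounded_above_of_compact_support hgc.mul_left
  refine hw.integrable_smul hg one_pos (C := C) fun y => ?_
  have h1 := hC y
  rw [norm_mul, norm_of_nonneg (exp_pos _).le, norm_eq_abs] at h1
  rw [neg_one_mul, exp_neg, ← div_eq_mul_inv, le_div_iff₀ (exp_pos _), mul_comm]
  exact h1

end

lemma transposeOp_continuous (α : ℝ) {φ : Plane → ℝ} (hφ : ContDiff ℝ ∞ φ) :
    Continuous (transposeOp α φ) := by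
  have h1 := fun i => (contDiff_partialDeriv hφ i).continuous
  have h2 := fun i => (contDiff_partialDeriv (contDiff_partialDeriv hφ i) i).continuous
  have h3 := fun i => (velocity_contDiff i).continuous
  unfold transposeOp
  fun_prop

lemma hasCompactSupport_transposeOp (α : ℝ) {φ : Plane → ℝ} (hφ : HasCompactSupport φ) :
    HasCompactSupport (transposeOp α φ) := by
  refine HasCompactSupport.intro hφ fun x hx => ?_
  have h0 : φ =ᶠ[𝓝 x] fun _ => 0 := notMem_tsupport_iff_eventuallyEq.1 hx
  have h1 := fun i => partialDeriv_of_eventuallyEq h0 i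
  have h2 := fun i => (partialDeriv_of_eventuallyEq (h1 i) i).eq_of_nhds
  have h3 := fun i => (h1 i).eq_of_nhds
  simp [transposeOp, h2, h3]

lemma exists_norm_stretch_le (α : ℝ) : ∀ y, ‖stretch α y‖ ≤ 24 * |α| :=
  (decayingDrift α).driftCoeff.bound_A

/-- The distributional equation, written for vector-valued integrals and with the scalar multiple
of `w` moved to the right-hand side. -/
lemma linearizedGraph_iff (μ α : ℝ) (m : ℝ≥0∞) (w f : L2sq m) : linearizedGraph μ α m w f ↔
    ∀ φ : Plane → ℝ, ContDiff ℝ ∞ φ → HasCompactSupport φ →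
      ∫ x, φ x • (f + ((1 + strainConst μ : ℝ) : ℂ) • w : L2sq m) x =
        (∫ x, transposeOp α φ x • w x) + ∫ x, φ x • stretch α x (w x) := by
  refine forall_congr' fun φ => forall_congr' fun hφ => forall_congr' fun hc => ?_
  have gw := gaussIntegrable_Lp w
  have gA := gw.clm_apply (stretch_continuous α).stronglyMeasurable (exists_norm_stretch_le α)
  have i1 := (gaussIntegrable_Lp f).integrable_of_hasCompactSupport hφ.continuous hc
  have i2 : Integrable fun x => (1 + strainConst μ) • φ x • w x :=
    (gw.integrable_of_hasCompactSupport hφ.continuous hc).smul (1 + strainConst μ)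
  have i3 := gw.integrable_of_hasCompactSupport (transposeOp_continuous α hφ)
    (hasCompactSupport_transposeOp α hc)
  have i4 := gA.integrable_of_hasCompactSupport hφ.continuous hc
  have i5 : Integrable fun x => transposeOp α φ x • w x + φ x • stretch α x (w x) := i3.add i4
  have e0 : ∫ x, φ x • (f + ((1 + strainConst μ : ℝ) : ℂ) • w : L2sq m) x =
      (∫ x, φ x • f x) + ∫ x, (1 + strainConst μ) • φ x • w x := by
    refine (integral_congr_ae ?_).trans (integral_add i1 i2)
    filter_upwards [(ae_weighted m).1 (Lp.coeFn_add f
      (((1 + strainConst μ : ℝ) : ℂ) • w)), (ae_weighted m).1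
      (Lp.coeFn_smul ((1 + strainConst μ : ℝ) : ℂ) w)] with x h1 h2
    rw [h1, Pi.add_apply, h2, Pi.smul_apply, smul_add, smul_comm (φ x)]
    rfl
  have hp : ∀ (j : Fin 2) {u : Plane → ℂ²}, Integrable u → (∫ x, u x) j = ∫ x, u x j :=
    fun j u hu => ((proj j : ℂ² →L[ℂ] ℂ).integral_comp_comm hu).symm
  rw [e0, ← integral_add i3 i4, ← eq_sub_iff_add_eq, ← integral_sub i5 i2, PiLp.ext_iff]
  refine forall_congr' fun j => ?_
  rw [hp j i1, hp j (u := fun x => transposeOp α φ x • w x + φ x • stretch α x (w x) -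
    (1 + strainConst μ) • φ x • w x) (i5.sub i2)]
  refine Eq.congr (integral_congr_ae (.of_forall fun x => ?_))
    (integral_congr_ae (.of_forall fun x => ?_))
  · simp [mul_comm]
  · simp only [PiLp.smul_apply, PiLp.add_apply, PiLp.sub_apply, stretch_apply,
      transposeScalarPart_eq μ α hφ, real_smul]
    push_cast
    ring

lemma abs_profile_le_one (y : Plane) : |profile (‖y‖ ^ 2)| ≤ 1 :=
  (le_mul_of_one_le_left (abs_nonneg _) (by nlinarith [sq_nonneg ‖y‖])).trans
    (one_add_mul_profile_le (sq_nonneg ‖y‖))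

lemma continuous_profile_norm_sq : Continuous fun y : Plane => profile (‖y‖ ^ 2) :=
  profile_contDiff.continuous.comp (by fun_prop)

lemma abs_mul_profile_le (α : ℝ) (y : Plane) : |α * profile (‖y‖ ^ 2)| ≤ |α| := by
  rw [abs_mul]; exact mul_le_of_le_one_right (abs_nonneg _) (abs_profile_le_one y)

lemma GaussIntegrable.mul_profile {w : Plane → E} (hw : GaussIntegrable w) (α : ℝ) :
    GaussIntegrable fun y => (α * profile (‖y‖ ^ 2)) • w y :=
  hw.smul (continuous_const.mul continuous_profile_norm_sq) (abs_mul_profile_le α)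

lemma abs_velocity_le (i : Fin 2) (y : Plane) : |velocity i y| ≤ 1 := by
  rw [velocity_eq, abs_mul]
  have h1 := one_add_mul_profile_le (sq_nonneg ‖y‖)
  have h4 : |(![-y 1, y 0] : Fin 2 → ℝ) i| ≤ ‖y‖ := by
    fin_cases i
    · simpa using abs_coord_le y 1
    · simpa using abs_coord_le y 0
  have h5 : ‖y‖ ≤ 1 + ‖y‖ ^ 2 := by nlinarith [sq_nonneg (‖y‖ - 1)]
  calc _ ≤ |profile (‖y‖ ^ 2)| * (1 + ‖y‖ ^ 2) := by gcongr; exact h4.trans h5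
    _ ≤ 1 := by linarith

lemma abs_transposeOp_le (α : ℝ) {χ : Plane → ℝ} {y : Plane}
    (h1 : ∀ i, |partialDeriv i χ y| ≤ C) (h2 : ∀ i, |partialDeriv i (partialDeriv i χ) y| ≤ C) :
    |transposeOp α χ y| ≤ (3 + 2 * |α|) * C * (1 + ‖y‖) := by
  have hC : 0 ≤ C := (abs_nonneg _).trans (h1 0)
  rw [transposeOp, Fin.sum_univ_two, Fin.sum_univ_two, Fin.sum_univ_two, mul_add α]
  have a := fun i => abs_le.1 (h2 i)
  have b : ∀ i, |y i * partialDeriv i χ y| ≤ ‖y‖ * C := fun i => by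
    rw [abs_mul]; exact mul_le_mul (abs_coord_le y i) (h1 i) (abs_nonneg _) (norm_nonneg _)
  have c : ∀ i, |α * (velocity i y * partialDeriv i χ y)| ≤ |α| * (1 * C) := fun i => by
    rw [abs_mul, abs_mul]
    gcongr
    exacts [abs_velocity_le i y, h1 i]
  have b := fun i => abs_le.1 (b i)
  have c := fun i => abs_le.1 (c i)
  have d1 : 0 ≤ |α| * C * ‖y‖ := by positivity
  have d2 : 0 ≤ C * ‖y‖ := by positivity
  rw [abs_le]
  constructor <;> linarith [a 0, a 1, b 0, b 1, c 0, c 1]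

/-- The distributional equation can be tested against the Mehler kernels. -/
lemma kernelEq_of_linearizedGraph {μ α : ℝ} {w f : L2sq m}
    (h : linearizedGraph μ α m w f) : KernelEq (fun y => α * profile (‖y‖ ^ 2)) (stretch α) w
      (f + ((1 + strainConst μ : ℝ) : ℂ) • w : L2sq m) := by
  rw [linearizedGraph_iff] at h
  intro s hs x
  set f₀ := f + ((1 + strainConst μ : ℝ) : ℂ) • w
  have gw := gaussIntegrable_Lp w
  have gf := gaussIntegrable_Lp f₀
  have gA := gw.clm_apply (stretch_continuous α).stronglyMeasurable (exists_norm_stretch_le α)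
  obtain ⟨χ, C, hC, hχ⟩ := exists_cutoff
  obtain ⟨B', hB', hb'⟩ := exists_logDeriv_bound (s₂ := s) hs (norm_nonneg x)
  have hb' := hb' s ⟨le_rfl, le_rfl⟩ x le_rfl
  have hk := fun y => mehler_pos hs x y
  have ha := mvar_pos hs
  have hbf := damp_pos s
  set q := damp s / (2 * mvar s) with hq
  have hq0 : 0 < q := by positivity
  have hev : ∀ y, ∀ᶠ n in atTop, χ n =ᶠ[𝓝 y] fun _ => 1 := fun y => by
    obtain ⟨N, hN⟩ := exists_nat_gt ‖y‖
    filter_upwards [eventually_ge_atTop N] with n hn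
    exact (hχ n).2.2.2.2.2 y (hN.trans_le (by exact_mod_cast hn))
  -- convergence of the zeroth-order terms
  have lim0 : ∀ {u : Plane → ℂ²}, GaussIntegrable u →
      Tendsto (fun n => ∫ y, (χ n y * mehler s x y) • u y) atTop (𝓝 (∫ y, mehler s x y • u y)) :=
    fun {u} hu => tendsto_integral_of_dominated_convergence (fun y => ‖mehler s x y • u y‖)
      (fun n => ((hχ n).1.continuous.mul (continuous_mehler_right s x)).aestronglyMeasurable.smul
        hu.aestronglyMeasurable) (hu.integrable_mehler hs x).norm
      (fun n => .of_forall fun y => by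
        rw [mul_smul, norm_smul]
        exact mul_le_of_le_one_left (norm_nonneg _) ((hχ n).2.2.1 y))
      (.of_forall fun y => tendsto_const_nhds.congr' (by
        filter_upwards [hev y] with n hn
        rw [hn.eq_of_nhds, one_mul]))
  -- convergence of the differential terms
  have lim1 : Tendsto (fun n => ∫ y, transposeOp α (fun y => χ n y * mehler s x y) y • w y) atTop
      (𝓝 (∫ y, transposeOp α (mehler s x) y • w y)) := by
    set M := (B' + q * (|α| * ‖x‖)) + (3 + 2 * |α|) * C + 4 * (C * (q * (1 + ‖x‖))) with hM
    refine tendsto_integral_of_dominated_convergence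
      (fun y => ‖(M * (1 + ‖y‖) ^ 2 * mehler s x y) • w y‖)
      (fun n => (transposeOp_continuous α ((hχ n).1.mul
        (mehler_contDiff s x))).aestronglyMeasurable.smul gw.aestronglyMeasurable)
      (gw.integrable_kernel (gaussKernel_mul_mehler hs (p := fun _ y => M * (1 + ‖y‖) ^ 2)
        (by fun_prop) fun _ _ => ⟨M, by positivity, fun _ _ y => by
          rw [abs_of_nonneg (by positivity)]⟩) x).norm
      (fun n => .of_forall fun y => ?_) (.of_forall fun y => tendsto_const_nhds.congr' ?_)
    · obtain ⟨h1, -, h3, h4, h5, -⟩ := hχ n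
      have hy := norm_nonneg y
      have hx := norm_nonneg x
      have e : transposeOp α (fun y => χ n y * mehler s x y) y =
          (χ n y * (mehlerLogDeriv s x y + q *
          (α * profile (‖y‖ ^ 2) * cross x y)) + transposeOp α (χ n) y + 2 *
          ∑ i, partialDeriv i (χ n) y * (q * (x i - damp s * y i))) * mehler s x y := by
        rw [transposeOp_mul α h1 (mehler_contDiff s x), transposeOp_mehler α hs]
        simp only [partialDeriv_mehler hs, Fin.sum_univ_two, hq]
        ring
      rw [e, norm_smul, norm_smul, norm_mul, norm_mul (M * _), norm_eq_abs, norm_eq_abs (M * _),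
        abs_of_nonneg (by positivity : 0 ≤ M * (1 + ‖y‖) ^ 2)]
      gcongr
      have t1 : |χ n y * (mehlerLogDeriv s x y + q * (α * profile (‖y‖ ^ 2) * cross x y))| ≤
          1 * (B' * (1 + ‖y‖) ^ 2 + q * (|α| * (‖x‖ * (1 + ‖y‖) ^ 2))) := by
        rw [abs_mul]
        refine mul_le_mul (h3 y) ((abs_add_le _ _).trans (add_le_add (hb' y) ?_)) (abs_nonneg _)
          zero_le_one
        rw [abs_mul, abs_of_pos hq0, abs_mul (α * _)]
        exact mul_le_mul_of_nonneg_left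
            (mul_le_mul (abs_mul_profile_le α y) ((abs_cross_le x y).trans
          (by gcongr; nlinarith)) (abs_nonneg _) (abs_nonneg _)) hq0.le
      have t2 : |transposeOp α (χ n) y| ≤ (3 + 2 * |α|) * C * (1 + ‖y‖) ^ 2 :=
        (abs_transposeOp_le α (h4 y) (h5 y)).trans (by gcongr; nlinarith)
      have t3 : ∀ i, |partialDeriv i (χ n) y * (q * (x i - damp s * y i))| ≤
          C * (q * ((1 + ‖x‖) * (1 + ‖y‖) ^ 2)) := fun i => by
        rw [abs_mul, abs_mul, abs_of_pos hq0]
        gcongr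
        · exact h4 y i
        · refine (abs_sub _ _).trans ?_
          rw [abs_mul, abs_of_pos hbf]
          nlinarith [abs_coord_le x i, abs_coord_le y i, damp_le_one hs.le, abs_nonneg (y i),
            mul_nonneg hx hy, mul_nonneg hx (sq_nonneg ‖y‖)]
      rw [Fin.sum_univ_two]
      have t4 := abs_add_le (partialDeriv 0 (χ n) y * (q * (x 0 - damp s * y 0)))
        (partialDeriv 1 (χ n) y * (q * (x 1 - damp s * y 1)))
      refine (abs_add_three _ _ _).trans ?_
      rw [abs_mul 2, abs_two]
      linarith [t3 0, t3 1]
    · filter_upwards [hev y] with n h0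
      have h1 := fun i => partialDeriv_of_eventuallyEq h0 i
      have h2 := fun i => (partialDeriv_of_eventuallyEq (h1 i) i).eq_of_nhds
      have h3 := fun i => (h1 i).eq_of_nhds
      rw [transposeOp_mul α (hχ n).1 (mehler_contDiff s x), h0.eq_of_nhds, show
        transposeOp α (χ n) y = 0 by simp [transposeOp, h2, h3]]
      simp [h3]
  have hlim := tendsto_nhds_unique
      ((lim0 gf).congr fun n => h _ ((hχ n).1.mul (mehler_contDiff s x))
    (hχ n).2.1.mul_right) (lim1.add (lim0 gA))
  -- the limit identity is the kernel equation
  have e : ∀ y, transposeOp α (mehler s x) y • w y = (mehlerLogDeriv s x y * mehler s x y) • w y +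
      crossKer s x y • (α * profile (‖y‖ ^ 2)) • w y := fun y => by
    rw [transposeOp_mehler α hs, smul_smul, ← add_smul, crossKer]
    congr 1
    ring
  have i2 := (gw.mul_profile α).integrable_kernel (gaussKernel_crossKer hs) x
  simp only [hlim, driftKer_apply, e]
  rw [integral_add i2 (gA.integrable_mehler hs x),
    integral_add (gw.integrable_kernel (gaussKernel_logDeriv hs) x) i2]
  abel

/-! ### From the kernel equation back to distributions -/

lemma mehler_left_eq (s : ℝ) (y : Plane) :
    (fun x => mehler s x y) = fun x => gauss (mvar s) (damp s • y - (1 : ℝ) • x) :=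
  funext fun x => by rw [one_smul, mehler, gauss_sub_comm]

lemma mehler_contDiff_left (s : ℝ) (y : Plane) : ContDiff ℝ ∞ fun x => mehler s x y :=
  mehler_left_eq s y ▸ gauss_sub_smul_contDiff _ _ _

lemma partialDeriv_mehler_left (hs : 0 < s) (x y : Plane) (i : Fin 2) :
    partialDeriv i (fun x => mehler s x y) x =
      -(2 * mvar s)⁻¹ * (x i - damp s * y i) * mehler s x y := by
  rw [mehler_left_eq, partialDeriv_gauss_sub_smul (mvar_pos hs).ne', ← congrFun
      (mehler_left_eq s y) x]
  simp
  ring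

lemma partialDeriv_partialDeriv_mehler_left (hs : 0 < s) (x y : Plane) (i : Fin 2) :
    partialDeriv i (partialDeriv i (fun x => mehler s x y)) x =
      ((2 * mvar s)⁻¹ ^ 2 * (x i - damp s * y i) ^ 2 - (2 * mvar s)⁻¹) * mehler s x y := by
  rw [mehler_left_eq, partialDeriv_partialDeriv_gauss_sub_smul (mvar_pos hs).ne',
    ← congrFun (mehler_left_eq s y) x]
  simp only [PiLp.smul_apply, smul_eq_mul]
  ring

/-- The forward equation `∂ₛ k = Δ_x k + ½ x·∇_x k + k`. -/
lemma mehler_forward (hs : 0 < s) (x y : Plane) :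
    (∑ i, partialDeriv i (partialDeriv i (fun x => mehler s x y)) x) + mehler s x y +
      (1 / 2) * ∑ i, x i * partialDeriv i (fun x => mehler s x y) x =
        mehlerLogDeriv s x y * mehler s x y := by
  have ha := (mvar_pos hs).ne'
  have hb := damp_sq s
  simp only [Fin.sum_univ_two, partialDeriv_partialDeriv_mehler_left hs,
      partialDeriv_mehler_left hs,
    mehlerLogDeriv, plane_norm_sq, PiLp.sub_apply, PiLp.smul_apply, smul_eq_mul, hb]
  field_simp
  ring

lemma integral_partialDeriv_mul {φ g : Plane → ℝ} (hφ : ContDiff ℝ ∞ φ) (hc : HasCompactSupport φ)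
    (hg : ContDiff ℝ ∞ g) (i : Fin 2) :
    ∫ x, φ x * partialDeriv i g x = -∫ x, partialDeriv i φ x * g x := by
  have h1 := contDiff_partialDeriv hφ i
  have h2 := contDiff_partialDeriv hg i
  exact integral_mul_fderiv_eq_neg_fderiv_mul_of_integrable
    ((h1.continuous.mul hg.continuous).integrable_of_hasCompactSupport
      (hasCompactSupport_partialDeriv hc i).mul_right)
    ((hφ.continuous.mul h2.continuous).integrable_of_hasCompactSupport hc.mul_right)
    ((hφ.continuous.mul hg.continuous).integrable_of_hasCompactSupport hc.mul_right)
    (fun x _ => hφ.differentiable (by simp) x) (fun x _ => hg.differentiable (by simp) x)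

lemma integral_mul_mehlerLogDeriv {φ : Plane → ℝ} (hφ : ContDiff ℝ ∞ φ) (hc : HasCompactSupport φ)
    (hs : 0 < s) (y : Plane) : ∫ x, φ x * (mehlerLogDeriv s x y * mehler s x y) =
      ∫ x, transposeOp 0 φ x * mehler s x y := by
  have hg := mehler_contDiff_left s y
  have hx : ∀ i : Fin 2, ContDiff ℝ ∞ fun x : Plane => x i := fun i => by fun_prop
  have hg' : ContDiff ℝ ∞ fun x => 1 / 2 * mehler s x y := contDiff_const.mul hg
  have hφ1 := fun i => contDiff_partialDeriv hφ i
  have hg1 := fun i => contDiff_partialDeriv hg i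
  have hc1 := fun i => hasCompactSupport_partialDeriv hc i
  have I : ∀ {u v : Plane → ℝ}, ContDiff ℝ ∞ u → HasCompactSupport u → ContDiff ℝ ∞ v →
      Integrable fun x => u x * v x := fun hu huc hv =>
    (hu.continuous.mul hv.continuous).integrable_of_hasCompactSupport huc.mul_right
  have d : ∀ {u : Plane → ℝ}, ContDiff ℝ ∞ u → ∀ x, DifferentiableAt ℝ u x := fun hu =>
    hu.differentiable (by simp)
  let A : Fin 2 → Plane → ℝ := fun i x =>
    partialDeriv i (fun x => mehler s x y) x + x i * (1 / 2 * mehler s x y)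
  have hA : ∀ i, ContDiff ℝ ∞ (A i) := fun i => (hg1 i).add ((hx i).mul hg')
  have eA : ∀ i x, partialDeriv i (A i) x = partialDeriv i
      (partialDeriv i fun x => mehler s x y) x +
      (x i * (1 / 2 * partialDeriv i (fun x => mehler s x y) x) + 1 / 2 * mehler s x y) :=
          fun i x => by
    rw [partialDeriv_add (d (hg1 i) x) (d ((hx i).mul hg') x), partialDeriv_mul (d (hx i) x)
        (d hg' x),
      partialDeriv_mul (differentiableAt_const _) (d hg x), partialDeriv_coord]
    simp [partialDeriv]
  have key : ∀ i, ∫ x, φ x * partialDeriv i (A i) x =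
      ∫ x, (partialDeriv i (partialDeriv i φ) x - 1 / 2 * (x i * partialDeriv i φ x)) *
        mehler s x y := fun i => by
    have h1 := integral_partialDeriv_mul (hφ1 i) (hc1 i) hg i
    simp only [integral_partialDeriv_mul hφ hc (hA i) i, A, mul_add, sub_mul]
    rw [integral_add (I (hφ1 i) (hc1 i) (hg1 i)) (I (hφ1 i) (hc1 i) ((hx i).mul hg')), h1,
        integral_sub
      (I (contDiff_partialDeriv (hφ1 i) i) (hasCompactSupport_partialDeriv (hc1 i) i) hg)
      (I (contDiff_const.mul ((hx i).mul (hφ1 i))) (hc1 i).mul_left.mul_left hg), neg_add, neg_neg,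
      ← sub_eq_add_neg]
    congr 2
    funext x
    ring
  calc _ = ∫ x, (φ x * partialDeriv 0 (A 0) x + φ x * partialDeriv 1 (A 1) x) := by
        congr 1
        funext x
        rw [← mehler_forward hs x y, eA, eA, Fin.sum_univ_two, Fin.sum_univ_two]
        ring
    _ = _ := by
        rw [integral_add (I hφ hc (contDiff_partialDeriv (hA 0) 0))
          (I hφ hc (contDiff_partialDeriv (hA 1) 1)), key, key, ← integral_add]
        · congr 1
          funext x
          simp only [transposeOp, Fin.sum_univ_two]
          ring
        all_goals exact I ((contDiff_partialDeriv (hφ1 _) _).sub (contDiff_const.mul ((hx _).mul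
          (hφ1 _)))) ((hasCompactSupport_partialDeriv (hc1 _) _).sub (hc1 _).mul_left.mul_left) hg

lemma integral_mul_crossKer {φ : Plane → ℝ} (hφ : ContDiff ℝ ∞ φ) (hc : HasCompactSupport φ)
    (hs : 0 < s) (y : Plane) : ∫ x, φ x * crossKer s x y = damp s *
      (-y 1 * (∫ x, partialDeriv 0 φ x * mehler s x y) +
        y 0 * ∫ x, partialDeriv 1 φ x * mehler s x y) := by
  have hg := mehler_contDiff_left s y
  have I : ∀ i, Integrable fun x => φ x * partialDeriv i (fun x => mehler s x y) x := fun i =>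
    (hφ.continuous.mul (contDiff_partialDeriv hg i).continuous).integrable_of_hasCompactSupport
      hc.mul_right
  have e := fun i => integral_partialDeriv_mul hφ hc hg i
  rw [← neg_eq_iff_eq_neg.2 (e 0), ← neg_eq_iff_eq_neg.2 (e 1), neg_mul_neg, mul_neg,
    ← integral_const_mul, ← integral_const_mul, ← sub_eq_add_neg,
    ← integral_sub ((I 0).const_mul _) ((I 1).const_mul _), ← integral_const_mul]
  refine integral_congr_ae (.of_forall fun x => ?_)
  simp only [partialDeriv_mehler_left hs, cross, crossKer]
  have ha := (mvar_pos hs).ne'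
  field_simp
  ring

section

lemma integral_smul_integral_swap [CompleteSpace E] {w : Plane → E} (hw : GaussIntegrable w)
    {ψ : Plane → ℝ} (hψ : Continuous ψ) (hc : HasCompactSupport ψ) {κ : Plane → Plane → ℝ}
    (hκ : GaussKernel κ) : ∫ x, ψ x • ∫ y, κ x y • w y = ∫ y, (∫ x, ψ x * κ x y) • w y ∧
      (Integrable fun x => ψ x • ∫ y, κ x y • w y) ∧
      Integrable fun y => (∫ x, ψ x * κ x y) • w y := by
  obtain ⟨r, hr⟩ := hc.isCompact.isBounded.exists_norm_le
  obtain ⟨C, δ, hδ, hb⟩ := hκ.2 r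
  have h1 : Integrable (uncurry fun x y => (ψ x * κ x y) • w y) (volume.prod volume) := by
    refine ((hψ.integrable_of_hasCompactSupport hc).norm.mul_prod
      (((hw δ hδ).norm.const_mul C))).mono' (((hψ.comp continuous_fst).mul
        hκ.1).aestronglyMeasurable.smul hw.aestronglyMeasurable.comp_snd) (.of_forall fun p => ?_)
    simp only [uncurry]
    rw [norm_smul, norm_mul, norm_smul, norm_of_nonneg (exp_pos _).le]
    by_cases hp : ψ p.1 = 0
    · simp [hp]
    · rw [mul_assoc, ← mul_assoc C]
      gcongr
      exact hb p.1 (hr _ (subset_tsupport _ hp)) p.2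
  simp only [← integral_smul, smul_smul, ← integral_smul_const]
  exact ⟨integral_integral_swap h1, h1.integral_prod_left, h1.integral_prod_right⟩

lemma norm_ofReal_smul_id_le (r : ℝ) : ‖(r : ℂ) • idL E‖ ≤ |r| := by
  rw [norm_smul, norm_real]
  exact mul_le_of_le_one_right (norm_nonneg _) norm_id_le'

/-- The mollifications of `u` converge to `u` in the sense of distributions. -/
lemma tendsto_integral_smul_mollify [CompleteSpace E] {u : Plane → E}
    (hu : MemLp u 2 (weightedMeasure m)) {ψ : Plane → ℝ} (hψ : Continuous ψ)
    (hc : HasCompactSupport ψ) : Tendsto (fun s => ∫ x, ψ x • ∫ y, mehler s x y • u y) (𝓝[>] 0)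
      (𝓝 (∫ x, ψ x • u x)) := by
  obtain ⟨C, hC⟩ := (show Continuous fun y : Plane => exp (‖y‖ ^ 2) * ψ y by
    fun_prop).bounded_above_of_compact_support hc.mul_left
  have hk : StronglyMeasurable fun y => (ψ y : ℂ) • idL E :=
    (Complex.continuous_ofReal.comp hψ).stronglyMeasurable.smul_const _
  obtain ⟨C', hP⟩ := exists_functionalBound m hk (C := C) one_pos fun y => by
    have h1 := hC y
    rw [norm_mul, norm_of_nonneg (exp_pos _).le] at h1
    rw [norm_smul, neg_one_mul, exp_neg, ← div_eq_mul_inv, le_div_iff₀ (exp_pos _), mul_comm,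
      norm_real]
    exact le_trans (by gcongr; exact mul_le_of_le_one_right (norm_nonneg _) norm_id_le') h1
  have hae : ⇑(hu.toLp u) =ᵐ[volume] u := (ae_weighted m).1 hu.coeFn_toLp
  have h2 := (hP.functional.continuous.tendsto _).comp (tendsto_semi m (hu.toLp u))
  have e : ∀ v : L²(E, m), hP.functional v = ∫ x, ψ x • v x := fun v => rfl
  rw [e] at h2
  have e1 : ∫ x, ψ x • (hu.toLp u) x = ∫ x, ψ x • u x := by
    refine integral_congr_ae ?_
    filter_upwards [hae] with x hx
    rw [hx]
  rw [e1] at h2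
  refine h2.congr' ?_
  filter_upwards [self_mem_nhdsWithin] with s hs
  rw [Function.comp_apply, e]
  refine integral_congr_ae ?_
  filter_upwards [semi_coeFn hs (hu.toLp u)] with x hx
  rw [hx, kernelFun_congr _ hae, kernelFun_mehlerKer]

lemma memLp_clm_apply {w : Plane → E}
    (hw : MemLp w 2 (weightedMeasure m)) {A : Plane → E →L[ℂ] F} (hA : StronglyMeasurable A)
        (hb : ∀ y, ‖A y‖ ≤ C) : MemLp (fun y => A y (w y)) 2 (weightedMeasure m) :=
  hw.of_le_mul (((ContinuousLinearMap.apply ℂ F : E →L[ℂ] _).flip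
    |>.isBoundedBilinearMap).continuous.comp_aestronglyMeasurable₂ hA.aestronglyMeasurable hw.1)
    (.of_forall fun y => (ContinuousLinearMap.le_opNorm _ _).trans
      (mul_le_mul_of_nonneg_right (hb y) (norm_nonneg _)))

end

lemma memLp_smul {w : Plane → E} (hw : MemLp w 2 (weightedMeasure m)) {g : Plane → ℝ}
    (hg : Continuous g) (hb : ∀ y, |g y| ≤ C) : MemLp (fun y => g y • w y) 2 (weightedMeasure m) :=
  hw.of_le_mul (c := C) (hg.aestronglyMeasurable.smul hw.1) (.of_forall fun y => by
    rw [norm_smul]; gcongr; exact hb y)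

/-- The equation tested against the Mehler kernels implies the distributional equation, by
integrating against a test function and letting the time of the kernel tend to zero. -/
lemma linearizedGraph_of_kernelEq {μ α : ℝ} {w f : L2sq m}
    (h : KernelEq (fun y => α * profile (‖y‖ ^ 2)) (stretch α) w
      (f + ((1 + strainConst μ : ℝ) : ℂ) • w : L2sq m)) : linearizedGraph μ α m w f := by
  rw [linearizedGraph_iff]
  intro φ hφ hc
  set f₀ := f + ((1 + strainConst μ : ℝ) : ℂ) • w
  have gw := gaussIntegrable_Lp w
  have hA := (stretch_continuous α).stronglyMeasurable
  have hAb := exists_norm_stretch_le α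
  have gA := gw.clm_apply hA hAb
  have hV : ∀ i, Continuous fun y => α * velocity i y := fun i =>
    continuous_const.mul (velocity_contDiff i).continuous
  have hVb : ∀ i y, |α * velocity i y| ≤ |α| := fun i y => by
    rw [abs_mul]; exact mul_le_of_le_one_right (abs_nonneg _) (abs_velocity_le i y)
  have gV := fun i => gw.smul (hV i) (hVb i)
  have hφ1 := fun i => (contDiff_partialDeriv hφ i).continuous
  have hc1 := fun i => hasCompactSupport_partialDeriv hc i
  have hT := transposeOp_continuous 0 hφ
  have hTc := hasCompactSupport_transposeOp 0 hc
  -- the equation for the mollifications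
  have key : ∀ s > 0, (∫ x, transposeOp 0 φ x • ∫ y, mehler s x y • w y) =
      (∫ x, φ x • ∫ y, mehler s x y • f₀ y) - (damp s •
        ((∫ x, partialDeriv 0 φ x • ∫ y, mehler s x y • (α * velocity 0 y) • w y) +
          ∫ x, partialDeriv 1 φ x • ∫ y, mehler s x y • (α * velocity 1 y) • w y) +
        ∫ x, φ x • ∫ y, mehler s x y • stretch α y (w y)) := fun s hs => by
    have hk := gaussKernel_mehler hs
    have hq := gaussKernel_crossKer hs
    have gH := gw.mul_profile α
    have W := fun i => integral_smul_integral_swap (gV i) (hφ1 i) (hc1 i) hk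
    have X := integral_smul_integral_swap gH hφ.continuous hc hq
    have Y := integral_smul_integral_swap gA hφ.continuous hc hk
    have e3 : ∫ x, φ x • ∫ y, crossKer s x y • (α * profile (‖y‖ ^ 2)) • w y = damp s •
        ((∫ x, partialDeriv 0 φ x • ∫ y, mehler s x y • (α * velocity 0 y) • w y) +
          ∫ x, partialDeriv 1 φ x • ∫ y, mehler s x y • (α * velocity 1 y) • w y) := by
      rw [X.1, (W 0).1, (W 1).1, ← integral_add (W 0).2.2 (W 1).2.2, ← integral_smul]
      refine integral_congr_ae (.of_forall fun y => ?_)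
      simp only [integral_mul_crossKer hφ hc hs, velocity_eq, smul_smul, ← add_smul,
        Matrix.cons_val_zero, Matrix.cons_val_one]
      congr 1
      ring
    have XY : Integrable fun x => (φ x • ∫ y, crossKer s x y • (α * profile (‖y‖ ^ 2)) • w y) +
        φ x • ∫ y, mehler s x y • stretch α y (w y) := X.2.1.add Y.2.1
    rw [← e3, ← integral_add X.2.1 Y.2.1, ← integral_sub (integral_smul_integral_swap
      (gaussIntegrable_Lp f₀) hφ.continuous hc hk).2.1 XY, (integral_smul_integral_swap gw hT hTc
      hk).1]
    simp only [← integral_mul_mehlerLogDeriv hφ hc hs]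
    rw [← (integral_smul_integral_swap gw hφ.continuous hc (gaussKernel_logDeriv hs)).1]
    refine integral_congr_ae (.of_forall fun x => ?_)
    simp only [h s hs x, driftKer_apply]
    rw [integral_add (gH.integrable_kernel hq x) (gA.integrable_mehler hs x), smul_sub, smul_add]
  have hw := Lp.memLp w
  have lV := fun i => tendsto_integral_smul_mollify (memLp_smul hw (hV i) (hVb i)) (hφ1 i) (hc1 i)
  have lb : Tendsto damp (𝓝[>] 0) (𝓝 1) :=
    damp_zero ▸ (damp_continuous.tendsto 0).mono_left nhdsWithin_le_nhds
  have hlim := tendsto_nhds_unique ((tendsto_integral_smul_mollify hw hT hTc).congr' (by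
    filter_upwards [self_mem_nhdsWithin] with s hs using key s hs))
    ((tendsto_integral_smul_mollify (Lp.memLp f₀) hφ.continuous hc).sub
      ((lb.smul ((lV 0).add (lV 1))).add (tendsto_integral_smul_mollify
        (memLp_clm_apply hw hA hAb) hφ.continuous hc)))
  have iV := fun i => (gV i).integrable_of_hasCompactSupport (hφ1 i) (hc1 i)
  have iVV : Integrable fun x => partialDeriv 0 φ x • (α * velocity 0 x) • w x +
    partialDeriv 1 φ x • (α * velocity 1 x) • w x := (iV 0).add (iV 1)
  have e4 : ∫ x, transposeOp α φ x • w x = (∫ x, transposeOp 0 φ x • w x) +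
      ((∫ x, partialDeriv 0 φ x • (α * velocity 0 x) • w x) +
        ∫ x, partialDeriv 1 φ x • (α * velocity 1 x) • w x) := by
    rw [← integral_add (iV 0) (iV 1), ← integral_add
        (gw.integrable_of_hasCompactSupport hT hTc) iVV]
    refine integral_congr_ae (.of_forall fun x => ?_)
    simp only [transposeOp, Fin.sum_univ_two, smul_smul, ← add_smul]
    congr 1
    ring
  rw [e4, hlim, one_smul]
  abel

/-- The maximal distributional operator, shifted by a constant, is the generator of
`vortexSemigroup`. -/
lemma linearizedGraph_iff_generatorGraph (μ α : ℝ) (m : ℝ≥0∞) (w f : L2sq m) :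
    linearizedGraph μ α m w f ↔ GeneratorGraph (fun t : ℝ≥0 => vortexSemigroup α m t) w
      (f + ((1 + strainConst μ : ℝ) : ℂ) • w) := by
  have D := (decayingDrift α).driftCoeff
  exact (Iff.intro kernelEq_of_linearizedGraph linearizedGraph_of_kernelEq).trans
    ((D.kernelEq_iff w _).trans (D.perturbationData m).generatorGraph_perturbed_iff.symm)

/-! ### The semigroup and its essential spectral radius -/

/-- The semigroup generated by the full operator. -/
def fullSemigroup (μ α : ℝ) (m : ℝ≥0∞) (t : ℝ) : L2sq m →L[ℂ] L2sq m :=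
  ((exp (-(1 + strainConst μ) * t) : ℝ) : ℂ) • vortexSemigroup α m t

lemma isSemigroupGeneratedBy_fullSemigroup (μ α : ℝ) (m : ℝ≥0∞) :
    IsSemigroupGeneratedBy (fun t : ℝ≥0 => fullSemigroup μ α m t) (linearizedGraph μ α m) where
  isC0Semigroup := by
    have h : IsC0Semigroup fun t : ℝ≥0 => vortexSemigroup α m t :=
      ((decayingDrift α).driftCoeff.perturbationData m).isC0Semigroup_perturbed
    refine ⟨?_, fun s t => ?_, fun x => ?_⟩
    · have := h.map_zero
      simp only [NNReal.coe_zero] at this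
      simp [fullSemigroup, this]
    · have := h.map_add s t
      ext1 x
      simp only [fullSemigroup, this, smul_apply, ContinuousLinearMap.comp_apply, map_smul,
          smul_smul]
      rw [← Complex.ofReal_mul, ← exp_add, NNReal.coe_add, mul_add, add_comm (_ * (s : ℝ))]
    · have h2 : Continuous fun t : ℝ≥0 => ((exp (-(1 + strainConst μ) * t) : ℝ) : ℂ) := by fun_prop
      exact h2.smul (h.continuous_orbit x)
  generator_iff x y := by
    rw [linearizedGraph_iff_generatorGraph]
    have e : ∀ t : ℝ, fullSemigroup μ α m t =
        Complex.exp (-((1 + strainConst μ : ℝ) : ℂ) * t) • vortexSemigroup α m t := fun t => by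
      rw [fullSemigroup]; push_cast; rfl
    have h0 : vortexSemigroup α m 0 = 1 :=
      ((decayingDrift α).driftCoeff.perturbationData m).perturbed_nonpos le_rfl
    generalize ((1 + strainConst μ : ℝ) : ℂ) = l at e ⊢
    refine ⟨fun h => ?_, fun h => ?_⟩
    · have := generatorGraph_rescale (T := fullSemigroup μ α m) (by simp [e, h0])
        (-l) h
      simpa [e, smul_smul, ← Complex.exp_add] using this
    · simpa [e] using generatorGraph_rescale h0 l h

lemma infinite_dimensional (hm1 : 1 < m) (hm : m ≠ ⊤) :
    ¬ FiniteDimensional ℂ (L2sq m) := fun h => by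
  refine not_isFredholm_vortexSemigroup hm1 hm 0 one_pos one_pos ?_
  have := isFredholm_of_norm_lt (A := (0 : L2sq m →L[ℂ] L2sq m))
    (C := ((1 : ℝ) : ℂ) • vortexSemigroup 0 m 1)
    (z := ((1 * exp ((1 - m.toReal) / 2 * 1) : ℝ) : ℂ)) ?_ ?_
  · rwa [zero_add] at this
  · rw [norm_zero, norm_pos_iff, Complex.ofReal_ne_zero]
    positivity
  · have := FiniteDimensional.proper ℂ (L2sq m)
    exact isCompactOperator_of_locallyCompactSpace_dom (((1 : ℝ) : ℂ) • vortexSemigroup 0 m 1)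

lemma essentialSpectralRadius_eq {X : Type*} [NormedAddCommGroup X] [NormedSpace ℂ X]
    {A : X →L[ℂ] X} {r : ℝ} (hr : 0 ≤ r)
    (h1 : ∀ z : ℂ, r < ‖z‖ → (z • idL X - A).IsFredholm)
    (h2 : ¬ ((r : ℂ) • idL X - A).IsFredholm) :
    essentialSpectralRadius A = ofReal r := by
  refine le_antisymm (iSup₂_le fun z hz => ?_) ?_
  · have : ‖z‖ ≤ r := not_lt.1 fun h => hz (h1 z h)
    change ‖z‖ₑ ≤ _
    rw [← ofReal_norm]
    exact ofReal_le_ofReal this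
  · refine le_trans (le_of_eq ?_) (le_iSup₂_of_le (r : ℂ) h2 le_rfl)
    change _ = ‖(r : ℂ)‖ₑ
    rw [← ofReal_norm, norm_real, norm_of_nonneg hr]

lemma essentialSpectralRadius_fullSemigroup (μ α : ℝ) (hm1 : 1 < m) (hm : m ≠ ⊤)
    (t : ℝ≥0) : essentialSpectralRadius (fullSemigroup μ α m t) =
      ofReal (exp (-(1 / 2 + strainConst μ + m.toReal / 2) * t)) := by
  rcases eq_or_lt_of_le t.2 with h0 | ht
  · have h0' : (t : ℝ) = 0 := h0.symm
    have e := (isSemigroupGeneratedBy_fullSemigroup μ α m).isC0Semigroup.map_zero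
    simp only [NNReal.coe_zero] at e
    rw [h0', e, mul_zero, exp_zero]
    refine essentialSpectralRadius_eq zero_le_one (fun z hz => ?_) fun h => ?_
    · have := isFredholm_of_norm_lt (A := idL (L2sq m)) (C := 0) (z := z)
        (ContinuousLinearMap.norm_id_le.trans_lt hz) isCompactOperator_zero
      rwa [add_zero] at this
    · rw [Complex.ofReal_one, one_smul, sub_self] at h
      have h2 := h.finite_ker
      have h3 : (0 : L2sq m →L[ℂ] L2sq m).ker = ⊤ := LinearMap.ker_zero
      rw [h3] at h2
      exact infinite_dimensional hm1 hm (Module.Finite.equiv Submodule.topEquiv)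
  · have ht : 0 < (t : ℝ) := ht
    have e : exp (-(1 / 2 + strainConst μ + m.toReal / 2) * t) =
        exp (-(1 + strainConst μ) * t) * exp ((1 - m.toReal) / 2 * t) := by
      rw [← exp_add]; ring_nf
    rw [e]
    exact essentialSpectralRadius_eq (by positivity)
      (fun z hz => (decayingDrift α).isFredholm_perturbed (zero_lt_one.trans hm1).ne' hm ht
          (exp_pos _) hz)
      (not_isFredholm_vortexSemigroup hm1 hm α ht (exp_pos _))

lemma essentialSpectralRadius_fullSemigroup_top (μ α : ℝ) {t : ℝ≥0} (ht : 0 < t) :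
    essentialSpectralRadius (fullSemigroup μ α ⊤ t) = 0 := by
  refine le_antisymm (iSup₂_le fun z hz => ?_) zero_le
  have : z = 0 := by
    by_contra h
    exact hz (isFredholm_vortexSemigroup_top α (by exact_mod_cast ht) _ h)
  simp [this]

/-! ### Eigenvectors of semigroups: general facts -/

/-- If `z - T` is surjective for all `z` outside a disc, then no such `z` is an eigenvalue: at a
point `z` of the spectrum of maximal modulus, `A = ε (z + ε - T)⁻¹` would be small for small `ε`
with `|z + ε| > |z|` because `z - T` is open, but it fixes the eigenvectors. -/
lemma eq_zero_of_surjective {X : Type*} [NormedAddCommGroup X] [NormedSpace ℂ X]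
    [CompleteSpace X] {T : X →L[ℂ] X} {z₀ : ℂ}
    (hs : ∀ z : ℂ, ‖z₀‖ ≤ ‖z‖ → Function.Surjective (z • idL X - T)) {x : X}
    (hTx : T x = z₀ • x) : x = 0 := by
  by_contra hx
  have hK : IsCompact (spectrum ℂ T ∩ {z | ‖z₀‖ ≤ ‖z‖}) :=
    (spectrum.isCompact T).inter_right (isClosed_le continuous_const continuous_norm)
  have hz₀ : z₀ ∈ spectrum ℂ T := fun hu => hx
    ((ContinuousLinearMap.isUnit_iff_bijective.1 hu).1 (a₂ := 0) (by
      rw [map_zero]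
      change z₀ • x - T x = 0
      rw [hTx, sub_self]))
  obtain ⟨z, ⟨hz, hz0⟩, hmax⟩ := hK.exists_isMaxOn ⟨z₀, hz₀, le_refl ‖z₀‖⟩
    continuous_norm.continuousOn
  obtain ⟨y, hy, hTy⟩ : ∃ y, y ≠ 0 ∧ T y = z • y := by
    by_contra! hno
    refine hz (ContinuousLinearMap.isUnit_iff_bijective.2
      ⟨(injective_iff_map_eq_zero _).2 fun y hy => ?_, hs z hz0⟩)
    by_contra hy0
    exact hno y hy0 (sub_eq_zero.1 hy).symm
  obtain ⟨C, hC, hpre⟩ := (z • idL X - T).exists_preimage_norm_le (hs z hz0)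
  obtain ⟨ε, hε, hlt⟩ : ∃ ε : ℂ, ‖ε‖ * C ≤ 1 / 4 ∧ ‖z‖ < ‖z + ε‖ := by
    by_contra! H
    have hn : ‖((1 / (4 * C) : ℝ) : ℂ)‖ = 1 / (4 * C) := by
      rw [norm_real, norm_of_nonneg (by positivity)]
    have hc : 1 / (4 * C) * C ≤ 1 / 4 := by field_simp; rfl
    have hp := parallelogram_law_with_norm ℝ z ((1 / (4 * C) : ℝ) : ℂ)
    have h1 := H _ (hn.symm ▸ hc)
    have h2 := H (-((1 / (4 * C) : ℝ) : ℂ)) (by rwa [norm_neg, hn])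
    rw [← sub_eq_add_neg] at h2
    have : 0 < 1 / (4 * C) := by positivity
    rw [hn] at hp
    nlinarith [norm_nonneg (z + ((1 / (4 * C) : ℝ) : ℂ)), norm_nonneg (z - ((1 / (4 * C) : ℝ) : ℂ))]
  obtain ⟨u, hu⟩ : IsUnit ((z + ε) • idL X - T) := by
    by_contra h
    exact hlt.not_ge (hmax ⟨h, hz0.trans hlt.le⟩)
  have hR : ∀ v, (↑u⁻¹ : X →L[ℂ] X) ((z + ε) • v - T v) = v := fun v => by
    have := congrArg (fun f : X →L[ℂ] X => f v) u.inv_mul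
    rwa [hu] at this
  set A : X →L[ℂ] X := ε • (↑u⁻¹ : X →L[ℂ] X) with hA
  have hAy : A y = y := by
    have := hR y
    rwa [hTy, add_smul, add_sub_cancel_left, map_smul] at this
  have h1 : 1 ≤ ‖A‖ := by
    have := A.le_opNorm y
    rw [hAy] at this
    exact (le_mul_iff_one_le_left (norm_pos_iff.2 hy)).1 this
  have h2 : ‖A‖ ≤ ‖ε‖ * C * (1 + ‖A‖) := A.opNorm_le_bound (by positivity) fun v => by
    obtain ⟨q, rfl, hq⟩ := hpre v
    have e : A ((z • idL X - T) q) = ε • (q - A q) := by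
      have e1 : (z • idL X - T) q = ((z + ε) • q - T q) - ε • q := by
        simp only [sub_apply, smul_apply, idL_apply, add_smul]
        abel
      rw [e1, hA, smul_apply, map_sub, hR, map_smul, smul_apply]
    rw [e, norm_smul]
    calc ‖ε‖ * ‖q - A q‖ ≤ ‖ε‖ * (‖q‖ + ‖A‖ * ‖q‖) := by
          gcongr
          exact (norm_sub_le _ _).trans (by gcongr; exact A.le_opNorm q)
      _ = ‖ε‖ * (1 + ‖A‖) * ‖q‖ := by ring
      _ ≤ ‖ε‖ * (1 + ‖A‖) * (C * ‖(z • idL X - T) q‖) := by gcongr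
      _ = _ := by ring
  nlinarith

/-- Uniqueness of Fourier coefficients. -/
lemma eq_zero_of_fourier [CompleteSpace E]
    {T : ℝ} (hT : 0 < T) {F : ℝ → E} (hF : Continuous F) (hper : F T = F 0)
    (h0 : ∀ n : ℤ, ∫ s in (0 : ℝ)..T, Complex.exp (-(2 * π * n / T : ℝ) * Complex.I * s) • F s
      = 0) : F 0 = 0 := by
  have : Fact (0 < T) := ⟨hT⟩
  refine (SeparatingDual.eq_zero_iff_forall_dual_eq_zero (R := ℂ) _).2 fun l => ?_
  set f : ℝ → ℂ := fun s => l (F s) with hf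
  have hfc : Continuous f := l.continuous.comp hF
  have hcoef : ∀ n : ℤ, fourierCoeff (AddCircle.liftIco T 0 f) n = 0 := fun n => by
    rw [fourierCoeff_liftIco_eq, fourierCoeffOn_eq_integral]
    have h1 := congrArg l (h0 n)
    have hc : Continuous fun s : ℝ => Complex.exp (-(2 * π * n / T : ℝ) * Complex.I * s) • F s :=
      (by fun_prop : Continuous fun s : ℝ => Complex.exp (-(2 * π * n / T : ℝ) *
        Complex.I * s)).smul hF
    rw [map_zero, ← l.intervalIntegral_comp_comm (hc.intervalIntegrable _ _)] at h1
    have h2 : ∫ x in (0 : ℝ)..(0 + T), (fourier (-n)) (x : AddCircle (0 + T - 0)) • f x = 0 := by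
      rw [zero_add, ← h1]
      refine intervalIntegral.integral_congr fun s _ => ?_
      simp only [map_smul, hf]
      rw [fourier_coe_apply]
      congr 2
      push_cast
      ring_nf
    rw [h2, smul_zero]
  let g : C(AddCircle T, ℂ) := ⟨AddCircle.liftIco T 0 f,
    AddCircle.liftIco_zero_continuous (by rw [hf]; simp only [hper]) hfc.continuousOn⟩
  have hgc : fourierCoeff g = 0 := funext hcoef
  have hg := hasSum_fourier_series_of_summable (f := g) (by rw [hgc]; exact summable_zero)
  have hg0 : g = 0 := by
    refine hg.unique ?_
    simp only [hgc, Pi.zero_apply, zero_smul]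
    exact hasSum_zero
  have h3 : AddCircle.liftIco T 0 f ((0 : ℝ) : AddCircle T) = f 0 :=
    AddCircle.liftIco_coe_apply ⟨le_rfl, by simpa using hT⟩
  change g ((0 : ℝ) : AddCircle T) = f 0 at h3
  rw [hg0] at h3
  exact h3.symm

/-- A generator of contractions is dissipative. -/
lemma re_inner_nonpos_of_contraction {H : Type*} [NormedAddCommGroup H] [InnerProductSpace ℂ H]
    [CompleteSpace H] {R : ℝ → H →L[ℂ] H} {x y : H} (hR : ∀ t, 0 ≤ t → ‖R t x‖ ≤ ‖x‖)
    (hxy : ∀ t, 0 ≤ t → R t x = x + ∫ s in (0 : ℝ)..t, R s y) (hy : Continuous fun t => R t y)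
    (hy0 : R 0 y = y) : (inner ℂ x y).re ≤ 0 := by
  have hder := (Complex.reCLM.comp ((innerSL ℂ x).restrictScalars ℝ)).hasFDerivAt.comp_hasDerivAt 0
    (intervalIntegral.integral_hasDerivAt_right (a := 0) (b := 0) (by simp)
      hy.stronglyMeasurable.stronglyMeasurableAtFilter hy.continuousAt)
  have h1 := hder.hasDerivWithinAt (s := Set.Ioi 0)
  rw [hasDerivWithinAt_iff_tendsto_slope' (by simp), hy0] at h1
  refine le_of_tendsto h1 (eventually_nhdsWithin_of_forall fun t (ht : 0 < t) => ?_)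
  rw [slope_def_field]
  refine div_nonpos_of_nonpos_of_nonneg ?_ (by linarith)
  change (inner ℂ x (∫ s in (0 : ℝ)..t, R s y)).re - (inner ℂ x (∫ s in (0 : ℝ)..0, R s y)).re ≤ 0
  rw [← sub_eq_of_eq_add' (hxy t ht.le), integral_same, inner_zero_right, inner_sub_right,
    Complex.sub_re, Complex.zero_re]
  have h6 : (inner ℂ x x).re = ‖x‖ ^ 2 := inner_self_eq_norm_sq (𝕜 := ℂ) x
  have h5 := (Complex.re_le_norm _).trans (norm_inner_le_norm x (R t x))
  have h7 := mul_le_mul_of_nonneg_left (hR t ht.le) (norm_nonneg x)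
  nlinarith

/-- A bounded orbit of a semigroup of symmetric operators does not grow: by symmetry
`‖R t x‖² = ⟪x, R (2 t) x⟫`, so the supremum `M` of the norms satisfies `M² ≤ ‖x‖ M`. -/
lemma norm_le_of_symmetric {H : Type*} [NormedAddCommGroup H] [InnerProductSpace ℂ H]
    {R : ℝ → H →L[ℂ] H} {x : H} {B : ℝ}
        (hsymm : ∀ t, 0 ≤ t → ∀ u v, inner ℂ (R t u) v = inner ℂ u (R t v))
    (hadd : ∀ t, 0 ≤ t → R (t + t) x = R t (R t x)) (hB : ∀ t, 0 ≤ t → ‖R t x‖ ≤ B) (ht : 0 ≤ t) :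
    ‖R t x‖ ≤ ‖x‖ := by
  have hbdd : BddAbove (Set.range fun t : Set.Ici (0 : ℝ) => ‖R t x‖) :=
    ⟨B, by rintro _ ⟨t, rfl⟩; exact hB t t.2⟩
  set M := ⨆ t : Set.Ici (0 : ℝ), ‖R t x‖ with hM
  have hle : ∀ t, 0 ≤ t → ‖R t x‖ ≤ M := fun t ht => le_ciSup hbdd ⟨t, ht⟩
  have hM0 : 0 ≤ M := (norm_nonneg _).trans (hle 0 le_rfl)
  have hsq : ∀ t, 0 ≤ t → ‖R t x‖ ^ 2 ≤ ‖x‖ * M := fun t ht => by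
    have h1 : ‖R t x‖ ^ 2 = ‖(inner ℂ (R t x) (R t x) : ℂ)‖ := by
      rw [inner_self_eq_norm_sq_to_K, norm_pow, RCLike.norm_ofReal, abs_norm]
    rw [h1, hsymm t ht, ← hadd t ht]
    exact (norm_inner_le_norm _ _).trans
        (mul_le_mul_of_nonneg_left (hle _ (by linarith)) (norm_nonneg _))
  have hM2 : M ≤ sqrt (‖x‖ * M) := by
    have : Nonempty (Set.Ici (0 : ℝ)) := ⟨⟨0, le_refl (0 : ℝ)⟩⟩
    exact ciSup_le fun t => le_sqrt_of_sq_le (hsq t t.2)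
  have h3 : M * M ≤ ‖x‖ * M := by
    have := sq_sqrt (mul_nonneg (norm_nonneg x) hM0)
    nlinarith [sqrt_nonneg (‖x‖ * M)]
  refine (hle t ht).trans ?_
  rcases hM0.eq_or_lt with h | h
  · rw [← h]; exact norm_nonneg _
  · exact le_of_mul_le_mul_right h3 h

/-! ### Comparison of the weighted spaces with the Gaussian space -/

lemma weightedMeasure_le_top (m : ℝ≥0∞) : weightedMeasure m ≤ weightedMeasure ⊤ :=
  withDensity_mono (.of_forall fun x => ofReal_le_ofReal (by
    rw [rho_top]; exact rho_le_exp m (by positivity)))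

/-- The inclusion of the Gaussian space `L²(∞)²` into `L²(m)²`. -/
def gaussInclusion (m : ℝ≥0∞) : L2sq ⊤ →L[ℂ] L2sq m :=
  LinearMap.mkContinuous
    { toFun := fun f => ((Lp.memLp f).mono_measure (weightedMeasure_le_top m)).toLp f
      map_add' := fun f g => by
        rw [← MemLp.toLp_add]
        refine (MemLp.toLp_eq_toLp_iff _ _).2 ?_
        exact (ae_weighted m).2 ((ae_weighted ⊤).1 (Lp.coeFn_add f g))
      map_smul' := fun c f => by
        rw [RingHom.id_apply, ← MemLp.toLp_const_smul]
        refine (MemLp.toLp_eq_toLp_iff _ _).2 ?_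
        exact (ae_weighted m).2 ((ae_weighted ⊤).1 (Lp.coeFn_smul c f)) }
    1 fun f => by
    rw [one_mul]
    change ‖((Lp.memLp f).mono_measure (weightedMeasure_le_top m)).toLp f‖ ≤ _
    rw [Lp.norm_toLp, Lp.norm_def]
    exact ENNReal.toReal_mono (Lp.memLp f).eLpNorm_ne_top
      (eLpNorm_mono_measure _ (weightedMeasure_le_top m))

lemma gaussInclusion_coeFn (m : ℝ≥0∞) (f : L2sq ⊤) : ⇑(gaussInclusion m f) =ᵐ[volume] f :=
  (ae_weighted m).1 (MemLp.coeFn_toLp ((Lp.memLp f).mono_measure (weightedMeasure_le_top m)))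

lemma eq_of_ae_volume {E : Type*} [NormedAddCommGroup E] {f g : L²(E, m)} (h : f =ᵐ[volume] g) :
    f = g :=
  Lp.ext ((ae_weighted m).2 h)

lemma KernelBound.gaussInclusion_op {κ : Plane → Plane → ℂ² →L[ℂ] ℂ²} {C' : ℝ}
    (h : KernelBound m κ C) (h' : KernelBound ⊤ κ C') (f : L2sq ⊤) :
    gaussInclusion m (h'.op f) = h.op (gaussInclusion m f) := by
  refine eq_of_ae_volume ?_
  refine (gaussInclusion_coeFn m _).trans ((h'.op_coeFn f).trans ?_)
  refine ((h.op_coeFn _).trans ?_).symm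
  rw [kernelFun_congr κ (gaussInclusion_coeFn m f)]

lemma gaussInclusion_semi (m : ℝ≥0∞) (t : ℝ) (f : L2sq ⊤) :
    gaussInclusion m (semi _ ⊤ t f) = semi _ m t (gaussInclusion m f) := by
  rcases le_or_gt t 0 with ht | ht
  · rw [semi_of_nonpos _ ht, semi_of_nonpos _ ht]; rfl
  · rw [semi_of_pos _ ht, semi_of_pos _ ht]
    exact (kernelBound_mehler m ht).gaussInclusion_op _ f

variable {h : Plane → ℝ} {A : Plane → ℂ² →L[ℂ] ℂ²}
  {c : ℝ}

lemma DriftCoeff.gaussInclusion_drift (D : DriftCoeff h A c) (m : ℝ≥0∞) (t : ℝ) (f : L2sq ⊤) :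
    gaussInclusion m (D.drift ⊤ t f) = D.drift m t (gaussInclusion m f) := by
  rcases le_or_gt t 0 with ht | ht
  · rw [D.drift_of_nonpos _ ht, D.drift_of_nonpos _ ht, zero_apply, zero_apply, map_zero]
  · rw [D.drift_of_pos _ ht, D.drift_of_pos _ ht]
    exact (D.kernelBound m ht).gaussInclusion_op _ f

/-- Intertwining operators for the unperturbed data intertwine the perturbed semigroups. -/
lemma PerturbationData.map_perturbed {X Y : Type*} [NormedAddCommGroup X] [NormedSpace ℂ X]
    [CompleteSpace X] [NormedAddCommGroup Y] [NormedSpace ℂ Y] [CompleteSpace Y]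
    {S K : ℝ → X →L[ℂ] X} {M β : ℝ} (P : PerturbationData S K M C β) {S' K' : ℝ → Y →L[ℂ] Y}
    {M' C' β' : ℝ} (P' : PerturbationData S' K' M' C' β') (L : X →L[ℂ] Y)
    (hS : ∀ t x, L (S t x) = S' t (L x)) (hK : ∀ t x, L (K t x) = K' t (L x)) (ht : 0 ≤ t)
    (x : X) : L (P.perturbed t x) = P'.perturbed t (L x) := by
  have hc := P.perturbed_continuous x
  refine P'.eq_perturbed (L.continuous.comp hc) (u := fun t => L (P.perturbed t x))
    (fun t ht => ?_) ht
  rw [P.perturbed_eq x ht, map_add, hS]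
  congr 1
  unfold volterra
  rw [← L.intervalIntegral_comp_comm (P.intervalIntegrable_K hc t le_rfl ht)]
  exact intervalIntegral.integral_congr fun s _ => hK s _

lemma DriftCoeff.gaussInclusion_perturbed (D : DriftCoeff h A c) (m : ℝ≥0∞) (ht : 0 ≤ t)
    (f : L2sq ⊤) : gaussInclusion m ((D.perturbationData ⊤).perturbed t f) =
      (D.perturbationData m).perturbed t (gaussInclusion m f) :=
  (D.perturbationData ⊤).map_perturbed (D.perturbationData m) _ (gaussInclusion_semi m)
    (D.gaussInclusion_drift m) ht f

lemma denseRange_gaussInclusion (m : ℝ≥0∞) : DenseRange (gaussInclusion m) := fun f => by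
  rw [Metric.mem_closure_iff]
  intro ε hε
  obtain ⟨g, hgm, hg, hgc, h⟩ := exists_norm_sub_toLp_le f (half_pos hε)
  have hgt : MemLp g 2 (weightedMeasure ⊤) := hg.memLp_of_hasCompactSupport hgc
  refine ⟨gaussInclusion m (hgt.toLp g), ⟨_, rfl⟩, ?_⟩
  have e : gaussInclusion m (hgt.toLp g) = hgm.toLp g :=
    eq_of_ae_volume (by
      filter_upwards [gaussInclusion_coeFn m (hgt.toLp g), (ae_weighted ⊤).1 hgt.coeFn_toLp,
        (ae_weighted m).1 hgm.coeFn_toLp] with x h1 h2 h3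
      rw [h1, h2, h3])
  rw [e, dist_eq_norm]
  linarith

lemma PerturbationData.generatorGraph_smul_iff {X : Type*} [NormedAddCommGroup X] [NormedSpace ℂ X]
    [CompleteSpace X] {S K : ℝ → X →L[ℂ] X} {M β : ℝ} (P : PerturbationData S K M C β) (w : X)
    (l : ℂ) : GeneratorGraph (fun t : ℝ≥0 => P.perturbed t) w (l • w) ↔
      ∀ t, 0 ≤ t → P.perturbed t w = Complex.exp (l * t) • w := by
  refine ⟨fun H t ht => P.perturbed_eigenvector H ht, fun H => ?_⟩
  rw [generatorGraph_iff_integral P.perturbed_continuous (P.perturbed_nonpos le_rfl)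
    (fun s t => P.perturbed_add)]
  intro t ht
  have hd : ∀ s : ℝ, HasDerivAt (fun s : ℝ => Complex.exp (l * s)) (Complex.exp (l * s) * l) s :=
      fun s => by
    have := ((Complex.ofRealCLM.hasDerivAt (x := s)).const_mul l).cexp
    simpa using this
  have e : ∀ s ∈ Set.uIcc 0 t, P.perturbed s (l • w) = (Complex.exp (l * s) * l) • w :=
      fun s hs => by
    rw [uIcc_of_le ht] at hs
    rw [map_smul, H s hs.1, smul_smul, mul_comm]
  rw [intervalIntegral.integral_congr e, intervalIntegral.integral_smul_const,
    intervalIntegral.integral_eq_sub_of_hasDerivAt (fun s _ => hd s)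
      ((by fun_prop : Continuous fun s : ℝ => Complex.exp (l * s) * l).intervalIntegrable _ _),
    H t ht]
  simp [sub_smul]

/-- The eigenvalue equation for the generator, in terms of the semigroup. -/
lemma DriftCoeff.kernelEq_smul_iff (D : DriftCoeff h A c) (w : L2sq m) (l : ℂ) :
    KernelEq h A w (l • w : L2sq m) ↔
      ∀ t, 0 ≤ t → (D.perturbationData m).perturbed t w = Complex.exp (l * t) • w :=
  (D.kernelEq_iff w (l • w)).trans ((D.perturbationData m).generatorGraph_perturbed_iff.symm.trans
    ((D.perturbationData m).generatorGraph_smul_iff w l))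

/-- Averaging `e^{-(l + 2πin)s} T(s) w` over a period gives eigenvectors of the generator out of an
eigenvector of the operator `T(1)` of the semigroup; by uniqueness of Fourier coefficients they do
not all vanish. -/
lemma PerturbationData.exists_eigenvector {X : Type*} [NormedAddCommGroup X] [NormedSpace ℂ X]
    [CompleteSpace X] {S K : ℝ → X →L[ℂ] X} {M β : ℝ} (P : PerturbationData S K M C β) {w : X}
    (hw : w ≠ 0) {l : ℂ} (h1 : P.perturbed 1 w = Complex.exp l • w) :
    ∃ (l' : ℂ) (v : X), v ≠ 0 ∧ l'.re = l.re ∧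
      ∀ t, 0 ≤ t → P.perturbed t v = Complex.exp (l' * t) • v := by
  by_contra! hno
  have hc := P.perturbed_continuous w
  have hce : ∀ l' : ℂ, Continuous fun s : ℝ => Complex.exp (-l' * s) • P.perturbed s w := fun l' =>
    (by fun_prop : Continuous fun s : ℝ => Complex.exp (-l' * s)).smul hc
  have hshift : ∀ l' : ℂ, Complex.exp l' = Complex.exp l → ∀ s : ℝ, 0 ≤ s →
      Complex.exp (-l' * (s + 1 : ℝ)) • P.perturbed (s + 1) w =
        Complex.exp (-l' * s) • P.perturbed s w := fun l' hl' s hs => by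
    rw [P.perturbed_add hs zero_le_one, ContinuousLinearMap.comp_apply, h1, map_smul, smul_smul,
      ← hl', ← Complex.exp_add]
    congr 2
    push_cast
    ring
  refine hw ?_
  have h0 : P.perturbed 0 w = w := by rw [P.perturbed_nonpos le_rfl]; rfl
  have key := eq_zero_of_fourier one_pos (F := fun s => Complex.exp (-l * s) • P.perturbed s w)
    (hce l) (by
      have := hshift l rfl 0 le_rfl
      rwa [zero_add] at this) fun n => ?_
  · simpa [h0] using key
  set l' : ℂ := l + n * (2 * π * Complex.I) with hl'
  have hexp : Complex.exp l' = Complex.exp l := by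
    rw [hl', Complex.exp_add, Complex.exp_int_mul_two_pi_mul_I, mul_one]
  set v := ∫ s in (0 : ℝ)..1, Complex.exp (-l' * s) • P.perturbed s w with hv
  have hval : ∫ s in (0 : ℝ)..1, Complex.exp (-(2 * π * n / 1 : ℝ) * Complex.I * s) •
      Complex.exp (-l * s) • P.perturbed s w = v := by
    refine intervalIntegral.integral_congr fun s _ => ?_
    simp only [smul_smul]
    rw [← Complex.exp_add]
    congr 2
    rw [hl']
    push_cast
    ring
  rw [hval]
  by_contra hv0
  obtain ⟨t, ht, hne⟩ := hno l' v hv0 (by rw [hl']; simp)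
  refine hne ?_
  have e1 : P.perturbed t v =
      Complex.exp (l' * t) • ∫ s in t..t + 1, Complex.exp (-l' * s) • P.perturbed s w := by
    rw [hv, ← ContinuousLinearMap.intervalIntegral_comp_comm _ ((hce l').intervalIntegrable _ _),
      ← intervalIntegral.integral_smul]
    have := intervalIntegral.integral_comp_add_right (a := 0) (b := 1)
      (fun s : ℝ => Complex.exp (l' * t) • Complex.exp (-l' * s) • P.perturbed s w) t
    rw [zero_add, add_comm (1 : ℝ) t] at this
    rw [← this]
    refine intervalIntegral.integral_congr fun s hs => ?_
    rw [uIcc_of_le zero_le_one] at hs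
    rw [map_smul, add_comm s t, P.perturbed_add ht hs.1, ContinuousLinearMap.comp_apply, smul_smul,
      ← Complex.exp_add]
    congr 2
    push_cast
    ring
  have hi := fun a b => (hce l').intervalIntegrable (μ := volume) a b
  have e2 : ∫ s in (1 : ℝ)..t + 1, Complex.exp (-l' * s) • P.perturbed s w =
      ∫ s in (0 : ℝ)..t, Complex.exp (-l' * s) • P.perturbed s w := by
    have := intervalIntegral.integral_comp_add_right (a := 0) (b := t)
      (fun s : ℝ => Complex.exp (-l' * s) • P.perturbed s w) 1
    rw [zero_add] at this
    rw [← this]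
    refine intervalIntegral.integral_congr fun s hs => ?_
    rw [uIcc_of_le ht] at hs
    exact hshift l' hexp s hs.1
  have e3 : ∫ s in t..t + 1, Complex.exp (-l' * s) • P.perturbed s w = v := by
    have h1 := integral_add_adjacent_intervals (hi 0 t) (hi t (t + 1))
    have h2 := integral_add_adjacent_intervals (hi 0 1) (hi 1 (t + 1))
    rw [← h2, e2, add_comm] at h1
    exact add_right_cancel h1
  rw [e1, e3]

/-- If the generator has no eigenvalue in the right half-plane on the Gaussian space, it has none on
`L²(m)²`, `m > 1`: the semigroup `T` at time one is compact on the dense Gaussian subspace, so that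
`z - T` is onto there if `|z| > 1`, while on `L²(m)²` the range of `z - T` is closed. -/
lemma DecayingDrift.eq_zero_of_kernelEq (D : DecayingDrift h A c)
    (H : ∀ l : ℂ, 0 < l.re → ∀ w : L2sq ⊤, KernelEq h A w (l • w : L2sq ⊤) → w = 0) (hm1 : 1 < m)
        {l : ℂ} (hl : 0 < l.re) {w : L2sq m} (hw : KernelEq h A w (l • w : L2sq m)) :
    w = 0 := by
  rcases eq_or_ne m ⊤ with rfl | hm
  · exact H l hl w hw
  have hM : 1 < m.toReal := by
    rw [← ENNReal.toReal_one]; exact (ENNReal.toReal_lt_toReal ENNReal.one_ne_top hm).2 hm1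
  set P := D.driftCoeff.perturbationData (E := ℂ²) m with hP
  set Q := D.driftCoeff.perturbationData (E := ℂ²) ⊤ with hQ
  have hw1 := (D.driftCoeff.kernelEq_smul_iff w l).1 hw 1 zero_le_one
  refine eq_zero_of_surjective (T := P.perturbed 1) (z₀ := Complex.exp l) (fun z hz => ?_)
    (by simpa using hw1)
  have hz1 : 1 < ‖z‖ := by
    refine lt_of_lt_of_le ?_ hz
    rw [Complex.norm_exp]
    exact one_lt_exp_iff.2 hl
  have hz0 : z ≠ 0 := norm_pos_iff.1 (by linarith)
  have hfred := D.isFredholm_perturbed (ne_zero_of_lt hm1) hm one_pos one_pos (z := z) (by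
    refine lt_of_le_of_lt ?_ hz1
    rw [one_mul]
    exact exp_le_one_iff.2 (by linarith))
  rw [Complex.ofReal_one, one_smul] at hfred
  have hcomp : IsCompactOperator (Q.perturbed 1) := by
    have h1 := (D.isCompactOperator_perturbed_sub ⊤ zero_le_one).add
        (isCompactOperator_semi_top one_pos)
    have e : Q.perturbed 1 = (Q.perturbed 1 - semi ℂ² ⊤ 1) + semi ℂ² ⊤ 1 := by abel
    rw [e]
    exact h1
  have hsurj : Function.Surjective (z • idL (L2sq ⊤) - Q.perturbed 1) := by
    rcases hcomp.hasEigenvalue_or_mem_resolventSet hz0 with hev | hres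
    · exfalso
      obtain ⟨x, hx⟩ := hev.exists_hasEigenvector
      have hx1 : Q.perturbed 1 x = Complex.exp (Complex.log z) • x := by
        rw [Complex.exp_log hz0]; exact hx.apply_eq_smul
      obtain ⟨l', v, hv, hre, hv'⟩ := Q.exists_eigenvector hx.2 hx1
      refine hv (H l' ?_ v ((D.driftCoeff.kernelEq_smul_iff v l').2 hv'))
      rw [hre, Complex.log_re]
      exact log_pos hz1
    · rw [spectrum.mem_resolventSet_iff] at hres
      exact (ContinuousLinearMap.isUnit_iff_bijective.1 hres).2
  have hcl : IsClosed (Set.range (z • idL (L2sq m) - P.perturbed 1)) := hfred.isClosed_range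
  rw [← Set.range_eq_univ, ← hcl.closure_eq]
  refine Dense.closure_eq ((denseRange_gaussInclusion m).mono ?_)
  rintro _ ⟨f, rfl⟩
  obtain ⟨g, rfl⟩ := hsurj f
  refine ⟨gaussInclusion m g, ?_⟩
  change z • gaussInclusion m g - P.perturbed 1 (gaussInclusion m g) =
    gaussInclusion m (z • g - Q.perturbed 1 g)
  rw [map_sub, map_smul, D.driftCoeff.gaussInclusion_perturbed m zero_le_one]

/-! ### The unperturbed semigroup on the Gaussian space -/

section Gaussian

variable {E : Type*} [NormedAddCommGroup E] [InnerProductSpace ℂ E]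

lemma KernelBound.op_congr [CompleteSpace F] {κ : Plane → Plane → E →L[ℂ] F} {C' : ℝ}
    (h : KernelBound m κ C) (h' : KernelBound m κ C') :
    h.op = h'.op :=
  ContinuousLinearMap.ext fun f => eq_of_ae_volume ((h.op_coeFn f).trans (h'.op_coeFn f).symm)

/-- On the Gaussian space the unperturbed semigroup is a contraction. -/
lemma norm_semi_top_le [CompleteSpace E] (t : ℝ) (f : L²(E, ⊤)) : ‖semi E ⊤ t f‖ ≤ ‖f‖ := by
  rcases le_or_gt t 0 with ht | ht
  · rw [semi_of_nonpos _ ht]; rfl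
  · have h : KernelBound ⊤ (mehlerKer E t) (sqrt 1) :=
      kernelBound_top ht (mehlerKer_meas t) (mehler_measurable t)
        (fun x y => (mehler_pos ht x y).le) (fun x y => by
          have := norm_mehlerKer_le (E := E) ht x y
          rw [one_mul] at this
          nlinarith [norm_nonneg (mehlerKer E t x y)]) zero_le_one fun x => by
        have e : ∀ y, ofReal (mehler t x y * gaussWeight y) =
            ofReal (gaussWeight x) * ofReal (mehler t y x) := fun y => by
          rw [← ofReal_mul (gaussWeight_pos x).le]
          exact congrArg _ (mehler_symm ht x y)
        simp only [e]
        rw [lintegral_const_mul' _ _ (by finiteness), lintegral_mehler_left ht, mul_one]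
        simp
    rw [semi_of_pos _ ht, (kernelBound_mehler ⊤ ht).op_congr h]
    refine (h.op.le_opNorm f).trans ?_
    have := h.norm_op_le.trans_eq sqrt_one
    exact mul_le_of_le_one_left (norm_nonneg _) this

lemma inner_top_eq (f g : L²(E, ⊤)) :
    (inner ℂ f g : ℂ) = ∫ x, exp (‖x‖ ^ 2 / 4) • (inner ℂ (f x) (g x) : ℂ) := by
  rw [L2.inner_def]
  refine (integral_withDensity_eq_integral_toReal_smul (μ := volume) (wt_measurable ⊤)
    (.of_forall fun x => (wt_ne_top ⊤ x).lt_top) _).trans ?_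
  refine integral_congr_ae (.of_forall fun x => ?_)
  dsimp only
  unfold wt
  rw [rho_top, ENNReal.toReal_ofReal (exp_pos _).le]

lemma integrable_inner_mehler (ht : 0 < t) (f g : L²(E, ⊤)) :
    Integrable (uncurry fun x y =>
      (exp (‖x‖ ^ 2 / 4) * mehler t x y) • (inner ℂ (g x) (f y) : ℂ)) (volume.prod volume) := by
  have hf := (memLp_weighted_iff.1 (Lp.memLp f)).1
  have hg := (memLp_weighted_iff.1 (Lp.memLp g)).1
  have hf2 := (memLp_weighted_iff.1 (Lp.memLp f)).2
  have hg2 := (memLp_weighted_iff.1 (Lp.memLp g)).2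
  have hK := kernelBound_mehler (E := E) ⊤ ht
  have hm : AEStronglyMeasurable (uncurry fun x y =>
      (exp (‖x‖ ^ 2 / 4) * mehler t x y) • (inner ℂ (g x) (f y) : ℂ))
      (volume.prod volume) := by
    have h1 : Continuous fun p : Plane × Plane => exp (‖p.1‖ ^ 2 / 4) * mehler t p.1 p.2 := by
      have := mehler_continuous t
      fun_prop
    exact h1.aestronglyMeasurable.smul (hg.comp_fst.inner hf.comp_snd)
  refine ⟨hm, ?_⟩
  rw [HasFiniteIntegral, lintegral_prod _ hm.enorm]
  have hG : AEMeasurable (fun z => ∫⁻ y, ‖mehlerKer E t z y (f y)‖ₑ) (weightedMeasure ⊤) :=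
    ((hK.aestronglyMeasurable_prod hf).enorm.lintegral_prod_right').mono_ac (weightedMeasure_ac ⊤)
  have hCS := lintegral_mul_sq_le (μ := weightedMeasure ⊤)
    (aestronglyMeasurable_weighted_iff.2 hg).enorm hG
  rw [lintegral_weightedMeasure, lintegral_weightedMeasure, lintegral_weightedMeasure] at hCS
  have hfin : (∫⁻ x, wt ⊤ x * (‖g x‖ₑ * ∫⁻ y, ‖mehlerKer E t x y (f y)‖ₑ)) ^ 2 < ⊤ :=
    hCS.trans_lt (ENNReal.mul_lt_top hg2 ((hK.lintegral_le hf).trans_lt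
      (ENNReal.mul_lt_top (by finiteness) hf2)))
  refine lt_of_le_of_lt (lintegral_mono fun x => ?_)
    ((ENNReal.pow_lt_top_iff.1 hfin).resolve_right (by norm_num))
  rw [← lintegral_const_mul' _ _ (by finiteness), ← lintegral_const_mul' _ _ (wt_ne_top ⊤ x)]
  refine lintegral_mono fun y => ?_
  have hk := (mehler_pos ht x y).le
  unfold wt
  rw [rho_top, ← ofReal_norm, ← ofReal_norm, ← ofReal_norm, ← ofReal_mul (norm_nonneg _),
    ← ofReal_mul (exp_pos _).le]
  refine ofReal_le_ofReal ?_
  simp only [uncurry, mehlerKer, smul_apply, idL_apply]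
  rw [norm_smul, norm_smul, norm_of_nonneg (by positivity), norm_real, norm_of_nonneg hk, mul_assoc]
  have := norm_inner_le_norm (𝕜 := ℂ) (g x) (f y)
  calc _ ≤ exp (‖x‖ ^ 2 / 4) * (mehler t x y * (‖g x‖ * ‖f y‖)) := by gcongr
    _ = _ := by ring

lemma inner_semi_top [CompleteSpace E] (ht : 0 < t) (f g : L²(E, ⊤)) :
    (inner ℂ g (semi E ⊤ t f) : ℂ) =
      ∫ x, ∫ y, (exp (‖x‖ ^ 2 / 4) * mehler t x y) • (inner ℂ (g x) (f y) : ℂ) := by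
  rw [inner_top_eq]
  refine integral_congr_ae ?_
  filter_upwards [semi_coeFn ht f,
    (kernelBound_mehler (E := E) ⊤ ht).ae_integrable (Lp.memLp f)] with x hx hi
  rw [hx]
  unfold kernelFun
  rw [← integral_inner hi, ← integral_smul]
  congr 1
  funext y
  simp only [mehlerKer, smul_apply, idL_apply, inner_smul_right, mul_smul]
  rw [← real_smul]

/-- On the Gaussian space the unperturbed semigroup is symmetric. -/
lemma semi_top_symm [CompleteSpace E] (t : ℝ) (f g : L²(E, ⊤)) :
    (inner ℂ (semi E ⊤ t f) g : ℂ) = inner ℂ f (semi E ⊤ t g) := by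
  rcases le_or_gt t 0 with ht | ht
  · rw [semi_of_nonpos _ ht]; rfl
  rw [← inner_conj_symm, inner_semi_top ht, inner_semi_top ht, ← integral_conj,
    integral_integral_swap (integrable_inner_mehler ht g f)]
  congr 1
  funext x
  rw [← integral_conj]
  congr 1
  funext y
  simp only [real_smul, map_mul, Complex.conj_ofReal, inner_conj_symm]
  rw [exp_mul_mehler_symm ht]

/-- The unperturbed case of the kernel equation. -/
lemma kernelEq_zero_iff [CompleteSpace E]
    (w f : L²(E, m)) :
    KernelEq (fun _ => 0) (fun _ => 0) w f ↔
      ∀ t, 0 ≤ t → semi E m t w = w + ∫ s in (0 : ℝ)..t, semi E m s f := by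
  have D : DriftCoeff (fun _ => 0) (fun _ => (0 : E →L[ℂ] E)) 0 :=
    ⟨measurable_const, stronglyMeasurable_const, le_rfl, by simp, by simp⟩
  have h0 : ∀ t, D.drift m t = 0 := fun t => by
    have := D.norm_drift_le m t
    rw [zero_mul, zero_mul, zero_div] at this
    exact norm_le_zero_iff.1 this
  rw [D.kernelEq_iff]
  simp only [volterra, h0, zero_apply, intervalIntegral.integral_zero, add_zero]

/-- The unperturbed generator is dissipative on the Gaussian space. -/
lemma re_inner_nonpos_of_kernelEq [CompleteSpace E] {w f : L²(E, ⊤)}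
    (h : KernelEq (fun _ => 0) (fun _ => 0) w f) : (inner ℂ w f : ℂ).re ≤ 0 :=
  re_inner_nonpos_of_contraction (R := semi E ⊤) (fun t _ => norm_semi_top_le t w)
    (kernelEq_zero_iff w f |>.1 h) (semi_continuous ⊤ f) (by rw [semi_of_nonpos _ le_rfl]; rfl)

end Gaussian

/-! ### The divergence of the regularised field -/

lemma kernelBound_first_order_gauss (ht : 0 < t)
    {κ : Plane → Plane → E →L[ℂ] F} (hκ : StronglyMeasurable (uncurry κ)) (hc : 0 ≤ c)
    (hle : ∀ x y, ‖κ x y‖ ≤ c * (1 + ‖x - damp t • y‖ / (2 * mvar t)) * mehler t x y) :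
    KernelBound ⊤ κ (c * driftConst ⊤ * exp (1 * t) / sqrt t) := by
  have ha := mvar_pos ht
  refine KernelBound.mono (C := sqrt (6 * c ^ 2 * (exp t / t)))
    ⟨hκ, sqrt_nonneg _, fun g hg => ?_⟩ ?_
  · rw [ofReal_sqrt_sq (by positivity)]
    have hm : Measurable fun y => ofReal (gaussWeight y) :=
      measurable_ofReal.comp gaussWeight_continuous.measurable
    have hqm : Measurable (uncurry fun x y : Plane => 2 * c ^ 2 *
        ((1 + ‖x - damp t • y‖ ^ 2 / (4 * mvar t ^ 2)) * mehler t x y)) := by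
      have := mehler_continuous t
      exact Continuous.measurable (by unfold uncurry; fun_prop)
    rw [← one_mul (ofReal (6 * c ^ 2 * (exp t / t)))]
    refine schur_test (W := wt ⊤) (p := fun y => ofReal (gaussWeight y))
      (p' := fun y => ofReal (gaussWeight y)) (q := fun x y => ‖κ x y‖ₑ)
      (q₁ := fun x y => ofReal (mehler t x y)) (q₂ := fun x y => ofReal (2 * c ^ 2 *
        ((1 + ‖x - damp t • y‖ ^ 2 / (4 * mvar t ^ 2)) * mehler t x y)))
      (wt_measurable ⊤) hm hm (fun y => by simpa using gaussWeight_pos y) (by simp)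
      (measurable_ofReal.comp (mehler_measurable t)) (measurable_ofReal.comp hqm)
      (fun x y => ?_) (fun x => ?_) (fun y => ?_) hg
    · rw [← ofReal_norm, ← ofReal_pow (norm_nonneg _),
        ← ofReal_mul (mehler_pos ht x y).le, mul_comm]
      exact ofReal_le_ofReal (sq_mul_gauss_le ha _ (hle x y) (norm_nonneg _))
    · have e : ∀ y, ofReal (mehler t x y) * ofReal (gaussWeight y) =
          ofReal (gaussWeight x) * ofReal (mehler t y x) := fun y => by
        rw [← ofReal_mul (gaussWeight_pos x).le, ← ofReal_mul (mehler_pos ht x y).le]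
        exact congrArg _ (mehler_symm ht x y)
      simp only [e]
      rw [lintegral_const_mul' _ _ (by finiteness), lintegral_mehler_left ht, mul_one, one_mul]
    · simp only [wt_top_mul_gaussWeight, one_mul, mul_one]
      refine (lintegral_moment_le (z := fun x => x - damp t • y) ha (by positivity)
        (by fun_prop) (lintegral_gauss_sub ha _).le
        (lintegral_gauss_sub (by positivity) _).le).trans ?_
      rw [mul_one]
      exact ofReal_le_ofReal (two_mul_one_add_le ht c)
  · rw [← sqrt_driftConst_eq hc, mul_assoc (6 * c ^ 2 * (exp t / t))]
    refine sqrt_le_sqrt (le_mul_of_one_le_right (by positivity) ?_)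
    nlinarith [one_le_schurConst ⊤, one_le_exp ht.le]

/-- The kernel of `w ↦ div (e^{tL} w)`. -/
def divKer (t : ℝ) (x y : Plane) : ℂ² →L[ℂ] ℂ :=
  ∑ i, ((-(2 * mvar t)⁻¹ * (x i - damp t * y i) * mehler t x y : ℝ) : ℂ) • proj i

lemma divKer_apply (t : ℝ) (x y : Plane) (v : ℂ²) :
    divKer t x y v = ∑ i, ((-(2 * mvar t)⁻¹ * (x i - damp t * y i) * mehler t x y : ℝ) : ℂ)
      * v i := by
  simp only [divKer, sum_apply, smul_apply, smul_eq_mul]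
  rfl

lemma divKer_meas (t : ℝ) : StronglyMeasurable (uncurry (divKer t)) := by
  have := mehler_continuous t
  refine Continuous.stronglyMeasurable ?_
  unfold uncurry divKer
  refine continuous_finsetSum _ fun i _ => Continuous.smul (Complex.continuous_ofReal.comp ?_)
    continuous_const
  fun_prop

lemma norm_proj_le (i : Fin 2) : ‖(proj i : ℂ² →L[ℂ] ℂ)‖ ≤ 1 :=
  ContinuousLinearMap.opNorm_le_bound _ zero_le_one fun v => by
    rw [one_mul]; exact PiLp.norm_apply_le v i

lemma norm_divKer_le (ht : 0 < t) (x y : Plane) : ‖divKer t x y‖ ≤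
    2 * (1 + ‖x - damp t • y‖ / (2 * mvar t)) * mehler t x y := by
  have ha := mvar_pos ht
  have hk := mehler_pos ht x y
  have h : ∀ i, ‖((-(2 * mvar t)⁻¹ * (x i - damp t * y i) * mehler t x y : ℝ) : ℂ) •
      (proj i : ℂ² →L[ℂ] ℂ)‖ ≤ (1 + ‖x - damp t • y‖ / (2 * mvar t)) * mehler t x y := fun i => by
    rw [norm_smul, norm_real, norm_eq_abs, abs_mul, abs_mul, abs_neg,
      abs_of_pos (by positivity : 0 < (2 * mvar t)⁻¹), abs_of_pos hk]
    have h1 := abs_coord_le (x - damp t • y) i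
    simp only [PiLp.sub_apply, PiLp.smul_apply, smul_eq_mul] at h1
    calc _ ≤ (2 * mvar t)⁻¹ * ‖x - damp t • y‖ * mehler t x y * 1 := by
          refine mul_le_mul (mul_le_mul_of_nonneg_right (mul_le_mul_of_nonneg_left h1
            (by positivity)) hk.le) (norm_proj_le i) (norm_nonneg _) (by positivity)
      _ ≤ _ := by
          rw [mul_one, div_eq_inv_mul]
          exact mul_le_mul_of_nonneg_right (by linarith) hk.le
  refine (norm_sum_le_of_le _ fun i _ => h i).trans (le_of_eq ?_)
  rw [Finset.sum_const, Finset.card_univ, Fintype.card_fin, nsmul_eq_mul]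
  push_cast
  ring

lemma kernelBound_div (ht : 0 < t) :
    KernelBound ⊤ (divKer t) (2 * driftConst ⊤ * exp (1 * t) / sqrt t) :=
  kernelBound_first_order_gauss ht (divKer_meas t) zero_le_two (norm_divKer_le ht)

/-- The operator `w ↦ div (e^{tL} w)` on the Gaussian space, for `t > 0`. -/
def divSemi (t : ℝ) : L2sq ⊤ →L[ℂ] L²(ℂ, ⊤) := if ht : 0 < t then (kernelBound_div ht).op else 0

lemma divSemi_of_pos (ht : 0 < t) : divSemi t = (kernelBound_div ht).op := dif_pos ht

lemma divSemi_coeFn (ht : 0 < t) (f : L2sq ⊤) :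
    ⇑(divSemi t f) =ᵐ[volume] kernelFun (divKer t) f := by
  rw [divSemi_of_pos ht]
  exact (kernelBound_div ht).op_coeFn f

lemma norm_divSemi_le (t : ℝ) : ‖divSemi t‖ ≤ 2 * driftConst ⊤ * exp (1 * t) / sqrt t := by
  unfold divSemi
  split_ifs with ht
  · exact (kernelBound_div ht).norm_op_le
  · rw [norm_zero]
    have := driftConst_nonneg ⊤
    positivity

lemma integral_mehler_mul_coord (hs : 0 < s) (ht : 0 < t) (x y : Plane) (i : Fin 2)
    (c d : ℝ) : (Integrable fun z : Plane => mehler s x z * mehler t z y * (c + d * z i)) ∧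
    ∫ z : Plane, mehler s x z * mehler t z y * (c + d * z i) = mehler (s + t) x y * (c + d *
      ((mvar (s + t))⁻¹ * (mvar s * damp t * y i + damp s * mvar t * x i))) := by
  have hast := mvar_pos (add_pos hs ht)
  set σ := mvar s * mvar t / mvar (s + t) with hσ
  have hσ0 : 0 < σ := div_pos (mul_pos (mvar_pos hs) (mvar_pos ht)) hast
  set p := (mvar (s + t))⁻¹ • ((mvar s * damp t) • y + (damp s * mvar t) • x) with hp
  have e : ∀ z : Plane, mehler s x z * mehler t z y * (c + d * z i) =
      mehler (s + t) x y * c * gauss σ (z - p) + mehler (s + t) x y * d *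
        (gauss σ (z - p) * (proj i : Plane →L[ℝ] ℝ) z) := fun z => by
    rw [mehler_mul hs ht x z y, ← hσ, ← hp, show (proj i : Plane →L[ℝ] ℝ) z = z i from rfl]
    ring
  have h1 := (integrable_gauss_sub hσ0 p).const_mul (mehler (s + t) x y * c)
  have h2 := (integrable_gauss_sub_mul_clm hσ0 p
    (proj i : Plane →L[ℝ] ℝ)).const_mul (mehler (s + t) x y * d)
  simp only [e]
  refine ⟨h1.add h2, ?_⟩
  rw [integral_add h1 h2, integral_const_mul, integral_const_mul, integral_gauss_sub hσ0,
    integral_gauss_mul_inner hσ0, show (proj i : Plane →L[ℝ] ℝ) p = p i from rfl, hp]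
  simp only [PiLp.smul_apply, PiLp.add_apply, smul_eq_mul]
  ring

lemma integral_sum_ofReal_mul {R : Fin 2 → Plane → ℝ} {r : Fin 2 → ℝ}
    (h : ∀ i, Integrable (R i) ∧ ∫ z, R i z = r i) (v : ℂ²) :
    ∫ z, ∑ i, ((R i z : ℝ) : ℂ) * v i = ∑ i, ((r i : ℝ) : ℂ) * v i := by
  refine (integral_finsetSum _ fun i _ => ((h i).1.ofReal (𝕜 := ℂ)).mul_const (v i)).trans ?_
  refine Finset.sum_congr rfl fun i _ => ?_
  exact (integral_mul_const _ _).trans (congrArg (· * v i)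
    (integral_ofReal.trans (congrArg _ (h i).2)))

lemma integral_divKer_mehlerKer (hs : 0 < s) (ht : 0 < t) (x y : Plane)
    (v : ℂ²) :
    ∫ z, divKer s x z (mehlerKer _ t z y v) = divKer (s + t) x y v := by
  have ha := mvar_pos hs
  have hast := mvar_pos (add_pos hs ht)
  have hadd := mvar_add s t
  rw [divKer_apply, ← integral_sum_ofReal_mul (R := fun i z => mehler s x z * mehler t z y *
    (-(2 * mvar s)⁻¹ * x i + (2 * mvar s)⁻¹ * damp s * z i)) (fun i => ?_) v]
  · congr 1
    funext z
    rw [divKer_apply]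
    refine Finset.sum_congr rfl fun i _ => ?_
    simp only [mehlerKer, smul_apply, idL_apply, PiLp.smul_apply, smul_eq_mul]
    push_cast
    ring
  · have h := integral_mehler_mul_coord hs ht x y i (-(2 * mvar s)⁻¹ * x i)
      ((2 * mvar s)⁻¹ * damp s)
    refine ⟨h.1, h.2.trans ?_⟩
    rw [damp_add]
    field_simp
    rw [hadd]
    ring

lemma integral_mehlerKer_divKer (hs : 0 < s) (ht : 0 < t) (x y : Plane)
    (v : ℂ²) :
    ∫ z, mehlerKer ℂ s x z (divKer t z y v) = (((damp s : ℝ) : ℂ) • divKer (s + t) x y) v := by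
  have ha := mvar_pos ht
  have hast := mvar_pos (add_pos hs ht)
  have hadd := mvar_add s t
  rw [smul_apply, divKer_apply, smul_eq_mul, Finset.mul_sum]
  have e : ∀ i, ((damp s : ℝ) : ℂ) * (((-(2 * mvar (s + t))⁻¹ *
      (x i - damp (s + t) * y i) * mehler (s + t) x y : ℝ) : ℂ) * v i) =
      ((damp s * (-(2 * mvar (s + t))⁻¹ *
      (x i - damp (s + t) * y i) * mehler (s + t) x y) : ℝ) : ℂ) * v i := fun i => by
    push_cast; ring
  simp only [e]
  rw [← integral_sum_ofReal_mul (R := fun i z => mehler s x z * mehler t z y *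
    ((2 * mvar t)⁻¹ * damp t * y i + -(2 * mvar t)⁻¹ * z i)) (fun i => ?_) v]
  · congr 1
    funext z
    simp only [mehlerKer, smul_apply, idL_apply, smul_eq_mul]
    rw [divKer_apply, Finset.mul_sum]
    refine Finset.sum_congr rfl fun i _ => ?_
    push_cast
    ring
  · have h := integral_mehler_mul_coord hs ht x y i ((2 * mvar t)⁻¹ * damp t * y i)
      (-(2 * mvar t)⁻¹)
    refine ⟨h.1, h.2.trans ?_⟩
    rw [damp_add]
    field_simp
    rw [hadd]
    ring

lemma divSemi_semi (hs : 0 < s) (ht : 0 ≤ t) (f : L2sq ⊤) :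
    divSemi s (semi _ ⊤ t f) = divSemi (s + t) f := by
  rcases ht.eq_or_lt with rfl | ht
  · rw [semi_of_nonpos _ le_rfl, add_zero]; rfl
  rw [divSemi_of_pos hs, divSemi_of_pos (add_pos hs ht), semi_of_pos _ ht,
    ← (kernelBound_div hs).op_comp (kernelBound_mehler ⊤ ht) (kernelBound_div (add_pos hs ht))
      (integral_divKer_mehlerKer hs ht)]
  rfl

/-- `e^{tL}` commutes with the divergence up to the factor `e^{-t/2}`. -/
lemma semi_divSemi (hs : 0 ≤ s) (ht : 0 < t) (f : L2sq ⊤) :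
    semi ℂ ⊤ s (divSemi t f) = ((damp s : ℝ) : ℂ) • divSemi (s + t) f := by
  rcases hs.eq_or_lt with rfl | hs
  · rw [semi_of_nonpos _ le_rfl, zero_add]; simp [damp]
  have h3 : KernelBound ⊤ (fun x y => ((damp s : ℝ) : ℂ) • divKer (s + t) x y)
      (2 * driftConst ⊤ * exp (1 * (s + t)) / sqrt (s + t)) :=
    kernelBound_first_order_gauss (add_pos hs ht) (show StronglyMeasurable (((damp s : ℝ) : ℂ) •
      uncurry (divKer (s + t))) from (divKer_meas (s + t)).const_smul _) zero_le_two
      fun x y => by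
        rw [norm_smul, norm_real, norm_of_nonneg (damp_pos s).le]
        exact (mul_le_of_le_one_left (norm_nonneg _) (damp_le_one hs.le)).trans
          (norm_divKer_le (add_pos hs ht) x y)
  have h := (kernelBound_mehler (E := ℂ) ⊤ hs).op_comp (kernelBound_div ht) h3
    (integral_mehlerKer_divKer hs ht)
  rw [semi_of_pos _ hs, divSemi_of_pos ht, ← ContinuousLinearMap.comp_apply, h]
  refine eq_of_ae_volume ((h3.op_coeFn f).trans ?_)
  filter_upwards [divSemi_coeFn (add_pos hs ht) f, (ae_weighted ⊤).1
    (Lp.coeFn_smul ((damp s : ℝ) : ℂ) (divSemi (s + t) f))] with x h1 h2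
  rw [h2, Pi.smul_apply, h1]
  unfold kernelFun
  rw [← integral_smul]
  rfl

lemma continuousOn_divSemi (f : L2sq ⊤) : ContinuousOn (fun t => divSemi t f) (Set.Ioi 0) :=
    fun t ht => by
  have ht : 0 < t := ht
  refine ContinuousAt.continuousWithinAt ?_
  have h : Continuous fun s => divSemi (t / 2) (semi _ ⊤ (s - t / 2) f) :=
    (divSemi (t / 2)).continuous.comp
        ((semi_continuous ⊤ f).comp (continuous_id.sub continuous_const))
  refine h.continuousAt.congr ?_
  filter_upwards [lt_mem_nhds (half_lt_self ht)] with s hs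
  rw [divSemi_semi (half_pos ht) (by linarith), add_sub_cancel]

/-! ### Rotations and angular modes -/

/-- The rotation of the plane by the angle `φ`. -/
def rot (φ : ℝ) : Plane ≃ₗᵢ[ℝ] Plane :=
  LinearIsometry.toLinearIsometryEquiv
    { toFun := fun x => !₂[cos φ * x 0 - sin φ * x 1, sin φ * x 0 + cos φ * x 1]
      map_add' := fun x y => by ext i; fin_cases i <;> simp <;> ring
      map_smul' := fun r x => by ext i; fin_cases i <;> simp <;> ring
      norm_map' := fun x => by
        rw [← sq_eq_sq₀ (norm_nonneg _) (norm_nonneg _), plane_norm_sq, plane_norm_sq]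
        simp
        linear_combination (x 0 ^ 2 + x 1 ^ 2) * cos_sq_add_sin_sq φ } rfl

@[simp] lemma rot_apply_zero (φ : ℝ) (x : Plane) : rot φ x 0 = cos φ * x 0 - sin φ * x 1 := rfl

@[simp] lemma rot_apply_one (φ : ℝ) (x : Plane) : rot φ x 1 = sin φ * x 0 + cos φ * x 1 := rfl

lemma rot_rot (φ ψ : ℝ) (x : Plane) : rot φ (rot ψ x) = rot (φ + ψ) x := by
  ext i
  fin_cases i <;> simp [cos_add, sin_add] <;> ring

lemma rot_zero (x : Plane) : rot 0 x = x := by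
  ext i
  fin_cases i <;> simp

lemma rot_continuous : Continuous fun p : ℝ × Plane => rot p.1 p.2 := by
  refine (PiLp.continuous_toLp 2 _).comp (continuous_pi fun i => ?_)
  fin_cases i
  · change Continuous fun p : ℝ × Plane => cos p.1 * p.2 0 - sin p.1 * p.2 1
    fun_prop
  · change Continuous fun p : ℝ × Plane => sin p.1 * p.2 0 + cos p.1 * p.2 1
    fun_prop

/-- The quarter turn `(v₁, v₂) ↦ (-v₂, v₁)` of complex vectors. -/
def turn : ℂ² →L[ℂ] ℂ² := unitOp 0 1 - unitOp 1 0

@[simp] lemma turn_apply_zero (v : ℂ²) : turn v 0 = -v 1 := by simp [turn, unitOp_apply]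

@[simp] lemma turn_apply_one (v : ℂ²) : turn v 1 = v 0 := by simp [turn, unitOp_apply]

/-- The rotation of complex vectors by the angle `φ`. -/
def rotC (φ : ℝ) : ℂ² →L[ℂ] ℂ² := ((cos φ : ℝ) : ℂ) • idL _ + ((sin φ : ℝ) : ℂ) • turn

lemma rotC_apply (φ : ℝ) (v : ℂ²) :
    rotC φ v = ((cos φ : ℝ) : ℂ) • v + ((sin φ : ℝ) : ℂ) • turn v := rfl

@[simp] lemma rotC_apply_zero (φ : ℝ) (v : ℂ²) : rotC φ v 0 = cos φ * v 0 - sin φ * v 1 := by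
  simp [rotC_apply]; ring

@[simp] lemma rotC_apply_one (φ : ℝ) (v : ℂ²) : rotC φ v 1 = sin φ * v 0 + cos φ * v 1 := by
  simp [rotC_apply]; ring

lemma rotC_rotC (φ ψ : ℝ) (v : ℂ²) : rotC φ (rotC ψ v) = rotC (φ + ψ) v := by
  ext i
  fin_cases i <;> simp [cos_add, sin_add, -Complex.ofReal_cos, -Complex.ofReal_sin] <;> ring

lemma rotC_real_smul (φ r : ℝ) (v : ℂ²) : rotC φ (r • v) = r • rotC φ v :=
  (rotC φ).map_smul_of_tower r v

lemma rotC_zero (v : ℂ²) : rotC 0 v = v := by simp [rotC_apply]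

lemma mehler_rot (s φ : ℝ) (x y : Plane) : mehler s (rot φ x) (rot φ y) = mehler s x y := by
  unfold mehler gauss
  rw [← map_smul, ← map_sub, LinearIsometryEquiv.norm_map]

lemma cross_rot (φ : ℝ) (x y : Plane) : cross (rot φ x) (rot φ y) = cross x y := by
  simp only [cross, rot_apply_zero, rot_apply_one]
  linear_combination (x 1 * y 0 - x 0 * y 1) * cos_sq_add_sin_sq φ

lemma mehlerLogDeriv_rot (s φ : ℝ) (x y : Plane) :
    mehlerLogDeriv s (rot φ x) (rot φ y) = mehlerLogDeriv s x y := by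
  unfold mehlerLogDeriv
  rw [← map_smul, ← map_sub, LinearIsometryEquiv.norm_map]
  simp only [rot_apply_zero, rot_apply_one]
  linear_combination (-(damp s * ((x 0 - damp s * y 0) * y 0 +
    (x 1 - damp s * y 1) * y 1) / (4 * mvar s))) * cos_sq_add_sin_sq φ

/-- The bilinear product `v ↦ y · v` of a complex vector with a point of the plane. -/
def dotC (y : Plane) : ℂ² →L[ℂ] ℂ := (y 0 : ℂ) • proj 0 + (y 1 : ℂ) • proj 1

lemma dotC_apply (y : Plane) (v : ℂ²) : dotC y v = y 0 * v 0 + y 1 * v 1 := rfl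

/-- The vector `y^⊥`, with complex entries. -/
def perpC (y : Plane) : ℂ² := !₂[-(y 1 : ℂ), (y 0 : ℂ)]

lemma dotC_rot (φ : ℝ) (y : Plane) (v : ℂ²) : dotC (rot φ y) (rotC φ v) = dotC y v := by
  have h := congrArg (fun r : ℝ => (r : ℂ)) (cos_sq_add_sin_sq φ)
  push_cast [-Complex.ofReal_cos, -Complex.ofReal_sin] at h
  simp only [dotC_apply, rot_apply_zero, rot_apply_one, rotC_apply_zero, rotC_apply_one]
  push_cast [-Complex.ofReal_cos, -Complex.ofReal_sin]
  linear_combination (y 0 * v 0 + y 1 * v 1) * h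

lemma stretch_eq (α : ℝ) (y : Plane) (v : ℂ²) : stretch α y v =
    (α : ℂ) • ((2 * deriv profile (‖y‖ ^ 2) * dotC y v) • perpC y +
      (profile (‖y‖ ^ 2) : ℂ) • turn v) := by
  ext i
  fin_cases i <;>
  · simp [stretch_apply, Fin.sum_univ_two, partialDeriv_velocity, dotC_apply, perpC]
    ring

lemma stretch_rot (α φ : ℝ) (y : Plane) (v : ℂ²) :
    stretch α (rot φ y) (rotC φ v) = rotC φ (stretch α y v) := by
  have h1 : perpC (rot φ y) = rotC φ (perpC y) := by
    ext i
    fin_cases i <;> simp [perpC] <;> ring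
  have h2 : turn (rotC φ v) = rotC φ (turn v) := by
    ext i
    fin_cases i <;> simp <;> ring
  rw [stretch_eq, stretch_eq, dotC_rot, LinearIsometryEquiv.norm_map, h1, h2, map_smul, map_add,
    map_smul, map_smul]

lemma driftKer_rot (α s φ : ℝ) (x y : Plane) (v : ℂ²) :
    driftKer (fun y => α * profile (‖y‖ ^ 2)) (stretch α) s (rot φ x) (rot φ y) (rotC φ v) =
      rotC φ (driftKer (fun y => α * profile (‖y‖ ^ 2)) (stretch α) s x y v) := by
  simp only [driftKer, smul_apply, add_apply, idL_apply, mehler_rot, cross_rot,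
    LinearIsometryEquiv.norm_map, stretch_rot, map_smul, map_add]

/-- The rotated field `x ↦ ρ_φ⁻¹ w(ρ_φ x)`. -/
def rotFun (φ : ℝ) (w : Plane → ℂ²) (x : Plane) : ℂ² := rotC (-φ) (w (rot φ x))

lemma integral_rotFun (φ : ℝ) (T : Plane → ℂ² → ℂ²)
    (T' : Plane → ℂ² → ℂ²)
    (hT : ∀ y v, T' (rot φ y) (rotC φ v) = rotC φ (T y v)) (w : Plane → ℂ²) :
    ∫ y, T y (rotFun φ w y) = rotC (-φ) (∫ y, T' y (w y)) := by
  have hinv : ∀ v, rotC (-φ) (rotC φ v) = v := fun v => by rw [rotC_rotC, neg_add_cancel, rotC_zero]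
  have hinv' : ∀ v, rotC φ (rotC (-φ) v) = v :=
      fun v => by rw [rotC_rotC, add_neg_cancel, rotC_zero]
  let L := ContinuousLinearEquiv.equivOfInverse (rotC (-φ)) (rotC φ) hinv' hinv
  change _ = L _
  rw [← L.integral_comp_comm, ← (rot φ).measurePreserving.integral_comp
    (rot φ).toHomeomorph.measurableEmbedding fun y => L (T' y (w y))]
  congr 1
  funext y
  change _ = rotC (-φ) _
  rw [← hinv (T _ _), ← hT, rotFun, hinv']

lemma KernelEq.congr {h : Plane → ℝ}
    {A : Plane → E →L[ℂ] E} {w w' f f' : Plane → E} (H : KernelEq h A w f) (hw : w =ᵐ[volume] w')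
    (hf : f =ᵐ[volume] f') : KernelEq h A w' f' := fun s hs x => by
  rw [← integral_congr_ae (hw.mono fun y hy => congrArg _ hy),
    ← integral_congr_ae (hf.mono fun y hy => congrArg _ hy), H s hs x,
    integral_congr_ae (hw.mono fun y hy => congrArg (driftKer h A s x y) hy)]

lemma KernelEq.rotFun {α φ : ℝ} {w f : Plane → ℂ²}
    (h : KernelEq (fun y => α * profile (‖y‖ ^ 2)) (stretch α) w f) :
    KernelEq (fun y => α * profile (‖y‖ ^ 2)) (stretch α) (rotFun φ w) (rotFun φ f) :=
        fun s hs x => by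
  rw [integral_rotFun φ (fun y v => driftKer _ _ s x y v)
      (fun y v => driftKer (fun y => α * profile (‖y‖ ^ 2)) (stretch α) s (rot φ x) y v)
      (fun y v => driftKer_rot α s φ x y v),
    integral_rotFun φ (fun y v => (mehlerLogDeriv s x y * mehler s x y) • v)
      (fun y v => (mehlerLogDeriv s (rot φ x) y * mehler s (rot φ x) y) • v)
      (fun y v => by rw [mehlerLogDeriv_rot, mehler_rot, rotC_real_smul]),
    integral_rotFun φ (fun y v => mehler s x y • v) (fun y v => mehler s (rot φ x) y • v)
      (fun y v => by rw [mehler_rot, rotC_real_smul]), ← map_sub, h s hs]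

lemma measurePreserving_rot (m : ℝ≥0∞) (φ : ℝ) :
    MeasurePreserving (rot φ) (weightedMeasure m) (weightedMeasure m) := by
  refine ⟨(rot φ).continuous.measurable, Measure.ext fun s hs => ?_⟩
  rw [Measure.map_apply (rot φ).continuous.measurable hs, weightedMeasure_eq,
    withDensity_apply _ hs, withDensity_apply _ ((rot φ).continuous.measurable hs),
    ← (rot φ).measurePreserving.setLIntegral_comp_preimage hs (wt_measurable m)]
  simp only [wt, LinearIsometryEquiv.norm_map]

/-- The rotation of vector fields, as an operator on the weighted space. -/
def rotOp (m : ℝ≥0∞) (φ : ℝ) : L2sq m →L[ℂ] L2sq m :=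
  ((rotC (-φ)).compLpL 2 (weightedMeasure m)).comp
    (Lp.compMeasurePreservingₗᵢ ℂ (rot φ) (measurePreserving_rot m φ)).toContinuousLinearMap

lemma rotOp_coeFn (m : ℝ≥0∞) (φ : ℝ) (w : L2sq m) : ⇑(rotOp m φ w) =ᵐ[volume] rotFun φ w := by
  refine (ae_weighted m).1 ?_
  filter_upwards [(rotC (-φ)).coeFn_compLpL
      (Lp.compMeasurePreserving (rot φ) (measurePreserving_rot m φ) w),
    Lp.coeFn_compMeasurePreserving w (measurePreserving_rot m φ)] with x h1 h2
  refine h1.trans ?_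
  rw [h2]
  rfl

lemma rotOp_rotOp (m : ℝ≥0∞) (φ ψ : ℝ) (w : L2sq m) :
    rotOp m φ (rotOp m ψ w) = rotOp m (φ + ψ) w := by
  refine eq_of_ae_volume ?_
  filter_upwards [rotOp_coeFn m φ (rotOp m ψ w), rotOp_coeFn m (φ + ψ) w,
    (rot φ).measurePreserving.quasiMeasurePreserving.ae (rotOp_coeFn m ψ w)] with x h1 h2 h3
  rw [h1, h2, rotFun, h3, rotFun, rotFun, rotC_rotC, rot_rot, neg_add, add_comm ψ]

lemma rotOp_two_pi (m : ℝ≥0∞) (φ : ℝ) (w : L2sq m) : rotOp m (φ + 2 * π) w = rotOp m φ w := by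
  refine eq_of_ae_volume ?_
  filter_upwards [rotOp_coeFn m (φ + 2 * π) w, rotOp_coeFn m φ w] with x h1 h2
  rw [h1, h2, rotFun, rotFun]
  have e1 : rot (φ + 2 * π) x = rot φ x := by ext i; fin_cases i <;> simp
  have e2 : ∀ v, rotC (-(φ + 2 * π)) v = rotC (-φ) v := fun v => by
    simp only [rotC_apply, cos_neg, sin_neg, cos_add_two_pi, sin_add_two_pi]
  rw [e1, e2]

lemma rotOp_zero (m : ℝ≥0∞) (w : L2sq m) : rotOp m 0 w = w := by
  refine eq_of_ae_volume ?_
  filter_upwards [rotOp_coeFn m 0 w] with x h1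
  rw [h1, rotFun, rot_zero, neg_zero, rotC_zero]

lemma continuous_rotOp (m : ℝ≥0∞) (w : L2sq m) : Continuous fun φ => rotOp m φ w := by
  let C : ℝ → L2sq m := fun φ => Lp.compMeasurePreserving (rot φ) (measurePreserving_rot m φ) w
  have hC : Continuous C :=
    (Lp.compMeasurePreserving_continuous (μ := weightedMeasure m) (ν := weightedMeasure m)
      (E := ℂ²) (p := 2) (by norm_num)).comp (f := fun φ : ℝ => (w,
        (⟨⟨rot φ, (rot φ).continuous⟩, measurePreserving_rot m φ⟩ :
          {f : C(Plane, Plane) // MeasurePreserving f (weightedMeasure m) (weightedMeasure m)})))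
      (continuous_const.prodMk (Continuous.subtype_mk
        (ContinuousMap.continuous_of_continuous_uncurry _ rot_continuous) _))
  have h : ∀ φ, rotOp m φ w = ((cos φ : ℝ) : ℂ) • C φ -
      ((sin φ : ℝ) : ℂ) • turn.compLpL 2 (weightedMeasure m) (C φ) := fun φ => by
    refine Lp.ext ?_
    filter_upwards [(rotC (-φ)).coeFn_compLpL (C φ), turn.coeFn_compLpL (C φ),
      Lp.coeFn_sub (((cos φ : ℝ) : ℂ) • C φ) (((sin φ : ℝ) : ℂ) •
        turn.compLpL 2 (weightedMeasure m) (C φ)), Lp.coeFn_smul ((cos φ : ℝ) : ℂ) (C φ),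
      Lp.coeFn_smul ((sin φ : ℝ) : ℂ) (turn.compLpL 2 (weightedMeasure m) (C φ))]
      with x h1 h2 h3 h4 h5
    refine h1.trans ?_
    rw [h3, Pi.sub_apply, h4, h5, Pi.smul_apply, Pi.smul_apply, h2, rotC_apply, cos_neg,
      sin_neg, Complex.ofReal_neg, neg_smul, sub_eq_add_neg]
  simp only [h]
  have := turn.compLpL 2 (weightedMeasure m) |>.continuous.comp hC
  have h1 : Continuous fun φ : ℝ => ((cos φ : ℝ) : ℂ) := by fun_prop
  have h2 : Continuous fun φ : ℝ => ((sin φ : ℝ) : ℂ) := by fun_prop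
  exact (h1.smul hC).sub (h2.smul this)

lemma eq_zero_of_fourier_modes {X ι : Type*} [NormedAddCommGroup X] [NormedSpace ℂ X]
    [CompleteSpace X]
    {R : ℝ → X →L[ℂ] X} {w : X} (hc : Continuous fun φ => R φ w) (h0 : R 0 w = w)
    (hadd : ∀ φ ψ, R φ (R ψ w) = R (φ + ψ) w) (hper : ∀ φ, R (φ + 2 * π) w = R φ w)
    {T : ι → X →L[ℂ] X} {c : ι → ℂ} (hT : ∀ i φ, T i (R φ w) = c i • R φ w)
    (H : ∀ n : ℤ, ∀ v, (∀ i, T i v = c i • v) →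
      (∀ φ : ℝ, R φ v = Complex.exp (n * φ * Complex.I) • v) → v = 0) : w = 0 := by
  rw [← h0]
  refine eq_zero_of_fourier two_pi_pos hc (by simpa using hper 0) fun n => ?_
  have he : ∀ φ : ℝ, Complex.exp (-(2 * π * n / (2 * π) : ℝ) * Complex.I * φ) =
      Complex.exp (-(n * φ * Complex.I)) := fun φ => by
    rw [mul_div_cancel_left₀ _ two_pi_pos.ne']
    push_cast
    congr 1
    ring
  simp only [he]
  have hci : ∀ a b, IntervalIntegrable (fun φ : ℝ => Complex.exp (-(n * φ * Complex.I)) • R φ w)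
      volume a b := fun a b => Continuous.intervalIntegrable
    ((by fun_prop : Continuous fun φ : ℝ => Complex.exp (-(n * φ * Complex.I))).smul hc) a b
  refine H n _ (fun i => ?_) fun φ => ?_
  · rw [← ContinuousLinearMap.intervalIntegral_comp_comm _ (hci _ _),
      ← intervalIntegral.integral_smul]
    refine intervalIntegral.integral_congr fun φ _ => ?_
    rw [map_smul, hT, smul_comm]
  · rw [← ContinuousLinearMap.intervalIntegral_comp_comm _ (hci _ _),
      ← intervalIntegral.integral_smul]
    have hp : Function.Periodic (fun ψ : ℝ => Complex.exp (-(n * ψ * Complex.I)) • R ψ w)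
        (2 * π) := fun ψ => by
      dsimp only
      rw [hper]
      congr 1
      rw [show -((n : ℂ) * ((ψ + 2 * π : ℝ) : ℂ) * Complex.I) =
        -(n * ψ * Complex.I) - n * (2 * π * Complex.I) by push_cast; ring,
        Complex.exp_sub, Complex.exp_int_mul_two_pi_mul_I, div_one]
    have h1 := hp.intervalIntegral_add_eq φ 0
    rw [zero_add] at h1
    have h2 := intervalIntegral.integral_comp_add_left (a := 0) (b := 2 * π)
      (fun ψ : ℝ => Complex.exp (-(n * ψ * Complex.I)) • R ψ w) φ
    rw [add_zero, h1] at h2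
    rw [intervalIntegral.integral_smul, ← h2, ← intervalIntegral.integral_smul]
    refine intervalIntegral.integral_congr fun ψ _ => ?_
    rw [map_smul, hadd, smul_smul, ← Complex.exp_add]
    congr 2
    push_cast
    ring

/-- A rotation-invariant eigenspace that is not zero contains an angular mode. -/
lemma eq_zero_of_modes {α : ℝ} {l : ℂ} {w : L2sq m}
    (hw : KernelEq (fun y => α * profile (‖y‖ ^ 2)) (stretch α) w (l • w : L2sq m))
    (H : ∀ n : ℤ, ∀ v : L2sq m,
      KernelEq (fun y => α * profile (‖y‖ ^ 2)) (stretch α) v (l • v : L2sq m) →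
      (∀ φ : ℝ, rotOp m φ v = Complex.exp (n * φ * Complex.I) • v) → v = 0) : w = 0 := by
  have hrot : ∀ φ, KernelEq (fun y => α * profile (‖y‖ ^ 2)) (stretch α) (rotOp m φ w)
      (l • rotOp m φ w : L2sq m) := fun φ => by
    rw [← map_smul]
    exact hw.rotFun.congr (rotOp_coeFn m φ w).symm (rotOp_coeFn m φ _).symm
  have hE := fun v => (decayingDrift α).driftCoeff.kernelEq_smul_iff (m := m) v l
  exact eq_zero_of_fourier_modes (R := rotOp m) (continuous_rotOp m w) (rotOp_zero m w)
    (fun φ ψ => rotOp_rotOp m φ ψ w) (fun φ => rotOp_two_pi m φ w)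
    (T := fun t : Set.Ici (0 : ℝ) => ((decayingDrift α).driftCoeff.perturbationData m).perturbed t)
    (c := fun t => Complex.exp (l * (t : ℝ))) (fun t φ => (hE _).1 (hrot φ) t t.2)
    fun n v hv => H n v ((hE v).2 fun t ht => hv ⟨t, ht⟩)

/-! ### Angular derivatives on a mode -/

lemma hasDerivAt_rot (φ : ℝ) (y : Plane) : HasDerivAt (fun φ => rot φ y) (rot (φ + π / 2) y) φ := by
  have e : ∀ φ, rot φ y = cos φ • y + sin φ • rot (π / 2) y := fun φ => by
    ext i; fin_cases i <;> simp <;> ring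
  rw [funext e, e (φ + _), cos_add_pi_div_two, sin_add_pi_div_two]
  exact ((hasDerivAt_cos φ).smul_const y).add ((hasDerivAt_sin φ).smul_const _)

lemma hasDerivAt_mehler_rot (hs : 0 < s) (x y : Plane) (φ : ℝ) :
    HasDerivAt (fun φ => mehler s x (rot φ y)) (crossKer s x (rot φ y)) φ := by
  refine ((hasFDerivAt_mehler hs x (rot φ y)).comp_hasDerivAt φ (hasDerivAt_rot φ y)).congr_deriv ?_
  rw [add_comm φ, ← rot_rot]
  set z := rot φ y
  simp [crossKer, cross, PiLp.inner_apply, Fin.sum_univ_two]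
  ring

section

/-- On functions that transform under rotations by `Θ φ`, the angular derivative, moved onto the
kernel, acts as the infinitesimal generator `G` of `Θ`. -/
lemma integral_crossKer [CompleteSpace E] {g : Plane → E} (hg : GaussIntegrable g)
    {Θ : ℝ → E →L[ℂ] E} {G : E →L[ℂ] E} (h : ∀ φ, ∀ᵐ y, g (rot φ y) = Θ φ (g y))
    (hΘ : ∀ v, HasDerivAt (fun φ => Θ φ v) (G v) 0) (hs : 0 < s) (x : Plane) :
    ∫ y, crossKer s x y • g y = -G (∫ y, mehler s x y • g y) := by
  obtain ⟨C, δ, hδ, hb⟩ := (gaussKernel_crossKer hs).2 ‖x‖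
  have hint := hg.integrable_mehler hs x
  have h1 := (hasDerivAt_integral_of_dominated_loc_of_deriv_le (μ := volume) (x₀ := (0 : ℝ))
    (F := fun φ y => mehler s x (rot φ y) • g y) (F' := fun φ y => crossKer s x (rot φ y) • g y)
    (bound := fun y => C * ‖exp (-δ * ‖y‖ ^ 2) • g y‖) univ_mem
    (.of_forall fun φ => ((continuous_mehler_right s x).comp
      (rot φ).continuous).aestronglyMeasurable.smul hg.aestronglyMeasurable)
    (by simpa only [rot_zero] using hint)
    (by simpa only [rot_zero] using (hg.integrable_kernel (gaussKernel_crossKer hs) x).1)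
    (.of_forall fun y φ _ => by
      rw [norm_smul, norm_smul, norm_of_nonneg (exp_pos _).le, ← mul_assoc, norm_eq_abs,
        ← (rot φ).norm_map y]
      exact mul_le_mul_of_nonneg_right (hb x le_rfl _) (norm_nonneg _))
    ((hg δ hδ).norm.const_mul _)
    (.of_forall fun y φ _ => (hasDerivAt_mehler_rot hs x y φ).smul_const (g y))).2
  have h2 : ∀ φ, ∫ y, mehler s x (rot φ y) • g y = Θ (-φ) (∫ y, mehler s x y • g y) := fun φ => by
    rw [← ContinuousLinearMap.integral_comp_comm _ hint, ← (rot φ).measurePreserving.integral_comp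
      (rot φ).toHomeomorph.measurableEmbedding fun y => Θ (-φ) (mehler s x y • g y)]
    refine integral_congr_ae ?_
    filter_upwards [(rot φ).measurePreserving.quasiMeasurePreserving.ae (h (-φ))] with y hy
    rw [(Θ (-φ)).map_smul_of_tower, ← hy, rot_rot, neg_add_cancel, rot_zero]
  simp only [h2, rot_zero] at h1
  have h3 := (hΘ (∫ y, mehler s x y • g y))
  rw [← neg_zero] at h3
  exact h1.unique (by simpa [Function.comp_def] using h3.scomp (0 : ℝ) (hasDerivAt_neg (0 : ℝ)))

lemma driftKer_zero_apply (A : Plane → E →L[ℂ] E) (s : ℝ) (x y : Plane) (v : E) :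
    driftKer (fun _ => 0) A s x y v = mehler s x y • A y v := by
  simp [driftKer]

/-- A bounded coefficient may be moved to the right-hand side. -/
lemma kernelEq_zero_sub {A : Plane → E →L[ℂ] E} {w f : Plane → E} (hf : GaussIntegrable f)
    (hA : GaussIntegrable fun y => A y (w y)) :
    KernelEq (fun _ => 0) A w f ↔
      KernelEq (fun _ => 0) (fun _ => 0) w fun y => f y - A y (w y) := by
  refine forall_congr' fun s => forall_congr' fun hs => forall_congr' fun x => ?_
  simp only [driftKer_zero_apply, zero_apply, smul_zero, integral_zero, sub_zero, smul_sub]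
  rw [integral_sub (hf.integrable_mehler hs x) (hA.integrable_mehler hs x)]

/-- On a mode, a radial drift is multiplication by a matrix. -/
lemma kernelEq_zero_of_mode [CompleteSpace E] {h : Plane → ℝ} {A : Plane → E →L[ℂ] E}
    {w f : Plane → E}
    {Θ : ℝ → E →L[ℂ] E} {G : E →L[ℂ] E} (H : KernelEq h A w f) (hw : GaussIntegrable w)
    (hh : Continuous h) (hhb : ∀ y, |h y| ≤ c) (hrad : ∀ φ y, h (rot φ y) = h y)
    (hA : GaussIntegrable fun y => A y (w y)) (hΘw : ∀ φ, ∀ᵐ y, w (rot φ y) = Θ φ (w y))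
    (hΘ : ∀ v, HasDerivAt (fun φ => Θ φ v) (G v) 0) :
    KernelEq (fun _ => 0) (fun y => A y - (h y : ℂ) • G) w f := by
  have hg := hw.smul hh hhb
  intro s hs x
  have h1 := integral_crossKer hg (Θ := Θ) (fun φ => by
    filter_upwards [hΘw φ] with y hy
    rw [hrad, hy, (Θ φ).map_smul_of_tower]) hΘ hs x
  have i3 := hg.integrable_mehler hs x
  rw [← ContinuousLinearMap.integral_comp_comm _ i3, ← integral_neg] at h1
  have i2 := hA.integrable_mehler hs x
  have i4 : Integrable fun y => -G (mehler s x y • h y • w y) := (G.integrable_comp i3).neg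
  rw [H s hs x]
  simp only [driftKer_apply]
  rw [integral_add (hg.integrable_kernel (gaussKernel_crossKer hs) x) i2, h1,
    ← integral_add i4 i2]
  congr 2
  funext y
  simp only [G.map_smul_of_tower, sub_apply, smul_apply, smul_sub, Complex.coe_smul, zero_smul,
    smul_zero, zero_add]
  abel

end

section

variable {E : Type*} [NormedAddCommGroup E] [InnerProductSpace ℂ E]

lemma eq_zero_of_re_inner {w g : L²(E, ⊤)} {c : Plane → ℝ} {l : ℂ} (hl : 0 < l.re)
    (hg : g =ᵐ[volume] fun y => l • w y + (c y * Complex.I : ℂ) • w y)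
    (h : (inner ℂ w g : ℂ).re ≤ 0) : w = 0 := by
  have e1 : RCLike.re (inner ℂ w g : ℂ) = l.re * RCLike.re (inner ℂ w w : ℂ) := by
    rw [L2.inner_def, L2.inner_def]
    rw [← integral_re (L2.integrable_inner w g), ← integral_re (L2.integrable_inner w w),
      ← integral_const_mul]
    refine integral_congr_ae ((ae_weighted ⊤).2 ?_)
    filter_upwards [hg] with y hy
    rw [hy, inner_add_right, inner_smul_right, inner_smul_right, inner_self_eq_norm_sq_to_K]
    simp [← Complex.ofReal_pow]
  change RCLike.re (inner ℂ w g : ℂ) ≤ 0 at h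
  rw [e1, inner_self_eq_norm_sq_to_K] at h
  have h2 : l.re * ‖w‖ ^ 2 ≤ 0 := by
    convert h using 2
    simp [← Complex.ofReal_pow]
  have h3 : ‖w‖ ^ 2 ≤ 0 := by nlinarith
  exact norm_eq_zero.1 (pow_eq_zero_iff two_ne_zero |>.1 (le_antisymm h3 (sq_nonneg _)))

/-- A skew-adjoint multiplication operator does not create unstable eigenvalues. -/
lemma eq_zero_of_kernelEq_skew [CompleteSpace E] {c : Plane → ℝ} (hc : Continuous c) {B : ℝ}
    (hB : ∀ y, |c y| ≤ B)
    {l : ℂ} (hl : 0 < l.re) {w : L²(E, ⊤)}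
    (h : KernelEq (fun _ => 0) (fun y => (-(c y * Complex.I) : ℂ) • idL E) w
      (l • w : L²(E, ⊤))) : w = 0 := by
  have hm : StronglyMeasurable fun y => (-(c y * Complex.I) : ℂ) • idL E :=
    Continuous.stronglyMeasurable (by fun_prop)
  have hb : ∀ y, ‖(-(c y * Complex.I) : ℂ) • idL E‖ ≤ B := fun y => by
    rw [norm_smul, norm_neg, norm_mul, Complex.norm_I, norm_real, mul_one]
    exact (mul_le_of_le_one_right (norm_nonneg _) norm_id_le').trans (hB y)
  have hA := memLp_clm_apply (Lp.memLp w) hm hb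
  set g := l • w - hA.toLp _ with hgd
  have hg : g =ᵐ[volume] fun y => (l • w : L²(E, ⊤)) y -
      ((-(c y * Complex.I) : ℂ) • idL E) (w y) := by
    refine (ae_weighted ⊤).1 ?_
    filter_upwards [Lp.coeFn_sub (l • w) (hA.toLp _), hA.coeFn_toLp] with y h1 h2
    rw [h1, Pi.sub_apply, h2]
  rw [kernelEq_zero_sub (gaussIntegrable_Lp _) ((gaussIntegrable_Lp w).clm_apply hm hb)] at h
  refine eq_zero_of_re_inner hl (c := c) (g := g) ?_
    (re_inner_nonpos_of_kernelEq (h.congr .rfl hg.symm))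
  filter_upwards [hg, (ae_weighted ⊤).1 (Lp.coeFn_smul l w)] with y h1 h2
  rw [h1, h2]
  simp

end

/-! ### The divergence of an eigenvector -/

/-- The family `K t w` has a limit `D` as `t → 0` when `w` is in the domain of the generator. -/
lemma exists_trace {X Y : Type*} [NormedAddCommGroup X] [NormedSpace ℂ X] [CompleteSpace X]
    [NormedAddCommGroup Y] [NormedSpace ℂ Y] [CompleteSpace Y] {S : ℝ → X →L[ℂ] X}
    {K : ℝ → X →L[ℂ] Y} {T : ℝ → Y →L[ℂ] Y} {b : ℝ → ℂ} {β : ℝ} {w f : X}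
    (hS : Continuous fun t => S t f) (hKc : ∀ v, ContinuousOn (fun t => K t v) (Set.Ioi 0))
    (hKb : ∀ t, ‖K t‖ ≤ C * exp (β * t) / √t)
    (hKS : ∀ s t, 0 < s → 0 ≤ t → ∀ v, K s (S t v) = K (s + t) v)
    (hTK : ∀ s t, 0 ≤ s → 0 < t → ∀ v, T s (K t v) = b s • K (s + t) v)
    (hw : ∀ t, 0 ≤ t → S t w = w + ∫ s in (0 : ℝ)..t, S s f) :
    ∃ D : Y, (∀ t, 0 < t → K t w = D + ∫ s in (0 : ℝ)..t, K s f) ∧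
      ∀ t, 0 < t → T t D = b t • K t w := by
  have hi : ∀ a c, 0 ≤ a → 0 ≤ c → IntervalIntegrable (fun s => K s f) volume a c :=
      fun a c ha hc => by
    exact ((PerturbationData.intervalIntegrable_kernel C β a c).mul_const ‖f‖).mono_fun'
      (((hKc f).mono fun x hx => lt_of_le_of_lt (le_min ha hc) hx.1).aestronglyMeasurable
        measurableSet_uIoc) (.of_forall fun s => (K s).le_of_opNorm_le (hKb s) f)
  have hst : ∀ s t, 0 < s → s ≤ t → K t w = K s w + ∫ r in s..t, K r f := fun s t hs hst => by
    have h1 := congrArg (K s) (hw (t - s) (sub_nonneg.2 hst))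
    rw [hKS s _ hs (sub_nonneg.2 hst), map_add, ← ContinuousLinearMap.intervalIntegral_comp_comm _
      (hS.intervalIntegrable _ _), add_sub_cancel] at h1
    have h2 := intervalIntegral.integral_comp_add_left (a := 0) (b := t - s) (fun r => K r f) s
    rw [add_zero, add_sub_cancel] at h2
    rw [h1, ← h2]
    refine congrArg _ (intervalIntegral.integral_congr fun r hr => hKS s r hs ?_ f)
    rw [uIcc_of_le (sub_nonneg.2 hst)] at hr
    exact hr.1
  set D := K 1 w - ∫ s in (0 : ℝ)..1, K s f with hD
  have hDt : ∀ t, 0 < t → K t w = D + ∫ s in (0 : ℝ)..t, K s f := fun t ht => by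
    rcases le_total t 1 with h | h
    · rw [hD, hst t 1 ht h, ← integral_add_adjacent_intervals
        (hi 0 t le_rfl ht.le) (hi t 1 ht.le zero_le_one)]
      abel
    · rw [hD, hst 1 t one_pos h, ← integral_add_adjacent_intervals
        (hi 0 1 le_rfl zero_le_one) (hi 1 t zero_le_one ht.le)]
      abel
  refine ⟨D, hDt, fun t ht => ?_⟩
  have hlim : Tendsto (fun s => K s w) (𝓝[>] 0) (𝓝 D) := by
    have h1 : ContinuousWithinAt (fun t => ∫ s in (0 : ℝ)..t, K s f) (Set.Icc 0 1) 0 :=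
      intervalIntegral.continuousWithinAt_primitive (by simp) (by
        rw [min_self, max_eq_right zero_le_one]; exact hi 0 1 le_rfl zero_le_one)
    have h2 := h1.tendsto.const_add D
    rw [integral_same, add_zero] at h2
    exact (h2.mono_left (nhdsWithin_le_iff.2 (Icc_mem_nhdsGT zero_lt_one))).congr'
      (eventually_nhdsWithin_of_forall fun s hs => (hDt s hs).symm)
  refine tendsto_nhds_unique (((T t).continuous.tendsto D).comp hlim) ?_
  have h4 : Tendsto (fun s => K s w) (𝓝 t) (𝓝 (K t w)) :=
    (hKc w).continuousAt (Ioi_mem_nhds ht)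
  have h5 : Tendsto (fun s : ℝ => t + s) (𝓝[>] 0) (𝓝 t) :=
    ((by fun_prop : Continuous fun s : ℝ => t + s).tendsto' 0 t (add_zero t)).mono_left
      nhdsWithin_le_nhds
  exact ((h4.comp h5).const_smul _).congr'
    (eventually_nhdsWithin_of_forall fun s hs => (hTK t s ht.le hs w).symm)

/-- The initial divergence of a vector field in the domain of the unperturbed generator. -/
lemma exists_divergence {w F : L2sq ⊤} (h : KernelEq (fun _ => 0) (fun _ => 0) w F) :
    ∃ D : L²(ℂ, ⊤), (∀ t, 0 < t → divSemi t w = D + ∫ s in (0 : ℝ)..t, divSemi s F) ∧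
      ∀ t, 0 < t → semi ℂ ⊤ t D = ((damp t : ℝ) : ℂ) • divSemi t w :=
  exists_trace (semi_continuous ⊤ F) continuousOn_divSemi norm_divSemi_le
    (fun _ _ hs ht v => divSemi_semi hs ht v) (fun _ _ hs ht v => semi_divSemi hs ht v)
    ((kernelEq_zero_iff w F).1 h)

lemma re_inner_divergence_nonpos {w F : L2sq ⊤} {D G : L²(ℂ, ⊤)}
    (h1 : ∀ t, 0 < t → divSemi t w = D + ∫ s in (0 : ℝ)..t, divSemi s F)
    (h2 : ∀ t, 0 < t → semi ℂ ⊤ t D = ((damp t : ℝ) : ℂ) • divSemi t w)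
    (hG : ∀ t, 0 < t → semi ℂ ⊤ t G = ((damp t : ℝ) : ℂ) • divSemi t F) :
    (inner ℂ D G : ℂ).re ≤ 0 := by
  have hb : ∀ t, ((damp t : ℝ) : ℂ) ≠ 0 := fun t => by exact_mod_cast (damp_pos t).ne'
  let R : ℝ → L²(ℂ, ⊤) →L[ℂ] L²(ℂ, ⊤) := fun t => ((damp t : ℝ) : ℂ)⁻¹ • semi ℂ ⊤ t
  have hRt : ∀ t f, R t f = ((damp t : ℝ) : ℂ)⁻¹ • semi ℂ ⊤ t f := fun t f => rfl
  have hRD : ∀ t, 0 < t → R t D = divSemi t w := fun t ht => by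
    rw [hRt, h2 t ht, inv_smul_smul₀ (hb t)]
  have hRG : ∀ t, 0 < t → R t G = divSemi t F := fun t ht => by
    rw [hRt, hG t ht, inv_smul_smul₀ (hb t)]
  have hR0 : ∀ f, R 0 f = f := fun f => by rw [hRt, semi_of_nonpos _ le_rfl]; simp [damp]
  refine re_inner_nonpos_of_contraction (R := R) (fun t ht => ?_) (fun t ht => ?_) ?_ (hR0 G)
  · refine norm_le_of_symmetric (R := R)
      (B := (damp 1)⁻¹ * ‖D‖ + ‖divSemi 1‖ * ‖w‖) (fun t _ u v => ?_) (fun t ht => ?_)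
      (fun t ht => ?_) ht
    · rw [hRt, hRt, inner_smul_left, inner_smul_right, semi_top_symm, map_inv₀, Complex.conj_ofReal]
    · rw [hRt, hRt, hRt, map_smul, smul_smul, damp_add, semi_add _ ht ht]
      push_cast
      rw [mul_inv]
      rfl
    · rcases le_or_gt t 1 with h | h
      · refine le_add_of_le_of_nonneg ?_ (by positivity)
        rw [hRt, norm_smul, norm_inv, norm_real, norm_of_nonneg (damp_pos t).le]
        refine mul_le_mul (inv_anti₀ (damp_pos 1) (by unfold damp; gcongr))
          (norm_semi_top_le t D) (norm_nonneg _) (inv_pos.2 (damp_pos 1)).le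
      · have h0 := damp_pos 1
        refine le_add_of_nonneg_of_le (by positivity) ?_
        rw [hRD t (one_pos.trans h), ← add_sub_cancel 1 t, ← divSemi_semi one_pos (sub_pos.2 h).le]
        exact ((divSemi 1).le_opNorm _).trans
          (mul_le_mul_of_nonneg_left (norm_semi_top_le _ w) (norm_nonneg _))
  · rcases ht.eq_or_lt with rfl | ht
    · rw [hR0, integral_same, add_zero]
    · rw [hRD t ht, h1 t ht]
      congr 1
      refine intervalIntegral.integral_congr_ae (.of_forall fun s hs => ?_)
      rw [uIoc_of_le ht.le] at hs
      exact (hRG s hs.1).symm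
  · refine Continuous.smul (Continuous.inv₀ ?_ hb) (semi_continuous ⊤ G)
    exact Complex.continuous_ofReal.comp damp_continuous

/-- Integration by parts against the initial divergence. -/
lemma integral_mul_divergence {φ : Plane → ℝ} (hφ : ContDiff ℝ 1 φ) {δ : ℝ} (hδ : 0 < δ)
    (hφb : ∀ y, |φ y| ≤ C * exp (-δ * ‖y‖ ^ 2))
    (hφb' : ∀ i y, |partialDeriv i φ y| ≤ C * exp (-δ * ‖y‖ ^ 2)) {w : L2sq ⊤}
    {D : L²(ℂ, ⊤)}
    (hD : ∀ t, 0 < t → semi ℂ ⊤ t D = ((damp t : ℝ) : ℂ) • divSemi t w) :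
    ∫ y, φ y • D y = ∫ y, ∑ i, ((-partialDeriv i φ y : ℝ) : ℂ) * w y i := by
  have hle : ∀ y : Plane, C * exp (-δ * ‖y‖ ^ 2) ≤ C := fun y =>
    mul_le_of_le_one_right (by simpa using (abs_nonneg _).trans (hφb 0)) (by
      rw [exp_le_one_iff]; nlinarith [sq_nonneg ‖y‖])
  have hdc : ∀ i, Continuous (partialDeriv i φ) := fun i =>
    (hφ.continuous_fderiv one_ne_zero).clm_apply continuous_const
  have hbdd : ∀ {ψ g : Plane → ℝ}, Continuous ψ → (∀ y, |ψ y| ≤ C * exp (-δ * ‖y‖ ^ 2)) →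
      Integrable g → Integrable fun z => ψ z * g z := fun hψ hb hg =>
    hg.bdd_mul hψ.aestronglyMeasurable (.of_forall fun y => (hb y).trans (hle y))
  obtain ⟨C₁, h1⟩ := exists_functionalBound ⊤ (k := fun y => ((φ y : ℝ) : ℂ) • idL ℂ)
    (Continuous.stronglyMeasurable (by have := hφ.continuous; fun_prop)) hδ fun y =>
      (norm_ofReal_smul_id_le (φ y)).trans (hφb y)
  let k₂ : Plane → ℂ² →L[ℂ] ℂ := fun y => ∑ i, ((-partialDeriv i φ y : ℝ) : ℂ) • proj i
  have hk₂ : ∀ y v, k₂ y v = ∑ i, ((-partialDeriv i φ y : ℝ) : ℂ) * v i := fun y v => by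
    simp only [k₂, sum_apply, smul_apply, smul_eq_mul]; rfl
  have hk₂c : Continuous k₂ := continuous_finsetSum _ fun i _ =>
    (Complex.continuous_ofReal.comp (hdc i).neg).smul continuous_const
  have hk₂b : ∀ y, ‖k₂ y‖ ≤ 2 * C * exp (-δ * ‖y‖ ^ 2) := fun y => by
    refine (norm_sum_le_of_le _ fun i _ => show _ ≤ C * exp (-δ * ‖y‖ ^ 2) from ?_).trans
      (le_of_eq ?_)
    · rw [norm_smul, norm_real, norm_neg]
      exact (mul_le_of_le_one_right (norm_nonneg _) (norm_proj_le i)).trans (hφb' i y)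
    · rw [Finset.sum_const, Finset.card_univ, Fintype.card_fin, nsmul_eq_mul]
      push_cast
      ring
  obtain ⟨C₂, h2⟩ := exists_functionalBound ⊤ hk₂c.stronglyMeasurable hδ hk₂b
  -- integration by parts in the kernels, for the regularised fields
  have key : ∀ t, 0 < t → h1.functional (divSemi t w) = h2.functional (semi _ ⊤ t w) :=
      fun t ht => by
    have hki : ∀ y, Integrable fun z => mehler t z y := fun y =>
      integrable_gauss_sub (mvar_pos ht) (damp t • y)
    have hkd : ∀ i y, Integrable fun z : Plane =>
        -(2 * mvar t)⁻¹ * (z i - damp t * y i) * mehler t z y := fun i y => by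
      have h1 := (integrable_gauss_sub_mul_clm (mvar_pos ht) (damp t • y)
        (proj i : Plane →L[ℝ] ℝ)).sub ((hki y).mul_const (damp t * y i))
      refine (h1.const_mul (-(2 * mvar t)⁻¹)).congr (.of_forall fun z => ?_)
      change _ * (gauss _ (z - _) * z i - gauss _ (z - _) * (damp t * y i)) =
        _ * (z i - damp t * y i) * gauss _ (z - _)
      ring
    have hibp : ∀ i y, ∫ z, φ z * (-(2 * mvar t)⁻¹ * (z i - damp t * y i) * mehler t z y) =
        -∫ z, partialDeriv i φ z * mehler t z y := fun i y => by
      simp only [← partialDeriv_mehler_left ht]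
      refine integral_mul_fderiv_eq_neg_fderiv_mul_of_integrable (hbdd (hdc i) (hφb' i) (hki y)) ?_
        (hbdd hφ.continuous hφb (hki y)) (fun x _ => hφ.differentiable one_ne_zero x)
        fun x _ => (mehler_contDiff_left t y).differentiable (by simp) x
      have := hbdd hφ.continuous hφb (hkd i y)
      simp only [← partialDeriv_mehler_left ht] at this
      exact this
    let k' : Plane → ℂ² →L[ℂ] ℂ := fun y =>
      ∑ i, ((-∫ z, partialDeriv i φ z * mehler t z y : ℝ) : ℂ) • proj i
    have hk' : ∀ y v, k' y v = ∑ i, ((-∫ z, partialDeriv i φ z * mehler t z y : ℝ) : ℂ) * v i :=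
      fun y v => by simp only [k', sum_apply, smul_apply, smul_eq_mul]; rfl
    rw [divSemi_of_pos ht, semi_of_pos ⊤ ht, h1.functional_comp (kernelBound_div ht)
        (k' := k') ?_ w,
      h2.functional_comp (kernelBound_mehler ⊤ ht) (k' := k') ?_ w]
    · intro y v
      rw [hk', ← integral_sum_ofReal_mul
          (R := fun i z => -(partialDeriv i φ z * mehler t z y)) fun i =>
          ⟨(hbdd (hdc i) (hφb' i) (hki y)).neg, integral_neg _⟩]
      congr 1
      funext z
      rw [mehlerKer, smul_apply, idL_apply, map_smul, hk₂, smul_eq_mul, Finset.mul_sum]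
      exact Finset.sum_congr rfl fun i _ => by push_cast; ring
    · intro y v
      rw [hk', ← integral_sum_ofReal_mul (R := fun i z => φ z * (-(2 * mvar t)⁻¹ *
        (z i - damp t * y i) * mehler t z y)) fun i => ⟨hbdd hφ.continuous hφb (hkd i y), hibp i y⟩]
      congr 1
      funext z
      rw [smul_apply, idL_apply, divKer_apply, smul_eq_mul, Finset.mul_sum]
      exact Finset.sum_congr rfl fun i _ => by push_cast; ring
  have hb : ∀ t, ((damp t : ℝ) : ℂ) ≠ 0 := fun t => by exact_mod_cast (damp_pos t).ne'
  have l1 := (h1.functional.continuous.comp (((Complex.continuous_ofReal.comp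
    damp_continuous).inv₀ hb).smul (semi_continuous ⊤ D))).tendsto' 0 (h1.functional D) (by
      simp [semi_of_nonpos, damp])
  have l2 := (h2.functional.continuous.comp (semi_continuous ⊤ w)).tendsto' 0 (h2.functional w) (by
    simp [semi_of_nonpos])
  have h5 := tendsto_nhds_unique ((l1.mono_left nhdsWithin_le_nhds).congr'
    (eventually_nhdsWithin_of_forall fun t ht => ?_))
        (l2.mono_left (nhdsWithin_le_nhds (s := Set.Ioi 0)))
  · rw [h1.functional_apply, h2.functional_apply] at h5
    simp only [hk₂] at h5
    exact h5
  · have h3 := key t ht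
    rw [← inv_smul_smul₀ (hb t) (divSemi t w), ← hD t ht] at h3
    exact h3

/-! ### Unstable modes in the Gaussian space -/

lemma exists_deriv_profile_le : ∃ C, ∀ s, 0 ≤ s → (1 + s) * |deriv profile s| ≤ C := by
  obtain ⟨C, hC⟩ := isCompact_Icc.exists_bound_of_continuousOn (s := Set.Icc 0 1)
    (profile_contDiff.continuous_deriv (by simp)).continuousOn
  refine ⟨max (2 * C) 1, fun s hs => ?_⟩
  have h0 := abs_nonneg (deriv profile s)
  rcases le_total s 1 with h | h
  · have h1 : |deriv profile s| ≤ C := hC s ⟨hs, h⟩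
    exact le_max_of_le_left (by nlinarith)
  · refine le_max_of_le_right (le_trans ?_ (one_add_mul_deriv_profile_le hs))
    nlinarith [mul_nonneg (by linarith : 0 ≤ 1 + s) h0]

lemma partialDeriv_profile (i : Fin 2) (y : Plane) : partialDeriv i (fun y => profile (‖y‖ ^ 2)) y =
    2 * y i * deriv profile (‖y‖ ^ 2) := by
  have h1 : HasFDerivAt (fun y : Plane => ‖y‖ ^ 2) (2 • innerSL ℝ y) y :=
    (hasStrictFDerivAt_norm_sq y).hasFDerivAt
  have h2 := (profile_contDiff.differentiable (by simp) (‖y‖ ^ 2)).hasDerivAt.comp_hasFDerivAt y h1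
  unfold partialDeriv
  refine (congrArg (fun L : Plane →L[ℝ] ℝ => L _) h2.fderiv).trans ?_
  simp only [smul_apply, innerSL_apply_apply, inner_single_right', smul_eq_mul, nsmul_eq_mul]
  push_cast
  ring

lemma norm_dotC_le (y : Plane) : ‖dotC y‖ ≤ 2 * ‖y‖ := by
  refine (norm_add_le _ _).trans ?_
  have : ∀ i, ‖(y i : ℂ) • (proj i : ℂ² →L[ℂ] ℂ)‖ ≤ ‖y‖ := fun i => by
    rw [norm_smul, norm_real]
    exact (mul_le_of_le_one_right (norm_nonneg _) (norm_proj_le i)).trans (abs_coord_le y i)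
  linarith [this 0, this 1]

lemma dotC_continuous : Continuous dotC := by unfold dotC; fun_prop

lemma divKer_eq (s : ℝ) (x y : Plane) (v : ℂ²) : divKer s x y v =
    (-(2 * mvar s)⁻¹ * mehler s x y : ℝ) * dotC (x - damp s • y) v := by
  rw [divKer_apply, dotC_apply, Fin.sum_univ_two]
  simp only [PiLp.sub_apply, PiLp.smul_apply, smul_eq_mul]
  push_cast
  ring

lemma integrable_divKer {v : Plane → ℂ²} (hv : GaussIntegrable v) (hs : 0 < s) (x : Plane) :
    Integrable fun y => divKer s x y (v y) := by
  have h := ((hv.clm_apply_of_growth (A := fun y => dotC (x - damp s • y))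
    (C := 2 * ‖x‖ + 2 * damp s) (dotC_continuous.comp (by fun_prop)).stronglyMeasurable
    fun y => (norm_dotC_le _).trans ?_).integrable_mehler hs x).const_mul
      ((-(2 * mvar s)⁻¹ : ℝ) : ℂ)
  · refine h.congr (.of_forall fun y => ?_)
    beta_reduce
    rw [divKer_eq, real_smul]
    push_cast
    ring
  · have h1 := norm_sub_le x (damp s • y)
    have hb := damp_pos s
    rw [norm_smul, norm_of_nonneg hb.le] at h1
    nlinarith [mul_nonneg hb.le (sq_nonneg (‖y‖ - 1)), mul_nonneg (norm_nonneg x) (sq_nonneg ‖y‖),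
      mul_nonneg hb.le (sq_nonneg ‖y‖)]

lemma integral_mehler_divergence {g : Plane → ℝ} (hg : ContDiff ℝ 1 g) {B : ℝ}
    (hb : ∀ y, |g y| ≤ B) (hb' : ∀ i y, |partialDeriv i g y| ≤ B) {w : L2sq ⊤}
    {D : L²(ℂ, ⊤)}
    (hD : ∀ t, 0 < t → semi ℂ ⊤ t D = ((damp t : ℝ) : ℂ) • divSemi t w) (hs : 0 < s)
    (x : Plane) : ∫ y, mehler s x y • (g y • D y) = ∫ y, (damp s * (g y * divKer s x y (w y)) -
      mehler s x y • ∑ i, (partialDeriv i g y : ℂ) * w y i) := by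
  have hB : 0 ≤ B := (abs_nonneg _).trans (hb 0)
  have hd : ∀ i y, partialDeriv i (fun y => mehler s x y * g y) y =
      (damp s / (2 * mvar s) * (x i - damp s * y i) * g y + partialDeriv i g y) * mehler s x y :=
    fun i y => by
      rw [partialDeriv_mul (differentiableAt_mehler hs x y) (hg.differentiable one_ne_zero y),
        partialDeriv_mehler hs]
      ring
  have ha := mvar_pos hs
  have hf := damp_pos s
  set K := damp s / (2 * mvar s) * (‖x‖ + damp s) with hK
  have hK0 : 0 ≤ K := by positivity
  obtain ⟨C, δ, hδ, hbd⟩ := (gaussKernel_mul_mehler hs (p := fun _ y => (K * B + B) * (1 + ‖y‖) ^ 2)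
    (by fun_prop) fun _ _ => ⟨K * B + B, by positivity, fun _ _ y =>
      (abs_of_nonneg (by positivity)).le⟩).2 ‖x‖
  have hle : ∀ {v : ℝ} y, |v| ≤ (K * B + B) * (1 + ‖y‖) ^ 2 →
      |v * mehler s x y| ≤ C * exp (-δ * ‖y‖ ^ 2) := fun y hv => by
    refine le_trans ?_ (hbd x le_rfl y)
    rw [abs_mul, abs_mul]
    exact mul_le_mul_of_nonneg_right (hv.trans (le_abs_self _)) (abs_nonneg _)
  have h1 : ∀ y : Plane, 1 ≤ (1 + ‖y‖) ^ 2 := fun y => by nlinarith [norm_nonneg y]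
  have hφ : ContDiff ℝ 1 fun y => mehler s x y * g y :=
    ((mehler_contDiff s x).of_le (by exact_mod_cast le_top)).mul hg
  have key := integral_mul_divergence hφ (C := C) hδ (fun y => ?_) (fun i y => ?_) hD
  · simp only [smul_smul]
    rw [key]
    congr 1
    funext y
    rw [divKer_eq, dotC_apply, Fin.sum_univ_two, Fin.sum_univ_two, hd, hd, real_smul]
    simp only [PiLp.sub_apply, PiLp.smul_apply, smul_eq_mul]
    have : (mvar s : ℂ) ≠ 0 := by exact_mod_cast ha.ne'
    push_cast
    field_simp
    ring
  · rw [mul_comm]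
    exact hle y (by nlinarith [hb y, h1 y, mul_nonneg hK0 hB])
  · rw [hd]
    refine hle y ((abs_add_le _ _).trans ?_)
    rw [add_mul, abs_mul, abs_mul, abs_of_pos (by positivity : 0 < damp s / (2 * mvar s)), hK]
    refine add_le_add ?_ ((hb' i y).trans (le_mul_of_one_le_right hB (h1 y)))
    rw [mul_right_comm _ B]
    gcongr ?_ * ?_
    · rw [mul_assoc]
      gcongr
      refine (abs_sub _ _).trans ?_
      rw [abs_mul, abs_of_pos hf]
      nlinarith [abs_coord_le x i, abs_coord_le y i, norm_nonneg x, norm_nonneg y,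
        mul_nonneg (norm_nonneg x) (norm_nonneg y), mul_nonneg (norm_nonneg x) (sq_nonneg ‖y‖),
        mul_nonneg hf.le (norm_nonneg y), mul_nonneg hf.le (sq_nonneg ‖y‖)]
    · exact hb y

lemma integral_mehler_divergence_one {w : L2sq ⊤} {D : L²(ℂ, ⊤)}
    (hD : ∀ t, 0 < t → semi ℂ ⊤ t D = ((damp t : ℝ) : ℂ) • divSemi t w) (hs : 0 < s)
    (x : Plane) : ∫ y, mehler s x y • D y = damp s * ∫ y, divKer s x y (w y) := by
  have h0 : ∀ i y, partialDeriv i (fun _ => (1 : ℝ)) y = 0 := fun i y => by simp [partialDeriv]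
  have h := integral_mehler_divergence (g := fun _ => 1) contDiff_const (B := 1) (by simp)
    (fun i y => by rw [h0]; simp) hD hs x
  simp only [one_smul, h0, Complex.ofReal_one, one_mul, Complex.ofReal_zero, zero_mul,
    Finset.sum_const_zero, smul_zero, sub_zero] at h
  rw [h, integral_const_mul]

/-- The product `y · v`, as a vector with one component. -/
def dotE (y : Plane) : ℂ² →L[ℂ] ℂ² := (dotC y).smulRight (single 0 1)

lemma dotE_apply (y : Plane) (v : ℂ²) : dotE y v = dotC y v • single 0 1 := rfl

lemma norm_dotE_le (y : Plane) : ‖dotE y‖ ≤ 2 * ‖y‖ := by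
  rw [dotE, ContinuousLinearMap.norm_smulRight_apply]
  simpa using norm_dotC_le y

lemma dotE_continuous : Continuous dotE :=
  ((ContinuousLinearMap.smulRightL ℂ ℂ² ℂ²).flip (single 0 1)).continuous.comp dotC_continuous

lemma GaussIntegrable.dotE {w : Plane → ℂ²} (hw : GaussIntegrable w) :
    GaussIntegrable fun y => dotE y (w y) :=
  hw.clm_apply_of_growth dotE_continuous.stronglyMeasurable (C := 1) fun y =>
    (norm_dotE_le y).trans (by nlinarith [sq_nonneg (‖y‖ - 1)])

lemma integral_mehler_dotE {v : Plane → ℂ²} (hv : GaussIntegrable v) (hs : 0 < s) (x : Plane)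
    (h : ∫ y, divKer s x y (v y) = 0) :
    ∫ y, mehler s x y • dotE y (v y) = (damp s)⁻¹ • dotE x (∫ y, mehler s x y • v y) := by
  have ha := mvar_pos hs
  have hb := damp_pos s
  rw [← ContinuousLinearMap.integral_comp_comm _ (hv.integrable_mehler hs x), ← integral_smul]
  have h1 : ∫ y, (((damp s)⁻¹ * (2 * mvar s) : ℝ) * divKer s x y (v y)) •
      (single 0 1 : ℂ²) = 0 := by
    rw [integral_smul_const, integral_const_mul, h, mul_zero, zero_smul]
  rw [← sub_eq_zero, ← integral_sub (hv.dotE.integrable_mehler hs x), ← h1]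
  · congr 1
    funext y
    have ha' : (mvar s : ℂ) ≠ 0 := by exact_mod_cast ha.ne'
    have hb' : (damp s : ℂ) ≠ 0 := by exact_mod_cast hb.ne'
    rw [divKer_eq, (dotE x).map_smul_of_tower, dotE_apply, dotE_apply, ← Complex.coe_smul,
      ← Complex.coe_smul, ← Complex.coe_smul, smul_smul, smul_smul, smul_smul, ← sub_smul]
    congr 1
    simp only [dotC_apply, PiLp.sub_apply, PiLp.smul_apply, smul_eq_mul]
    push_cast
    field_simp
    ring
  · exact ((dotE x).integrable_comp (hv.integrable_mehler hs x)).smul (damp s)⁻¹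

/-- For solenoidal fields, the equation for `y · w`. -/
lemma kernelEq_dotE {w f : Plane → ℂ²} (hw : GaussIntegrable w)
    (hf : GaussIntegrable f) (h : KernelEq (fun _ => 0) (fun _ => 0) w f)
    (h1 : ∀ s, 0 < s → ∀ x, ∫ y, divKer s x y (w y) = 0)
    (h2 : ∀ s, 0 < s → ∀ x, ∫ y, divKer s x y (f y) = 0) :
    KernelEq (fun _ => 0) (fun _ => 0) (fun y => dotE y (w y))
      fun y => (1 / 2 : ℂ) • dotE y (w y) + dotE y (f y) := fun s hs x => by
  have hb := damp_pos s
  have e1 := (hasDerivAt_integral_mehler hw hs x)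
  rw [h s hs x] at e1
  have e2 := ((hasDerivAt_damp s).inv hb.ne').smul
    (((dotE x).restrictScalars ℝ).hasFDerivAt.comp_hasDerivAt s e1)
  have e3 := (hasDerivAt_integral_mehler hw.dotE hs x).congr_of_eventuallyEq
    (f₁ := fun s => (damp s)⁻¹ • dotE x (∫ y, mehler s x y • w y)) (by
      filter_upwards [Ioi_mem_nhds hs] with r hr
      exact (integral_mehler_dotE hw hr x (h1 r hr x)).symm)
  rw [← e2.unique e3]
  simp only [driftKer_zero_apply, zero_apply, smul_zero, integral_zero, sub_zero, smul_add]
  rw [integral_add ((hw.dotE.integrable_mehler hs x).smul (1 / 2 : ℂ) |>.congr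
    (.of_forall fun y => smul_comm (1 / 2 : ℂ) (mehler s x y) (dotE y (w y))))
        (hf.dotE.integrable_mehler hs x),
    integral_mehler_dotE hf hs x (h2 s hs x)]
  simp only [smul_comm (mehler s x _) (1 / 2 : ℂ)]
  rw [integral_smul, integral_mehler_dotE hw hs x (h1 s hs x), add_comm]
  congr 1
  rw [← Complex.coe_smul, ← Complex.coe_smul, smul_smul]
  change _ • dotE x _ = _
  congr 1
  push_cast
  field_simp

lemma memLp_dotE (w : L2sq ⊤) : MemLp (fun y => dotE y (w y)) 2 (weightedMeasure 2) := by
  obtain ⟨hw1, hw2⟩ := memLp_weighted_iff.1 (Lp.memLp w)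
  refine memLp_weighted_iff.2 ⟨(gaussIntegrable_Lp w).dotE.aestronglyMeasurable, ?_⟩
  refine lt_of_le_of_lt (lintegral_mono fun y => ?_)
    (show ∫⁻ y, ofReal 108 * (wt ⊤ y * ‖w y‖ₑ ^ 2) < ⊤ by
      rw [lintegral_const_mul' _ _ ENNReal.ofReal_ne_top]
      exact ENNReal.mul_lt_top ENNReal.ofReal_lt_top hw2)
  have h1 : ‖dotE y (w y)‖ₑ ≤ ofReal (2 * ‖y‖) * ‖w y‖ₑ := by
    rw [← ofReal_norm, ← ofReal_norm, ← ofReal_mul (by positivity)]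
    exact ofReal_le_ofReal ((ContinuousLinearMap.le_opNorm _ _).trans
      (mul_le_mul_of_nonneg_right (norm_dotE_le y) (norm_nonneg _)))
  have h2 : rho 2 (‖y‖ ^ 2) * (2 * ‖y‖) ^ 2 ≤ 108 * rho ⊤ (‖y‖ ^ 2) := by
    rw [rho_top, rho_eq two_ne_zero (by norm_num)]
    set r := ‖y‖ ^ 2 with hr
    have hr0 : 0 ≤ r := sq_nonneg _
    have h3 : (r / 12 + 1) ^ 3 ≤ exp (r / 4) := by
      refine (pow_le_pow_left₀ (by positivity) (add_one_le_exp (r / 12)) 3).trans (le_of_eq ?_)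
      rw [← exp_nat_mul]
      congr 1
      push_cast
      ring
    have h4 : (1 + r / (4 * (2 : ℝ≥0∞).toReal)) ^ (2 : ℝ≥0∞).toReal = (1 + r / 8) ^ 2 := by norm_num
    rw [h4, mul_pow, ← hr]
    refine le_trans ?_ (mul_le_mul_of_nonneg_left h3 (by norm_num))
    nlinarith [mul_nonneg hr0 hr0, mul_nonneg hr0 (mul_nonneg hr0 hr0)]
  calc wt 2 y * ‖dotE y (w y)‖ₑ ^ 2 ≤ wt 2 y * (ofReal (2 * ‖y‖) * ‖w y‖ₑ) ^ 2 := by gcongr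
    _ = ofReal (rho 2 (‖y‖ ^ 2) * (2 * ‖y‖) ^ 2) * ‖w y‖ₑ ^ 2 := by
        rw [mul_pow, ← ofReal_pow (by positivity), ofReal_mul
          (zero_le_one.trans (one_le_rho 2 (sq_nonneg _))), wt, mul_assoc]
    _ ≤ ofReal (108 * rho ⊤ (‖y‖ ^ 2)) * ‖w y‖ₑ ^ 2 := by gcongr
    _ = _ := by rw [ofReal_mul (by norm_num), wt, mul_assoc]

/-- The matrix to which the vortex drift and the stretching reduce on the `n`-th angular mode. -/
def modeMatrix (α : ℝ) (n : ℤ) (y : Plane) : ℂ² →L[ℂ] ℂ² :=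
  stretch α y - ((α * profile (‖y‖ ^ 2) : ℝ) : ℂ) • ((n * Complex.I : ℂ) • idL _ + turn)

lemma modeMatrix_apply (α : ℝ) (n : ℤ) (y : Plane) (v : ℂ²) :
    modeMatrix α n y v = (α * (2 * deriv profile (‖y‖ ^ 2) * dotC y v) : ℂ) • perpC y +
      (-((α * n * profile (‖y‖ ^ 2) : ℝ) * Complex.I) : ℂ) • v := by
  simp only [modeMatrix, sub_apply, smul_apply, add_apply, idL_apply, stretch_eq]
  push_cast
  module

lemma modeMatrix_continuous (α : ℝ) (n : ℤ) : Continuous (modeMatrix α n) := by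
  have h1 := continuous_profile_norm_sq
  have h2 := stretch_continuous α
  unfold modeMatrix
  fun_prop

lemma exists_norm_modeMatrix_le (α : ℝ) (n : ℤ) : ∃ C, ∀ y, ‖modeMatrix α n y‖ ≤ C := by
  refine ⟨24 * |α| + |α| * ‖(n * Complex.I : ℂ) • idL _ + turn‖, fun y =>
    (norm_sub_le _ _).trans (add_le_add (exists_norm_stretch_le α y) ?_)⟩
  rw [norm_smul, norm_real]
  exact mul_le_mul_of_nonneg_right (abs_mul_profile_le α y) (norm_nonneg _)

lemma hasDerivAt_cexp_mode (n : ℤ) :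
    HasDerivAt (fun φ : ℝ => Complex.exp (n * φ * Complex.I)) (n * Complex.I) 0 := by
  have h : HasDerivAt (fun φ : ℝ => (n * φ * Complex.I : ℂ)) (n * 1 * Complex.I) 0 :=
    (Complex.ofRealCLM.hasDerivAt.const_mul (n : ℂ)).mul_const Complex.I
  simpa using h.cexp

lemma hasDerivAt_rotC (v : ℂ²) : HasDerivAt (fun φ => rotC φ v) (turn v) 0 := by
  have h1 := (hasDerivAt_cos 0).ofReal_comp.smul_const v
  have h2 := (hasDerivAt_sin 0).ofReal_comp.smul_const (turn v)
  refine (h1.add h2).congr_deriv ?_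
  simp

section Mode

variable {α : ℝ} {n : ℤ} {l : ℂ} {w : L2sq ⊤}

lemma ae_mode (hmode : ∀ φ : ℝ, rotOp ⊤ φ w = Complex.exp (n * φ * Complex.I) • w) (φ : ℝ) :
    ∀ᵐ y, w (rot φ y) = (Complex.exp (n * φ * Complex.I) • rotC φ) (w y) := by
  have h1 := rotOp_coeFn ⊤ φ w
  rw [hmode φ] at h1
  filter_upwards [h1, (ae_weighted ⊤).1 (Lp.coeFn_smul (Complex.exp (n * φ * Complex.I)) w)]
    with y h2 h3
  rw [h3, Pi.smul_apply] at h2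
  rw [smul_apply, ← map_smul, h2, rotFun, rotC_rotC, add_neg_cancel, rotC_zero]

lemma kernelEq_modeMatrix
    (hw : KernelEq (fun y => α * profile (‖y‖ ^ 2)) (stretch α) w (l • w : L2sq ⊤))
    (hmode : ∀ φ : ℝ, rotOp ⊤ φ w = Complex.exp (n * φ * Complex.I) • w) :
    KernelEq (fun _ => 0) (modeMatrix α n) w (l • w : L2sq ⊤) := by
  refine kernelEq_zero_of_mode hw (gaussIntegrable_Lp w)
    (continuous_const.mul continuous_profile_norm_sq) (abs_mul_profile_le α)
    (fun φ y => by rw [LinearIsometryEquiv.norm_map])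
    ((gaussIntegrable_Lp w).clm_apply (stretch_continuous α).stronglyMeasurable
      (exists_norm_stretch_le α)) (ae_mode hmode) (fun v =>
        ((hasDerivAt_cexp_mode n).smul (hasDerivAt_rotC v)).congr_deriv ?_)
  simp [rotC_zero]
  abel

/-- On a mode, the divergence of `modeMatrix α n w` is `-i α n` times the angular velocity times the
divergence of `w`. -/
lemma integral_divKer_modeMatrix
    (hmode : ∀ φ : ℝ, rotOp ⊤ φ w = Complex.exp (n * φ * Complex.I) • w)
    {D : L²(ℂ, ⊤)}
    (hD : ∀ t, 0 < t → semi ℂ ⊤ t D = ((damp t : ℝ) : ℂ) • divSemi t w) (hs : 0 < s)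
    (x : Plane) : damp s * ∫ y, divKer s x y (modeMatrix α n y (w y)) =
      ∫ y, mehler s x y • ((-((α * n * profile (‖y‖ ^ 2) : ℝ) * Complex.I) : ℂ) * D y) := by
  have gw := gaussIntegrable_Lp w
  obtain ⟨C, hC⟩ := exists_deriv_profile_le
  have hgr : ∀ y : Plane, |2 * deriv profile (‖y‖ ^ 2)| * ‖y‖ ≤ C := fun y => by
    rw [abs_mul, abs_two]
    nlinarith [hC _ (sq_nonneg ‖y‖), sq_nonneg (‖y‖ - 1), abs_nonneg (deriv profile (‖y‖ ^ 2))]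
  -- the scalar `2 H' (y · w)`
  have gg : GaussIntegrable fun y => (2 * deriv profile (‖y‖ ^ 2)) • dotC y (w y) := by
    refine (gw.clm_apply_of_growth dotC_continuous.stronglyMeasurable (C := 1) fun y =>
      (norm_dotC_le y).trans (by nlinarith [sq_nonneg (‖y‖ - 1)])).smul (C := 2 * C)
      (continuous_const.mul ((profile_contDiff.continuous_deriv (by simp)).comp (by fun_prop)))
      fun y => ?_
    rw [abs_mul, abs_two]
    nlinarith [hC _ (sq_nonneg ‖y‖), sq_nonneg ‖y‖, abs_nonneg (deriv profile (‖y‖ ^ 2))]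
  have gh := gw.smul continuous_profile_norm_sq abs_profile_le_one
  have h1 := integral_crossKer gg (Θ := fun φ => Complex.exp (n * φ * Complex.I) •
    idL ℂ) (G := (n * Complex.I : ℂ) • idL ℂ) (fun φ => by
      filter_upwards [ae_mode hmode φ] with y hy
      rw [hy, LinearIsometryEquiv.norm_map]
      simp only [smul_apply, map_smul, dotC_rot, idL_apply, smul_eq_mul, real_smul]
      ring) (fun v => (hasDerivAt_cexp_mode n).smul_const v) hs x
  have h2 := integral_mehler_divergence (g := fun y => profile (‖y‖ ^ 2)) (B := max 1 C)
    ((profile_contDiff.comp (contDiff_norm_sq ℝ)).of_le (by exact_mod_cast le_top))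
    (fun y => le_max_of_le_left (abs_profile_le_one y)) (fun i y => le_max_of_le_right (by
      rw [partialDeriv_profile, mul_right_comm, abs_mul]
      exact le_trans (by gcongr; exact abs_coord_le y i) (hgr y))) hD hs x
  have i1 := gg.integrable_kernel (gaussKernel_crossKer hs) x
  have i2 := integrable_divKer gh hs x
  have i3 := gg.integrable_mehler hs x
  have hb' : (damp s : ℂ) ≠ 0 := by exact_mod_cast (damp_pos s).ne'
  have e2 : ∀ y, ((damp s : ℂ) * ((profile (‖y‖ ^ 2) : ℂ) * divKer s x y (w y)) -
      mehler s x y • ∑ i, (partialDeriv i (fun y => profile (‖y‖ ^ 2)) y : ℂ) * w y i) =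
      damp s * divKer s x y (profile (‖y‖ ^ 2) • w y) -
        mehler s x y • (2 * deriv profile (‖y‖ ^ 2)) • dotC y (w y) := fun y => by
    rw [ContinuousLinearMap.map_smul_of_tower, dotC_apply, Fin.sum_univ_two, partialDeriv_profile,
      partialDeriv_profile, real_smul, real_smul, real_smul, real_smul]
    push_cast
    ring
  simp only [e2] at h2
  rw [integral_sub (i2.const_mul _) i3, integral_const_mul] at h2
  have e1 : ∀ y, divKer s x y (modeMatrix α n y (w y)) =
      -(α / damp s : ℂ) * (crossKer s x y • (2 * deriv profile (‖y‖ ^ 2)) • dotC y (w y)) -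
      (α * n * Complex.I : ℂ) * divKer s x y (profile (‖y‖ ^ 2) • w y) := fun y => by
    have hp : dotC (x - damp s • y) (perpC y) = cross x y := by
      simp [dotC_apply, perpC, cross]
      ring
    have ha' : (mvar s : ℂ) ≠ 0 := by exact_mod_cast (mvar_pos hs).ne'
    simp only [modeMatrix_apply, map_add, map_smul, ContinuousLinearMap.map_smul_of_tower,
      divKer_eq s x y (perpC y), hp, real_smul, smul_eq_mul, crossKer]
    push_cast
    field_simp
    ring
  have e3 : ∀ y, mehler s x y • ((-((α * n * profile (‖y‖ ^ 2) : ℝ) * Complex.I) : ℂ) * D y) =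
      -(α * n * Complex.I : ℂ) * (mehler s x y • (profile (‖y‖ ^ 2) • D y)) := fun y => by
    simp only [real_smul]
    push_cast
    ring
  simp only [e1, e3]
  rw [integral_const_mul, h2, integral_sub (i1.const_mul _) (i2.const_mul _), integral_const_mul,
    integral_const_mul, h1]
  simp only [smul_apply, idL_apply, smul_eq_mul]
  field_simp
  ring

/-- On the Gaussian space there is no unstable angular mode. -/
lemma eq_zero_of_mode (hl : 0 < l.re)
    (hw : KernelEq (fun y => α * profile (‖y‖ ^ 2)) (stretch α) w (l • w : L2sq ⊤))
    (hmode : ∀ φ : ℝ, rotOp ⊤ φ w = Complex.exp (n * φ * Complex.I) • w) : w = 0 := by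
  obtain ⟨C, hC⟩ := exists_norm_modeMatrix_le α n
  have hM := kernelEq_modeMatrix hw hmode
  have gw := gaussIntegrable_Lp w
  have mM := (modeMatrix_continuous α n).stronglyMeasurable
  have gM := gw.clm_apply mM hC
  have hA := memLp_clm_apply (Lp.memLp w) mM hC
  set c : Plane → ℝ := fun y => α * n * profile (‖y‖ ^ 2) with hcd
  have hcc : Continuous c := continuous_const.mul continuous_profile_norm_sq
  have hcb : ∀ y, (1 + ‖y‖ ^ 2) * |c y| ≤ |α * n| := fun y => by
    rw [hcd, abs_mul (α * n), mul_left_comm]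
    exact mul_le_of_le_one_right (abs_nonneg _) (one_add_mul_profile_le (sq_nonneg ‖y‖))
  have hcb1 : ∀ y, |c y| ≤ |α * n| := fun y =>
    (le_mul_of_one_le_left (abs_nonneg _) (by nlinarith [sq_nonneg ‖y‖])).trans (hcb y)
  set F : L2sq ⊤ := l • w - hA.toLp _ with hFd
  have hF : F =ᵐ[volume] fun y => l • w y - modeMatrix α n y (w y) := by
    refine (ae_weighted ⊤).1 ?_
    filter_upwards
        [Lp.coeFn_sub (l • w) (hA.toLp _), hA.coeFn_toLp, Lp.coeFn_smul l w] with y h1 h2 h3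
    rw [h1, Pi.sub_apply, h2, h3, Pi.smul_apply]
  have hlw : (l • w : L2sq ⊤) =ᵐ[volume] fun y => l • w y := (ae_weighted ⊤).1 (Lp.coeFn_smul l w)
  have hwF : KernelEq (fun _ => 0) (fun _ => 0) w F :=
    ((kernelEq_zero_sub (gaussIntegrable_Lp _) gM).1 hM).congr .rfl (by
      filter_upwards [hlw, hF] with y h1 h2
      rw [h1, h2])
  obtain ⟨D, hD1, hD2⟩ := exists_divergence hwF
  -- the divergence satisfies a scalar equation with a skew-adjoint potential
  have hsk := memLp_clm_apply (Lp.memLp D) (A := fun y => ((c y * Complex.I : ℂ) • idL ℂ))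
    (Continuous.stronglyMeasurable (by fun_prop)) (C := |α * n|) fun y => by
      rw [norm_smul, norm_mul, Complex.norm_I, norm_real, mul_one]
      exact (mul_le_of_le_one_right (norm_nonneg _) norm_id_le').trans (hcb1 y)
  set G : L²(ℂ, ⊤) := l • D + hsk.toLp _ with hGd
  have hG : G =ᵐ[volume] fun y => l • D y + (c y * Complex.I : ℂ) • D y := by
    refine (ae_weighted ⊤).1 ?_
    filter_upwards
        [Lp.coeFn_add (l • D) (hsk.toLp _), hsk.coeFn_toLp, Lp.coeFn_smul l D] with y h1 h2 h3
    rw [h1, Pi.add_apply, h2, h3, Pi.smul_apply, smul_apply, idL_apply]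
  have gF := gaussIntegrable_Lp F
  have key : ∀ s, 0 < s → ∀ x, ∫ y, mehler s x y • G y = damp s * ∫ y, divKer s x y (F y) :=
      fun s hs x => by
    have gD := gaussIntegrable_Lp D
    have i1 := (gD.integrable_mehler hs x).const_mul l
    have i2 : Integrable fun y => mehler s x y • (-(c y * Complex.I : ℂ) * D y) := by
      refine ((gaussIntegrable_Lp (hsk.toLp _)).integrable_mehler hs x).neg.congr ?_
      filter_upwards [(ae_weighted ⊤).1 hsk.coeFn_toLp] with y hy
      rw [Pi.neg_apply, hy, smul_apply, idL_apply, smul_eq_mul, neg_mul, smul_neg]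
    calc _ = ∫ y, l * (mehler s x y • D y) - mehler s x y • (-(c y * Complex.I : ℂ) * D y) := by
          refine integral_congr_ae ?_
          filter_upwards [hG] with y hy
          rw [hy]
          simp only [real_smul, smul_eq_mul]
          ring
      _ = damp s * ∫ y, (l * divKer s x y (w y) - divKer s x y (modeMatrix α n y (w y))) := by
          rw [integral_sub i1 i2, integral_const_mul, integral_mehler_divergence_one hD2 hs x,
            ← integral_divKer_modeMatrix hmode hD2 hs x, integral_sub
            ((integrable_divKer gw hs x).const_mul l) (integrable_divKer gM hs x),
                integral_const_mul]
          ring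
      _ = _ := by
          congr 1
          refine integral_congr_ae ?_
          filter_upwards [hF] with y hy
          rw [hy, map_sub, map_smul, smul_eq_mul]
  have hb' : ∀ s, (damp s : ℂ) ≠ 0 := fun s => by exact_mod_cast (damp_pos s).ne'
  have hD0 : D = 0 := eq_zero_of_re_inner hl hG (re_inner_divergence_nonpos hD1 hD2 fun t ht => by
    refine eq_of_ae_volume ?_
    filter_upwards [semi_coeFn ht G, divSemi_coeFn ht F, (ae_weighted ⊤).1
      (Lp.coeFn_smul ((damp t : ℝ) : ℂ) (divSemi t F))] with x h1 h2 h3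
    rw [h1, h3, Pi.smul_apply, h2, kernelFun_mehlerKer, key t ht x]
    rfl)
  have hD0' : ⇑D =ᵐ[volume] fun _ => (0 : ℂ) := by
    rw [hD0]; exact (ae_weighted ⊤).1 (Lp.coeFn_zero _ _ _)
  have hdw : ∀ s, 0 < s → ∀ x, ∫ y, divKer s x y (w y) = 0 := fun s hs x =>
    (mul_eq_zero.1 ((integral_mehler_divergence_one hD2 hs x).symm.trans (integral_eq_zero_of_ae
      (hD0'.mono fun y hy => by simp [hy])))).resolve_left (hb' s)
  have hdF : ∀ s, 0 < s → ∀ x, ∫ y, divKer s x y (F y) = 0 := fun s hs x =>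
    (mul_eq_zero.1 ((key s hs x).symm.trans (integral_eq_zero_of_ae (by
      filter_upwards [hD0', hG] with y h2 h3
      simp [h3, h2])))).resolve_left (hb' s)
  -- the radial component satisfies a scalar equation with the same potential
  let A : Plane → ℂ² →L[ℂ] ℂ² := fun y => (-(c y * Complex.I) : ℂ) • idL _
  have hAn : ∀ y, ‖A y‖ ≤ |c y| := fun y => by
    rw [norm_smul, norm_neg, norm_mul, Complex.norm_I, norm_real, mul_one]
    exact mul_le_of_le_one_right (norm_nonneg _) norm_id_le'
  have DA : DecayingDrift (fun _ => 0) A (2 * |α * n|) := by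
    refine ⟨measurable_const, Continuous.stronglyMeasurable (by fun_prop), by positivity,
      fun y => by simp; positivity, fun y => ?_⟩
    rw [le_div_iff₀ (by positivity)]
    have h1 := hcb y
    have h2 := hAn y
    nlinarith [sq_nonneg (‖y‖ - 1), norm_nonneg y, abs_nonneg (c y), sq_nonneg ‖y‖]
  have hP := memLp_dotE w
  have hPK : KernelEq (fun _ => 0) A (hP.toLp _) ((l + 1 / 2) • hP.toLp _ : L2sq 2) := by
    have hPe : hP.toLp _ =ᵐ[volume] fun y => dotE y (w y) := (ae_weighted 2).1 hP.coeFn_toLp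
    refine (kernelEq_zero_sub (gaussIntegrable_Lp _) ((gaussIntegrable_Lp _).clm_apply DA.meas_A
      fun y => (hAn y).trans (hcb1 y))).2 ((kernelEq_dotE gw gF hwF hdw hdF).congr hPe.symm ?_)
    filter_upwards [hPe, hF, (ae_weighted 2).1 (Lp.coeFn_smul (l + 1 / 2) (hP.toLp _))]
      with y h1 h2 h3
    have hperp : dotC y (perpC y) = 0 := by simp [dotC_apply, perpC]; ring
    rw [h3, Pi.smul_apply, h1, h2, modeMatrix_apply]
    have hcy : c y = α * n * profile (‖y‖ ^ 2) := rfl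
    simp only [A, dotE_apply, map_sub, map_add, map_smul, hperp, smul_apply, idL_apply, hcy]
    module
  have hP0 := DA.eq_zero_of_kernelEq (fun z hz v hv => eq_zero_of_kernelEq_skew hcc hcb1 hz hv)
    (m := 2) (by norm_num) (by simp; linarith) hPK
  refine eq_zero_of_kernelEq_skew hcc hcb1 hl fun s hs x => (hM s hs x).trans ?_
  congr 1
  refine integral_congr_ae ?_
  have h0 := (ae_weighted 2).1 hP.coeFn_toLp
  rw [hP0] at h0
  filter_upwards [h0, (ae_weighted 2).1 (Lp.coeFn_zero ℂ² 2 (weightedMeasure 2))] with y h1 h2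
  have h3 : dotC y (w y) = 0 := by
    rw [h2] at h1
    have := congrArg (fun v : ℂ² => v 0) h1
    simpa [dotE_apply] using this.symm
  rw [driftKer_zero_apply, driftKer_zero_apply, modeMatrix_apply, h3]
  simp [hcd]

end Mode

/-- The vortex operator has no eigenvalue with positive real part, once the constant `1 + c_μ` is
removed. -/
lemma eq_zero_of_unstable {α : ℝ} (hm : 1 < m) {l : ℂ} (hl : 0 < l.re) {w : L2sq m}
    (hw : KernelEq (fun y => α * profile (‖y‖ ^ 2)) (stretch α) w (l • w : L2sq m)) : w = 0 :=
  (decayingDrift α).eq_zero_of_kernelEq (fun _ hz _ hv =>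
    eq_zero_of_modes hv fun _ _ h1 h2 => eq_zero_of_mode hz h1 h2) hm hl hw

end SingularBurgers

end

theorem lemma5 (μ α : ℝ) (hμ : 1 < μ) (m : ℝ≥0∞) (hm : 1 < m) :
    (∃ T : ℝ≥0 → L2sq m →L[ℂ] L2sq m,
      IsSemigroupGeneratedBy T (linearizedGraph μ α m) ∧
      (m ≠ ⊤ → ∀ τ : ℝ≥0, essentialSpectralRadius (T τ) =
        ENNReal.ofReal (Real.exp (-(1 / 2 + strainConst μ + m.toReal / 2) * τ))) ∧
      (m = ⊤ → ∀ τ : ℝ≥0, 0 < τ → essentialSpectralRadius (T τ) = 0)) ∧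
    (∀ z : ℂ, IsEigenvalue (linearizedGraph μ α m) z →
      (m ≠ ⊤ → -(1 / 2) - strainConst μ - m.toReal / 2 ≤ z.re) →
      z.re ≤ -1 - strainConst μ) := by
  refine ⟨⟨fun τ => fullSemigroup μ α m τ, isSemigroupGeneratedBy_fullSemigroup μ α m,
    fun hm' τ => essentialSpectralRadius_fullSemigroup μ α hm hm' τ, ?_⟩, ?_⟩
  · rintro rfl τ hτ
    exact essentialSpectralRadius_fullSemigroup_top μ α hτ
  · rintro z ⟨w, hw0, hw⟩ -
    by_contra! hz
    refine hw0 (eq_zero_of_unstable (α := α) hm (l := z + ((1 + strainConst μ : ℝ) : ℂ)) ?_ ?_)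
    · rw [Complex.add_re, Complex.ofReal_re]
      linarith
    · rw [add_smul]
      exact kernelEq_of_linearizedGraph hw
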